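/- **Setting.** Let $D\ge 1$, let $I$ be a finite set, $p:I\to\mathbb Z/2$ (fermion parities) and $n\ge 0$. Write $z\cdot w=\sum_\alpha z_\alpha w_\alpha$, $z^2=z\cdot z$ for $z,w\in\mathbb C^D$, and let $(h_{m\sigma})_\sigma$ be a basis of the homogeneous harmonic polynomials of degree $m$ on $\mathbb C^D$. A *GCI theory* with fields $\phi_A$ $(A\in I)$ consists of a Hilbert space $\mathcal H$, a dense subspace $\mathcal D$ and the following data. - Fields: formal series $\phi_A(z)=\sum_{n\in\mathbb Z}\sum_{m\ge0}\sum_\sigma\phi_{A\{n,m,\sigma\}}(z^2)^n h_{m\sigma}(z)$, whose modes are operators $\mathcal D\to\mathcal D$, not all zero for any $A$, and such that for each $A$ and $\Psi\in\mathcal D$ there is $N$ with $\phi_{A\{n,m,\sigma\}}\Psi=0$ for all $n\le -N$ and all $m,\sigma$. - Covariance: operators $T_\alpha,C_\alpha,H,\Omega_{\alpha\beta}=-\Omega_{\beta\alpha}$ on $\mathcal D$ ($1\le\alpha,\beta\le D$) that satisfy the relations of the conformal Lie algebra: $[T_\alpha,C_\beta]=2(\delta_{\alpha\beta}H-\Omega_{\alpha\beta})$,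 $[H,T_\alpha]=T_\alpha$, $[H,C_\alpha]=-C_\alpha$, $[T_\alpha,T_\beta]=[C_\alpha,C_\beta]=[H,\Omega_{\alpha\beta}]=0$, $[\Omega_{\alpha\beta},T_\gamma]=\delta_{\alpha\gamma}T_\beta-\delta_{\beta\gamma}T_\alpha$, the same with $C$ in place of $T$, and $[\Omega_{\alpha\beta},\Omega_{\gamma\delta}]=\delta_{\beta\delta}\Omega_{\alpha\gamma}+\delta_{\alpha\gamma}\Omega_{\beta\delta}-\delta_{\beta\gamma}\Omega_{\alpha\delta}-\delta_{\alpha\delta}\Omega_{\beta\gamma}$. They are unitary, i.e. $T_\alpha^*=-C_\alpha$, $H^*=H$, $\Omega_{\alpha\beta}^*=-\Omega_{\alpha\beta}$ as forms on $\mathcal D$. There are dimensions $d_A\in\mathbb R$ and a representation $\rho$ of $\mathrm{Spin}(D)$ on $\mathbb C^I$, differentiable along the planar rotations, with $\rho(g)_{AB}\neq0$ only if $d_A=d_B$ and $\rho(-1)=\mathrm{diag}(e^{2\pi i d_A})$. With $S_{\alpha\beta}$ the matrix of the infinitesimal rotation in the plane $\alpha\beta$ (the derivative at $t=0$ of $\rho$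 along the lift of the rotation by the angle $-t$ from $e_\alpha$ towards $e_\beta$), $$[T_\alpha,\phi_A(z)]=\partial_\alpha\phi_A(z),\qquad [H,\phi_A(z)]=(z\cdot\partial+d_A)\phi_A(z),$$ $$[\Omega_{\alpha\beta},\phi_A(z)]=(z_\alpha\partial_\beta-z_\beta\partial_\alpha)\phi_A(z)+(S_{\alpha\beta})_A^B\phi_B(z),$$ $$[C_\alpha,\phi_A(z)]=\bigl(z^2\partial_\alpha-2z_\alpha\, z\cdot\partial-2z_\alpha d_A\bigr)\phi_A(z)+2z_\beta(S_{\beta\alpha})_A^B\phi_B(z).$$ - Conjugation: the system is closed under conjugation, $\phi^*_A=J_A^B\phi_B$, with $\bar JJ=1$, $J_{AB}\ne0$ only if $d_A=d_B$ and $p_A=p_B$, and, for unit vectors $u,v$, $J\rho(uv)=\overline{\rho(Ru\,Rv)}J$, where $uv\in\mathrm{Spin}(D)$ is the Clifford product and $R$ is the reflection $x_D\mapsto-x_D$. With $\phi_A(\zeta,u):=e^{2\pi i d_A\zeta}\phi_A(e^{2\pi i\zeta}u)$, for $\zeta$ real and $u\in\mathbb S^{D-1}$ (mode by mode in $\zeta$),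 $\phi_A(\zeta,u)^*$ is the linear combination of the $\phi^*_B(\zeta,u)$ given by $\langle\Psi_1,\phi_A(\zeta,u)\Psi_2\rangle=\sum_B\rho(u\,e_D)_{AB}\langle\phi^*_B(\zeta,u)\Psi_1,\Psi_2\rangle$. - Spectrum and vacuum: $H\ge0$, and up to a factor there is a unique vector of $\mathcal D$ annihilated by all $T_\alpha,C_\alpha,H,\Omega_{\alpha\beta}$; it is spanned by a unit vector $|0\rangle$. - Strong locality: for all $A,B$ there is $M$ with $((z-w)^2)^M\bigl(\phi_A(z)\phi_B(w)-(-1)^{p_Ap_B}\phi_B(w)\phi_A(z)\bigr)=0$. - Completeness: $\mathcal D$ is spanned by the vectors obtained from $|0\rangle$ by applying modes of the fields. If the eigenspaces of $H$ on $\mathcal D$ are finite dimensional, put, as a formal series in the $e^{\pm\pi i\zeta_k}$ with coefficients power series in $q^{1/2}=e^{\pi i\tau}$ (taking the trace level by level over the eigenvalues $j/2$, $j=0,1,2,\dots$), $$\langle\phi_{A_1}(\zeta_1,u_1)\cdots\phi_{A_n}(\zeta_n,u_n)\rangle_q=\frac{\mathrm{tr}_{\mathcal D}\,\phi_{A_1}(\zeta_1,u_1)\cdots\phi_{A_n}(\zeta_n,u_n)\,q^H}{\mathrm{tr}_{\mathcal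 D}\,q^H},\qquad u_k\in\mathbb S^{D-1}.$$ Let $V\langle\langle e^{\pm\pi i\zeta},u\rangle\rangle_+$ be the space of the series $\sum v_{\kappa,m,\sigma}e^{\pi i\kappa\zeta}h_{m\sigma}(u)$ $(\kappa\in\mathbb Z)$ such that for some $N$, $v_{\kappa,m,\sigma}=0$ whenever $2m>\kappa+N$. Let $\zeta_{jk}=\zeta_j-\zeta_k$, and let $\Omega_n=\prod_{j<k}e^{-\pi i\tau/2}\vartheta_{11}(\zeta_{jk}+\alpha_{jk},\tau)\vartheta_{11}(\zeta_{jk}-\alpha_{jk},\tau)$, where $u_j\cdot u_k=\cos2\pi\alpha_{jk}$ and $\vartheta_{11}(\zeta,\tau)=\sum_{l\in\mathbb Z} e^{\pi i\tau(l+1/2)^2+2\pi i(l+1/2)(\zeta+1/2)}$. **Theorem.** Fix $D,I,p,n$. There are, for each $N\in\mathbb N$, a number $C_N$ and fixed series $E^{(N)}_{c;A_1\dots A_n}(\zeta_{12},\dots,\zeta_{n-1\,n};u_1,\dots,u_n;\tau)$, $c=1,\dots,C_N$, $A_k\in I$, in $\mathbb C\langle\langle e^{\pm\pi i\zeta_1},u_1\rangle\rangle_+\cdots\langle\langle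 e^{\pm\pi i\zeta_n},u_n\rangle\rangle_+[[q^{1/2}]]$, depending on the $\zeta_k$ only through their differences and with only even (odd) powers of $e^{\pi i\zeta_k}$ if $\phi_{A_k}$ is bosonic (fermionic), such that: 1. they converge absolutely in the domain $\{0<-\mathrm{Im}\,\zeta_{jk}<\mathrm{Im}\,\tau\ (1\le j<k\le n),\ \mathrm{Im}\,\tau>0,\ u_k\in\mathbb S^{D-1}\}$ to meromorphic functions over $(\mathbb C\times\mathbb S^{D-1})^n\times\{\mathrm{Im}\,\tau>0\}$, of the form (function analytic for $\mathrm{Im}\,\tau>0$)$/\Omega_n^N$; 2. these functions are $\mathbb Z_2$-symmetric: for every permutation $s$, $E^{(N)}_{c;A_{s(1)}\dots A_{s(n)}}$ at $(\zeta_{s(1)},u_{s(1)};\dots;\zeta_{s(n)},u_{s(n)};\tau)$ equals $(-1)^{\varepsilon(s)}E^{(N)}_{c;A_1\dots A_n}$ at $(\zeta_1,u_1;\dots;\zeta_n,u_n;\tau)$, where $\varepsilon(s)=\sum p_{A_{s(i)}}p_{A_{s(j)}}$ over $i<j$ with $s(i)>s(j)$; 3. they are doubly periodic (antiperiodic) in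 $\zeta_m$ with periods $1$ and $\tau$ if $\phi_{A_m}$ is bosonic (fermionic), $m=1,\dots,n$; 4. for every GCI theory with these data such that $H$ has finite-dimensional eigenspaces, and all sufficiently large $N$, there are power series $G_{c;A_1\dots A_n}(u_1,\dots,u_n;\tau)$ in $q^{1/2}$, whose coefficients are polynomials in $u_1,\dots,u_n$, symmetric under permutations of the $u_k$ and harmonic in each $u_k$, such that, as formal series and for all $A_1,\dots,A_n\in I$ and $u_k\in\mathbb S^{D-1}$, $$\langle\phi_{A_1}(\zeta_1,u_1)\cdots\phi_{A_n}(\zeta_n,u_n)\rangle_q=\sum_{c=1}^{C_N}G_{c;A_1\dots A_n}(u_1,\dots,u_n;\tau)\,E^{(N)}_{c;A_1\dots A_n}(\zeta_{12},\dots,\zeta_{n-1\,n};u_1,\dots,u_n;\tau).$$ -/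

import Mathlib

open scoped InnerProductSpace

namespace GCI

noncomputable section

/-! ### Harmonic polynomials and the unit sphere -/

/-- The Laplace operator `∑_α ∂²/∂z_α²` on polynomials in `z_1, …, z_D`. -/
def laplacian (D : ℕ) :
    MvPolynomial (Fin D) ℂ →ₗ[ℂ] MvPolynomial (Fin D) ℂ :=
  ∑ α : Fin D,
    ((MvPolynomial.pderiv α).toLinearMap ∘ₗ (MvPolynomial.pderiv α).toLinearMap)

/-- Homogeneous harmonic polynomials of degree `m` on `ℂ^D`. -/
def harmonic (D m : ℕ) : Submodule ℂ (MvPolynomial (Fin D) ℂ) :=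
  MvPolynomial.homogeneousSubmodule (Fin D) ℂ m ⊓ LinearMap.ker (laplacian D)

/-- The unit sphere `𝕊^{D-1}` in `ℝ^D`. -/
abbrev UnitSphere (D : ℕ) : Type := Metric.sphere (0 : EuclideanSpace ℝ (Fin D)) 1

/-- The coordinates of a point of the sphere, as complex numbers. -/
def coord {D : ℕ} (u : UnitSphere D) : Fin D → ℂ :=
  fun α => ((u : EuclideanSpace ℝ (Fin D)) α : ℂ)

/-- The complex bilinear product `z · w = ∑_α z_α w_α` on `ℂ^D`. -/
def dot {D : ℕ} (z w : Fin D → ℂ) : ℂ := ∑ α, z α * w α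

/-- The standard basis vectors, as points of the sphere. -/
def unitVec {D : ℕ} (α : Fin D) : UnitSphere D :=
  ⟨EuclideanSpace.single α 1, by simp⟩

/-- The last index, `e_D = unitVec lastIdx`. -/
def lastIdx (D : ℕ) [NeZero D] : Fin D := Fin.rev 0

/-- The reflection `(v_1, …, v_{D-1}, v_D) ↦ (v_1, …, v_{D-1}, -v_D)` of the sphere. -/
def reflLast {D : ℕ} [NeZero D] (u : UnitSphere D) : UnitSphere D :=
  ⟨(ℝ ∙ (EuclideanSpace.single (lastIdx D) (1 : ℝ)))ᗮ.reflection u, by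
    simp⟩

/-- The unit vector `cos (t/2) e_α + sin (t/2) e_β` (for `α ≠ β`). -/
def arc {D : ℕ} (α β : Fin D) (h : α ≠ β) (t : ℝ) : UnitSphere D :=
  ⟨Real.cos (t / 2) • EuclideanSpace.single α 1 + Real.sin (t / 2) • EuclideanSpace.single β 1, by
    have h1 : ⟪(Real.cos (t / 2) • EuclideanSpace.single α (1 : ℝ) : EuclideanSpace ℝ (Fin D)),
        Real.sin (t / 2) • EuclideanSpace.single β 1⟫_ℝ = 0 := by
      simp [inner_smul_left, inner_smul_right, EuclideanSpace.inner_single_left, h]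
    have h2 := norm_add_sq_eq_norm_sq_add_norm_sq_of_inner_eq_zero _ _ h1
    rw [mem_sphere_zero_iff_norm]
    have h3 : ‖(Real.cos (t / 2) • EuclideanSpace.single α (1 : ℝ) : EuclideanSpace ℝ (Fin D))
        + Real.sin (t / 2) • EuclideanSpace.single β 1‖ ^ 2 = 1 := by
      rw [sq, h2]
      simp only [norm_smul, PiLp.norm_single, norm_one, mul_one, Real.norm_eq_abs,
        abs_mul_abs_self]
      nlinarith [Real.sin_sq_add_cos_sq (t / 2)]
    exact (pow_eq_one_iff_of_nonneg (norm_nonneg _) two_ne_zero).1 h3⟩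

/-! ### The group `Spin(D)` -/

/-- The Euclidean quadratic form on `ℝ^D`. -/
def quad (D : ℕ) : QuadraticForm ℝ (EuclideanSpace ℝ (Fin D)) :=
  LinearMap.BilinMap.toQuadraticMap (innerₗ (EuclideanSpace ℝ (Fin D)))

/-- The compact group `Spin(D)`. -/
abbrev Spin (D : ℕ) : Type := spinGroup (quad D)

theorem ι_mul_self {D : ℕ} (u : UnitSphere D) :
    CliffordAlgebra.ι (quad D) u * CliffordAlgebra.ι (quad D) u = 1 := by
  rw [CliffordAlgebra.ι_sq_scalar]
  have : quad D u = 1 := by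
    simp [quad, LinearMap.BilinMap.toQuadraticMap_apply]
  rw [this, map_one]

/-- The element `u v` (Clifford product of two unit vectors) of `Spin(D)`; it covers the rotation
`R_u R_v`, where `R_w` is the reflection in the hyperplane orthogonal to `w`. -/
def spinPair {D : ℕ} (u v : UnitSphere D) : Spin D :=
  ⟨CliffordAlgebra.ι (quad D) u * CliffordAlgebra.ι (quad D) v, by
    have hl : ∀ w : UnitSphere D, ∃ x : (CliffordAlgebra (quad D))ˣ,
        x ∈ lipschitzGroup (quad D) ∧ (x : CliffordAlgebra (quad D)) =
          CliffordAlgebra.ι (quad D) w := fun w =>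
      ⟨⟨_, _, ι_mul_self w, ι_mul_self w⟩, Subgroup.subset_closure ⟨w, rfl⟩, rfl⟩
    obtain ⟨x, hx, hxu⟩ := hl u
    obtain ⟨y, hy, hyv⟩ := hl v
    have hu := ι_mul_self u
    have hv := ι_mul_self v
    refine spinGroup.mem_iff.2 ⟨pinGroup.mem_iff.2 ⟨⟨x * y, mul_mem hx hy, ?_⟩, ?_⟩, ?_⟩
    · simp [hxu, hyv]
    · rw [Unitary.mem_iff, star_mul, CliffordAlgebra.star_ι, CliffordAlgebra.star_ι]
      constructor
      · rw [neg_mul_neg, mul_assoc, ← mul_assoc _ _ (CliffordAlgebra.ι (quad D) (v : _)), hu,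
          one_mul, hv]
      · rw [neg_mul_neg, mul_assoc, ← mul_assoc _ _ (CliffordAlgebra.ι (quad D) (u : _)), hv,
          one_mul, hu]
    · exact CliffordAlgebra.ι_mul_ι_mem_evenOdd_zero (quad D) _ _⟩

/-- The antipode of a point of the sphere. -/
def antipode {D : ℕ} (u : UnitSphere D) : UnitSphere D := ⟨-(u : EuclideanSpace ℝ (Fin D)), by simp⟩

/-- The central element `-1` of `Spin(D)`. -/
def spinNegOne (D : ℕ) [NeZero D] : Spin D :=
  spinPair (unitVec (lastIdx D)) (antipode (unitVec (lastIdx D)))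

/-! ### Quantum fields as formal series

A field is the formal series
`φ_A(z) = ∑_{n ∈ ℤ} ∑_{m ≥ 0} ∑_σ φ_{A{n,m,σ}} (z²)^n h_{m,σ}(z)`,
with operator valued modes `mode A n m σ = φ_{A{n,m,σ}}`, where `(h_{m,σ})_σ` is a basis of the
homogeneous harmonic polynomials of degree `m`. An identity between such series is an identity
between their homogeneous parts in `z` (or in `z` and `w`), and each homogeneous part, applied to a
vector, is a finite sum, which is determined by its values at the points `z` with `z² ≠ 0`. -/

section Series

variable {D : ℕ} {I : Type*} {ι : ℕ → Type*} [∀ m, Fintype (ι m)]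
  (h : ∀ m, Module.Basis (ι m) ℂ (harmonic D m))
  {V : Type*} [AddCommGroup V] [Module ℂ V]
  (mode : I → ℤ → (m : ℕ) → ι m → Module.End ℂ V)

/-- The value at `z` of the homogeneous part of degree `k` of `φ_A(z) Ψ`. -/
def part (A : I) (k : ℤ) (z : Fin D → ℂ) (Ψ : V) : V :=
  ∑ᶠ x : ℤ × ℕ, if 2 * x.1 + (x.2 : ℤ) = k then
    ∑ σ : ι x.2,
      (dot z z ^ x.1 * MvPolynomial.eval z (h x.2 σ : MvPolynomial (Fin D) ℂ)) •
        mode A x.1 x.2 σ Ψ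
  else 0

/-- The value at `z` of the homogeneous part of degree `k - 1` of `∂φ_A(z)/∂z_α Ψ`: the derivative
of the homogeneous part of degree `k` of `φ_A(z) Ψ`. -/
def dpart (A : I) (α : Fin D) (k : ℤ) (z : Fin D → ℂ) (Ψ : V) : V :=
  ∑ᶠ x : ℤ × ℕ, if 2 * x.1 + (x.2 : ℤ) = k then
    ∑ σ : ι x.2,
      ((x.1 : ℂ) * dot z z ^ (x.1 - 1) * (2 * z α) *
          MvPolynomial.eval z (h x.2 σ : MvPolynomial (Fin D) ℂ) +
        dot z z ^ x.1 *
          MvPolynomial.eval z (MvPolynomial.pderiv α (h x.2 σ : MvPolynomial (Fin D) ℂ))) •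
        mode A x.1 x.2 σ Ψ
  else 0

end Series

/-- Multiplication of a series in `(z, w)`, given by its values `f k₁ k₂` in bidegree `(k₁, k₂)`
at the point `(z, w)`, by `(z - w)² = z² - 2 z·w + w²`. -/
def mulInterval {D : ℕ} {V : Type*} [AddCommGroup V] [Module ℂ V] (z w : Fin D → ℂ)
    (f : ℤ → ℤ → V) : ℤ → ℤ → V := fun k₁ k₂ =>
  dot z z • f (k₁ - 2) k₂ - (2 * dot z w) • f (k₁ - 1) (k₂ - 1) + dot w w • f k₁ (k₂ - 2)

/-- The Kronecker symbol. -/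
def kron {D : ℕ} (α β : Fin D) : ℂ := if α = β then 1 else 0

/-- The sign `(-1)^{a b}` for parities `a, b ∈ ℤ/2`. -/
def paritySign (a b : ZMod 2) : ℂ := (-1) ^ (a.val * b.val)

/-- A quantum field theory with global conformal invariance in the analytic (`z`-)picture, with
fields `φ_A`, `A ∈ I`, of fermion parity `p A`. -/
structure GCITheory (D : ℕ) [NeZero D] (I : Type*) [Fintype I] [DecidableEq I] (p : I → ZMod 2)
    {ι : ℕ → Type*} [∀ m, Fintype (ι m)] (h : ∀ m, Module.Basis (ι m) ℂ (harmonic D m))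
    (ℋ : Type*) [NormedAddCommGroup ℋ] [InnerProductSpace ℂ ℋ] [CompleteSpace ℋ] where
  /-- The common invariant dense domain. -/
  dom : Submodule ℂ ℋ
  dense : Dense (dom : Set ℋ)
  /-- The modes `φ_{A{n,m,σ}}` of the fields. -/
  mode : I → ℤ → (m : ℕ) → ι m → Module.End ℂ dom
  /-- Every field is non-zero. -/
  field_ne_zero : ∀ A, ∃ n m σ, mode A n m σ ≠ 0
  /-- For every vector `Ψ` the powers of `z²` in `φ_A(z) Ψ` are bounded below. -/
  truncation : ∀ A, ∀ Ψ : dom, ∃ N : ℤ, ∀ n ≤ -N, ∀ m σ, mode A n m σ Ψ = 0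
  /-- Generators of translations. -/
  T : Fin D → Module.End ℂ dom
  /-- Generators of special conformal transformations. -/
  C : Fin D → Module.End ℂ dom
  /-- The conformal Hamiltonian. -/
  H : Module.End ℂ dom
  /-- Generators of rotations. -/
  Ω : Fin D → Fin D → Module.End ℂ dom
  -- The commutation relations of the conformal Lie algebra.
  comm_TC : ∀ α β, ⁅T α, C β⁆ = (2 : ℂ) • (kron α β • H - Ω α β)
  comm_HT : ∀ α, ⁅H, T α⁆ = T α
  comm_HC : ∀ α, ⁅H, C α⁆ = -C α
  comm_TT : ∀ α β, ⁅T α, T β⁆ = 0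
  comm_CC : ∀ α β, ⁅C α, C β⁆ = 0
  comm_HΩ : ∀ α β, ⁅H, Ω α β⁆ = 0
  Ω_antisymm : ∀ α β, Ω β α = -Ω α β
  comm_ΩT : ∀ α β γ, ⁅Ω α β, T γ⁆ = kron α γ • T β - kron β γ • T α
  comm_ΩC : ∀ α β γ, ⁅Ω α β, C γ⁆ = kron α γ • C β - kron β γ • C α
  comm_ΩΩ : ∀ α β γ δ, ⁅Ω α β, Ω γ δ⁆ =
    kron β δ • Ω α γ + kron α γ • Ω β δ - kron β γ • Ω α δ - kron α δ • Ω β γ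
  -- Unitarity: the generators of the real conformal group are skew-symmetric.
  adj_T : ∀ α, ∀ Ψ₁ Ψ₂ : dom, ⟪T α Ψ₁, Ψ₂⟫_ℂ = -⟪Ψ₁, C α Ψ₂⟫_ℂ
  adj_H : ∀ Ψ₁ Ψ₂ : dom, ⟪H Ψ₁, Ψ₂⟫_ℂ = ⟪Ψ₁, H Ψ₂⟫_ℂ
  adj_Ω : ∀ α β, ∀ Ψ₁ Ψ₂ : dom, ⟪Ω α β Ψ₁, Ψ₂⟫_ℂ = -⟪Ψ₁, Ω α β Ψ₂⟫_ℂ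
  /-- The dimensions of the fields. -/
  d : I → ℝ
  /-- The finite-dimensional representation of `Spin(D)` on the field multiplet. -/
  ρ : Spin D →* Matrix I I ℂ
  ρ_dim : ∀ g A B, ρ g A B ≠ 0 → d A = d B
  /-- Together with the phases `e^{2πiζ d_A}` of the conformal time translations, `ρ` is a
  representation of the maximal compact subgroup `(U(1) × Spin(D))/ℤ₂`. -/
  ρ_neg_one : ρ (spinNegOne D) =
    Matrix.diagonal fun A => Complex.exp (2 * Real.pi * Complex.I * (d A : ℂ))
  /-- The matrices of the infinitesimal rotations on the field multiplet. -/
  S : Fin D → Fin D → Matrix I I ℂ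
  S_diag : ∀ α, S α α = 0
  S_deriv : ∀ α β, ∀ hαβ : α ≠ β, ∀ A B,
    HasDerivAt (fun t : ℝ => ρ (spinPair (arc α β hαβ 0) (arc α β hαβ t)) A B) (S α β A B) 0
  -- Conformal covariance, degree by degree.
  cov_T : ∀ A α k, ∀ z : Fin D → ℂ, dot z z ≠ 0 → ∀ Ψ : dom,
    T α (part h mode A k z Ψ) - part h mode A k z (T α Ψ) = dpart h mode A α (k + 1) z Ψ
  cov_H : ∀ A k, ∀ z : Fin D → ℂ, dot z z ≠ 0 → ∀ Ψ : dom,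
    H (part h mode A k z Ψ) - part h mode A k z (H Ψ) =
      ((k : ℂ) + (d A : ℂ)) • part h mode A k z Ψ
  cov_Ω : ∀ A α β k, ∀ z : Fin D → ℂ, dot z z ≠ 0 → ∀ Ψ : dom,
    Ω α β (part h mode A k z Ψ) - part h mode A k z (Ω α β Ψ) =
      z α • dpart h mode A β k z Ψ - z β • dpart h mode A α k z Ψ
        + ∑ B, S α β A B • part h mode B k z Ψ
  cov_C : ∀ A α k, ∀ z : Fin D → ℂ, dot z z ≠ 0 → ∀ Ψ : dom,
    C α (part h mode A k z Ψ) - part h mode A k z (C α Ψ) =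
      dot z z • dpart h mode A α (k - 1) z Ψ
        - (2 * z α * (((k - 1 : ℤ) : ℂ) + (d A : ℂ))) • part h mode A (k - 1) z Ψ
        + (2 : ℂ) • ∑ β, ∑ B, (z β * S β α A B) • part h mode B (k - 1) z Ψ
  /-- The matrix of the conjugation of the field multiplet, `φ*_A = ∑_B J_{AB} φ_B`. -/
  J : Matrix I I ℂ
  J_involutive : J.map (starRingEnd ℂ) * J = 1
  J_grading : ∀ A B, J A B ≠ 0 → d A = d B ∧ p A = p B
  J_invariant : ∀ u v : UnitSphere D, J * ρ (spinPair u v) =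
    (ρ (spinPair (reflLast u) (reflLast v))).map (starRingEnd ℂ) * J
  /-- Hermitian conjugation of the fields at the points `z = e^{2πiζ} u` (`ζ` real) of the
  compactified Minkowski space, expressed through the Fourier modes in `ζ`. -/
  conj_law : ∀ A, ∀ u : UnitSphere D, ∀ k k' : ℤ, (k : ℝ) + k' + 2 * d A = 0 → ∀ Ψ₁ Ψ₂ : dom,
    ⟪Ψ₁, part h mode A k (coord u) Ψ₂⟫_ℂ =
      ∑ B, ρ (spinPair u (unitVec (lastIdx D))) A B *
        ⟪∑ B', J B B' • part h mode B' k' (coord u) Ψ₁, Ψ₂⟫_ℂ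
  /-- Positivity of the energy. -/
  H_nonneg : ∀ Ψ : dom, 0 ≤ (⟪Ψ, H Ψ⟫_ℂ).re
  /-- The vacuum. -/
  vac : dom
  vac_norm : ‖vac‖ = 1
  vac_inv : H vac = 0 ∧ (∀ α, T α vac = 0) ∧ (∀ α, C α vac = 0) ∧ ∀ α β, Ω α β vac = 0
  vac_unique : ∀ Ψ : dom, (H Ψ = 0 ∧ (∀ α, T α Ψ = 0) ∧ (∀ α, C α Ψ = 0) ∧ ∀ α β, Ω α β Ψ = 0) →
    ∃ c : ℂ, Ψ = c • vac
  /-- Strong locality: `((z - w)²)^M (φ_A(z) φ_B(w) - (-1)^{p_A p_B} φ_B(w) φ_A(z)) = 0` for some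
  `M = M_{AB}`. -/
  locality : ∀ A B, ∃ M : ℕ, ∀ Ψ : dom, ∀ z w : Fin D → ℂ, dot z z ≠ 0 → dot w w ≠ 0 → ∀ k₁ k₂,
    (mulInterval z w)^[M] (fun k₁ k₂ =>
      part h mode A k₁ z (part h mode B k₂ w Ψ) -
        paritySign (p A) (p B) • part h mode B k₂ w (part h mode A k₁ z Ψ)) k₁ k₂ = 0
  /-- Completeness: the domain is generated from the vacuum by the modes of the fields. -/
  complete : ∀ W : Submodule ℂ dom, vac ∈ W →
    (∀ A n m σ, ∀ Ψ ∈ W, mode A n m σ Ψ ∈ W) → W = ⊤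

/-! ### Thermal correlation functions -/

namespace GCITheory

variable {D : ℕ} [NeZero D] {I : Type*} [Fintype I] [DecidableEq I] {p : I → ZMod 2}
  {ι : ℕ → Type*} [∀ m, Fintype (ι m)] {h : ∀ m, Module.Basis (ι m) ℂ (harmonic D m)}
  {ℋ : Type*} [NormedAddCommGroup ℋ] [InnerProductSpace ℂ ℋ] [CompleteSpace ℋ]
  (𝒯 : GCITheory D I p h ℋ)

/-- The Hamiltonian has finite-dimensional eigenspaces. -/
def FiniteEigenspaces : Prop := ∀ E : ℂ, FiniteDimensional ℂ (Module.End.eigenspace 𝒯.H E)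

/-- The compact picture field `φ_A(ζ, u) = e^{2πiζ d_A} φ_A(e^{2πiζ} u)` at a fixed `u`: the
operator coefficient of `e^{πiκζ}` applied to a vector. -/
def compactMode (A : I) (κ : ℤ) (u : UnitSphere D) (Ψ : 𝒯.dom) : 𝒯.dom :=
  ∑ᶠ k : ℤ, if 2 * (𝒯.d A + k) = κ then part h 𝒯.mode A k (coord u) Ψ else 0

/-- The coefficient of `e^{πi ∑ κ_k ζ_k}` in `φ_{A_1}(ζ_1, u_1) ⋯ φ_{A_n}(ζ_n, u_n) Ψ`. -/
def product {n : ℕ} (A : Fin n → I) (κ : Fin n → ℤ) (u : Fin n → UnitSphere D) (Ψ : 𝒯.dom) :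
    𝒯.dom :=
  (List.finRange n).foldr (fun k Φ => 𝒯.compactMode (A k) (κ k) (u k) Φ) Ψ

/-- The trace of `X` over the eigenspace of `H` of eigenvalue `j/2`. -/
def levelTrace (fin : 𝒯.FiniteEigenspaces) (X : 𝒯.dom → 𝒯.dom) (j : ℕ) : ℂ :=
  haveI := fin ((j : ℂ) / 2)
  ∑ i, ⟪((stdOrthonormalBasis ℂ (Module.End.eigenspace 𝒯.H ((j : ℂ) / 2)) i : _) : 𝒯.dom),
    X (stdOrthonormalBasis ℂ (Module.End.eigenspace 𝒯.H ((j : ℂ) / 2)) i : _)⟫_ℂ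

/-- `tr (X q^H)`, as a power series in `q^{1/2}`. -/
def trace (fin : 𝒯.FiniteEigenspaces) (X : 𝒯.dom → 𝒯.dom) : PowerSeries ℂ :=
  PowerSeries.mk (𝒯.levelTrace fin X)

/-- The coefficient of `e^{πi ∑ κ_k ζ_k}` in the thermal correlation function
`⟨φ_{A_1}(ζ_1, u_1) ⋯ φ_{A_n}(ζ_n, u_n)⟩_q = tr (φ_{A_1}(ζ_1, u_1) ⋯ φ_{A_n}(ζ_n, u_n) q^H) / tr q^H`,
a power series in `q^{1/2}`. -/
def thermal (fin : 𝒯.FiniteEigenspaces) {n : ℕ} (A : Fin n → I) (κ : Fin n → ℤ)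
    (u : Fin n → UnitSphere D) : PowerSeries ℂ :=
  (𝒯.trace fin id)⁻¹ * 𝒯.trace fin (𝒯.product A κ u)

end GCITheory

/-! ### Formal series in `ζ_1, u_1, …, ζ_n, u_n` and `q^{1/2}` -/

/-- Polynomials in the coordinates of `n` points `u_1, …, u_n` of `ℝ^D`; the variable `(k, α)` is
the coordinate `α` of `u_k`. -/
abbrev PointPoly (D n : ℕ) : Type := MvPolynomial (Fin n × Fin D) ℂ

/-- Evaluation of polynomials at `n` points of `ℂ^D`. -/
def evalAt {D n : ℕ} (u : Fin n → Fin D → ℂ) : PointPoly D n →+* ℂ :=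
  MvPolynomial.eval fun x => u x.1 x.2

/-- Polynomials that are harmonic in each of the points. These represent uniquely the polynomial
functions on the `n`-th power of the sphere. -/
def IsMultiHarmonic {D n : ℕ} (P : PointPoly D n) : Prop :=
  ∀ k : Fin n, ∑ α : Fin D, MvPolynomial.pderiv (k, α) (MvPolynomial.pderiv (k, α) P) = 0

/-- Invariance under permutations of the points. -/
def IsSymm {D n : ℕ} (P : PointPoly D n) : Prop :=
  ∀ s : Equiv.Perm (Fin n), MvPolynomial.rename (fun x => (s x.1, x.2)) P = P

/-- The degree of a polynomial in the coordinates of the point number `k`. -/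
def degIn {D n : ℕ} (k : Fin n) (P : PointPoly D n) : ℕ :=
  P.support.sup fun s => ∑ α : Fin D, s (k, α)

/-- Series `∑_κ E_κ e^{πi ∑ κ_k ζ_k}` whose coefficients are power series in `q^{1/2}` with
coefficients polynomials in `u_1, …, u_n`. -/
abbrev ThermalSeries (D n : ℕ) : Type := (Fin n → ℤ) → PowerSeries (PointPoly D n)

/-- The space `ℂ⟨⟨e^{±πiζ_1}, u_1⟩⟩_+ ⋯ ⟨⟨e^{±πiζ_n}, u_n⟩⟩_+ [[q^{1/2}]]`.

A series in `V⟨⟨e^{±πiζ}, u⟩⟩_+` is a series `∑ v_{κ,m,σ} e^{πiκζ} h_{m,σ}(u)` such that, for some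
`N`, `v_{κ,m,σ} = 0` whenever `2 m > κ + N`: these are the powers of `z²` bounded below when
`z = e^{2πiζ} u`. Iterating, the bound in the variable `k` may depend on the term in the variables
`l > k`. -/
def MemPlus {D n : ℕ} (E : ThermalSeries D n) : Prop :=
  (∀ κ j, IsMultiHarmonic (PowerSeries.coeff j (E κ))) ∧
    ∀ (j : ℕ) (k : Fin n) (κ₀ : Fin n → ℤ), ∃ N : ℕ, ∀ κ : Fin n → ℤ, (∀ l, k < l → κ l = κ₀ l) →
      PowerSeries.coeff j (E κ) ≠ 0 → 2 * (degIn k (PowerSeries.coeff j (E κ)) : ℤ) ≤ κ k + N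

/-- The series depends on the `ζ_k` only through the differences `ζ_j - ζ_k`. -/
def DependsOnDifferences {D n : ℕ} (E : ThermalSeries D n) : Prop :=
  ∀ κ, E κ ≠ 0 → ∑ k, κ k = 0

/-- The domain of all `(ζ, τ)` with `0 < -Im (ζ_j - ζ_k) < Im τ` for `j < k` and `Im τ > 0`. -/
def convDomain (n : ℕ) : Set ((Fin n → ℂ) × ℂ) :=
  {x | 0 < x.2.im ∧ ∀ j k, j < k → 0 < -(x.1 j - x.1 k).im ∧ -(x.1 j - x.1 k).im < x.2.im}

/-- The series converges absolutely to `f` on the domain (with `q^{1/2} = e^{πiτ}`). -/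
def ConvergesTo {D n : ℕ} (E : ThermalSeries D n)
    (f : (Fin n → ℂ) → (Fin n → UnitSphere D) → ℂ → ℂ) : Prop :=
  ∀ ζ τ, (ζ, τ) ∈ convDomain n → ∀ u : Fin n → UnitSphere D,
    HasSum (fun x : ℕ × (Fin n → ℤ) =>
      evalAt (fun k => coord (u k)) (PowerSeries.coeff x.1 (E x.2)) *
        Complex.exp (Real.pi * Complex.I * (x.1 * τ + ∑ k, (x.2 k : ℂ) * ζ k))) (f ζ u τ)

/-- Meromorphy over `(ℂ × 𝕊^{D-1})^n × {Im τ > 0}`: locally a quotient `g / h` of functions that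
are analytic in `(ζ, u, τ)`, with `u` in a complex neighbourhood of the sphere, where `h` does not
vanish identically in `(ζ, τ)` near the given point. -/
def IsMeromorphicOver {D n : ℕ} (f : (Fin n → ℂ) → (Fin n → UnitSphere D) → ℂ → ℂ) : Prop :=
  ∀ (ζ₀ : Fin n → ℂ) (u₀ : Fin n → UnitSphere D) (τ₀ : ℂ), 0 < τ₀.im →
    ∃ g h : (Fin n → ℂ) × (Fin n → Fin D → ℂ) × ℂ → ℂ,
      AnalyticAt ℂ g (ζ₀, fun k => coord (u₀ k), τ₀) ∧
      AnalyticAt ℂ h (ζ₀, fun k => coord (u₀ k), τ₀) ∧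
      (∃ᶠ x in nhds (ζ₀, τ₀), h (x.1, fun k => coord (u₀ k), x.2) ≠ 0) ∧
      ∀ᶠ x in nhds (ζ₀, u₀, τ₀), h (x.1, fun k => coord (x.2.1 k), x.2.2) ≠ 0 →
        f x.1 x.2.1 x.2.2 =
          g (x.1, fun k => coord (x.2.1 k), x.2.2) / h (x.1, fun k => coord (x.2.1 k), x.2.2)

/-- The Jacobi theta function
`ϑ₁₁(ζ, τ) = ∑_n e^{πiτ(n+1/2)² + 2πi(n+1/2)(ζ+1/2)}`. -/
def theta11 (ζ τ : ℂ) : ℂ :=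
  Complex.exp (Real.pi * Complex.I * τ / 4 + Real.pi * Complex.I * (ζ + 1 / 2)) *
    jacobiTheta₂ (ζ + 1 / 2 + τ / 2) τ

/-- The elliptic interval `e^{-πiτ/2} ϑ₁₁(ζ + α, τ) ϑ₁₁(ζ - α, τ)`, where `u · v = cos 2πα`. -/
def ellInterval {D : ℕ} (ζ : ℂ) (u v : UnitSphere D) (τ : ℂ) : ℂ :=
  let α : ℝ := Real.arccos ⟪(u : EuclideanSpace ℝ (Fin D)), (v : EuclideanSpace ℝ (Fin D))⟫_ℝ /
    (2 * Real.pi)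
  Complex.exp (-(Real.pi * Complex.I * τ / 2)) * theta11 (ζ + α) τ * theta11 (ζ - α) τ

/-- The product of the elliptic intervals of all pairs of points. -/
def ellProduct {D n : ℕ} (ζ : Fin n → ℂ) (u : Fin n → UnitSphere D) (τ : ℂ) : ℂ :=
  ∏ j, ∏ k, if j < k then ellInterval (ζ j - ζ k) (u j) (u k) τ else 1

/-- The function becomes everywhere analytic after multiplication by the `N`-th power of the
product of the elliptic intervals (off whose zeros it is given by the quotient). -/
def HasEllipticDenominator {D n : ℕ} (N : ℕ)
    (f : (Fin n → ℂ) → (Fin n → UnitSphere D) → ℂ → ℂ) : Prop :=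
  ∃ F : (Fin n → ℂ) × (Fin n → Fin D → ℂ) × ℂ → ℂ,
    AnalyticOnNhd ℂ F {x | 0 < x.2.2.im} ∧
    ∀ ζ u τ, 0 < τ.im → ellProduct ζ u τ ≠ 0 →
      f ζ u τ = F (ζ, fun k => coord (u k), τ) / ellProduct ζ u τ ^ N

/-- The statistical sign of a permutation of fields. -/
def statSign {I : Type*} (p : I → ZMod 2) {n : ℕ} (A : Fin n → I) (s : Equiv.Perm (Fin n)) : ℂ :=
  ∏ i, ∏ j, if i < j ∧ s j < s i then paritySign (p (A (s i))) (p (A (s j))) else 1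

end

end GCI

/-!
In the gap variables `x_k = e^{πi(ζ_k - ζ_{k-1})}`, `x_0 = e^{πi(τ + ζ_0 - ζ_m)}`, in which the
domain of convergence is a polydisc, the trace of a product of modes becomes a power series: the
exponents are the energies of the intermediate states (`charges_traceSeries`), which are
non-negative. That they are integers, and the charges of the fields have the parity of the fields,
is the theorem on spin and statistics (`spin_statistics`), proved from the two-point functions.

The elliptic interval, divided by a monomial, is the power series `pairSeries` with constant term
`1` (`ellInterval_eq_ellFun`, `pval_pairSeries`). By the finite form of the Jacobi triple product
its inverse converges absolutely where it should (`wnorm_inv_pairSeries_ne_top`). So the trace is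
the numerator `numSeries`, its product with the `N`-th power of the elliptic intervals of all pairs,
times an inverse that is the same for all theories.

For large `N` locality makes the numerator symmetric under permutations of the fields: in terms of
Laurent polynomials in the `e^{πiζ_k}` the elliptic interval is divisible by the ordinary one
(`dvd_pairLaurent`, `exists_symmetricTraces`). The cyclicity of the trace moves the last field to
the first place (`symTraceInt_rotation`). Together they give the behaviour of the numerator under
translations of a single `ζ_k` by `τ` (`symTraceInt_add_single`), that of a theta function of a
lattice. So its coefficients are determined by those at the finitely many charges of minimal length
modulo the lattice, and the numerator is a combination of lattice theta series with coefficients in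
`ℂ[[q^{1/2}]]` (`numSeries_eq_sum`). Quotients of these theta functions by the product of the
elliptic intervals are elliptic.

The coefficients are polynomials in the `u_k`. Polynomials are a finite module over the symmetric
ones (`exists_generators`), and the module generators are absorbed into the basis `basisSeries`,
which is summed over permutations to make it `ℤ₂`-symmetric; the symmetric factors remain as the
`G` (`exists_expansion`). On the sphere every polynomial agrees with one that is harmonic in each
point (`exists_multiHarmonic`), and the degrees in the `u_k` of the coefficients of the basis are
bounded by the exponents of the gap variables (`memPlus_toThermal`).
-/

open scoped InnerProductSpace

namespace GCI

noncomputable section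

open Complex (exp I)
open Equiv (Perm)
open Finset (sum_congr mul_sum prod_congr sum_add_distrib sum_mul mem_univ prod_mul_distrib
  sum_eq_zero sum_sub_distrib mem_filter prod_eq_one prod_insert sum_comm sum_insert mem_range
  single_le_sum range Icc sum_const sum_nonneg sum_le_sum univ)
open Finset.HasAntidiagonal (antidiagonal mem_antidiagonal)
open Function (comp_apply iterate_succ_apply')
open Module (End)
open MvPolynomial (eval pderiv)
open MvPowerSeries (coeff monomial)
open PowerSeries (coeff_mk)
open Real (pi)
open scoped ENNReal NNReal

/-! ### Power series in several variables: truncation, weighted norms, evaluation -/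

section MvPS

variable {σ R : Type*}

/-- Congruence of power series modulo terms of total degree at least `n`. -/
def CongrLT [CommRing R] (n : ℕ) (f g : MvPowerSeries σ R) : Prop :=
  ∀ e : σ →₀ ℕ, e.degree < n → coeff e f = coeff e g

namespace CongrLT

variable [CommRing R] {n : ℕ} {f f' g g' : MvPowerSeries σ R}

lemma refl (n : ℕ) (f : MvPowerSeries σ R) : CongrLT n f f := fun _ _ => rfl

lemma symm (h : CongrLT n f g) : CongrLT n g f := fun e he => (h e he).symm

lemma trans {k : MvPowerSeries σ R} (h : CongrLT n f g) (h' : CongrLT n g k) : CongrLT n f k :=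
  fun e he => (h e he).trans (h' e he)

lemma add (h : CongrLT n f f') (h' : CongrLT n g g') : CongrLT n (f + g) (f' + g') :=
  fun e he => by rw [map_add, map_add, h e he, h' e he]

lemma mul (h : CongrLT n f f') (h' : CongrLT n g g') : CongrLT n (f * g) (f' * g') := by
  classical
  intro e he
  rw [MvPowerSeries.coeff_mul, MvPowerSeries.coeff_mul]
  refine sum_congr rfl fun x hx => ?_
  have hd : x.1.degree + x.2.degree = e.degree := by
    rw [← mem_antidiagonal.1 hx, map_add]
  rw [h _ (by omega), h' _ (by omega)]

lemma prod {α : Type*} (s : Finset α) {F G : α → MvPowerSeries σ R}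
    (h : ∀ a ∈ s, CongrLT n (F a) (G a)) : CongrLT n (∏ a ∈ s, F a) (∏ a ∈ s, G a) := by
  classical
  induction s using Finset.induction_on with
  | empty => simpa using refl n 1
  | insert a s ha ih =>
    rw [prod_insert ha, prod_insert ha]
    exact (h a (by simp)).mul (ih fun b hb => h b (by simp [hb]))

lemma sum {α : Type*} (s : Finset α) {F G : α → MvPowerSeries σ R}
    (h : ∀ a ∈ s, CongrLT n (F a) (G a)) : CongrLT n (∑ a ∈ s, F a) (∑ a ∈ s, G a) := by
  intro e he
  rw [map_sum, map_sum]
  exact sum_congr rfl fun a ha => h a ha e he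

lemma monomial_zero {e : σ →₀ ℕ} (he : n ≤ e.degree) (a : R) : CongrLT n (monomial e a) 0 := by
  classical
  intro e' he'
  rw [MvPowerSeries.coeff_monomial, if_neg, map_zero]
  rintro rfl
  omega

end CongrLT

/-- If the coefficients of `f` lie in a graded family of subgroups that is closed under products,
so do those of the inverse of `f`. -/
lemma coeff_invOfUnit_mem [CommRing R] (F : (σ →₀ ℕ) → AddSubgroup R) (h1 : (1 : R) ∈ F 0)
    (hmul : ∀ a b x y, x ∈ F a → y ∈ F b → x * y ∈ F (a + b)) {f : MvPowerSeries σ R}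
    (hf : ∀ e, coeff e f ∈ F e) (e : σ →₀ ℕ) : coeff e (f.invOfUnit 1) ∈ F e := by
  classical
  induction e using WellFoundedLT.induction with
  | ind e ih =>
    rw [MvPowerSeries.coeff_invOfUnit]
    split_ifs with h
    · subst h; simpa using h1
    · rw [inv_one, Units.val_one, neg_one_mul]
      refine neg_mem (sum_mem fun x hx => ?_)
      split_ifs with hlt
      · rw [← mem_antidiagonal.1 hx]
        exact hmul _ _ _ _ (hf _) (ih _ hlt)
      · exact zero_mem _

lemma coeff_mul_mem [CommRing R] (F F' F'' : (σ →₀ ℕ) → AddSubgroup R)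
    (hmul : ∀ a b x y, x ∈ F a → y ∈ F' b → x * y ∈ F'' (a + b)) {f g : MvPowerSeries σ R}
    (hf : ∀ e, coeff e f ∈ F e) (hg : ∀ e, coeff e g ∈ F' e) (e : σ →₀ ℕ) :
    coeff e (f * g) ∈ F'' e := by
  classical
  rw [MvPowerSeries.coeff_mul]
  refine sum_mem fun x hx => ?_
  rw [← mem_antidiagonal.1 hx]
  exact hmul _ _ _ _ (hf _) (hg _)

/-- The monomial `x^e`. -/
def mpow {M : Type*} [CommMonoid M] (x : σ → M) (e : σ →₀ ℕ) : M := e.prod fun i k => x i ^ k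

@[simp] lemma mpow_zero {M : Type*} [CommMonoid M] (x : σ → M) : mpow x 0 = 1 := by simp [mpow]

lemma mpow_add {M : Type*} [CommMonoid M] (x : σ → M) (a b : σ →₀ ℕ) :
    mpow x (a + b) = mpow x a * mpow x b := by
  classical
  exact Finsupp.prod_add_index' (by simp) (by simp [pow_add])

lemma mpow_nsmul {M : Type*} [CommMonoid M] (x : σ → M) (k : ℕ) (a : σ →₀ ℕ) :
    mpow x (k • a) = mpow x a ^ k := by
  induction k with
  | zero => simp
  | succ k ih => rw [succ_nsmul, mpow_add, ih, pow_succ]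

lemma mpow_eq_prod [Fintype σ] {M : Type*} [CommMonoid M] (x : σ → M) (e : σ →₀ ℕ) :
    mpow x e = ∏ i, x i ^ e i :=
  Finsupp.prod_fintype _ _ (by simp)

lemma nnnorm_mpow (x : σ → ℂ) (e : σ →₀ ℕ) : ‖mpow x e‖₊ = mpow (fun i => ‖x i‖₊) e := by
  simp [mpow, Finsupp.prod]

/-- The weighted `ℓ¹`-norm `∑_e |f_e| r^e`, which may be infinite. -/
def wnorm (r : σ → ℝ≥0) (f : MvPowerSeries σ ℂ) : ℝ≥0∞ :=
  ∑' e, ((‖coeff e f‖₊ * mpow r e : ℝ≥0) : ℝ≥0∞)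

/-- The weighted norm is submultiplicative. -/
lemma wnorm_mul_le (r : σ → ℝ≥0) (f g : MvPowerSeries σ ℂ) :
    wnorm r (f * g) ≤ wnorm r f * wnorm r g := by
  classical
  have key : wnorm r f * wnorm r g = ∑' e : σ →₀ ℕ, ∑ x ∈ antidiagonal e,
      ((‖coeff x.1 f‖₊ * mpow r x.1 : ℝ≥0) : ℝ≥0∞) *
        ((‖coeff x.2 g‖₊ * mpow r x.2 : ℝ≥0) : ℝ≥0∞) := by
    have h2 : ∀ e : σ →₀ ℕ, ∑ x ∈ antidiagonal e,
      ((‖coeff x.1 f‖₊ * mpow r x.1 : ℝ≥0) : ℝ≥0∞) *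
        ((‖coeff x.2 g‖₊ * mpow r x.2 : ℝ≥0) : ℝ≥0∞) = ∑' x : antidiagonal e,
      ((‖coeff x.1.1 f‖₊ * mpow r x.1.1 : ℝ≥0) : ℝ≥0∞) *
        ((‖coeff x.1.2 g‖₊ * mpow r x.1.2 : ℝ≥0) : ℝ≥0∞) := fun e => by
      rw [tsum_fintype]; exact (Finset.sum_coe_sort _ (fun x : (σ →₀ ℕ) × (σ →₀ ℕ) =>
        ((‖coeff x.1 f‖₊ * mpow r x.1 : ℝ≥0) : ℝ≥0∞) *
        ((‖coeff x.2 g‖₊ * mpow r x.2 : ℝ≥0) : ℝ≥0∞))).symm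
    simp_rw [h2]
    rw [wnorm, wnorm, ← ENNReal.tsum_mul_right]
    simp_rw [← ENNReal.tsum_mul_left]
    rw [← ENNReal.tsum_prod (f := fun a b => ((‖coeff a f‖₊ * mpow r a : ℝ≥0) : ℝ≥0∞) *
        ((‖coeff b g‖₊ * mpow r b : ℝ≥0) : ℝ≥0∞)),
      ← (Finset.HasAntidiagonal.sigmaAntidiagonalEquivProd (A := σ →₀ ℕ)).tsum_eq]
    exact ENNReal.tsum_sigma' _
  rw [key]
  refine ENNReal.tsum_le_tsum fun e => ?_
  rw [MvPowerSeries.coeff_mul]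
  norm_cast
  calc ‖∑ x ∈ antidiagonal e, coeff x.1 f * coeff x.2 g‖₊ * mpow r e
      ≤ (∑ x ∈ antidiagonal e, ‖coeff x.1 f * coeff x.2 g‖₊) * mpow r e := by
        gcongr; exact nnnorm_sum_le _ _
    _ = _ := by
        rw [sum_mul]
        refine sum_congr rfl fun x hx => ?_
        rw [← mem_antidiagonal.1 hx, mpow_add, nnnorm_mul]; ring

lemma wnorm_monomial (r : σ → ℝ≥0) (e : σ →₀ ℕ) (a : ℂ) :
    wnorm r (monomial e a) = ((‖a‖₊ * mpow r e : ℝ≥0) : ℝ≥0∞) := by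
  classical
  rw [wnorm, tsum_eq_single e, MvPowerSeries.coeff_monomial_same]
  intro e' he'
  rw [MvPowerSeries.coeff_monomial_ne he']; simp

lemma wnorm_one (r : σ → ℝ≥0) : wnorm r (1 : MvPowerSeries σ ℂ) = 1 := by
  have := wnorm_monomial r 0 1
  rw [MvPowerSeries.monomial_zero_one] at this
  rw [this]; simp

lemma wnorm_add_le (r : σ → ℝ≥0) (f g : MvPowerSeries σ ℂ) :
    wnorm r (f + g) ≤ wnorm r f + wnorm r g := by
  rw [wnorm, wnorm, wnorm, ← ENNReal.tsum_add]
  refine ENNReal.tsum_le_tsum fun e => ?_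
  rw [map_add]
  norm_cast
  rw [← add_mul]
  gcongr
  exact nnnorm_add_le _ _

lemma wnorm_sum_le {α : Type*} (r : σ → ℝ≥0) (s : Finset α) (F : α → MvPowerSeries σ ℂ) :
    wnorm r (∑ a ∈ s, F a) ≤ ∑ a ∈ s, wnorm r (F a) := by
  classical
  induction s using Finset.induction_on with
  | empty => simp [wnorm]
  | insert a s ha ih =>
    rw [sum_insert ha, sum_insert ha]
    exact (wnorm_add_le _ _ _).trans (by gcongr)

lemma wnorm_prod_le {α : Type*} (r : σ → ℝ≥0) (s : Finset α) (F : α → MvPowerSeries σ ℂ) :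
    wnorm r (∏ a ∈ s, F a) ≤ ∏ a ∈ s, wnorm r (F a) := by
  classical
  induction s using Finset.induction_on with
  | empty => simp [wnorm_one]
  | insert a s ha ih =>
    rw [prod_insert ha, prod_insert ha]
    exact (wnorm_mul_le _ _ _).trans (by gcongr)

lemma wnorm_pow_le (r : σ → ℝ≥0) (f : MvPowerSeries σ ℂ) (k : ℕ) :
    wnorm r (f ^ k) ≤ wnorm r f ^ k := by
  have := wnorm_prod_le r (range k) (fun _ => f)
  simpa using this

/-- A power series whose truncations agree with series of bounded norm has bounded norm. -/
lemma wnorm_le_of_congrLT {r : σ → ℝ≥0} {f : MvPowerSeries σ ℂ} {C : ℝ≥0∞}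
    (h : ∀ n, ∃ g, CongrLT n f g ∧ wnorm r g ≤ C) : wnorm r f ≤ C := by
  rw [wnorm, ENNReal.tsum_eq_iSup_sum]
  refine iSup_le fun s => ?_
  obtain ⟨g, hg, hC⟩ := h (s.sup Finsupp.degree + 1)
  refine le_trans (le_of_eq (sum_congr rfl fun e he => ?_)) ((ENNReal.sum_le_tsum s).trans hC)
  have : Finsupp.degree e ≤ s.sup Finsupp.degree := Finset.le_sup (f := Finsupp.degree) he
  rw [hg e (by omega)]

/-- The value of a power series at a point (where it converges absolutely). -/
def pval (x : σ → ℂ) (f : MvPowerSeries σ ℂ) : ℂ := ∑' e, coeff e f * mpow x e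

lemma summable_norm_of_wnorm {x : σ → ℂ} {f : MvPowerSeries σ ℂ}
    (h : wnorm (fun i => ‖x i‖₊) f ≠ ∞) : Summable fun e => ‖coeff e f * mpow x e‖ := by
  have h1 := ENNReal.tsum_coe_ne_top_iff_summable.1 h
  refine (NNReal.summable_coe.2 h1).congr fun e => ?_
  rw [← nnnorm_mpow, ← nnnorm_mul, coe_nnnorm]

lemma hasSum_pval {x : σ → ℂ} {f : MvPowerSeries σ ℂ}
    (h : wnorm (fun i => ‖x i‖₊) f ≠ ∞) : HasSum (fun e => coeff e f * mpow x e) (pval x f) :=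
  (summable_norm_of_wnorm h).of_norm.hasSum

lemma pval_mul {x : σ → ℂ} {f g : MvPowerSeries σ ℂ} (hf : wnorm (fun i => ‖x i‖₊) f ≠ ∞)
    (hg : wnorm (fun i => ‖x i‖₊) g ≠ ∞) : pval x (f * g) = pval x f * pval x g := by
  classical
  have h1 := (summable_norm_of_wnorm hf).of_norm
  have h2 := (summable_norm_of_wnorm hg).of_norm
  have h3 := summable_mul_of_summable_norm (summable_norm_of_wnorm hf) (summable_norm_of_wnorm hg)
  rw [pval, pval, pval, h1.tsum_mul_tsum_eq_tsum_sum_antidiagonal h2 h3]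
  refine tsum_congr fun e => ?_
  rw [MvPowerSeries.coeff_mul, sum_mul]
  refine sum_congr rfl fun y hy => ?_
  rw [← mem_antidiagonal.1 hy, mpow_add]; ring

lemma pval_one (x : σ → ℂ) : pval x 1 = 1 := by
  classical
  rw [pval, tsum_eq_single 0]
  · simp [MvPowerSeries.coeff_one]
  · intro e he
    simp [MvPowerSeries.coeff_one, he]

lemma wnorm_pow_ne_top {r : σ → ℝ≥0} {f : MvPowerSeries σ ℂ} (h : wnorm r f ≠ ∞) (k : ℕ) :
    wnorm r (f ^ k) ≠ ∞ :=
  ne_top_of_le_ne_top (ENNReal.pow_ne_top h) (wnorm_pow_le r f k)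

lemma wnorm_mul_ne_top {r : σ → ℝ≥0} {f g : MvPowerSeries σ ℂ} (h : wnorm r f ≠ ∞)
    (h' : wnorm r g ≠ ∞) : wnorm r (f * g) ≠ ∞ :=
  ne_top_of_le_ne_top (ENNReal.mul_ne_top h h') (wnorm_mul_le r f g)

lemma wnorm_prod_ne_top {α : Type*} {r : σ → ℝ≥0} {s : Finset α} {F : α → MvPowerSeries σ ℂ}
    (h : ∀ a ∈ s, wnorm r (F a) ≠ ∞) : wnorm r (∏ a ∈ s, F a) ≠ ∞ :=
  ne_top_of_le_ne_top (ENNReal.prod_ne_top h) (wnorm_prod_le r s F)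

lemma pval_pow {x : σ → ℂ} {f : MvPowerSeries σ ℂ} (hf : wnorm (fun i => ‖x i‖₊) f ≠ ∞)
    (k : ℕ) : pval x (f ^ k) = pval x f ^ k := by
  induction k with
  | zero => simp [pval_one]
  | succ k ih => rw [pow_succ, pval_mul (wnorm_pow_ne_top hf k) hf, ih, pow_succ]

lemma pval_prod {α : Type*} {x : σ → ℂ} {s : Finset α} {F : α → MvPowerSeries σ ℂ}
    (h : ∀ a ∈ s, wnorm (fun i => ‖x i‖₊) (F a) ≠ ∞) :
    pval x (∏ a ∈ s, F a) = ∏ a ∈ s, pval x (F a) := by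
  classical
  induction s using Finset.induction_on with
  | empty => simp [pval_one]
  | insert a s ha ih =>
    rw [prod_insert ha, prod_insert ha, pval_mul (h a (by simp))
      (wnorm_prod_ne_top fun b hb => h b (by simp [hb])), ih fun b hb => h b (by simp [hb])]

/-! ### Locally finite sums of monomials -/

/-- The sum `∑_j t_j x^{ex j}` of a locally finite family of monomials. -/
def famSum {J : Type*} [CommRing R] (t : J → R) (ex : J → σ →₀ ℕ) : MvPowerSeries σ R :=
  open Classical in fun e => ∑ᶠ j, if ex j = e then t j else 0

/-- Local finiteness of a family of monomials. -/
def LocFin {J : Type*} [CommRing R] (t : J → R) (ex : J → σ →₀ ℕ) : Prop :=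
  ∀ n, {j | t j ≠ 0 ∧ (ex j).degree < n}.Finite

section fam

variable {J : Type*} [CommRing R] {t : J → R} {ex : J → σ →₀ ℕ}

open Classical in
lemma coeff_famSum (e : σ →₀ ℕ) :
    coeff e (famSum t ex) = ∑ᶠ j, if ex j = e then t j else 0 := rfl

open Classical in
lemma LocFin.finite (h : LocFin t ex) (e : σ →₀ ℕ) :
    (Function.support fun j => if ex j = e then t j else 0).Finite := by
  refine (h (e.degree + 1)).subset fun j hj => ?_
  simp only [Function.mem_support, ne_eq, ite_eq_right_iff, not_forall] at hj
  obtain ⟨h1, h2⟩ := hj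
  exact ⟨h2, by rw [h1]; omega⟩

lemma famSum_congr (F : Finset J) {n : ℕ}
    (h : ∀ j, t j ≠ 0 → (ex j).degree < n → j ∈ F) :
    CongrLT n (famSum t ex) (∑ j ∈ F, monomial (ex j) (t j)) := by
  classical
  intro e he
  rw [coeff_famSum, map_sum, finsum_eq_sum_of_support_subset (s := F)]
  · refine sum_congr rfl fun j _ => ?_
    rw [MvPowerSeries.coeff_monomial]
    exact if_congr eq_comm rfl rfl
  · intro j hj
    simp only [Function.mem_support, ne_eq, ite_eq_right_iff, not_forall] at hj
    obtain ⟨h1, h2⟩ := hj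
    exact h j h2 (by rw [h1]; exact he)

lemma map_famSum {S : Type*} [CommRing S] (φ : R →+* S) (h : LocFin t ex) :
    MvPowerSeries.map φ (famSum t ex) = famSum (fun j => φ (t j)) ex := by
  classical
  ext e
  rw [MvPowerSeries.coeff_map, coeff_famSum, coeff_famSum]
  refine (AddMonoidHom.map_finsum φ.toAddMonoidHom (h.finite e)).trans ?_
  exact finsum_congr fun j => by split_ifs <;> simp

/-- For an injective exponent map, the coefficients of the sum are the given ones. -/
lemma coeff_famSum_of_injOn (h : ∀ i j, t i ≠ 0 → t j ≠ 0 → ex i = ex j → i = j) (j : J)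
    (hj : t j ≠ 0) : coeff (ex j) (famSum t ex) = t j := by
  classical
  rw [coeff_famSum, finsum_eq_single _ j, if_pos rfl]
  intro i hi
  split_ifs with h'
  · by_contra h0
    exact hi (h i j h0 hj h')
  · rfl

lemma coeff_famSum_mem {e : σ →₀ ℕ} (F : AddSubgroup R) (h : ∀ j, ex j = e → t j ∈ F) :
    coeff e (famSum t ex) ∈ F := by
  classical
  rw [coeff_famSum]
  refine finsum_induction (· ∈ F) (zero_mem _) (fun _ _ => add_mem) fun j => ?_
  split_ifs with h'
  · exact h j h'
  · exact zero_mem _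

end fam

lemma wnorm_famSum_le {J : Type*} {t : J → ℂ} {ex : J → σ →₀ ℕ} (h : LocFin t ex)
    (r : σ → ℝ≥0) :
    wnorm r (famSum t ex) ≤ ∑' j, ((‖t j‖₊ * mpow r (ex j) : ℝ≥0) : ℝ≥0∞) := by
  classical
  have h1 : ∀ j, ((‖t j‖₊ * mpow r (ex j) : ℝ≥0) : ℝ≥0∞) =
      ∑' e, if ex j = e then ((‖t j‖₊ * mpow r e : ℝ≥0) : ℝ≥0∞) else 0 := fun j => by
    rw [tsum_eq_single (ex j)]
    · simp
    · intro e he; rw [if_neg he.symm]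
  simp_rw [h1]
  rw [ENNReal.tsum_comm]
  refine ENNReal.tsum_le_tsum fun e => ?_
  rw [coeff_famSum, finsum_eq_sum _ (h.finite e)]
  refine le_trans ?_ (ENNReal.sum_le_tsum (h.finite e).toFinset)
  calc ((‖∑ j ∈ (h.finite e).toFinset, if ex j = e then t j else 0‖₊ * mpow r e : ℝ≥0) : ℝ≥0∞)
      ≤ (((∑ j ∈ (h.finite e).toFinset, ‖if ex j = e then t j else 0‖₊) * mpow r e : ℝ≥0) :
          ℝ≥0∞) := by
        gcongr; exact nnnorm_sum_le _ _
    _ = _ := by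
        rw [sum_mul, ENNReal.ofNNReal_finsetSum]
        exact sum_congr rfl fun j _ => by split_ifs <;> simp

lemma pval_famSum {J : Type*} {t : J → ℂ} {ex : J → σ →₀ ℕ} (h : LocFin t ex) {x : σ → ℂ}
    {a : ℂ} (hs : HasSum (fun j => t j * mpow x (ex j)) a) : pval x (famSum t ex) = a := by
  classical
  have h1 := hs.tsum_fiberwise ex
  rw [pval, ← h1.tsum_eq]
  refine tsum_congr fun e => ?_
  have h2 : ∑' b : ex ⁻¹' {e}, t b * mpow x (ex b) =
      ∑' j, if ex j = e then t j * mpow x e else 0 := by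
    rw [tsum_subtype (ex ⁻¹' {e}) (fun b => t b * mpow x (ex b))]
    refine tsum_congr fun j => ?_
    by_cases hj : ex j = e
    · simp [Set.indicator, hj]
    · simp [Set.indicator, hj]
  rw [h2, coeff_famSum, finsum_eq_sum _ (h.finite e), sum_mul, tsum_eq_sum]
  · exact sum_congr rfl fun j _ => by split_ifs <;> simp
  · intro j hj
    simp only [Set.Finite.mem_toFinset, Function.mem_support, ne_eq, not_not] at hj
    split_ifs with h'
    · rw [if_pos h'] at hj; rw [hj, zero_mul]
    · rfl

end MvPS

/-! ### A finite form of the Jacobi triple product -/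

section JTP

/-- The triangular number `r (r + 1) / 2` of an integer `r`. -/
def tri (r : ℤ) : ℕ := (r * (r + 1) / 2).toNat

lemma two_mul_tri (r : ℤ) : 2 * (tri r : ℤ) = r * (r + 1) := by
  have h : (0 : ℤ) ≤ r * (r + 1) := by
    rcases le_or_gt 0 r with h | h <;> nlinarith
  have h2 : 2 * (r * (r + 1) / 2) = r * (r + 1) :=
    Int.two_mul_ediv_two_of_even (Int.even_mul_succ_self r)
  rw [tri, Int.toNat_of_nonneg (by omega), h2]

lemma tri_add_tri_neg (r : ℤ) : (tri r : ℤ) + tri (-r) = r ^ 2 := by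
  have := two_mul_tri r; have := two_mul_tri (-r); nlinarith

variable {A : Type*} [CommRing A]

/-- The Gaussian binomial coefficients, defined by the `q`-Pascal rule. -/
def gaussBinom (q : A) : ℕ → ℕ → A
  | _, 0 => 1
  | 0, _ + 1 => 0
  | m + 1, k + 1 => gaussBinom q m (k + 1) + q ^ (m - k) * gaussBinom q m k

/-- The finite `q`-Pochhammer symbol `(1 - q) ⋯ (1 - q^n)`. -/
def qPoch (q : A) (n : ℕ) : A := ∏ i ∈ range n, (1 - q ^ (i + 1))

lemma qPoch_succ (q : A) (n : ℕ) : qPoch q (n + 1) = qPoch q n * (1 - q ^ (n + 1)) := by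
  rw [qPoch, Finset.prod_range_succ, qPoch]

lemma gaussBinom_zero_right (q : A) (m : ℕ) : gaussBinom q m 0 = 1 := by
  cases m <;> rfl

lemma gaussBinom_eq_zero (q : A) {m k : ℕ} (h : m < k) : gaussBinom q m k = 0 := by
  induction m generalizing k with
  | zero => obtain ⟨k, rfl⟩ : ∃ j, k = j + 1 := ⟨k - 1, by omega⟩; rfl
  | succ m ih =>
    obtain ⟨k, rfl⟩ : ∃ j, k = j + 1 := ⟨k - 1, by omega⟩
    rw [gaussBinom, ih (by omega), ih (by omega)]; ring

lemma gaussBinom_mul_qPoch (q : A) {m k : ℕ} (h : k ≤ m) :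
    gaussBinom q m k * qPoch q k * qPoch q (m - k) = qPoch q m := by
  induction m generalizing k with
  | zero => obtain rfl : k = 0 := by omega
            simp [gaussBinom, qPoch]
  | succ m ih =>
    rcases k with _ | k
    · simp [gaussBinom, qPoch]
    · rcases (by omega : k = m ∨ k < m) with rfl | hk
      · rw [gaussBinom, gaussBinom_eq_zero q (by omega), qPoch_succ]
        have h1 := ih (le_refl k)
        have h0 : qPoch q 0 = 1 := by simp [qPoch]
        rw [Nat.sub_self, h0, mul_one] at h1
        rw [Nat.sub_self, Nat.sub_self, h0, pow_zero, zero_add, one_mul, mul_one, ← mul_assoc, h1]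
      · have h1 := ih (k := k + 1) (by omega)
        have h2 := ih (k := k) (by omega)
        obtain ⟨d, rfl⟩ : ∃ d, m = k + 1 + d := ⟨m - k - 1, by omega⟩
        rw [gaussBinom, show k + 1 + d + 1 - (k + 1) = d + 1 by omega,
          show k + 1 + d - k = d + 1 by omega]
        rw [show k + 1 + d - (k + 1) = d by omega] at h1
        rw [show k + 1 + d - k = d + 1 by omega] at h2
        rw [qPoch_succ q (k + 1 + d)]
        calc _ = (gaussBinom q (k + 1 + d) (k + 1) * qPoch q (k + 1) * qPoch q d) *
                (1 - q ^ (d + 1)) + q ^ (d + 1) * (gaussBinom q (k + 1 + d) k * qPoch q k *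
                  qPoch q (d + 1)) * (1 - q ^ (k + 1)) := by
              rw [qPoch_succ q d, qPoch_succ q k]; ring
          _ = _ := by rw [h1, h2]; ring

/-- The general term of the triple product sum. -/
def jtpTerm (x y : A) (r : ℤ) : A := (-1) ^ r.natAbs * (x ^ tri r * y ^ tri (-r))

lemma jtpTerm_step (x y : A) (a : ℕ) (r : ℤ) (d : ℕ) (hd : (d : ℤ) = a - r) :
    jtpTerm x y r * (-((x * y) ^ a * x)) = (x * y) ^ d * jtpTerm x y (r + 1) := by
  have hs : (-1 : A) ^ (r + 1).natAbs = -(-1) ^ r.natAbs := by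
    rcases Int.even_or_odd r with h | h
    · rw [Even.neg_one_pow (Int.natAbs_even.2 h),
        Odd.neg_one_pow (Int.natAbs_odd.2 (Even.add_one h))]
    · rw [Odd.neg_one_pow (Int.natAbs_odd.2 h),
        Even.neg_one_pow (Int.natAbs_even.2 (Odd.add_one h))]; ring
  have e1 : a + 1 + tri r = d + tri (r + 1) := by
    have := two_mul_tri r; have := two_mul_tri (r + 1); zify; nlinarith
  have e2 : a + tri (-r) = d + tri (-(r + 1)) := by
    have := two_mul_tri (-r); have := two_mul_tri (-(r + 1)); zify; nlinarith
  rw [jtpTerm, jtpTerm, hs]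
  calc _ = -(-1) ^ r.natAbs * (x ^ (a + 1 + tri r) * y ^ (a + tri (-r))) := by ring
    _ = _ := by rw [e1, e2]; ring

lemma prod_one_sub_step (x y : A) (a b : ℕ) (P : A)
    (h : P = ∑ k ∈ range (a + b + 1),
      gaussBinom (x * y) (a + b) k * jtpTerm x y ((k : ℤ) - b)) :
    P * (1 - (x * y) ^ a * x) = ∑ k ∈ range (a + 1 + b + 1),
      gaussBinom (x * y) (a + 1 + b) k * jtpTerm x y ((k : ℤ) - b) := by
  have h1 : P * (1 - (x * y) ^ a * x) = P + ∑ k ∈ range (a + b + 1),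
      (x * y) ^ (a + b - k) * gaussBinom (x * y) (a + b) k * jtpTerm x y ((k + 1 : ℕ) - b : ℤ) := by
    rw [mul_sub, mul_one, sub_eq_add_neg, ← mul_neg]
    congr 1
    rw [h, sum_mul]
    refine sum_congr rfl fun k hk => ?_
    have hk := mem_range.1 hk
    rw [mul_assoc, jtpTerm_step x y a _ (a + b - k) (by push_cast [show k ≤ a + b by omega]; ring)]
    rw [show ((k : ℤ) - b + 1) = ((k + 1 : ℕ) : ℤ) - b by push_cast; ring]; ring
  have h2 : P = ∑ k ∈ range (a + b + 1),
      gaussBinom (x * y) (a + b) (k + 1) * jtpTerm x y ((k + 1 : ℕ) - b : ℤ) +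
        jtpTerm x y ((0 : ℕ) - b : ℤ) := by
    rw [h, Finset.sum_range_succ', gaussBinom_zero_right, one_mul, Finset.sum_range_succ _ (a + b),
      gaussBinom_eq_zero (x * y) (show a + b < a + b + 1 by omega)]
    simp
  rw [h1, show a + 1 + b + 1 = (a + b + 1) + 1 by omega, Finset.sum_range_succ' _ (a + b + 1),
    gaussBinom_zero_right, one_mul]
  nth_rewrite 1 [h2]
  rw [add_right_comm, ← sum_add_distrib]
  congr 1
  refine sum_congr rfl fun k _ => ?_
  rw [show a + 1 + b = a + b + 1 by omega, gaussBinom]; ring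

lemma gaussBinom_symm {q : A} (hq : ∀ i, IsUnit (1 - q ^ (i + 1))) {m k : ℕ} (h : k ≤ m) :
    gaussBinom q m (m - k) = gaussBinom q m k := by
  have hu : ∀ n, IsUnit (qPoch q n) := fun n => by
    induction n with
    | zero => simp [qPoch]
    | succ n ih => rw [qPoch_succ]; exact ih.mul (hq n)
  have h1 := gaussBinom_mul_qPoch q h
  have h2 := gaussBinom_mul_qPoch q (Nat.sub_le m k)
  rw [Nat.sub_sub_self h] at h2
  refine ((hu k).mul (hu (m - k))).mul_left_injective ?_
  dsimp only
  linear_combination h2 - h1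

/-- The finite Jacobi triple product. -/
lemma finite_jacobi {x y : A} (hq : ∀ i, IsUnit (1 - (x * y) ^ (i + 1))) (a b : ℕ) :
    (∏ i ∈ range b, (1 - (x * y) ^ i * y)) * ∏ i ∈ range a, (1 - (x * y) ^ i * x) =
      ∑ k ∈ range (a + b + 1),
        gaussBinom (x * y) (a + b) k * jtpTerm x y ((k : ℤ) - b) := by
  have base : ∀ (x y : A) (a : ℕ), ∏ i ∈ range a, (1 - (x * y) ^ i * x) =
      ∑ k ∈ range (a + 1), gaussBinom (x * y) a k * jtpTerm x y k := by
    intro x y a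
    induction a with
    | zero => simp [gaussBinom, jtpTerm, tri]
    | succ a ih =>
      have := prod_one_sub_step x y a 0 _ (by simpa using ih)
      simpa [Finset.prod_range_succ] using this
  induction a with
  | zero =>
    have h := base y x b
    rw [mul_comm y x] at h
    rw [Finset.range_zero, Finset.prod_empty, mul_one, h, ← Finset.sum_range_reflect, zero_add]
    refine sum_congr rfl fun k hk => ?_
    have hk := mem_range.1 hk
    rw [show b + 1 - 1 - k = b - k by omega, gaussBinom_symm hq (by omega)]
    rw [jtpTerm, jtpTerm, show ((b - k : ℕ) : ℤ) = -((k : ℤ) - b) by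
      push_cast [show k ≤ b by omega]; ring, Int.natAbs_neg, neg_neg]
    ring
  | succ a ih =>
    rw [Finset.prod_range_succ, ← mul_assoc]
    exact prod_one_sub_step x y a b _ ih

end JTP

section JTPTrunc

variable {σ R : Type*} [CommRing R]

lemma CongrLT.mono {m n : ℕ} (h : m ≤ n) {f g : MvPowerSeries σ R} (hfg : CongrLT n f g) :
    CongrLT m f g := fun e he => hfg e (he.trans_le h)

lemma CongrLT.monomial_mul {n : ℕ} {f g : MvPowerSeries σ R} (h : CongrLT n f g)
    (e : σ →₀ ℕ) (a : R) : CongrLT (e.degree + n) (monomial e a * f) (monomial e a * g) := by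
  intro e' he'
  rw [MvPowerSeries.coeff_monomial_mul, MvPowerSeries.coeff_monomial_mul]
  split_ifs with hle
  · have : e'.degree = e.degree + (e' - e).degree := by
      rw [← map_add, add_tsub_cancel_of_le hle]
    rw [h _ (by omega)]
  · rfl

lemma monomial_pow' (e : σ →₀ ℕ) (a : R) (k : ℕ) :
    (monomial e a : MvPowerSeries σ R) ^ k = monomial (k • e) (a ^ k) :=
  by
  induction k with
  | zero => simp
  | succ k ih => rw [pow_succ, ih, MvPowerSeries.monomial_mul_monomial, succ_nsmul, pow_succ]

lemma isUnit_of_constantCoeff_one {f : MvPowerSeries σ R}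
    (h : MvPowerSeries.constantCoeff f = 1) : IsUnit f :=
  MvPowerSeries.isUnit_iff_constantCoeff.2 (h ▸ isUnit_one)

lemma constantCoeff_monomial {e : σ →₀ ℕ} (he : e ≠ 0) (a : R) :
    MvPowerSeries.constantCoeff (monomial e a) = 0 := by
  rw [← MvPowerSeries.coeff_zero_eq_constantCoeff_apply, MvPowerSeries.coeff_monomial_ne he.symm]

lemma one_le_degree {e : σ →₀ ℕ} (he : e ≠ 0) : 1 ≤ e.degree :=
  Nat.one_le_iff_ne_zero.2 fun h => he ((Finsupp.degree_eq_zero_iff e).1 h)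

lemma qPoch_congr (e : σ →₀ ℕ) (he : e ≠ 0) {m n : ℕ} (h : m ≤ n) :
    CongrLT (m + 1) (qPoch (monomial e (1 : R)) n) (qPoch (monomial e (1 : R)) m) := by
  induction n, h using Nat.le_induction with
  | base => exact .refl _ _
  | succ n hn ih =>
    rw [qPoch_succ]
    have h2 : CongrLT (m + 1) (1 - monomial e (1 : R) ^ (n + 1)) (1 : MvPowerSeries σ R) := by
      rw [monomial_pow', one_pow, sub_eq_add_neg, ← map_neg]
      have hd : 1 ≤ e.degree := one_le_degree he
      simpa using (CongrLT.refl (m + 1) (1 : MvPowerSeries σ R)).add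
        (CongrLT.monomial_zero (n := m + 1) (e := (n + 1) • e) (by
          rw [map_nsmul, smul_eq_mul]; nlinarith) (-1))
    simpa using ih.mul h2

lemma CongrLT.cancel {n : ℕ} {u f g : MvPowerSeries σ R} (hu : IsUnit u)
    (h : CongrLT n (u * f) (u * g)) : CongrLT n f g := by
  obtain ⟨v, rfl⟩ := hu
  simpa using (CongrLT.refl n (↑v⁻¹ : MvPowerSeries σ R)).mul h

lemma constantCoeff_qPoch (e : σ →₀ ℕ) (he : e ≠ 0) (n : ℕ) :
    MvPowerSeries.constantCoeff (qPoch (monomial e (1 : R)) n) = 1 := by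
  rw [qPoch, map_prod]
  refine prod_eq_one fun i _ => ?_
  rw [map_sub, map_one, map_pow, constantCoeff_monomial he]; simp

lemma gaussBinom_congr (e : σ →₀ ℕ) (he : e ≠ 0) (n : ℕ) (r : ℤ) (k : ℕ) (hk : (k : ℤ) - n = r)
    (hr : r.natAbs ≤ n) :
    CongrLT (n - r.natAbs + 1)
      (qPoch (monomial e (1 : R)) n * gaussBinom (monomial e (1 : R)) (n + n) k) 1 := by
  set q : MvPowerSeries σ R := monomial e 1
  set d := n - r.natAbs with hd
  have hu : IsUnit (qPoch q d) := isUnit_of_constantCoeff_one (constantCoeff_qPoch e he d)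
  have h1 := gaussBinom_mul_qPoch q (show k ≤ n + n by omega)
  have c1 : CongrLT (d + 1) (qPoch q k) (qPoch q d) := qPoch_congr e he (by omega)
  have c2 : CongrLT (d + 1) (qPoch q (n + n - k)) (qPoch q d) := qPoch_congr e he (by omega)
  have c3 : CongrLT (d + 1) (qPoch q (n + n)) (qPoch q d) := qPoch_congr e he (by omega)
  have c4 : CongrLT (d + 1) (qPoch q n) (qPoch q d) := qPoch_congr e he (by omega)
  refine .cancel hu ?_
  have c5 : CongrLT (d + 1) (qPoch q d * (qPoch q n * gaussBinom q (n + n) k))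
      (qPoch q k * (qPoch q (n + n - k) * gaussBinom q (n + n) k)) :=
    c1.symm.mul ((c4.trans c2.symm).mul (.refl _ _))
  refine c5.trans ?_
  rw [mul_one]
  refine CongrLT.trans ?_ c3
  rw [← h1]
  have : qPoch q k * (qPoch q (n + n - k) * gaussBinom q (n + n) k) =
    gaussBinom q (n + n) k * qPoch q k * qPoch q (n + n - k) := by ring
  rw [this]; exact .refl _ _

/-- The Jacobi triple product, modulo terms of high degree. -/
lemma jacobi_congr {α β : σ →₀ ℕ} (hα : α ≠ 0) (hβ : β ≠ 0) {w v : R} (hwv : w * v = 1)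
    (n : ℕ) :
    CongrLT n
      ((∏ i ∈ range n, (1 - monomial (i • (α + β) + β) v)) *
        (∏ i ∈ range n, (1 - monomial (i • (α + β) + α) w)) *
        ∏ i ∈ range n, (1 - monomial ((i + 1) • (α + β)) (1 : R)))
      (∑ k ∈ range (n + n + 1),
        jtpTerm (monomial α w) (monomial β v) ((k : ℤ) - n)) := by
  have hαβ : α + β ≠ 0 := fun h => hα (add_eq_zero.1 h).1
  have hxy : (monomial α w * monomial β v : MvPowerSeries σ R) = monomial (α + β) 1 := by
    rw [MvPowerSeries.monomial_mul_monomial, hwv]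
  have h := finite_jacobi (x := (monomial α w : MvPowerSeries σ R)) (y := monomial β v)
    (fun i => by
      rw [hxy]
      refine isUnit_of_constantCoeff_one ?_
      rw [map_sub, map_one, map_pow, constantCoeff_monomial hαβ]; simp) n n
  rw [hxy] at h
  have e1 : ∀ (γ : σ →₀ ℕ) (w : R) (i : ℕ), (monomial (i • (α + β) + γ) w : MvPowerSeries σ R) =
      monomial (α + β) 1 ^ i * monomial γ w := fun γ w i => by
    rw [monomial_pow', MvPowerSeries.monomial_mul_monomial, one_pow, one_mul]
  have e2 : ∏ i ∈ range n, (1 - monomial ((i + 1) • (α + β)) (1 : R)) =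
      qPoch (monomial (α + β) (1 : R)) n := by
    simp_rw [qPoch, monomial_pow', one_pow]
  simp_rw [e1] 
  rw [e2, h, sum_mul]
  refine CongrLT.sum _ fun k hk => ?_
  have hk := mem_range.1 hk
  set r : ℤ := (k : ℤ) - n with hr
  have h1 : jtpTerm (monomial α w) (monomial β v) r =
      (monomial (tri r • α + tri (-r) • β) ((-1) ^ r.natAbs * (w ^ tri r * v ^ tri (-r))) :
        MvPowerSeries σ R) := by
    have h0 : ((-1) ^ r.natAbs : MvPowerSeries σ R) = monomial 0 ((-1) ^ r.natAbs) := by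
      have : (-1 : MvPowerSeries σ R) = monomial 0 (-1) := by
        rw [map_neg, MvPowerSeries.monomial_zero_one]
      rw [this, monomial_pow', smul_zero]
    rw [jtpTerm, monomial_pow', monomial_pow', MvPowerSeries.monomial_mul_monomial, h0,
      MvPowerSeries.monomial_mul_monomial, zero_add]
  have hdeg : (tri r • α + tri (-r) • β).degree ≥ r.natAbs ^ 2 := by
    have h3 : 1 ≤ α.degree := one_le_degree hα
    have h4 : 1 ≤ β.degree := one_le_degree hβ
    have h5 : tri r + tri (-r) = r.natAbs ^ 2 := by
      zify; rw [tri_add_tri_neg, sq_abs]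
    rw [map_add, map_nsmul, map_nsmul, smul_eq_mul, smul_eq_mul, ← h5]
    nlinarith [Nat.zero_le (tri r), Nat.zero_le (tri (-r))]
  have c := (gaussBinom_congr (R := R) (α + β) hαβ n r k rfl (by omega)).monomial_mul
    (tri r • α + tri (-r) • β) ((-1) ^ r.natAbs * (w ^ tri r * v ^ tri (-r)))
  rw [← h1, mul_one] at c
  refine CongrLT.mono (n := (tri r • α + tri (-r) • β).degree + (n - r.natAbs + 1)) ?_
    (CongrLT.trans ?_ c)
  · have := Nat.le_self_pow two_ne_zero r.natAbs
    omega
  · have : ∀ a b c : MvPowerSeries σ R, a * b * c = b * (c * a) := fun a b c => by ring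
    rw [this]; exact .refl _ _

end JTPTrunc

/-! ### The elliptic interval as a power series -/

section PairSeries

variable {σ R : Type*} [CommRing R]

/-- The exponent of the term `(a, b)` of `pairSeries`. -/
def pairExp (α β : σ →₀ ℕ) (ab : ℤ × ℤ) : σ →₀ ℕ :=
  (tri ab.1 + tri ab.2) • α + (tri (-ab.1) + tri (-ab.2)) • β

/-- The coefficient of the term `(a, b)` of `pairSeries`. -/
def pairCoef (c : R) (ab : ℤ × ℤ) : R :=
  (-1) ^ (ab.1 + ab.2).natAbs * (Polynomial.Chebyshev.T R (ab.1 - ab.2)).eval c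

/-- The product of two theta series
`∑_{a,b} (-1)^{a+b} T_{a-b}(c) x^{tri a + tri b} y^{tri(-a) + tri(-b)}` at the monomials
`x = X^α`, `y = X^β`; for `c = cos θ` the first factor is `∑_a (-1)^a (x e^{iθ})^{tri a}
(y e^{-iθ})^{tri(-a)}`, and the second one has `-θ` in place of `θ`. -/
def pairSeries (α β : σ →₀ ℕ) (c : R) : MvPowerSeries σ R := famSum (pairCoef c) (pairExp α β)

lemma sq_le_degree_pairExp {α β : σ →₀ ℕ} (hα : α ≠ 0) (hβ : β ≠ 0) (ab : ℤ × ℤ) :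
    ab.1 ^ 2 + ab.2 ^ 2 ≤ ((pairExp α β ab).degree : ℤ) := by
  have h3 := one_le_degree hα
  have h4 := one_le_degree hβ
  have h5 := tri_add_tri_neg ab.1
  have h6 := tri_add_tri_neg ab.2
  rw [pairExp, map_add, map_nsmul, map_nsmul, smul_eq_mul, smul_eq_mul, ← h5, ← h6]
  have h7 : tri ab.1 + tri ab.2 ≤ (tri ab.1 + tri ab.2) * α.degree := Nat.le_mul_of_pos_right _ h3
  have h8 : tri (-ab.1) + tri (-ab.2) ≤ (tri (-ab.1) + tri (-ab.2)) * β.degree :=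
    Nat.le_mul_of_pos_right _ h4
  push_cast
  zify at h7 h8
  linarith

lemma mem_box_of_degree_lt {α β : σ →₀ ℕ} (hα : α ≠ 0) (hβ : β ≠ 0) {ab : ℤ × ℤ} {n : ℕ}
    (h : (pairExp α β ab).degree < n) :
    ab ∈ Icc (-n : ℤ) n ×ˢ Icc (-n : ℤ) n := by
  have h1 := sq_le_degree_pairExp hα hβ ab
  have h2 : ((pairExp α β ab).degree : ℤ) < n := by exact_mod_cast h
  simp only [Finset.mem_product, Finset.mem_Icc]
  refine ⟨⟨?_, ?_⟩, ⟨?_, ?_⟩⟩ <;> nlinarith [sq_nonneg ab.1, sq_nonneg ab.2]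

lemma locFin_pair {α β : σ →₀ ℕ} (hα : α ≠ 0) (hβ : β ≠ 0) (c : R) :
    LocFin (pairCoef c) (pairExp α β) := fun n =>
  (Finset.finite_toSet (Icc (-n : ℤ) n ×ˢ Icc (-n : ℤ) n)).subset fun _ h =>
    mem_box_of_degree_lt hα hβ h.2

lemma pairSeries_symm (α β : σ →₀ ℕ) (c : R) : pairSeries β α c = pairSeries α β c := by
  classical
  ext e
  rw [pairSeries, pairSeries, coeff_famSum, coeff_famSum,
    ← finsum_comp_equiv ((Equiv.neg ℤ).prodCongr (Equiv.neg ℤ))]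
  refine finsum_congr fun ab => if_congr ?_ ?_ rfl
  · simp only [pairExp, Equiv.prodCongr_apply, Prod.map, Equiv.neg_apply, neg_neg]
    rw [add_comm]
  · simp only [pairCoef, Equiv.prodCongr_apply, Prod.map, Equiv.neg_apply]
    rw [← neg_add, Int.natAbs_neg, neg_sub_neg, ← neg_sub, Polynomial.Chebyshev.T_neg]

lemma map_pairSeries {S : Type*} [CommRing S] (φ : R →+* S) {α β : σ →₀ ℕ} (hα : α ≠ 0)
    (hβ : β ≠ 0) (c : R) :
    MvPowerSeries.map φ (pairSeries α β c) = pairSeries α β (φ c) := by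
  rw [pairSeries, map_famSum φ (locFin_pair hα hβ c), pairSeries]
  congr 1
  ext ab
  rw [pairCoef, pairCoef, map_mul, map_pow, map_neg, map_one, ← Polynomial.Chebyshev.map_T φ,
    Polynomial.eval_map, Polynomial.eval₂_hom]

lemma constantCoeff_pairSeries {α β : σ →₀ ℕ} (hα : α ≠ 0) (hβ : β ≠ 0) (c : R) :
    MvPowerSeries.constantCoeff (pairSeries α β c) = 1 := by
  classical
  rw [← MvPowerSeries.coeff_zero_eq_constantCoeff_apply, pairSeries, coeff_famSum,
    finsum_eq_single _ (0, 0)]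
  · simp [pairExp, pairCoef, tri]
  · intro ab hab
    rw [if_neg]
    intro h
    have h1 := sq_le_degree_pairExp hα hβ ab
    rw [h, map_zero, Nat.cast_zero] at h1
    have h2 := sq_nonneg ab.1
    have h3 := sq_nonneg ab.2
    exact hab (Prod.ext (pow_eq_zero_iff two_ne_zero |>.1 (by linarith))
      (pow_eq_zero_iff two_ne_zero |>.1 (by linarith)))

/-! ### Absolute convergence of the inverse -/

/-- The truncated theta series. -/
def thetaTrunc (α β : σ →₀ ℕ) (w v : R) (n : ℕ) : MvPowerSeries σ R :=
  ∑ k ∈ range (n + n + 1), jtpTerm (monomial α w) (monomial β v) ((k : ℤ) - n)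

lemma thetaTrunc_eq (α β : σ →₀ ℕ) (w v : R) (n : ℕ) :
    thetaTrunc α β w v n =
      ∑ a ∈ Icc (-n : ℤ) n, jtpTerm (monomial α w) (monomial β v) a := by
  refine Finset.sum_nbij (fun k => (k : ℤ) - n) ?_ ?_ ?_ fun _ _ => rfl
  · intro k hk
    simp only [mem_range, Finset.mem_Icc] at hk ⊢; omega
  · intro a _ b _ h
    simpa using h
  · intro a ha
    simp only [Finset.coe_Icc, Set.mem_Icc] at ha
    exact ⟨(a + n).toNat, by simp only [Finset.coe_range, Set.mem_Iio]; omega, by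
      simp only [Int.ofNat_toNat]; omega⟩

lemma jtpTerm_monomial (α β : σ →₀ ℕ) (w v : R) (r : ℤ) :
    jtpTerm (monomial α w) (monomial β v) r =
      (monomial (tri r • α + tri (-r) • β) ((-1) ^ r.natAbs * (w ^ tri r * v ^ tri (-r))) :
        MvPowerSeries σ R) := by
  have h0 : ((-1) ^ r.natAbs : MvPowerSeries σ R) = monomial 0 ((-1) ^ r.natAbs) := by
    have : (-1 : MvPowerSeries σ R) = monomial 0 (-1) := by
      rw [map_neg, MvPowerSeries.monomial_zero_one]
    rw [this, monomial_pow', smul_zero]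
  rw [jtpTerm, monomial_pow', monomial_pow', MvPowerSeries.monomial_mul_monomial, h0,
    MvPowerSeries.monomial_mul_monomial, zero_add]

lemma pow_tri_mul {w v : ℂ} (h : w * v = 1) (r : ℤ) : w ^ tri r * v ^ tri (-r) = w ^ r := by
  have hw : w ≠ 0 := left_ne_zero_of_mul_eq_one h
  have hv : v = w⁻¹ := eq_inv_of_mul_eq_one_right h
  rw [hv, inv_pow, ← zpow_natCast, ← zpow_natCast, ← zpow_neg, ← zpow_add₀ hw]
  congr 1
  have := two_mul_tri r; have := two_mul_tri (-r); nlinarith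

lemma neg_one_pow_natAbs_add (a b : ℤ) :
    (-1 : R) ^ (a + b).natAbs = (-1) ^ a.natAbs * (-1) ^ b.natAbs := by
  rw [← pow_add]
  refine neg_one_pow_congr ?_
  rw [Int.natAbs_even, Nat.even_add, Int.natAbs_even, Int.natAbs_even, Int.even_add]

lemma chebyshev_cos (n : ℤ) (θ : ℂ) :
    2 * (Polynomial.Chebyshev.T ℂ n).eval (Complex.cos θ) =
      exp (θ * I) ^ n + exp (θ * I) ^ (-n) := by
  rw [Polynomial.Chebyshev.T_complex_cos, Complex.cos, ← Complex.exp_int_mul,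
    ← Complex.exp_int_mul]
  push_cast
  rw [mul_div_cancel₀ _ (two_ne_zero)]
  congr 2 <;> ring_nf

lemma pairSeries_congr {α β : σ →₀ ℕ} (hα : α ≠ 0) (hβ : β ≠ 0) (θ : ℂ) (n : ℕ) :
    CongrLT n (pairSeries α β (Complex.cos θ))
      (thetaTrunc α β (exp (θ * I)) (exp (-(θ * I))) n *
        thetaTrunc α β (exp (-(θ * I))) (exp (θ * I)) n) := by
  refine (famSum_congr (Icc (-n : ℤ) n ×ˢ Icc (-n : ℤ) n)
    fun ab _ h => mem_box_of_degree_lt hα hβ h).trans ?_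
  set w := exp (θ * I)
  set v := exp (-(θ * I)) with hv
  have hwv : w * v = 1 := by rw [hv, ← Complex.exp_add]; simp
  have hvw : v * w = 1 := by rw [mul_comm, hwv]
  have hvi : v = w⁻¹ := eq_inv_of_mul_eq_one_right hwv
  have hw : w ≠ 0 := left_ne_zero_of_mul_eq_one hwv
  set B := Icc (-n : ℤ) n
  have e1 : thetaTrunc α β w v n * thetaTrunc α β v w n = ∑ ab ∈ B ×ˢ B,
      (monomial (pairExp α β ab) ((-1) ^ (ab.1 + ab.2).natAbs * w ^ (ab.1 - ab.2)) :
        MvPowerSeries σ ℂ) := by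
    rw [thetaTrunc_eq, thetaTrunc_eq, Finset.sum_mul_sum, Finset.sum_product]
    refine sum_congr rfl fun a _ => sum_congr rfl fun b _ => ?_
    rw [jtpTerm_monomial, jtpTerm_monomial, MvPowerSeries.monomial_mul_monomial, pow_tri_mul hwv,
      pow_tri_mul hvw, pairExp, neg_one_pow_natAbs_add, zpow_sub₀ hw, hvi, inv_zpow]
    congr 1
    · congr 1
      simp only [add_smul]; abel
    · ring
  have e2 : thetaTrunc α β w v n * thetaTrunc α β v w n = ∑ ab ∈ B ×ˢ B,
      (monomial (pairExp α β ab) ((-1) ^ (ab.1 + ab.2).natAbs * w ^ (-(ab.1 - ab.2))) :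
        MvPowerSeries σ ℂ) := by
    rw [e1]
    refine Finset.sum_nbij' Prod.swap Prod.swap ?_ ?_ ?_ ?_ ?_
    · simp only [Finset.mem_product, Prod.fst_swap, Prod.snd_swap]; tauto
    · simp only [Finset.mem_product, Prod.fst_swap, Prod.snd_swap]; tauto
    · simp
    · simp
    · intro ab _
      simp only [pairExp, Prod.fst_swap, Prod.snd_swap, neg_sub]
      rw [add_comm (tri ab.2), add_comm (tri (-ab.2)), add_comm ab.2]
  have h2 : (2 : ℂ) • (thetaTrunc α β w v n * thetaTrunc α β v w n) =
      (2 : ℂ) • ∑ ab ∈ B ×ˢ B, (monomial (pairExp α β ab) (pairCoef (Complex.cos θ) ab) :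
        MvPowerSeries σ ℂ) := by
    rw [two_smul]
    nth_rewrite 1 [e1]
    rw [e2, ← sum_add_distrib, Finset.smul_sum]
    refine sum_congr rfl fun ab _ => ?_
    rw [← map_add, ← mul_add, ← map_smul, smul_eq_mul, pairCoef, ← chebyshev_cos]
    congr 1; ring
  rw [smul_right_injective _ (two_ne_zero (α := ℂ)) h2]
  exact .refl _ _

/-- The truncated geometric series. -/
def geomTrunc (m : MvPowerSeries σ R) (n : ℕ) : MvPowerSeries σ R := ∑ k ∈ range n, m ^ k

lemma one_sub_mul_geomTrunc {e : σ →₀ ℕ} (he : e ≠ 0) (a : R) (n : ℕ) :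
    CongrLT n ((1 - monomial e a) * geomTrunc (monomial e a) n) 1 := by
  rw [geomTrunc, mul_neg_geom_sum, monomial_pow', sub_eq_add_neg, ← map_neg]
  have hd := one_le_degree he
  have h := (CongrLT.refl n (1 : MvPowerSeries σ R)).add
    (CongrLT.monomial_zero (n := n) (e := n • e) (by rw [map_nsmul, smul_eq_mul]; nlinarith)
      (-(a ^ n)))
  rwa [add_zero] at h

lemma wnorm_geomTrunc_le (r : σ → ℝ≥0) (e : σ →₀ ℕ) {a : ℂ} (ha : ‖a‖ = 1) (n : ℕ) :
    wnorm r (geomTrunc (monomial e a) n) ≤ ((∑ k ∈ range n, mpow r e ^ k : ℝ≥0) : ℝ≥0∞) := by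
  refine (wnorm_sum_le _ _ _).trans (le_of_eq ?_)
  rw [ENNReal.ofNNReal_finsetSum]
  refine sum_congr rfl fun k _ => ?_
  have : ‖a‖₊ = 1 := by ext; simpa using ha
  rw [monomial_pow', wnorm_monomial, mpow_nsmul, nnnorm_pow, this]; simp

lemma prod_geom_le {Q b : ℝ≥0} (hQ : Q < 1) (hb : b < 1) (n : ℕ) :
    ((∏ i ∈ range n, ∑ k ∈ range n, (Q ^ i * b) ^ k : ℝ≥0) : ℝ) ≤
      Real.exp (1 / ((1 - b) * (1 - Q))) := by
  have hQ' : (Q : ℝ) < 1 := by exact_mod_cast hQ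
  have hb' : (b : ℝ) < 1 := by exact_mod_cast hb
  have hQ0 : (0 : ℝ) ≤ Q := Q.2
  have hb0 : (0 : ℝ) ≤ b := b.2
  push_cast
  have h1 : ∀ i, ∑ k ∈ range n, ((Q : ℝ) ^ i * b) ^ k ≤
      Real.exp ((Q : ℝ) ^ i * (1 / (1 - b))) := fun i => by
    have hQi : (Q : ℝ) ^ i ≤ 1 := pow_le_one₀ hQ0 hQ'.le
    have hQi0 : 0 ≤ (Q : ℝ) ^ i := pow_nonneg hQ0 i
    have hx0 : 0 ≤ (Q : ℝ) ^ i * b := mul_nonneg hQi0 hb0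
    have hxb : (Q : ℝ) ^ i * b ≤ b := by nlinarith
    have hx1 : (Q : ℝ) ^ i * b < 1 := hxb.trans_lt hb'
    calc ∑ k ∈ range n, ((Q : ℝ) ^ i * b) ^ k ≤ (1 - (Q : ℝ) ^ i * b)⁻¹ := by
          rw [← tsum_geometric_of_lt_one hx0 hx1]
          exact (summable_geometric_of_lt_one hx0 hx1).sum_le_tsum _ fun k _ => pow_nonneg hx0 k
      _ = (Q : ℝ) ^ i * b / (1 - (Q : ℝ) ^ i * b) + 1 := by
          have : (1 - (Q : ℝ) ^ i * b) ≠ 0 := by linarith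
          field_simp; ring
      _ ≤ (Q : ℝ) ^ i * (1 / (1 - b)) + 1 := by
          gcongr
          rw [mul_div_assoc]
          gcongr
      _ ≤ _ := Real.add_one_le_exp _
  calc ∏ i ∈ range n, ∑ k ∈ range n, ((Q : ℝ) ^ i * b) ^ k
      ≤ ∏ i ∈ range n, Real.exp ((Q : ℝ) ^ i * (1 / (1 - b))) :=
        Finset.prod_le_prod (fun i _ => sum_nonneg fun k _ => by positivity) fun i _ => h1 i
    _ = Real.exp ((∑ i ∈ range n, (Q : ℝ) ^ i) * (1 / (1 - b))) := by
        rw [← Real.exp_sum, sum_mul]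
    _ ≤ _ := by
        refine Real.exp_le_exp.2 ?_
        have h2 : ∑ i ∈ range n, (Q : ℝ) ^ i ≤ 1 / (1 - Q) := by
          rw [one_div, ← tsum_geometric_of_lt_one hQ0 hQ']
          exact (summable_geometric_of_lt_one hQ0 hQ').sum_le_tsum _ fun k _ => pow_nonneg hQ0 k
        have h3 : (0 : ℝ) ≤ 1 / (1 - b) := by
          rw [one_div]; exact inv_nonneg.2 (by linarith)
        refine (mul_le_mul_of_nonneg_right h2 h3).trans (le_of_eq ?_)
        rw [one_div_mul_one_div, mul_comm]

lemma wnorm_prod_geomTrunc_le {r : σ → ℝ≥0} {γ δ : σ →₀ ℕ} (hγ : mpow r γ < 1)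
    (hδ : mpow r δ < 1) {a : ℂ} (ha : ‖a‖ = 1) (n : ℕ) :
    wnorm r (∏ i ∈ range n, geomTrunc (monomial (i • γ + δ) a) n) ≤
      ENNReal.ofReal (Real.exp (1 / ((1 - mpow r δ) * (1 - mpow r γ)))) := by
  refine (wnorm_prod_le _ _ _).trans ?_
  calc _ ≤ ∏ i ∈ range n,
        ((∑ k ∈ range n, (mpow r γ ^ i * mpow r δ) ^ k : ℝ≥0) : ℝ≥0∞) := by
        refine Finset.prod_le_prod' fun i _ => ?_
        have := wnorm_geomTrunc_le r (i • γ + δ) ha n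
        rwa [mpow_add, mpow_nsmul] at this
    _ = ((∏ i ∈ range n, ∑ k ∈ range n, (mpow r γ ^ i * mpow r δ) ^ k : ℝ≥0) :
          ℝ≥0∞) := by rw [ENNReal.ofNNReal_finsetProd]
    _ ≤ _ := by
        rw [← ENNReal.ofReal_coe_nnreal]
        exact ENNReal.ofReal_le_ofReal (prod_geom_le hγ hδ n)

/-- The series inverse to the elliptic interval converges absolutely for `|x|, |y| < 1`: by the
triple product it is, up to any given degree, a product of geometric series. -/
lemma wnorm_inv_pairSeries_ne_top {α β : σ →₀ ℕ} (hα : α ≠ 0) (hβ : β ≠ 0) (θ : ℝ)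
    {r : σ → ℝ≥0} (hrα : mpow r α < 1) (hrβ : mpow r β < 1) :
    wnorm r ((pairSeries α β (Complex.cos θ)).invOfUnit 1) ≠ ∞ := by
  have hq : mpow r (α + β) < 1 := by
    rw [mpow_add]; exact mul_lt_one_of_nonneg_of_lt_one_left zero_le hrα hrβ.le
  have hαβ : α + β ≠ 0 := fun h => hα (add_eq_zero.1 h).1
  set w := exp (θ * I)
  set v := exp (-(θ * I)) with hv
  have hwv : w * v = 1 := by rw [hv, ← Complex.exp_add]; simp
  have hvw : v * w = 1 := by rw [mul_comm, hwv]
  have nw : ‖w‖ = 1 := Complex.norm_exp_ofReal_mul_I θ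
  have nv : ‖v‖ = 1 := by
    have := Complex.norm_exp_ofReal_mul_I (-θ)
    rwa [Complex.ofReal_neg, neg_mul] at this
  set s := pairSeries α β (Complex.cos θ)
  have hs : s * s.invOfUnit 1 = 1 :=
    MvPowerSeries.mul_invOfUnit _ _ (by simpa using constantCoeff_pairSeries hα hβ _)
  let P : (σ →₀ ℕ) → ℂ → ℕ → MvPowerSeries σ ℂ := fun δ a n =>
    ∏ i ∈ range n, (1 - monomial (i • (α + β) + δ) a)
  let G : (σ →₀ ℕ) → ℂ → ℕ → MvPowerSeries σ ℂ := fun δ a n =>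
    ∏ i ∈ range n, geomTrunc (monomial (i • (α + β) + δ) a) n
  have hPG : ∀ δ a n, δ ≠ 0 → CongrLT n (P δ a n * G δ a n) 1 := fun δ a n hδ => by
    have h := CongrLT.prod (n := n) (range n)
      (F := fun i => (1 - monomial (i • (α + β) + δ) a) *
        geomTrunc (monomial (i • (α + β) + δ) a) n)
      (G := fun _ => 1) fun i _ =>
        one_sub_mul_geomTrunc (fun h => hδ (add_eq_zero.1 h).2) a n
    rwa [prod_mul_distrib, Finset.prod_const_one] at h
  have hth : ∀ w v : ℂ, w * v = 1 → ∀ n, CongrLT n (thetaTrunc α β w v n)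
      (P β v n * P α w n * P (α + β) 1 n) := fun w v h n => by
    have := jacobi_congr hα hβ h n
    simp only [P]
    simp_rw [succ_nsmul] at this
    exact this.symm
  obtain ⟨C, hC, hb⟩ : ∃ C : (σ →₀ ℕ) → ℝ≥0∞, (∀ δ, C δ ≠ ∞) ∧
      ∀ n δ a, ‖a‖ = 1 → mpow r δ < 1 → wnorm r (G δ a n) ≤ C δ :=
    ⟨fun δ => ENNReal.ofReal (Real.exp (1 / ((1 - mpow r δ) * (1 - mpow r (α + β))))),
      fun δ => ENNReal.ofReal_ne_top, fun n δ a ha hδ => wnorm_prod_geomTrunc_le hq hδ ha n⟩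
  refine ne_top_of_le_ne_top (b := (C β * C α * C (α + β)) * (C β * C α * C (α + β)))
    (ENNReal.mul_ne_top (ENNReal.mul_ne_top (ENNReal.mul_ne_top (hC _) (hC _)) (hC _))
      (ENNReal.mul_ne_top (ENNReal.mul_ne_top (hC _) (hC _)) (hC _)))
    (wnorm_le_of_congrLT fun n => ?_)
  refine ⟨(G β v n * G α w n * G (α + β) 1 n) * (G β w n * G α v n * G (α + β) 1 n), ?_, ?_⟩
  · have h1 := (pairSeries_congr hα hβ θ n).trans ((hth w v hwv n).mul (hth v w hvw n))
    have hu : IsUnit s := isUnit_of_constantCoeff_one (constantCoeff_pairSeries hα hβ _)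
    refine CongrLT.cancel hu ?_
    rw [hs]
    refine CongrLT.symm ((h1.mul (.refl n _)).trans ?_)
    have h2 := (((hPG β v n hβ).mul (hPG α w n hα)).mul (hPG (α + β) 1 n hαβ)).mul
      (((hPG β w n hβ).mul (hPG α v n hα)).mul (hPG (α + β) 1 n hαβ))
    simp only [mul_one] at h2
    refine CongrLT.trans ?_ h2
    have : ∀ a b c d e f a' b' c' d' e' f' : MvPowerSeries σ ℂ,
      a * b * c * (d * e * f) * (a' * b' * c' * (d' * e' * f')) =
      a * a' * (b * b') * (c * c') * (d * d' * (e * e') * (f * f')) := by intros; ring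
    rw [this]
    exact .refl _ _
  · refine (wnorm_mul_le _ _ _).trans (mul_le_mul' ?_ ?_) <;>
      refine (wnorm_mul_le _ _ _).trans (mul_le_mul' ((wnorm_mul_le _ _ _).trans
        (mul_le_mul' ?_ ?_)) ?_) <;> exact hb _ _ _ (by simp [nw, nv]) (by assumption)

end PairSeries

/-! ### Analyticity of normally convergent sums -/

section Analytic

variable {E : Type*} [NormedAddCommGroup E] [NormedSpace ℂ E] {J : Type*}

/-- A sum of power series whose majorants have a finite sum is analytic. -/
lemma analyticAt_tsum {f : J → E → ℂ} {p : J → FormalMultilinearSeries ℂ E ℂ} {x : E}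
    {r : ℝ≥0} (hr : 0 < r)
    (hp : ∀ j y, ‖y‖ < r → HasSum (fun n => p j n fun _ => y) (f j (x + y)))
    (hs : Summable fun z : J × ℕ => ‖p z.1 z.2‖ * (r : ℝ) ^ z.2) :
    AnalyticAt ℂ (fun y => ∑' j, f j y) x := by
  have hr' : (0 : ℝ) < r := hr
  have hsn : ∀ n, Summable fun j => ‖p j n‖ := fun n => by
    have h := (hs.comp_injective (i := fun j => (j, n)) fun a b h => (Prod.mk.inj h).1)
    refine (h.mul_right (((r : ℝ) ^ n)⁻¹)).congr fun j => ?_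
    simp [(pow_pos hr' n).ne']
  have hs' : Summable fun z : ℕ × J => ‖p z.2 z.1‖ * (r : ℝ) ^ z.1 :=
    (Equiv.prodComm ℕ J).summable_iff.2 hs
  let P : FormalMultilinearSeries ℂ E ℂ := fun n => ∑' j, p j n
  refine ⟨P, r, ⟨?_, by exact_mod_cast hr, ?_⟩⟩
  · refine P.le_radius_of_summable_norm (Summable.of_nonneg_of_le
      (fun n => by positivity) (fun n => ?_) hs'.prod)
    change ‖∑' j, p j n‖ * (r : ℝ) ^ n ≤ ∑' j, ‖p j n‖ * (r : ℝ) ^ n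
    rw [tsum_mul_right]
    exact mul_le_mul_of_nonneg_right (norm_tsum_le_tsum_norm (hsn n)) (by positivity)
  · intro y hy
    have hy' : ‖y‖ < r := by
      rw [Metric.mem_eball, edist_zero_right] at hy
      exact_mod_cast hy
    have hsum : Summable fun z : ℕ × J => p z.2 z.1 fun _ => y := by
      refine Summable.of_norm_bounded hs' fun z => ?_
      refine ((p z.2 z.1).le_opNorm _).trans ?_
      rw [Finset.prod_const, Finset.card_univ, Fintype.card_fin]
      gcongr
    have h1 : ∀ n, P n (fun _ => y) = ∑' j, p j n fun _ => y := fun n =>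
      ((hsn n).of_norm.hasSum.mapL (ContinuousMultilinearMap.apply ℂ _ ℂ (fun _ => y))).tsum_eq.symm
    simp_rw [h1]
    have h2 : Summable fun z : J × ℕ => p z.1 z.2 fun _ => y :=
      (Equiv.prodComm J ℕ).summable_iff.2 hsum
    have h3 : ∑' j, f j (x + y) = ∑' z : ℕ × J, p z.2 z.1 fun _ => y := by
      calc ∑' j, f j (x + y) = ∑' j, ∑' n, p j n fun _ => y :=
            tsum_congr fun j => (hp j y hy').tsum_eq.symm
        _ = ∑' z : J × ℕ, p z.1 z.2 fun _ => y := h2.tsum_prod.symm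
        _ = _ := (Equiv.prodComm J ℕ).tsum_eq fun z : ℕ × J => p z.2 z.1 fun _ => y
    rw [h3]
    exact hsum.hasSum.prod_fiberwise fun n => (hsum.prod_factor n).hasSum

/-- The power series of `L^k exp ℓ` at `0`. -/
def expSeries (ℓ L : E →L[ℂ] ℂ) (k : ℕ) : FormalMultilinearSeries ℂ E ℂ := fun n =>
  if k ≤ n then ((n - k).factorial : ℂ)⁻¹ •
    (ContinuousMultilinearMap.mkPiAlgebra ℂ (Fin n) ℂ).compContinuousLinearMap
      (fun i => if (i : ℕ) < k then L else ℓ) else 0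

lemma prod_fin_ite {M : Type*} [CommMonoid M] (a b : M) (k d : ℕ) :
    ∏ i : Fin (k + d), (if (i : ℕ) < k then a else b) = a ^ k * b ^ d := by
  rw [Fin.prod_univ_eq_prod_range (fun i => if i < k then a else b), Finset.prod_range_add]
  congr 1
  · rw [prod_congr rfl (g := fun _ => a) fun i hi => if_pos (mem_range.1 hi)]; simp
  · simp

lemma expSeries_apply (ℓ L : E →L[ℂ] ℂ) (k d : ℕ) (y : E) :
    (expSeries ℓ L k (k + d) fun _ => y) = L y ^ k * (ℓ y ^ d / d.factorial) := by
  rw [expSeries, if_pos (by omega)]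
  simp only [add_tsub_cancel_left, smul_apply,
    ContinuousMultilinearMap.compContinuousLinearMap_apply,
    ContinuousMultilinearMap.mkPiAlgebra_apply, smul_eq_mul]
  have : ∀ i : Fin (k + d), (if (i : ℕ) < k then L else ℓ) y = if (i : ℕ) < k then L y else ℓ y :=
    fun i => by split_ifs <;> rfl
  simp_rw [this]
  rw [prod_fin_ite]
  field_simp

lemma norm_expSeries_le (ℓ L : E →L[ℂ] ℂ) (k d : ℕ) :
    ‖expSeries ℓ L k (k + d)‖ ≤ ‖L‖ ^ k * (‖ℓ‖ ^ d / d.factorial) := by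
  rw [expSeries, if_pos (by omega), norm_smul, add_tsub_cancel_left]
  have h := ContinuousMultilinearMap.norm_compContinuousLinearMap_le
    (ContinuousMultilinearMap.mkPiAlgebra ℂ (Fin (k + d)) ℂ)
      (fun i => if (i : ℕ) < k then L else ℓ)
  rw [ContinuousMultilinearMap.norm_mkPiAlgebra, one_mul] at h
  have : ∀ i : Fin (k + d), ‖(if (i : ℕ) < k then L else ℓ)‖ = if (i : ℕ) < k then ‖L‖ else ‖ℓ‖ :=
    fun i => by split_ifs <;> rfl
  simp_rw [this] at h
  rw [prod_fin_ite] at h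
  calc _ ≤ ‖((d.factorial : ℂ))⁻¹‖ * (‖L‖ ^ k * ‖ℓ‖ ^ d) := by gcongr
    _ = _ := by
      rw [norm_inv, Complex.norm_natCast]; field_simp

lemma hasSum_shift {M : Type*} [AddCommGroup M] [TopologicalSpace M] [IsTopologicalAddGroup M]
    {g : ℕ → M} {a : M} (k : ℕ)
    (h0 : ∀ n < k, g n = 0) (h : HasSum (fun d => g (k + d)) a) : HasSum g a := by
  have : ∑ i ∈ range k, g i = 0 := sum_eq_zero fun i hi => h0 i (mem_range.1 hi)
  rw [← add_zero a, ← this]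
  exact (hasSum_nat_add_iff k).1 (by simpa only [add_comm] using h)

lemma expSeries_of_lt (ℓ L : E →L[ℂ] ℂ) {k n : ℕ} (h : n < k) : expSeries ℓ L k n = 0 := by
  rw [expSeries, if_neg (by omega)]

lemma summable_prod_of_hasSum {F : J × ℕ → ℝ} {g : J → ℝ} (h0 : ∀ z, 0 ≤ F z)
    (h : ∀ j, HasSum (fun n => F (j, n)) (g j)) (hg : Summable g) : Summable F :=
  (summable_prod_of_nonneg h0).2
    ⟨fun j => (h j).summable, hg.congr fun j => (h j).tsum_eq.symm⟩

lemma exists_majorant_expSeries (ℓ L : E →L[ℂ] ℂ) (k : ℕ) {r : ℝ} (hr : 0 ≤ r) :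
    ∃ b : ℕ → ℝ, (∀ n, ‖expSeries ℓ L k n‖ * r ^ n ≤ b n) ∧
      HasSum b ((‖L‖ * r) ^ k * Real.exp (‖ℓ‖ * r)) := by
  refine ⟨fun n => (‖L‖ * r) ^ k *
    (if k ≤ n then (‖ℓ‖ * r) ^ (n - k) / (n - k).factorial else 0), fun n => ?_, ?_⟩
  · beta_reduce
    rcases lt_or_ge n k with h | h
    · rw [if_neg (by omega), expSeries_of_lt _ _ h]; simp
    · obtain ⟨d, rfl⟩ := Nat.exists_eq_add_of_le h
      rw [if_pos h]
      refine (mul_le_mul_of_nonneg_right (norm_expSeries_le _ _ _ _) (by positivity)).trans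
        (le_of_eq ?_)
      rw [add_tsub_cancel_left, mul_pow, mul_pow, pow_add]; ring
  · refine HasSum.mul_left _ (hasSum_shift k (fun n hn => if_neg (by omega)) ?_)
    simp only [le_add_iff_nonneg_right, zero_le, if_true, add_tsub_cancel_left]
    rw [Real.exp_eq_exp_ℝ]
    exact NormedSpace.expSeries_div_hasSum_exp _

lemma hasSum_expSeries (ℓ L : E →L[ℂ] ℂ) (k : ℕ) (y : E) :
    HasSum (fun n => expSeries ℓ L k n fun _ => y) (L y ^ k * exp (ℓ y)) := by
  refine hasSum_shift k (fun n hn => by rw [expSeries_of_lt _ _ hn]; rfl) ?_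
  simp_rw [expSeries_apply]
  refine HasSum.mul_left _ ?_
  rw [Complex.exp_eq_exp_ℂ]
  exact NormedSpace.expSeries_div_hasSum_exp (ℓ y)

end Analytic

/-! ### Gaussian sums -/

lemma summable_gauss {δ : ℝ} (hδ : 0 < δ) (M : ℝ) :
    Summable fun a : ℤ => Real.exp (-δ * (a : ℝ) ^ 2 + M * |(a : ℝ)|) := by
  have h := summable_pow_mul_jacobiTheta₂_term_bound (M / (2 * pi))
    (T := δ / pi) (by positivity) 0
  refine h.congr fun a => ?_
  rw [pow_zero, one_mul]
  congr 1
  have := Real.pi_ne_zero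
  push_cast
  field_simp
  ring

lemma summable_prod_fin {n : ℕ} {f : Fin n → ℤ → ℝ} (h0 : ∀ i a, 0 ≤ f i a)
    (h : ∀ i, Summable (f i)) : Summable fun a : Fin n → ℤ => ∏ i, f i (a i) := by
  induction n with
  | zero => exact summable_of_hasFiniteSupport (Set.toFinite _)
  | succ n ih =>
    rw [← (Fin.consEquiv fun _ => ℤ).summable_iff]
    have := (h 0).mul_of_nonneg (ih (f := fun i => f i.succ) (fun i => h0 _) fun i => h _)
      (fun a => h0 _ _) (fun a => Finset.prod_nonneg fun i _ => h0 _ _)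
    refine this.congr fun a => ?_
    simp [Fin.consEquiv, Fin.prod_univ_succ]

/-- Gaussian sums over `ℤ^n` converge. -/
lemma summable_gauss_fin (n : ℕ) {δ : ℝ} (hδ : 0 < δ) (M : ℝ) :
    Summable fun a : Fin n → ℤ => Real.exp (-δ * ∑ i, (a i : ℝ) ^ 2 + M * ∑ i, |(a i : ℝ)|) := by
  refine (summable_prod_fin (n := n) (f := fun _ a => Real.exp (-δ * (a : ℝ) ^ 2 + M * |(a : ℝ)|))
    (fun _ _ => (Real.exp_pos _).le) fun _ => summable_gauss hδ M).congr fun a => ?_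
  rw [← Real.exp_sum, sum_add_distrib, mul_sum, mul_sum]

/-! ### Chebyshev polynomials: growth of the Taylor coefficients -/

/-- The majorant `∑_k |P_k| r^k` of a polynomial. -/
def polyMaj (r : ℝ) (P : Polynomial ℂ) : ℝ := ∑ k ∈ P.support, ‖P.coeff k‖ * r ^ k

lemma polyMaj_eq {r : ℝ} {P : Polynomial ℂ} {N : ℕ} (h : P.natDegree < N) :
    polyMaj r P = ∑ k ∈ range N, ‖P.coeff k‖ * r ^ k := by
  refine Finset.sum_subset (fun k hk => mem_range.2
    ((Polynomial.le_natDegree_of_mem_supp k hk).trans_lt h)) fun k _ hk => ?_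
  rw [Polynomial.notMem_support_iff.1 hk]; simp

lemma polyMaj_nonneg {r : ℝ} (hr : 0 ≤ r) (P : Polynomial ℂ) : 0 ≤ polyMaj r P :=
  sum_nonneg fun _ _ => by positivity

lemma polyMaj_sub_le {r : ℝ} (hr : 0 ≤ r) (P Q : Polynomial ℂ) :
    polyMaj r (P - Q) ≤ polyMaj r P + polyMaj r Q := by
  set N := max P.natDegree Q.natDegree + 1
  have h1 : P.natDegree < N := by omega
  have h2 : Q.natDegree < N := by omega
  have h3 : (P - Q).natDegree < N := (Polynomial.natDegree_sub_le _ _).trans_lt (by omega)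
  rw [polyMaj_eq h1, polyMaj_eq h2, polyMaj_eq h3, ← sum_add_distrib]
  refine sum_le_sum fun k _ => ?_
  rw [← add_mul, Polynomial.coeff_sub]
  gcongr
  exact norm_sub_le _ _

lemma polyMaj_C_mul (r : ℝ) (a : ℂ) (P : Polynomial ℂ) :
    polyMaj r (Polynomial.C a * P) = ‖a‖ * polyMaj r P := by
  have h3 : (Polynomial.C a * P).natDegree < P.natDegree + 1 :=
    (Polynomial.natDegree_C_mul_le _ _).trans_lt (by omega)
  rw [polyMaj_eq h3, polyMaj_eq (Nat.lt_succ_self _), mul_sum]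
  refine sum_congr rfl fun k _ => ?_
  rw [Polynomial.coeff_C_mul, norm_mul, mul_assoc]

lemma polyMaj_X_mul (r : ℝ) (P : Polynomial ℂ) :
    polyMaj r (Polynomial.X * P) = r * polyMaj r P := by
  have h3 : (Polynomial.X * P).natDegree < P.natDegree + 2 :=
    Polynomial.natDegree_mul_le.trans_lt (by
      have := Polynomial.natDegree_X_le (R := ℂ); omega)
  rw [polyMaj_eq h3, polyMaj_eq (Nat.lt_succ_self _), Finset.sum_range_succ', mul_sum]
  simp only [Polynomial.coeff_X_mul, Polynomial.coeff_X_mul_zero, norm_zero, zero_mul, add_zero]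
  exact sum_congr rfl fun k _ => by ring

/-- The Taylor expansion of the Chebyshev polynomial at `c`. -/
def chebTaylor (c : ℂ) (s : ℤ) : Polynomial ℂ :=
  (Polynomial.Chebyshev.T ℂ s).comp (Polynomial.X + Polynomial.C c)

lemma polyMaj_chebTaylor_le (c : ℂ) {r : ℝ} (hr : 0 ≤ r) (s : ℤ) :
    polyMaj r (chebTaylor c s) ≤ (2 * (‖c‖ + r) + 1) ^ s.natAbs := by
  set K := 2 * (‖c‖ + r) + 1 with hK
  have hK1 : 1 ≤ K := by have := norm_nonneg c; linarith
  have h : ∀ n : ℕ, polyMaj r (chebTaylor c n) ≤ K ^ n ∧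
      polyMaj r (chebTaylor c (n + 1 : ℕ)) ≤ K ^ (n + 1) := by
    intro n
    induction n with
    | zero =>
      have h0 : polyMaj r (1 : Polynomial ℂ) = 1 := by
        rw [polyMaj_eq (N := 1) (by simp)]; simp
      refine ⟨by simp [chebTaylor, h0], ?_⟩
      have e : chebTaylor c ((0 + 1 : ℕ) : ℤ) =
          Polynomial.X * 1 - Polynomial.C (-c) * 1 := by simp [chebTaylor]
      rw [e]
      refine (polyMaj_sub_le hr _ _).trans ?_
      rw [polyMaj_X_mul, polyMaj_C_mul, h0, norm_neg]
      have := norm_nonneg c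
      simp only [zero_add, pow_one, mul_one]; linarith
    | succ n ih =>
      refine ⟨ih.2, ?_⟩
      have e : chebTaylor c ((n + 1 + 1 : ℕ) : ℤ) =
          Polynomial.C 2 * (Polynomial.X * chebTaylor c (n + 1 : ℕ) -
            Polynomial.C (-c) * chebTaylor c (n + 1 : ℕ)) - chebTaylor c n := by
        have := Polynomial.Chebyshev.T_add_two ℂ n
        have h2 : ((n + 1 + 1 : ℕ) : ℤ) = n + 2 := by push_cast; ring
        rw [chebTaylor, h2, this]
        simp only [chebTaylor, Polynomial.sub_comp, Polynomial.mul_comp, Polynomial.X_comp,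
          Polynomial.ofNat_comp, Nat.cast_add, Nat.cast_one, map_neg]
        rw [show (Polynomial.C (2 : ℂ)) = 2 from rfl]
        ring
      rw [e]
      refine (polyMaj_sub_le hr _ _).trans ?_
      rw [polyMaj_C_mul]
      have h1 := polyMaj_sub_le hr (Polynomial.X * chebTaylor c (n + 1 : ℕ))
        (Polynomial.C (-c) * chebTaylor c (n + 1 : ℕ))
      rw [polyMaj_X_mul, polyMaj_C_mul, norm_neg] at h1
      have h2 : (r + ‖c‖) * polyMaj r (chebTaylor c (n + 1 : ℕ)) ≤ (r + ‖c‖) * K ^ (n + 1) := by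
        have := norm_nonneg c
        gcongr; exact ih.2
      have h3 : K ^ n ≤ K ^ (n + 1) := pow_le_pow_right₀ hK1 (by omega)
      have h4 : K ^ (n + 1 + 1) = 2 * ((r + ‖c‖) * K ^ (n + 1)) + K ^ (n + 1) := by
        rw [pow_succ K (n + 1)]; nth_rewrite 2 [hK]; ring
      have h5 : ‖(2 : ℂ)‖ = 2 := by simp
      rw [h5, h4]
      linarith [ih.1]
  have hs : chebTaylor c s = chebTaylor c s.natAbs := by
    rcases Int.natAbs_eq s with hs | hs
    · exact congrArg (chebTaylor c) hs
    · rw [chebTaylor, chebTaylor]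
      conv_lhs => rw [hs, Polynomial.Chebyshev.T_neg]
  rw [hs]
  exact (h s.natAbs).1

section ExpPoly

variable {E : Type*} [NormedAddCommGroup E] [NormedSpace ℂ E] {J : Type*}

lemma formalMultilinearSeries_sum_apply {K : Type*} (s : Finset K)
    (F : K → FormalMultilinearSeries ℂ E ℂ) (n : ℕ) : (∑ k ∈ s, F k) n = ∑ k ∈ s, F k n := by
  classical
  induction s using Finset.induction_on with
  | empty => rfl
  | insert a s ha ih => rw [sum_insert ha, sum_insert ha, ← ih]; rfl

/-- Normally convergent sums of exponentials of linear forms, multiplied by polynomials in a linear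
form, are analytic. -/
lemma analyticAt_tsum_exp_poly (P : J → Polynomial ℂ) (ℓ : J → E →L[ℂ] ℂ) (L : E →L[ℂ] ℂ) (x : E)
    {r : ℝ≥0} (hr : 0 < r) (hs : Summable fun j =>
      ‖exp (ℓ j x)‖ * (polyMaj (‖L‖ * r) (P j) * Real.exp (‖ℓ j‖ * r))) :
    AnalyticAt ℂ (fun y => ∑' j, (P j).eval (L (y - x)) * exp (ℓ j y)) x := by
  refine analyticAt_tsum (r := r) (p := fun j => ∑ k ∈ (P j).support,
    ((P j).coeff k * exp (ℓ j x)) • expSeries (ℓ j) L k) hr (fun j y _ => ?_) ?_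
  · have h2 := hasSum_sum (s := (P j).support) fun k _ =>
      (hasSum_expSeries (ℓ j) L k y).mul_left ((P j).coeff k * exp (ℓ j x))
    have e : (P j).eval (L (x + y - x)) * exp (ℓ j (x + y)) = ∑ k ∈ (P j).support,
        (P j).coeff k * exp (ℓ j x) * (L y ^ k * exp (ℓ j y)) := by
      rw [add_sub_cancel_left, map_add, Complex.exp_add, Polynomial.eval_eq_sum, Polynomial.sum,
        sum_mul]
      exact sum_congr rfl fun k _ => by ring
    rw [e]
    refine h2.congr_fun fun n => ?_
    rw [formalMultilinearSeries_sum_apply, sum_apply]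
    rfl
  · choose b hb hb' using fun j k => exists_majorant_expSeries (ℓ j) L k r.coe_nonneg
    have h0 : ∀ j k n, 0 ≤ b j k n := fun j k n =>
      (mul_nonneg (norm_nonneg _) (pow_nonneg r.coe_nonneg _)).trans (hb j k n)
    have h1 : ∀ j, HasSum (fun n => ∑ k ∈ (P j).support,
        ‖(P j).coeff k * exp (ℓ j x)‖ * b j k n)
        (‖exp (ℓ j x)‖ * (polyMaj (‖L‖ * r) (P j) * Real.exp (‖ℓ j‖ * r))) := fun j => by
      have := hasSum_sum (s := (P j).support) fun k _ =>
        (hb' j k).mul_left ‖(P j).coeff k * exp (ℓ j x)‖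
      have e : ‖exp (ℓ j x)‖ * (polyMaj (‖L‖ * r) (P j) * Real.exp (‖ℓ j‖ * r)) =
          ∑ k ∈ (P j).support, ‖(P j).coeff k * exp (ℓ j x)‖ *
            ((‖L‖ * r) ^ k * Real.exp (‖ℓ j‖ * r)) := by
        unfold polyMaj
        rw [sum_mul, mul_sum]
        refine sum_congr rfl fun k _ => ?_
        rw [norm_mul]; ring
      rw [e]
      exact this
    have h2 : ∀ z : J × ℕ, 0 ≤ ∑ k ∈ (P z.1).support,
        ‖(P z.1).coeff k * exp (ℓ z.1 x)‖ * b z.1 k z.2 :=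
      fun z => sum_nonneg fun k _ => mul_nonneg (norm_nonneg _) (h0 _ _ _)
    have h3 := summable_prod_of_hasSum h2 h1 hs
    refine Summable.of_nonneg_of_le
      (fun z => mul_nonneg (norm_nonneg _) (pow_nonneg r.coe_nonneg _)) (fun z => ?_) h3
    rw [formalMultilinearSeries_sum_apply]
    refine (mul_le_mul_of_nonneg_right (norm_sum_le _ _) (pow_nonneg r.coe_nonneg _)).trans ?_
    rw [sum_mul]
    refine sum_le_sum fun k _ => ?_
    rw [FormalMultilinearSeries.smul_apply, norm_smul, mul_assoc]
    exact mul_le_mul_of_nonneg_left (hb _ _ _) (norm_nonneg _)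

end ExpPoly

/-! ### The elliptic interval as an analytic function -/

/-- The exponent of the term `(a, b)` of the double series of the elliptic interval, a linear form
in `(ζ, c, τ)`. -/
def ellForm (ab : ℤ × ℤ) : ℂ × ℂ × ℂ →L[ℂ] ℂ :=
  (2 * pi * I * ((tri (-ab.1) + tri (-ab.2) : ℕ) : ℂ)) •
      (ContinuousLinearMap.snd ℂ ℂ ℂ).comp (ContinuousLinearMap.snd ℂ ℂ (ℂ × ℂ)) +
    (2 * pi * I * ((1 - ab.1 - ab.2 : ℤ) : ℂ)) • ContinuousLinearMap.fst ℂ ℂ (ℂ × ℂ)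

lemma ellForm_apply (ab : ℤ × ℤ) (x : ℂ × ℂ × ℂ) : ellForm ab x =
    2 * pi * I * ((tri (-ab.1) + tri (-ab.2) : ℕ) : ℂ) * x.2.2 +
      2 * pi * I * ((1 - ab.1 - ab.2 : ℤ) : ℂ) * x.1 := rfl

/-- The elliptic interval as a function of `ζ`, the cosine `c = u · v` and `τ`, given by a double
series, which extends it analytically in `c`. -/
def ellFun (ζ c τ : ℂ) : ℂ := -∑' ab, pairCoef c ab * exp (ellForm ab (ζ, c, τ))

lemma norm_ellForm_le (ab : ℤ × ℤ) : ‖ellForm ab‖ ≤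
    2 * pi * ((tri (-ab.1) + tri (-ab.2) : ℕ) + (1 + |(ab.1 : ℝ)| + |(ab.2 : ℝ)|)) := by
  have hp := Real.pi_pos
  refine (norm_add_le _ _).trans ?_
  rw [mul_add (2 * pi)]
  have hn : ‖(2 * pi * I : ℂ)‖ = 2 * pi := by
    simp [abs_of_pos hp]
  refine add_le_add ?_ ?_
  · rw [norm_smul, norm_mul, hn, Complex.norm_natCast]
    refine (mul_le_of_le_one_right (by positivity) ?_)
    refine (ContinuousLinearMap.opNorm_comp_le _ _).trans ?_
    exact mul_le_one₀ (ContinuousLinearMap.norm_snd_le _ _ _) (norm_nonneg _)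
      (ContinuousLinearMap.norm_snd_le _ _ _)
  · rw [norm_smul, norm_mul, hn, Complex.norm_intCast]
    refine (mul_le_of_le_one_right (by positivity) (ContinuousLinearMap.norm_fst_le _ _ _)).trans ?_
    refine mul_le_mul_of_nonneg_left ?_ (by positivity)
    push_cast
    have h1 := abs_sub (1 - (ab.1 : ℝ)) ab.2
    have h2 := abs_sub (1 : ℝ) ab.1
    rw [abs_one] at h2
    linarith

lemma norm_exp_ellForm_le (ab : ℤ × ℤ) (x : ℂ × ℂ × ℂ) : ‖exp (ellForm ab x)‖ ≤
    Real.exp (2 * pi * (-((tri (-ab.1) + tri (-ab.2) : ℕ) : ℝ) * x.2.2.im +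
      (1 + |(ab.1 : ℝ)| + |(ab.2 : ℝ)|) * |x.1.im|)) := by
  rw [Complex.norm_exp, Real.exp_le_exp, ellForm_apply]
  have e : (2 * pi * I * ((tri (-ab.1) + tri (-ab.2) : ℕ) : ℂ) * x.2.2 +
      2 * pi * I * ((1 - ab.1 - ab.2 : ℤ) : ℂ) * x.1).re =
      2 * pi * (-((tri (-ab.1) + tri (-ab.2) : ℕ) : ℝ) * x.2.2.im -
        (1 - ab.1 - ab.2 : ℝ) * x.1.im) := by
    have h1 : (2 * pi * I * ((tri (-ab.1) + tri (-ab.2) : ℕ) : ℂ) * x.2.2 +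
      2 * pi * I * ((1 - ab.1 - ab.2 : ℤ) : ℂ) * x.1) =
      ((2 * pi * (tri (-ab.1) + tri (-ab.2) : ℕ) : ℝ) : ℂ) * (x.2.2 * I) +
      ((2 * pi * (1 - ab.1 - ab.2 : ℝ) : ℝ) : ℂ) * (x.1 * I) := by
      push_cast; ring
    rw [h1, Complex.add_re, Complex.re_ofReal_mul, Complex.re_ofReal_mul, Complex.mul_I_re,
      Complex.mul_I_re]
    ring
  rw [e]
  refine mul_le_mul_of_nonneg_left ?_ (by positivity)
  have h1 : -((1 - ab.1 - ab.2 : ℝ) * x.1.im) ≤ |(1 - ab.1 - ab.2 : ℝ)| * |x.1.im| := by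
    rw [← abs_mul]; exact neg_le_abs _
  have h2 : |(1 - ab.1 - ab.2 : ℝ)| ≤ 1 + |(ab.1 : ℝ)| + |(ab.2 : ℝ)| := by
    have h1 := abs_sub (1 - (ab.1 : ℝ)) ab.2
    have h2 := abs_sub (1 : ℝ) ab.1
    rw [abs_one] at h2
    linarith
  have h3 := mul_le_mul_of_nonneg_right h2 (abs_nonneg x.1.im)
  linarith

lemma tri_neg_ge (a : ℤ) : ((a : ℝ) ^ 2 - |(a : ℝ)|) / 2 ≤ (tri (-a) : ℝ) := by
  have h : (2 * (tri (-a) : ℤ) : ℝ) = ((-a * (-a + 1) : ℤ) : ℝ) := by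
    exact_mod_cast two_mul_tri (-a)
  push_cast at h
  have := le_abs_self (a : ℝ)
  nlinarith

lemma summable_ell (x : ℂ × ℂ × ℂ) {K : ℝ} (hK : 1 ≤ K) {r : ℝ} (hr0 : 0 ≤ r)
    (hr : r < x.2.2.im) : Summable fun ab : ℤ × ℤ =>
      ‖exp (ellForm ab x)‖ * (K ^ (ab.1 - ab.2).natAbs * Real.exp (‖ellForm ab‖ * r)) := by
  have hp := Real.pi_pos
  set Y := |x.1.im|
  set δ := pi * (x.2.2.im - r) with hδ
  have hδ0 : 0 < δ := mul_pos hp (by linarith)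
  set M := δ + 2 * pi * (Y + r) + Real.log K with hM
  have hs := ((summable_gauss hδ0 M).mul_of_nonneg (summable_gauss hδ0 M)
    (fun _ => (Real.exp_pos _).le) (fun _ => (Real.exp_pos _).le)).mul_left
      (Real.exp (2 * pi * (Y + r)))
  refine Summable.of_nonneg_of_le (fun _ => by positivity) (fun ab => ?_) hs
  have h1 := norm_exp_ellForm_le ab x
  have h2 := mul_le_mul_of_nonneg_right (norm_ellForm_le ab) hr0
  have hlog : 0 ≤ Real.log K := Real.log_nonneg hK
  have h3 : K ^ (ab.1 - ab.2).natAbs ≤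
      Real.exp (Real.log K * (|(ab.1 : ℝ)| + |(ab.2 : ℝ)|)) := by
    rw [Real.exp_mul, Real.exp_log (by linarith), ← Real.rpow_natCast]
    refine Real.rpow_le_rpow_of_exponent_le hK ?_
    rw [Nat.cast_natAbs]
    push_cast
    exact abs_sub _ _
  refine (mul_le_mul h1 (mul_le_mul h3 (Real.exp_le_exp.2 h2) (Real.exp_pos _).le
    (Real.exp_pos _).le) (by positivity) (Real.exp_pos _).le).trans ?_
  rw [← Real.exp_add, ← Real.exp_add, ← Real.exp_add, ← Real.exp_add, Real.exp_le_exp]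
  have ha := tri_neg_ge ab.1
  have hb := tri_neg_ge ab.2
  have h5 : δ * ((ab.1 : ℝ) ^ 2 - |(ab.1 : ℝ)| + ((ab.2 : ℝ) ^ 2 - |(ab.2 : ℝ)|)) ≤
      δ * (2 * (tri (-ab.1) + tri (-ab.2))) := by gcongr; linarith
  push_cast
  rw [hM]
  have e : δ * (2 * ((tri (-ab.1) : ℝ) + tri (-ab.2))) =
    2 * pi * ((tri (-ab.1) + tri (-ab.2)) * x.2.2.im) -
      2 * pi * ((tri (-ab.1) + tri (-ab.2)) * r) := by rw [hδ]; ring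
  nlinarith

lemma eval_chebTaylor (c : ℂ) (s : ℤ) (y : ℂ) :
    (chebTaylor c s).eval y = (Polynomial.Chebyshev.T ℂ s).eval (y + c) := by
  simp [chebTaylor, Polynomial.eval_comp]

lemma norm_neg_one_pow_mul (n : ℕ) (z : ℂ) : ‖(-1) ^ n * z‖ = ‖z‖ := by simp

lemma norm_pairCoef_le (c : ℂ) (ab : ℤ × ℤ) :
    ‖pairCoef c ab‖ ≤ (2 * ‖c‖ + 1) ^ (ab.1 - ab.2).natAbs := by
  rw [pairCoef, norm_neg_one_pow_mul]
  have h := polyMaj_chebTaylor_le c le_rfl (ab.1 - ab.2)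
  rw [add_zero] at h
  refine le_trans (le_of_eq ?_) h
  rw [polyMaj_eq (Nat.lt_succ_self _), Finset.sum_range_succ']
  have : (Polynomial.Chebyshev.T ℂ (ab.1 - ab.2)).eval c =
      (chebTaylor c (ab.1 - ab.2)).coeff 0 := by
    rw [Polynomial.coeff_zero_eq_eval_zero, eval_chebTaylor, zero_add]
  rw [this]; simp

lemma summable_norm_ell (ζ c : ℂ) {τ : ℂ} (hτ : 0 < τ.im) :
    Summable fun ab => ‖pairCoef c ab * exp (ellForm ab (ζ, c, τ))‖ := by
  have hK : 1 ≤ 2 * ‖c‖ + 1 := by have := norm_nonneg c; linarith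
  refine Summable.of_nonneg_of_le (fun _ => norm_nonneg _) (fun ab => ?_)
    (summable_ell (ζ, c, τ) hK le_rfl hτ)
  rw [norm_mul, mul_comm, mul_zero, Real.exp_zero, mul_one]
  exact mul_le_mul_of_nonneg_left (norm_pairCoef_le _ _) (norm_nonneg _)

lemma hasSum_ellFun (ζ c : ℂ) {τ : ℂ} (hτ : 0 < τ.im) :
    HasSum (fun ab => pairCoef c ab * exp (ellForm ab (ζ, c, τ))) (-ellFun ζ c τ) := by
  rw [ellFun, neg_neg]
  exact (summable_norm_ell ζ c hτ).of_norm.hasSum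

lemma analyticAt_ellFun {x : ℂ × ℂ × ℂ} (hx : 0 < x.2.2.im) :
    AnalyticAt ℂ (fun y : ℂ × ℂ × ℂ => ellFun y.1 y.2.1 y.2.2) x := by
  set L := (ContinuousLinearMap.fst ℂ ℂ ℂ).comp (ContinuousLinearMap.snd ℂ ℂ (ℂ × ℂ))
  have hr : (0 : ℝ) < x.2.2.im / 2 := by linarith
  set r : ℝ≥0 := ⟨x.2.2.im / 2, hr.le⟩
  have hK : 1 ≤ 2 * (‖x.2.1‖ + ‖L‖ * r) + 1 := by
    have := norm_nonneg x.2.1; have : 0 ≤ ‖L‖ * r := by positivity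
    linarith
  have h := analyticAt_tsum_exp_poly (J := ℤ × ℤ)
    (fun ab => Polynomial.C ((-1) ^ (ab.1 + ab.2).natAbs) * chebTaylor x.2.1 (ab.1 - ab.2))
    ellForm L x (r := r) hr (by
      refine Summable.of_nonneg_of_le (fun ab => mul_nonneg (norm_nonneg _) (mul_nonneg
        (polyMaj_nonneg (by positivity) _) (Real.exp_pos _).le)) (fun ab => ?_)
        (summable_ell x hK (r := r) r.2 (by change x.2.2.im / 2 < _; linarith))
      refine mul_le_mul_of_nonneg_left (mul_le_mul_of_nonneg_right ?_ (Real.exp_pos _).le)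
        (norm_nonneg _)
      rw [polyMaj_C_mul, norm_pow, norm_neg, norm_one, one_pow, one_mul]
      exact polyMaj_chebTaylor_le _ (by positivity) _)
  refine h.neg.congr (Filter.Eventually.of_forall fun y => ?_)
  simp only [Pi.neg_apply, ellFun]
  congr 1
  refine tsum_congr fun ab => ?_
  rw [Polynomial.eval_mul, Polynomial.eval_C, eval_chebTaylor, pairCoef]
  have : L (y - x) + x.2.1 = y.2.1 := by simp [L]
  rw [this]

/-! ### Values of the power series of the elliptic interval -/

section Values

variable {σ : Type*} {α β : σ →₀ ℕ} {x : σ → ℂ} {ζ τ : ℂ}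

lemma mpow_pairExp (hα' : mpow x α = exp (-(2 * pi * I * ζ)))
    (hβ' : mpow x β = exp (2 * pi * I * (τ + ζ))) (c : ℂ) (ab : ℤ × ℤ) :
    mpow x (pairExp α β ab) = exp (-(2 * pi * I * ζ)) *
      exp (ellForm ab (ζ, c, τ)) := by
  rw [pairExp, mpow_add, mpow_nsmul, mpow_nsmul, hα', hβ', ← Complex.exp_nat_mul,
    ← Complex.exp_nat_mul, ← Complex.exp_add, ← Complex.exp_add, ellForm_apply]
  congr 1
  have h1 : ∀ a : ℤ, ((tri a : ℂ)) - tri (-a) = a := fun a => by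
    have h1 := two_mul_tri a
    have h2 := two_mul_tri (-a)
    have : (tri a : ℤ) - tri (-a) = a := by nlinarith
    exact_mod_cast this
  have h2 := h1 ab.1
  have h3 := h1 ab.2
  push_cast
  linear_combination (-(2 * pi * I * ζ)) * (h2 + h3)

lemma hasSum_pairSeries (hα' : mpow x α = exp (-(2 * pi * I * ζ)))
    (hβ' : mpow x β = exp (2 * pi * I * (τ + ζ))) (hτ : 0 < τ.im) (c : ℂ) :
    HasSum (fun ab => pairCoef c ab * mpow x (pairExp α β ab))
      (-(exp (-(2 * pi * I * ζ)) * ellFun ζ c τ)) := by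
  have h := (hasSum_ellFun ζ c hτ).mul_left (exp (-(2 * pi * I * ζ)))
  rw [mul_neg] at h
  refine h.congr_fun fun ab => ?_
  rw [mpow_pairExp hα' hβ' c]; ring

lemma pval_pairSeries (hα : α ≠ 0) (hβ : β ≠ 0)
    (hα' : mpow x α = exp (-(2 * pi * I * ζ)))
    (hβ' : mpow x β = exp (2 * pi * I * (τ + ζ))) (hτ : 0 < τ.im) (c : ℂ) :
    pval x (pairSeries α β c) = -(exp (-(2 * pi * I * ζ)) * ellFun ζ c τ) :=
  pval_famSum (locFin_pair hα hβ c) (hasSum_pairSeries hα' hβ' hτ c)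

lemma wnorm_pairSeries_ne_top (hα : α ≠ 0) (hβ : β ≠ 0)
    (hα' : mpow x α = exp (-(2 * pi * I * ζ)))
    (hβ' : mpow x β = exp (2 * pi * I * (τ + ζ))) (hτ : 0 < τ.im) (c : ℂ) :
    wnorm (fun i => ‖x i‖₊) (pairSeries α β c) ≠ ∞ := by
  refine ne_top_of_le_ne_top ?_ (wnorm_famSum_le (locFin_pair hα hβ c) _)
  refine ENNReal.tsum_coe_ne_top_iff_summable.2 (NNReal.summable_coe.1 ?_)
  refine ((summable_norm_ell ζ c hτ).mul_left
    ‖exp (-(2 * pi * I * ζ))‖).congr fun ab => ?_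
  rw [← nnnorm_mpow, mpow_pairExp hα' hβ' c]
  simp only [norm_mul, NNReal.coe_mul, coe_nnnorm, nnnorm_mul]
  ring

lemma norm_exp_lt_one {z : ℂ} (h : z.re < 0) : ‖exp z‖ < 1 := by
  rw [Complex.norm_exp]; simpa using h

lemma re_two_pi_I_mul (z : ℂ) : (2 * pi * I * z).re = -(2 * pi * z.im) := by
  have : (2 * pi * I * z) = ((2 * pi : ℝ) : ℂ) * (z * I) := by
    push_cast; ring
  rw [this, Complex.re_ofReal_mul, Complex.mul_I_re]; ring

/-- The elliptic interval has no zeros in the annulus `0 < -Im ζ < Im τ`. -/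
lemma ellFun_ne_zero (θ : ℝ) (h1 : 0 < -ζ.im) (h2 : -ζ.im < τ.im) :
    ellFun ζ (Complex.cos θ) τ ≠ 0 := by
  have hτ : 0 < τ.im := h1.trans h2
  have hp := Real.pi_pos
  set α : Fin 2 →₀ ℕ := Finsupp.single 0 1
  set β : Fin 2 →₀ ℕ := Finsupp.single 1 1
  have hα : α ≠ 0 := by simp [α]
  have hβ : β ≠ 0 := by simp [β]
  set x : Fin 2 → ℂ := ![exp (-(2 * pi * I * ζ)),
    exp (2 * pi * I * (τ + ζ))]
  have hα' : mpow x α = exp (-(2 * pi * I * ζ)) := by simp [mpow, α, x]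
  have hβ' : mpow x β = exp (2 * pi * I * (τ + ζ)) := by simp [mpow, β, x]
  have hrα : mpow (fun i => ‖x i‖₊) α < 1 := by
    rw [← nnnorm_mpow, hα', ← NNReal.coe_lt_coe, coe_nnnorm]
    refine norm_exp_lt_one ?_
    rw [Complex.neg_re, re_two_pi_I_mul]
    nlinarith
  have hrβ : mpow (fun i => ‖x i‖₊) β < 1 := by
    rw [← nnnorm_mpow, hβ', ← NNReal.coe_lt_coe, coe_nnnorm]
    refine norm_exp_lt_one ?_
    rw [re_two_pi_I_mul, Complex.add_im]
    nlinarith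
  have h3 := pval_mul (wnorm_pairSeries_ne_top hα hβ hα' hβ' hτ (Complex.cos θ))
    (wnorm_inv_pairSeries_ne_top hα hβ θ hrα hrβ)
  rw [MvPowerSeries.mul_invOfUnit _ _ (by simpa using constantCoeff_pairSeries hα hβ _), pval_one,
    pval_pairSeries hα hβ hα' hβ' hτ] at h3
  intro h
  rw [h] at h3
  simp at h3

end Values

/-! ### The elliptic interval and the Jacobi theta function -/

lemma neg_exp (z : ℂ) : -exp z = exp (z - pi * I) := by
  rw [Complex.exp_sub, Complex.exp_pi_mul_I, div_neg, div_one]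

lemma theta11_add_one (ζ τ : ℂ) : theta11 (ζ + 1) τ = -theta11 ζ τ := by
  have e1 : ζ + 1 + 1 / 2 + τ / 2 = ζ + 1 / 2 + τ / 2 + 1 := by ring
  have e2 : pi * I * τ / 4 + pi * I * (ζ + 1 + 1 / 2) =
    (pi * I * τ / 4 + pi * I * (ζ + 1 / 2)) + pi * I := by ring
  rw [theta11, theta11, e1, jacobiTheta₂_add_left, e2, Complex.exp_add, Complex.exp_pi_mul_I]
  ring

lemma theta11_add_tau (ζ τ : ℂ) : theta11 (ζ + τ) τ =
    -(exp (-(pi * I * τ) - 2 * pi * I * ζ) * theta11 ζ τ) := by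
  have e1 : ζ + τ + 1 / 2 + τ / 2 = ζ + 1 / 2 + τ / 2 + τ := by ring
  rw [theta11, theta11, e1, jacobiTheta₂_add_left', ← mul_assoc, ← mul_assoc, ← neg_mul,
    ← Complex.exp_add, ← Complex.exp_add]
  congr 1
  rw [neg_exp]
  congr 1
  ring

lemma theta11_neg (ζ τ : ℂ) : theta11 (-ζ) τ = -theta11 ζ τ := by
  have e1 : -ζ + 1 / 2 + τ / 2 = -(ζ + 1 / 2 + τ / 2) + 1 + τ := by ring
  rw [theta11, theta11, e1, jacobiTheta₂_add_left', jacobiTheta₂_add_left, jacobiTheta₂_neg_left,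
    ← mul_assoc, ← Complex.exp_add, ← neg_mul]
  congr 1
  rw [neg_exp]
  congr 1
  ring

lemma hasSum_theta11 (ζ : ℂ) {τ : ℂ} (hτ : 0 < τ.im) :
    HasSum (fun a : ℤ => exp (pi * I * τ / 4 +
      pi * I * (ζ + 1 / 2)) * jacobiTheta₂_term (-a) (ζ + 1 / 2 + τ / 2) τ)
      (theta11 ζ τ) :=
  ((Equiv.neg ℤ).hasSum_iff.2 (hasSum_jacobiTheta₂_term _ hτ)).mul_left _

variable {D : ℕ}

lemma dot_coord (u v : UnitSphere D) : dot (coord u) (coord v) =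
    ((⟪(u : EuclideanSpace ℝ (Fin D)), (v : EuclideanSpace ℝ (Fin D))⟫_ℝ : ℝ) : ℂ) := by
  simp only [dot, coord, PiLp.inner_apply, RCLike.inner_apply, conj_trivial]
  push_cast
  exact sum_congr rfl fun _ _ => mul_comm _ _

lemma dot_coord_eq_cos (u v : UnitSphere D) : dot (coord u) (coord v) = Complex.cos
    ((Real.arccos ⟪(u : EuclideanSpace ℝ (Fin D)), (v : EuclideanSpace ℝ (Fin D))⟫_ℝ : ℝ) : ℂ) := by
  have h := abs_real_inner_le_norm (u : EuclideanSpace ℝ (Fin D)) (v : EuclideanSpace ℝ (Fin D))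
  rw [norm_eq_of_mem_sphere, norm_eq_of_mem_sphere, one_mul, abs_le] at h
  rw [dot_coord, ← Complex.ofReal_cos, Real.cos_arccos h.1 h.2]

lemma theta11_term_mul (ζ α τ : ℂ) (ab : ℤ × ℤ) :
    exp (-(pi * I * τ / 2)) *
      (exp (pi * I * τ / 4 + pi * I * (ζ + α + 1 / 2)) *
        jacobiTheta₂_term (-ab.1) (ζ + α + 1 / 2 + τ / 2) τ *
      (exp (pi * I * τ / 4 + pi * I * (ζ - α + 1 / 2)) *
        jacobiTheta₂_term (-ab.2) (ζ - α + 1 / 2 + τ / 2) τ)) =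
      -((-1) ^ (ab.1 + ab.2).natAbs *
        exp (2 * pi * α * I) ^ (-(ab.1 - ab.2)) *
        exp (ellForm ab (ζ, 0, τ))) := by
  have hsg : (-1 : ℂ) ^ (ab.1 + ab.2).natAbs =
      exp (-((ab.1 + ab.2 : ℤ) : ℂ) * (pi * I)) := by
    rw [neg_mul, Complex.exp_neg, Complex.exp_int_mul, Complex.exp_pi_mul_I]
    rcases Int.even_or_odd (ab.1 + ab.2) with h | h
    · rw [Even.neg_one_pow (Int.natAbs_even.2 h), Even.neg_one_zpow h, inv_one]
    · rw [Odd.neg_one_pow (Int.natAbs_odd.2 h), Odd.neg_one_zpow h]; norm_num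
  have hneg : ∀ z : ℂ, -z = exp (pi * I) * z := fun z => by
    rw [Complex.exp_pi_mul_I]; ring
  refine Eq.trans ?_ (hneg _).symm
  rw [hsg, ← Complex.exp_int_mul, jacobiTheta₂_term, jacobiTheta₂_term]
  simp only [← Complex.exp_add]
  congr 1
  rw [ellForm_apply]
  have t1 : (2 * (tri (-ab.1) : ℂ)) = (-ab.1 * (-ab.1 + 1)) := by exact_mod_cast two_mul_tri (-ab.1)
  have t2 : (2 * (tri (-ab.2) : ℂ)) = (-ab.2 * (-ab.2 + 1)) := by exact_mod_cast two_mul_tri (-ab.2)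
  push_cast
  linear_combination (-(pi * I * τ)) * (t1 + t2)

lemma hasSum_mul_complex {f g : ℤ → ℂ} {a b : ℂ} (hf : HasSum f a) (hg : HasSum g b) :
    HasSum (fun ab : ℤ × ℤ => f ab.1 * g ab.2) (a * b) :=
  hf.mul hg (summable_mul_of_summable_norm hf.summable.norm hg.summable.norm)

lemma exp_theta11_mul (ζ α : ℂ) {τ : ℂ} (hτ : 0 < τ.im) :
    exp (-(pi * I * τ / 2)) * theta11 (ζ + α) τ * theta11 (ζ - α) τ =
      ellFun ζ (Complex.cos (2 * pi * α)) τ := by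
  have h0 := hasSum_mul_complex (hasSum_theta11 (ζ + α) hτ) (hasSum_theta11 (ζ - α) hτ)
  have h1 : HasSum (fun ab : ℤ × ℤ => -((-1) ^ (ab.1 + ab.2).natAbs *
        exp (2 * pi * α * I) ^ (-(ab.1 - ab.2)) *
        exp (ellForm ab (ζ, 0, τ))))
      (exp (-(pi * I * τ / 2)) *
        (theta11 (ζ + α) τ * theta11 (ζ - α) τ)) :=
    (h0.mul_left _).congr_fun fun ab => (theta11_term_mul ζ α τ ab).symm
  have h2 := (Equiv.prodComm ℤ ℤ).hasSum_iff.2 h1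
  have h4 := (hasSum_ellFun ζ (Complex.cos (2 * pi * α)) hτ).mul_left (-2)
  have h5 := (h1.add h2).unique (h4.congr_fun fun ab => by
    have hc := chebyshev_cos (ab.1 - ab.2) (2 * pi * α)
    have hf : ellForm ab.swap = ellForm ab := by
      rw [ellForm, ellForm, Prod.fst_swap, Prod.snd_swap, add_comm (tri (-ab.2)),
        show (1 - ab.2 - ab.1 : ℤ) = 1 - ab.1 - ab.2 by ring]
    have hg : ellForm ab (ζ, Complex.cos (2 * pi * α), τ) = ellForm ab (ζ, 0, τ) := rfl
    simp only [comp_apply, Equiv.prodComm_apply, Prod.fst_swap, Prod.snd_swap, hf, hg]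
    rw [add_comm ab.2, pairCoef]
    rw [neg_sub, neg_sub]
    rw [neg_sub] at hc
    linear_combination ((-1) ^ (ab.1 + ab.2).natAbs * exp (ellForm ab (ζ, 0, τ))) * hc)
  rw [mul_assoc]
  apply mul_left_cancel₀ (two_ne_zero (α := ℂ))
  linear_combination h5

/-- The product of the two theta series, symmetrized in the summation variables: the phases in `α`
become Chebyshev polynomials of `u · v`. -/
lemma ellInterval_eq_ellFun (ζ : ℂ) (u v : UnitSphere D) {τ : ℂ} (hτ : 0 < τ.im) :
    ellInterval ζ u v τ = ellFun ζ (dot (coord u) (coord v)) τ := by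
  have hpi : (pi : ℂ) ≠ 0 := by exact_mod_cast Real.pi_ne_zero
  rw [dot_coord_eq_cos]
  refine (exp_theta11_mul ζ _ hτ).trans ?_
  congr 2
  push_cast
  field_simp

/-! ### Gap variables -/

section Gaps

/-- Families of charges: `κ` belongs to the monomial `e^{πi ∑ κ_k ζ_k}`. -/
abbrev Charges (m : ℕ) : Type := Fin (m + 1) → ℤ

variable {m : ℕ}

/-- The charges `κ_k = e_k - e_{k+1}` (cyclically) of a monomial in the gap variables: the gap
variable number `k` stands for `e^{πi(ζ_k - ζ_{k-1})}`, and for `e^{πi(τ + ζ_0 - ζ_m)}` if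
`k = 0`. -/
def charge (e : Fin (m + 1) →₀ ℕ) : Charges m := fun k => (e k : ℤ) - e (k + 1)

lemma charge_add (e e' : Fin (m + 1) →₀ ℕ) : charge (e + e') = charge e + charge e' := by
  ext k; simp [charge]; ring

lemma charge_nsmul (i : ℕ) (e : Fin (m + 1) →₀ ℕ) : charge (i • e) = i • charge e := by
  ext k; simp [charge]; ring

lemma charge_zero : charge (0 : Fin (m + 1) →₀ ℕ) = 0 := by ext k; simp [charge]

lemma sum_charge (e : Fin (m + 1) →₀ ℕ) : ∑ k, charge e k = 0 := by
  simp only [charge, sum_sub_distrib]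
  rw [sub_eq_zero]
  exact (Equiv.sum_comp (Equiv.addRight (1 : Fin (m + 1))) fun k => (e k : ℤ)).symm

lemma eq_of_charge {e e' : Fin (m + 1) →₀ ℕ} (h : charge e = charge e') (h0 : e 0 = e' 0) :
    e = e' := by
  ext k
  induction k using Fin.induction with
  | zero => exact h0
  | succ k ih =>
    have := congrFun h k.castSucc
    simp only [charge, Fin.coeSucc_eq_succ] at this
    omega

open Classical in
/-- A power series in the gap variables, written as a series in the `e^{πiζ_k}` with coefficients
power series in `q^{1/2}`. -/
def toThermal {R : Type*} [CommRing R] (f : MvPowerSeries (Fin (m + 1)) R) :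
    Charges m → PowerSeries R := fun κ =>
  PowerSeries.mk fun j => if h : ∃ e, charge e = κ ∧ e 0 = j then coeff h.choose f else 0

section toThermal

variable {R : Type*} [CommRing R]

lemma coeff_toThermal (f : MvPowerSeries (Fin (m + 1)) R) {κ : Charges m} {j : ℕ}
    {e : Fin (m + 1) →₀ ℕ} (h1 : charge e = κ) (h2 : e 0 = j) :
    PowerSeries.coeff j (toThermal f κ) = coeff e f := by
  classical
  have h : ∃ e, charge e = κ ∧ e 0 = j := ⟨e, h1, h2⟩
  rw [toThermal, coeff_mk, dif_pos h]
  have := h.choose_spec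
  rw [eq_of_charge (this.1.trans h1.symm) (this.2.trans h2.symm)]

lemma coeff_toThermal_eq_zero (f : MvPowerSeries (Fin (m + 1)) R) {κ : Charges m} {j : ℕ}
    (h : ∀ e, charge e = κ → e 0 ≠ j) : PowerSeries.coeff j (toThermal f κ) = 0 := by
  classical
  rw [toThermal, coeff_mk, dif_neg]
  rintro ⟨e, h1, h2⟩
  exact h e h1 h2

lemma coeff_toThermal_ne_zero {f : MvPowerSeries (Fin (m + 1)) R} {κ : Charges m} {j : ℕ}
    (h : PowerSeries.coeff j (toThermal f κ) ≠ 0) :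
    ∃ e, charge e = κ ∧ e 0 = j ∧ PowerSeries.coeff j (toThermal f κ) = coeff e f := by
  by_contra hne
  refine h (coeff_toThermal_eq_zero f fun e h1 h2 => hne ⟨e, h1, h2, coeff_toThermal f h1 h2⟩)

lemma map_toThermal {S : Type*} [CommRing S] (φ : R →+* S) (f : MvPowerSeries (Fin (m + 1)) R)
    (κ : Charges m) :
    PowerSeries.map φ (toThermal f κ) = toThermal (MvPowerSeries.map φ f) κ := by
  ext j
  rw [PowerSeries.coeff_map]
  by_cases h : ∃ e, charge e = κ ∧ e 0 = j
  · obtain ⟨e, h1, h2⟩ := h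
    rw [coeff_toThermal _ h1 h2, coeff_toThermal _ h1 h2, MvPowerSeries.coeff_map]
  · have h' : ∀ e, charge e = κ → e 0 ≠ j := fun e h1 h2 => h ⟨e, h1, h2⟩
    rw [coeff_toThermal_eq_zero _ h', coeff_toThermal_eq_zero _ h', map_zero]

lemma toThermal_sum {α : Type*} (s : Finset α) (F : α → MvPowerSeries (Fin (m + 1)) R)
    (κ : Charges m) : toThermal (∑ a ∈ s, F a) κ = ∑ a ∈ s, toThermal (F a) κ := by
  ext j
  rw [map_sum]
  by_cases h : ∃ e, charge e = κ ∧ e 0 = j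
  · obtain ⟨e, h1, h2⟩ := h
    simp_rw [coeff_toThermal _ h1 h2, map_sum]
  · have h' : ∀ e, charge e = κ → e 0 ≠ j := fun e h1 h2 => h ⟨e, h1, h2⟩
    simp_rw [coeff_toThermal_eq_zero _ h']; simp

/-- The exponent of `q^{1/2}`, the product of all gap variables. -/
def allOne : Fin (m + 1) →₀ ℕ := Finsupp.equivFunOnFinite.symm fun _ => 1

@[simp] lemma allOne_apply (k : Fin (m + 1)) : (allOne : Fin (m + 1) →₀ ℕ) k = 1 := rfl

lemma charge_allOne : charge (allOne : Fin (m + 1) →₀ ℕ) = 0 := by ext k; simp [charge]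

lemma degree_nsmul_allOne (i : ℕ) : i ≤ (i • (allOne : Fin (m + 1) →₀ ℕ)).degree := by
  have : (allOne : Fin (m + 1) →₀ ℕ) ≠ 0 := fun h => by
    have := DFunLike.congr_fun h 0; simp at this
  have := one_le_degree this
  rw [map_nsmul, smul_eq_mul]; nlinarith

/-- A power series in `q^{1/2}` as a series in the gap variables. -/
def ofNome (g : PowerSeries R) : MvPowerSeries (Fin (m + 1)) R :=
  famSum (fun i : ℕ => PowerSeries.coeff i g) fun i => i • allOne

open Classical in
lemma coeff_ofNome_mul (g : PowerSeries R) (f : MvPowerSeries (Fin (m + 1)) R)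
    (e : Fin (m + 1) →₀ ℕ) : coeff e (ofNome g * f) = ∑ i ∈ range (e 0 + 1),
      if i • allOne ≤ e then PowerSeries.coeff i g * coeff (e - i • allOne) f else 0 := by
  have h1 : CongrLT (e.degree + 1) (ofNome g : MvPowerSeries (Fin (m + 1)) R) _ :=
    famSum_congr (range (e.degree + 1)) fun i _ hi =>
      mem_range.2 ((degree_nsmul_allOne i).trans_lt hi)
  rw [(h1.mul (.refl _ f)) e (by omega), sum_mul, map_sum]
  simp_rw [MvPowerSeries.coeff_monomial_mul]
  refine (Finset.sum_subset (fun i hi => ?_) fun i _ hi => if_neg fun h => ?_).symm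
  · have : e 0 ≤ e.degree := Finsupp.le_degree 0 e
    simp only [mem_range] at hi ⊢; omega
  · have := h 0
    simp at this hi; omega

lemma toThermal_ofNome_mul (g : PowerSeries R) (f : MvPowerSeries (Fin (m + 1)) R)
    (κ : Charges m) : toThermal (ofNome g * f) κ = g * toThermal f κ := by
  classical
  ext j
  rw [PowerSeries.coeff_mul, Finset.Nat.sum_antidiagonal_eq_sum_range_succ_mk]
  by_cases h : ∃ e, charge e = κ ∧ e 0 = j
  · obtain ⟨e, h1, h2⟩ := h
    rw [coeff_toThermal _ h1 h2, coeff_ofNome_mul, h2]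
    refine sum_congr rfl fun i hi => ?_
    rw [mem_range] at hi
    split_ifs with hle
    · rw [coeff_toThermal f (e := e - i • allOne)]
      · have h3 : charge (e - i • allOne + i • allOne) = charge e := by
          rw [tsub_add_cancel_of_le hle]
        rw [charge_add, charge_nsmul, charge_allOne, smul_zero, add_zero] at h3
        rw [h3, h1]
      · simp [h2]
    · rw [coeff_toThermal_eq_zero, mul_zero]
      intro e' h3 h4
      refine hle ?_
      have : e' + i • allOne = e := eq_of_charge (by
        rw [charge_add, charge_nsmul, charge_allOne, smul_zero, add_zero, h3, h1]) (by
        simp [h4, h2]; omega)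
      rw [← this]; exact le_add_self
  · have h' : ∀ e, charge e = κ → e 0 ≠ j := fun e h1 h2 => h ⟨e, h1, h2⟩
    rw [coeff_toThermal_eq_zero _ h']
    refine (sum_eq_zero fun i hi => ?_).symm
    rw [coeff_toThermal_eq_zero, mul_zero]
    intro e' h3 h4
    refine h' (e' + i • allOne) (by
      rw [charge_add, charge_nsmul, charge_allOne, smul_zero, add_zero, h3]) ?_
    rw [mem_range] at hi
    simp [h4]; omega

lemma toThermal_C_mul (x : R)
    (f : MvPowerSeries (Fin (m + 1)) R) (κ : Charges m) :
    toThermal (MvPowerSeries.C x * f) κ = PowerSeries.C x * toThermal f κ := by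
  ext j
  rw [PowerSeries.coeff_C_mul, toThermal, toThermal, coeff_mk, coeff_mk]
  split_ifs
  · exact MvPowerSeries.coeff_C_mul ..
  · rw [mul_zero]

end toThermal

/-! ### Values of series in the gap variables -/

/-- The values of the gap variables. -/
def gapPoint (ζ : Fin (m + 1) → ℂ) (τ : ℂ) (k : Fin (m + 1)) : ℂ :=
  exp (pi * I * (ζ k - ζ (k - 1) + if k = 0 then τ else 0))

lemma mpow_gapPoint (ζ : Fin (m + 1) → ℂ) (τ : ℂ) (e : Fin (m + 1) →₀ ℕ) :
    mpow (gapPoint ζ τ) e =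
      exp (pi * I * (e 0 * τ + ∑ k, (charge e k : ℂ) * ζ k)) := by
  rw [mpow_eq_prod]
  simp only [gapPoint, ← Complex.exp_nat_mul]
  rw [← Complex.exp_sum]
  congr 1
  have h1 : ∑ k, (e k : ℂ) * ζ (k - 1) = ∑ k, (e (k + 1) : ℂ) * ζ k := by
    rw [← Equiv.sum_comp (Equiv.addRight (1 : Fin (m + 1)))]
    simp
  have h2 : ∑ k, (e k : ℂ) * (if k = 0 then τ else 0) = e 0 * τ := by simp
  have h3 : ∑ k, (charge e k : ℂ) * ζ k = ∑ k, (e k : ℂ) * ζ k - ∑ k, (e k : ℂ) * ζ (k - 1) := by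
    rw [h1, ← sum_sub_distrib]
    refine sum_congr rfl fun k _ => ?_
    simp [charge]; ring
  rw [h3, ← h2, ← sum_sub_distrib, ← sum_add_distrib, mul_sum]
  exact sum_congr rfl fun k _ => by ring

lemma norm_gapPoint_lt_one {ζ : Fin (m + 1) → ℂ} {τ : ℂ} (h : (ζ, τ) ∈ convDomain (m + 1))
    (k : Fin (m + 1)) : ‖gapPoint ζ τ k‖ < 1 := by
  have hp := Real.pi_pos
  have key : ∀ z : ℂ, 0 < z.im → ‖exp (pi * I * z)‖ < 1 := fun z hz => by
    refine norm_exp_lt_one ?_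
    have : (pi * I * z) = (pi : ℂ) * (z * I) := by ring
    rw [this, Complex.re_ofReal_mul, Complex.mul_I_re]
    nlinarith
  refine key _ ?_
  induction k using Fin.cases with
  | zero =>
    rw [if_pos rfl, zero_sub]
    rcases Nat.eq_zero_or_pos m with rfl | hm
    · have : (-1 : Fin 1) = 0 := Subsingleton.elim _ _
      rw [this, sub_self, zero_add]; exact h.1
    · have hl : (-1 : Fin (m + 1)) = Fin.last m := by
        exact neg_eq_of_add_eq_zero_left (Fin.last_add_one m)
      have := h.2 0 (Fin.last m) (by rw [Fin.lt_def]; simpa using hm)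
      rw [hl]
      simp only [Complex.add_im, Complex.sub_im] at this ⊢
      linarith [this.2]
  | succ k =>
    have h1 : k.succ - 1 = k.castSucc := by
      rw [← Fin.coeSucc_eq_succ]; exact add_sub_cancel_right _ _
    have := h.2 k.castSucc k.succ (Fin.castSucc_lt_succ)
    rw [h1, if_neg (Fin.succ_ne_zero k), add_zero]
    simp only [Complex.sub_im] at this ⊢
    linarith [this.1]

lemma hasSum_toThermal {ζ : Fin (m + 1) → ℂ} {τ : ℂ} {f : MvPowerSeries (Fin (m + 1)) ℂ}
    (h : wnorm (fun i => ‖gapPoint ζ τ i‖₊) f ≠ ∞) :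
    HasSum (fun x : ℕ × (Charges m) => PowerSeries.coeff x.1 (toThermal f x.2) *
        exp (pi * I * (x.1 * τ + ∑ k, (x.2 k : ℂ) * ζ k)))
      (pval (gapPoint ζ τ) f) := by
  have hi : Function.Injective fun e : Fin (m + 1) →₀ ℕ => (e 0, charge e) := fun e e' h =>
    eq_of_charge (Prod.mk.inj h).2 (Prod.mk.inj h).1
  refine (hi.hasSum_iff fun x hx => ?_).1 ((hasSum_pval h).congr_fun fun e => ?_)
  · rw [coeff_toThermal_eq_zero, zero_mul]
    intro e h1 h2
    exact hx ⟨e, Prod.ext h2 h1⟩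
  · rw [mpow_gapPoint, comp_apply, coeff_toThermal f rfl rfl]

/-! ### The product of the elliptic intervals as a power series in the gap variables -/

/-- The exponent of `e^{-2πi(ζ_j - ζ_k)}`. -/
def arcExp (j k : Fin (m + 1)) : Fin (m + 1) →₀ ℕ :=
  Finsupp.equivFunOnFinite.symm fun l => if j < l ∧ l ≤ k then 2 else 0

/-- The exponent of `e^{2πi(τ + ζ_j - ζ_k)}`. -/
def coarcExp (j k : Fin (m + 1)) : Fin (m + 1) →₀ ℕ :=
  Finsupp.equivFunOnFinite.symm fun l => if j < l ∧ l ≤ k then 0 else 2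

lemma arcExp_apply (j k l : Fin (m + 1)) : arcExp j k l = if j < l ∧ l ≤ k then 2 else 0 := rfl

lemma coarcExp_apply (j k l : Fin (m + 1)) :
    coarcExp j k l = if j < l ∧ l ≤ k then 0 else 2 := rfl

lemma arc_add_coarc (j k : Fin (m + 1)) : arcExp j k + coarcExp j k = 2 • allOne := by
  ext l
  simp only [Finsupp.add_apply, arcExp_apply, coarcExp_apply, Finsupp.smul_apply, allOne_apply]
  split_ifs <;> rfl

lemma arcExp_zero (j k : Fin (m + 1)) : arcExp j k 0 = 0 := by
  rw [arcExp_apply, if_neg]; simp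

lemma coarcExp_zero (j k : Fin (m + 1)) : coarcExp j k 0 = 2 := by
  rw [coarcExp_apply, if_neg]; simp

lemma arcExp_ne_zero {j k : Fin (m + 1)} (h : j < k) : arcExp j k ≠ 0 := fun h0 => by
  have := DFunLike.congr_fun h0 k
  simp [arcExp_apply, h] at this

lemma coarcExp_ne_zero (j k : Fin (m + 1)) : coarcExp j k ≠ 0 := fun h0 => by
  have := DFunLike.congr_fun h0 0
  simp [coarcExp_zero] at this

lemma charge_arcExp {j k : Fin (m + 1)} (h : j < k) :
    charge (arcExp j k) = Pi.single k 2 - Pi.single j 2 := by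
  ext l
  simp only [charge, arcExp_apply, Pi.sub_apply, Pi.single_apply]
  induction l using Fin.lastCases with
  | last =>
    rw [Fin.last_add_one]
    simp only [Fin.not_lt_zero, false_and, if_false]
    have h1 : j < Fin.last m := h.trans_le (Fin.le_last k)
    simp only [h1, true_and, h1.ne', if_false]
    rcases eq_or_ne k (Fin.last m) with rfl | hk
    · simp
    · rw [if_neg (fun h2 => hk (Fin.last_le_iff.1 h2)), if_neg hk.symm]; simp
  | cast l =>
    rw [Fin.coeSucc_eq_succ]
    simp only [Fin.lt_def, Fin.le_def, Fin.ext_iff, Fin.val_succ, Fin.val_castSucc] at h ⊢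
    split_ifs <;> omega

lemma charge_coarcExp {j k : Fin (m + 1)} (h : j < k) :
    charge (coarcExp j k) = Pi.single j 2 - Pi.single k 2 := by
  have h1 := congrArg charge (arc_add_coarc j k)
  rw [charge_add, charge_nsmul, charge_allOne, smul_zero, charge_arcExp h] at h1
  rw [← neg_sub (Pi.single k 2 : Charges m)]
  exact eq_neg_of_add_eq_zero_right h1

lemma mpow_arcExp (ζ : Fin (m + 1) → ℂ) (τ : ℂ) {j k : Fin (m + 1)} (h : j < k) :
    mpow (gapPoint ζ τ) (arcExp j k) =
      exp (-(2 * pi * I * (ζ j - ζ k))) := by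
  rw [mpow_gapPoint, arcExp_zero, charge_arcExp h]
  congr 1
  simp only [Pi.sub_apply, Pi.single_apply, Int.cast_sub, Int.cast_ite, Int.cast_ofNat,
    Int.cast_zero, sub_mul, ite_mul, zero_mul, sum_sub_distrib, Finset.sum_ite_eq',
    mem_univ, if_true, Nat.cast_zero]
  ring

lemma mpow_coarcExp (ζ : Fin (m + 1) → ℂ) (τ : ℂ) {j k : Fin (m + 1)} (h : j < k) :
    mpow (gapPoint ζ τ) (coarcExp j k) =
      exp (2 * pi * I * (τ + (ζ j - ζ k))) := by
  rw [mpow_gapPoint, coarcExp_zero, charge_coarcExp h]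
  congr 1
  simp only [Pi.sub_apply, Pi.single_apply, Int.cast_sub, Int.cast_ite, Int.cast_ofNat,
    Int.cast_zero, sub_mul, ite_mul, zero_mul, sum_sub_distrib, Finset.sum_ite_eq',
    mem_univ, if_true, Nat.cast_ofNat]
  ring

variable {R : Type*} [CommRing R]

/-- The product over all pairs of points of the power series of the elliptic intervals, for the
cosines `c j k`. -/
def ellSeries (c : Fin (m + 1) → Fin (m + 1) → R) : MvPowerSeries (Fin (m + 1)) R :=
  ∏ j, ∏ k, if j < k then pairSeries (arcExp j k) (coarcExp j k) (c j k) else 1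

/-- The inverse of `ellSeries`. -/
def ellInv (c : Fin (m + 1) → Fin (m + 1) → R) : MvPowerSeries (Fin (m + 1)) R :=
  ∏ j, ∏ k, if j < k then (pairSeries (arcExp j k) (coarcExp j k) (c j k)).invOfUnit 1 else 1

lemma pairSeries_mul_inv {j k : Fin (m + 1)} (h : j < k) (c : R) :
    pairSeries (arcExp j k) (coarcExp j k) c *
      (pairSeries (arcExp j k) (coarcExp j k) c).invOfUnit 1 = 1 :=
  MvPowerSeries.mul_invOfUnit _ _ (by
    simpa using constantCoeff_pairSeries (arcExp_ne_zero h) (coarcExp_ne_zero j k) c)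

lemma ellSeries_mul_ellInv (c : Fin (m + 1) → Fin (m + 1) → R) :
    ellSeries c * ellInv c = 1 := by
  rw [ellSeries, ellInv, ← prod_mul_distrib]
  refine prod_eq_one fun j _ => ?_
  rw [← prod_mul_distrib]
  refine prod_eq_one fun k _ => ?_
  split_ifs with h
  · exact pairSeries_mul_inv h _
  · exact one_mul 1

lemma map_ellSeries {S : Type*} [CommRing S] (φ : R →+* S) (c : Fin (m + 1) → Fin (m + 1) → R) :
    MvPowerSeries.map φ (ellSeries c) = ellSeries fun j k => φ (c j k) := by
  rw [ellSeries, map_prod, ellSeries]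
  refine prod_congr rfl fun j _ => ?_
  rw [map_prod]
  refine prod_congr rfl fun k _ => ?_
  split_ifs with h
  · exact map_pairSeries φ (arcExp_ne_zero h) (coarcExp_ne_zero j k) _
  · exact map_one _

lemma map_ellInv {S : Type*} [CommRing S] (φ : R →+* S) (c : Fin (m + 1) → Fin (m + 1) → R) :
    MvPowerSeries.map φ (ellInv c) = ellInv fun j k => φ (c j k) := by
  have h1 := congrArg (MvPowerSeries.map φ) (ellSeries_mul_ellInv c)
  rw [map_mul, map_one, map_ellSeries] at h1
  have h2 := ellSeries_mul_ellInv fun j k => φ (c j k)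
  calc _ = ellSeries (fun j k => φ (c j k)) * ellInv (fun j k => φ (c j k)) *
        MvPowerSeries.map φ (ellInv c) := by rw [h2, one_mul]
    _ = ellSeries (fun j k => φ (c j k)) * MvPowerSeries.map φ (ellInv c) *
        ellInv fun j k => φ (c j k) := by ring
    _ = _ := by rw [h1, one_mul]

/-- The exponent of the monomial by which `ellSeries` differs from the product of the elliptic
intervals. -/
def arcsExp (m : ℕ) : Fin (m + 1) →₀ ℕ := ∑ j, ∑ k, if j < k then arcExp j k else 0

variable {D : ℕ}

/-- The cosines of the angles between the points. -/
def cosines (u : Fin (m + 1) → UnitSphere D) (j k : Fin (m + 1)) : ℂ :=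
  dot (coord (u j)) (coord (u k))

lemma cosines_comm (u : Fin (m + 1) → UnitSphere D) (j k : Fin (m + 1)) :
    cosines u j k = cosines u k j := by
  rw [cosines, cosines, dot, dot]; exact sum_congr rfl fun _ _ => mul_comm _ _

lemma pval_ellSeries (u : Fin (m + 1) → UnitSphere D) (ζ : Fin (m + 1) → ℂ) {τ : ℂ}
    (hτ : 0 < τ.im) :
    wnorm (fun i => ‖gapPoint ζ τ i‖₊) (ellSeries (cosines u)) ≠ ∞ ∧
    pval (gapPoint ζ τ) (ellSeries (cosines u)) = mpow (gapPoint ζ τ) (arcsExp m) *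
      ∏ j, ∏ k, (if j < k then -ellInterval (ζ j - ζ k) (u j) (u k) τ else 1) := by
  have hw : ∀ j k : Fin (m + 1), wnorm (fun i => ‖gapPoint ζ τ i‖₊)
      (if j < k then pairSeries (arcExp j k) (coarcExp j k) (cosines u j k) else 1) ≠ ∞ := by
    intro j k
    split_ifs with h
    · exact wnorm_pairSeries_ne_top (arcExp_ne_zero h) (coarcExp_ne_zero j k) (mpow_arcExp ζ τ h)
        (mpow_coarcExp ζ τ h) hτ _
    · rw [wnorm_one]; simp
  refine ⟨wnorm_prod_ne_top fun j _ => wnorm_prod_ne_top fun k _ => hw j k, ?_⟩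
  have hm : mpow (gapPoint ζ τ) (arcsExp m) =
      ∏ j, ∏ k, if j < k then mpow (gapPoint ζ τ) (arcExp j k) else 1 := by
    let F : Multiplicative (Fin (m + 1) →₀ ℕ) →* ℂ :=
      { toFun := fun e => mpow (gapPoint ζ τ) e.toAdd
        map_one' := mpow_zero _
        map_mul' := fun a b => mpow_add _ _ _ }
    have h1 : ∀ e, mpow (gapPoint ζ τ) e = F (Multiplicative.ofAdd e) := fun e => rfl
    rw [h1, arcsExp, ofAdd_sum, map_prod]
    refine prod_congr rfl fun j _ => ?_
    rw [ofAdd_sum, map_prod]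
    refine prod_congr rfl fun k _ => ?_
    rw [← h1]
    split_ifs <;> simp
  rw [ellSeries, pval_prod fun j _ => wnorm_prod_ne_top fun k _ => hw j k, hm,
    ← prod_mul_distrib]
  refine prod_congr rfl fun j _ => ?_
  rw [pval_prod fun k _ => hw j k, ← prod_mul_distrib]
  refine prod_congr rfl fun k _ => ?_
  split_ifs with h
  · rw [pval_pairSeries (arcExp_ne_zero h) (coarcExp_ne_zero j k) (mpow_arcExp ζ τ h)
        (mpow_coarcExp ζ τ h) hτ, mpow_arcExp ζ τ h, ellInterval_eq_ellFun _ _ _ hτ, cosines]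
    ring
  · rw [pval_one, one_mul]

lemma mpow_lt_one {r : Fin (m + 1) → ℝ≥0} (hr : ∀ i, r i < 1) {e : Fin (m + 1) →₀ ℕ}
    (he : e ≠ 0) : mpow r e < 1 := by
  rw [mpow_eq_prod]
  obtain ⟨i, hi⟩ := Finsupp.ne_iff.1 he
  rw [← Finset.mul_prod_erase _ _ (mem_univ i)]
  refine mul_lt_one_of_nonneg_of_lt_one_left zero_le (pow_lt_one₀ zero_le (hr i) hi) ?_
  exact Finset.prod_le_one' fun j _ => pow_le_one' (hr j).le _

lemma wnorm_ellInv_ne_top (u : Fin (m + 1) → UnitSphere D) {r : Fin (m + 1) → ℝ≥0}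
    (hr : ∀ i, r i < 1) : wnorm r (ellInv (cosines u)) ≠ ∞ := by
  refine wnorm_prod_ne_top fun j _ => wnorm_prod_ne_top fun k _ => ?_
  split_ifs with h
  · rw [cosines, dot_coord_eq_cos]
    exact wnorm_inv_pairSeries_ne_top (arcExp_ne_zero h) (coarcExp_ne_zero j k) _
      (mpow_lt_one hr (arcExp_ne_zero h)) (mpow_lt_one hr (coarcExp_ne_zero j k))
  · rw [wnorm_one]; simp

/-- In the domain of convergence, the value of `ellInv` is the reciprocal of the product of the
elliptic intervals, up to a sign and a monomial. -/
lemma pval_ellInv (u : Fin (m + 1) → UnitSphere D) {ζ : Fin (m + 1) → ℂ} {τ : ℂ}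
    (h : (ζ, τ) ∈ convDomain (m + 1)) :
    mpow (gapPoint ζ τ) (arcsExp m) *
      (∏ j, ∏ k, (if j < k then -ellInterval (ζ j - ζ k) (u j) (u k) τ else 1)) *
        pval (gapPoint ζ τ) (ellInv (cosines u)) = 1 := by
  have hr : ∀ i, ‖gapPoint ζ τ i‖₊ < 1 := fun i => by
    rw [← NNReal.coe_lt_coe]; exact norm_gapPoint_lt_one h i
  obtain ⟨h1, h2⟩ := pval_ellSeries u ζ h.1
  rw [← h2, ← pval_mul h1 (wnorm_ellInv_ne_top u hr), ellSeries_mul_ellInv, pval_one]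

end Gaps

/-! ### Bounds on the degrees of the coefficients -/

/-- Power series with coefficients in a graded family of subgroups that is closed under products. -/
def coeffIn {σ R : Type*} [CommRing R] (F : (σ →₀ ℕ) → AddSubgroup R) (h1 : (1 : R) ∈ F 0)
    (hmul : ∀ a b x y, x ∈ F a → y ∈ F b → x * y ∈ F (a + b)) :
    Submonoid (MvPowerSeries σ R) where
  carrier := {f | ∀ e, coeff e f ∈ F e}
  one_mem' := fun e => by
    classical
    rw [MvPowerSeries.coeff_one]
    split_ifs with h
    · rw [h]; exact h1
    · exact zero_mem _
  mul_mem' := fun hf hg => coeff_mul_mem F F F hmul hf hg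

section Degrees

variable {D n : ℕ}

/-- Polynomials of degree at most `w k / 2` in the point number `k`. -/
def degLE (w : Fin n → ℕ) : AddSubgroup (PointPoly D n) where
  carrier := {P | ∀ s ∈ P.support, ∀ k, 2 * ∑ α : Fin D, s (k, α) ≤ w k}
  zero_mem' := by simp
  add_mem' := fun {P Q} hP hQ s hs k => by
    classical
    rcases Finset.mem_union.1 (MvPolynomial.support_add hs) with h | h
    · exact hP s h k
    · exact hQ s h k
  neg_mem' := fun {P} hP s hs k => hP s (by simpa using hs) k

lemma mem_degLE {w : Fin n → ℕ} {P : PointPoly D n} :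
    P ∈ degLE w ↔ ∀ s ∈ P.support, ∀ k, 2 * ∑ α : Fin D, s (k, α) ≤ w k := Iff.rfl

lemma degLE_iff_degIn {w : Fin n → ℕ} {P : PointPoly D n} :
    P ∈ degLE w ↔ ∀ k, 2 * degIn k P ≤ w k := by
  rw [mem_degLE]
  constructor
  · intro h k
    have : degIn k P ≤ w k / 2 := Finset.sup_le fun s hs => by have := h s hs k; omega
    omega
  · intro h s hs k
    have : ∑ α : Fin D, s (k, α) ≤ degIn k P :=
      Finset.le_sup (f := fun s : Fin n × Fin D →₀ ℕ => ∑ α : Fin D, s (k, α)) hs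
    have := h k
    omega

lemma degLE_mono {w w' : Fin n → ℕ} (h : w ≤ w') {P : PointPoly D n} (hP : P ∈ degLE w) :
    P ∈ degLE w' := fun s hs k => (hP s hs k).trans (h k)

lemma mul_mem_degLE {w w' : Fin n → ℕ} {P Q : PointPoly D n} (hP : P ∈ degLE w)
    (hQ : Q ∈ degLE w') : P * Q ∈ degLE (w + w') := by
  classical
  intro s hs k
  obtain ⟨a, ha, b, hb, rfl⟩ := Finset.mem_add.1 (MvPolynomial.support_mul P Q hs)
  have h1 := hP a ha k
  have h2 := hQ b hb k
  simp only [Finsupp.add_apply, sum_add_distrib, Pi.add_apply]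
  omega

lemma one_mem_degLE (w : Fin n → ℕ) : (1 : PointPoly D n) ∈ degLE w := by
  classical
  intro s hs k
  have : s = 0 := by
    rw [MvPolynomial.mem_support_iff, MvPolynomial.coeff_one] at hs
    by_contra h
    exact hs (if_neg (Ne.symm h))
  simp [this]

lemma X_mem_degLE (k : Fin n) (α : Fin D) :
    (MvPolynomial.X (k, α) : PointPoly D n) ∈ degLE (Pi.single k 2) := by
  classical
  intro s hs l
  have : s = Finsupp.single (k, α) 1 := by
    rw [MvPolynomial.mem_support_iff, MvPolynomial.coeff_X] at hs
    by_contra h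
    exact hs (if_neg (Ne.symm h))
  rw [this]
  rcases eq_or_ne k l with rfl | h
  · rw [Pi.single_eq_same, Finset.sum_eq_single α]
    · simp
    · intro β _ hβ; simp [hβ.symm]
    · simp
  · rw [sum_eq_zero]
    · simp
    · intro β _; simp [h]

/-- The scalar product of two of the points. -/
def dotPoly (j k : Fin n) : PointPoly D n :=
  ∑ α : Fin D, MvPolynomial.X (j, α) * MvPolynomial.X (k, α)

lemma evalAt_dotPoly (u : Fin n → Fin D → ℂ) (j k : Fin n) :
    evalAt u (dotPoly j k) = dot (u j) (u k) := by
  simp [evalAt, dotPoly, dot, map_sum]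

lemma dotPoly_mem_degLE (j k : Fin n) :
    (dotPoly j k : PointPoly D n) ∈ degLE (Pi.single j 2 + Pi.single k 2) :=
  sum_mem fun α _ => mul_mem_degLE (X_mem_degLE j α) (X_mem_degLE k α)

lemma chebyshev_mem_degLE {w : Fin n → ℕ} {c : PointPoly D n} (hc : c ∈ degLE w) (s : ℤ) :
    (Polynomial.Chebyshev.T _ s).eval c ∈ degLE (s.natAbs • w) := by
  have h : ∀ i : ℕ, (Polynomial.Chebyshev.T _ (i : ℤ)).eval c ∈ degLE (i • w) ∧
      (Polynomial.Chebyshev.T _ ((i + 1 : ℕ) : ℤ)).eval c ∈ degLE ((i + 1) • w) := by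
    intro i
    induction i with
    | zero => exact ⟨by simpa using one_mem_degLE _, by simpa using hc⟩
    | succ i ih =>
      refine ⟨ih.2, ?_⟩
      have h2 : ((i + 1 + 1 : ℕ) : ℤ) = i + 2 := by push_cast; ring
      rw [h2, Polynomial.Chebyshev.T_add_two]
      simp only [Polynomial.eval_sub, Polynomial.eval_mul, Polynomial.eval_ofNat,
        Polynomial.eval_X]
      refine sub_mem ?_ (degLE_mono ?_ ih.1)
      · rw [mul_assoc, ← Nat.cast_ofNat (R := PointPoly D n), ← nsmul_eq_mul]
        refine nsmul_mem ?_ 2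
        have := mul_mem_degLE hc ih.2
        rw [succ_nsmul (n := i + 1), add_comm]
        exact this
      · exact nsmul_le_nsmul_left (zero_le) (by omega)
  have h1 := (h s.natAbs).1
  rcases Int.natAbs_eq s with hs | hs
  · rwa [← hs] at h1
  · rwa [← Polynomial.Chebyshev.T_neg, ← hs] at h1

end Degrees

section DegreesGaps

variable {m D : ℕ}

/-- The bound on the degree in the point number `k` of the coefficient of `x^e`: the two gaps
adjacent to the point contribute. -/
def gapWeight (e : Fin (m + 1) →₀ ℕ) : Fin (m + 1) → ℕ := fun k => e k + e (k + 1)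

lemma gapWeight_add (e e' : Fin (m + 1) →₀ ℕ) :
    gapWeight (e + e') = gapWeight e + gapWeight e' := by
  ext k; simp [gapWeight]; ring

/-- Power series whose coefficients have degrees bounded by `gapWeight`. -/
def degBounded (m D : ℕ) : Submonoid (MvPowerSeries (Fin (m + 1)) (PointPoly D (m + 1))) :=
  coeffIn (fun e => degLE (gapWeight e)) (one_mem_degLE _) fun a b x y hx hy => by
    rw [gapWeight_add]; exact mul_mem_degLE hx hy

/-- The Chebyshev degree of a coefficient of the pair series is bounded by its exponents. -/
lemma gapWeight_pairExp {j k : Fin (m + 1)} (h : j < k) (ab : ℤ × ℤ) :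
    (ab.1 - ab.2).natAbs • (Pi.single j 2 + Pi.single k 2 : Fin (m + 1) → ℕ) ≤
      gapWeight (pairExp (arcExp j k) (coarcExp j k) ab) := by
  have h1 := tri_add_tri_neg ab.1
  have h2 := tri_add_tri_neg ab.2
  have h3 : ((ab.1 - ab.2).natAbs : ℤ) ≤ ab.1 ^ 2 + ab.2 ^ 2 := by
    have e1 : ∀ a : ℤ, |a| ≤ a ^ 2 := fun a => by
      rw [← sq_abs]
      rcases (abs_nonneg a).eq_or_lt with h | h
      · rw [← h]; norm_num
      · nlinarith
    rw [Int.natCast_natAbs]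
    exact (abs_sub _ _).trans (add_le_add (e1 _) (e1 _))
  intro l
  have hb : ∀ l, l = j ∨ l = k → gapWeight (pairExp (arcExp j k) (coarcExp j k) ab) l =
      2 * ((tri ab.1 + tri ab.2) + (tri (-ab.1) + tri (-ab.2))) := by
    intro l hl
    have c1 := congrFun (charge_arcExp h) l
    have c2 := DFunLike.congr_fun (arc_add_coarc j k) l
    have c3 := DFunLike.congr_fun (arc_add_coarc j k) (l + 1)
    simp only [charge, Pi.sub_apply, Finsupp.add_apply, Finsupp.smul_apply, allOne_apply]
      at c1 c2 c3
    have c4 : arcExp j k l + arcExp j k (l + 1) = 2 := by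
      have b1 : arcExp j k l ≤ 2 := by rw [arcExp_apply]; split_ifs <;> omega
      have b2 : arcExp j k (l + 1) ≤ 2 := by rw [arcExp_apply]; split_ifs <;> omega
      rcases hl with rfl | rfl
      · rw [Pi.single_eq_same, Pi.single_eq_of_ne h.ne] at c1; omega
      · rw [Pi.single_eq_same, Pi.single_eq_of_ne h.ne'] at c1; omega
    have c5 : coarcExp j k l + coarcExp j k (l + 1) = 2 := by simp at c2 c3; omega
    simp only [gapWeight, pairExp, Finsupp.add_apply, Finsupp.smul_apply, smul_eq_mul]
    calc _ = (tri ab.1 + tri ab.2) * (arcExp j k l + arcExp j k (l + 1)) +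
          (tri (-ab.1) + tri (-ab.2)) * (coarcExp j k l + coarcExp j k (l + 1)) := by ring
      _ = _ := by rw [c4, c5]; ring
  simp only [Pi.smul_apply, Pi.add_apply, smul_eq_mul]
  rcases eq_or_ne l j with rfl | hj
  · rw [hb l (Or.inl rfl), Pi.single_eq_same, Pi.single_eq_of_ne h.ne]
    zify at h1 h2 h3 ⊢; linarith
  · rcases eq_or_ne l k with rfl | hk
    · rw [hb l (Or.inr rfl), Pi.single_eq_same, Pi.single_eq_of_ne h.ne']
      zify at h1 h2 h3 ⊢; linarith
    · rw [Pi.single_eq_of_ne hj, Pi.single_eq_of_ne hk]; simp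

lemma ellInv_mem_degBounded :
    ellInv (fun j k => dotPoly j k) ∈ degBounded m D := by
  refine prod_mem fun j _ => prod_mem fun k _ => ?_
  split_ifs with h
  · refine coeff_invOfUnit_mem _ (one_mem_degLE _) (fun a b x y hx hy => by
      rw [gapWeight_add]; exact mul_mem_degLE hx hy) fun e => coeff_famSum_mem _ fun ab hab => ?_
    rw [← hab]
    have h1 := degLE_mono (gapWeight_pairExp h ab)
      (chebyshev_mem_degLE (dotPoly_mem_degLE (D := D) j k) (ab.1 - ab.2))
    rw [pairCoef]
    rcases neg_one_pow_eq_or (PointPoly D (m + 1)) (ab.1 + ab.2).natAbs with h2 | h2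
    · rw [h2, one_mul]; exact h1
    · rw [h2, neg_one_mul]; exact neg_mem h1
  · exact one_mem _

/-- The family of coefficient groups of the power series in the squares of the variables. -/
def evenFam {σ : Type*} (R : Type*) [CommRing R] (e : σ →₀ ℕ) : AddSubgroup R where
  carrier := {x | (∀ k, Even (e k)) ∨ x = 0}
  zero_mem' := Or.inr rfl
  add_mem' := fun {x y} hx hy => by
    rcases hx with hx | rfl
    · exact Or.inl hx
    · simpa using hy
  neg_mem' := fun {x} hx => by simpa using hx

lemma mul_mem_evenFam {σ R : Type*} [CommRing R] (a b : σ →₀ ℕ) (x y : R) (hx : x ∈ evenFam R a)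
    (hy : y ∈ evenFam R b) : x * y ∈ evenFam R (a + b) := by
  rcases hx with hx | rfl
  · rcases hy with hy | rfl
    · exact Or.inl fun k => (hx k).add (hy k)
    · exact Or.inr (mul_zero x)
  · exact Or.inr (zero_mul y)

lemma one_mem_evenFam {σ R : Type*} [CommRing R] : (1 : R) ∈ evenFam R (0 : σ →₀ ℕ) :=
  Or.inl fun _ => Even.zero

/-- Power series in the squares of the gap variables. -/
def evenSeries (m : ℕ) (R : Type*) [CommRing R] : Submonoid (MvPowerSeries (Fin (m + 1)) R) :=
  coeffIn (evenFam R) one_mem_evenFam mul_mem_evenFam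

lemma even_of_mem_evenSeries {R : Type*} [CommRing R] {f : MvPowerSeries (Fin (m + 1)) R}
    (hf : f ∈ evenSeries m R) {e : Fin (m + 1) →₀ ℕ} (he : coeff e f ≠ 0) (k : Fin (m + 1)) :
    Even (e k) := by
  rcases hf e with h | h
  · exact h k
  · exact absurd h he

lemma pairSeries_mem_evenSeries {R : Type*} [CommRing R] (j k : Fin (m + 1)) (c : R) :
    pairSeries (arcExp j k) (coarcExp j k) c ∈ evenSeries m R := by
  intro e
  refine coeff_famSum_mem _ fun ab hab => Or.inl fun l => ?_
  rw [← hab]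
  simp only [pairExp, Finsupp.add_apply, Finsupp.smul_apply, arcExp_apply, coarcExp_apply,
    smul_eq_mul]
  split_ifs <;> simp

lemma ellSeries_mem_evenSeries {R : Type*} [CommRing R]
    (c : Fin (m + 1) → Fin (m + 1) → R) : ellSeries c ∈ evenSeries m R := by
  refine prod_mem fun j _ => prod_mem fun k _ => ?_
  split_ifs with h
  · exact pairSeries_mem_evenSeries _ _ _
  · exact one_mem _

lemma ellInv_mem_evenSeries {R : Type*} [CommRing R]
    (c : Fin (m + 1) → Fin (m + 1) → R) : ellInv c ∈ evenSeries m R := by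
  refine prod_mem fun j _ => prod_mem fun k _ => ?_
  split_ifs with h
  · exact coeff_invOfUnit_mem _ one_mem_evenFam mul_mem_evenFam
      (pairSeries_mem_evenSeries j k (c j k))
  · exact one_mem _

/-- In an exponent with given `q^{1/2}`-degree `e 0`, the charges of the points `l > k` bound the
gap variable following the point `k`. -/
lemma gap_le_of_charge (e : Fin (m + 1) →₀ ℕ) (k : Fin (m + 1)) :
    (e (k + 1) : ℤ) ≤ e 0 + ∑ l, if k < l then |charge e l| else 0 := by
  induction k using Fin.reverseInduction with
  | last =>
    rw [Fin.last_add_one]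
    have : 0 ≤ ∑ l, if Fin.last m < l then |charge e l| else 0 :=
      sum_nonneg fun l _ => by split_ifs <;> positivity
    linarith
  | cast k ih =>
    rw [Fin.coeSucc_eq_succ]
    have h1 : (∑ l, if k.succ < l then |charge e l| else 0) + |charge e k.succ| ≤
        ∑ l, if k.castSucc < l then |charge e l| else 0 := by
      have h2 : |charge e k.succ| = ∑ l, if l = k.succ then |charge e l| else 0 := by simp
      rw [h2, ← sum_add_distrib]
      refine sum_le_sum fun l _ => ?_
      have := abs_nonneg (charge e l)
      have hl : k.castSucc < l ↔ k.succ ≤ l := Fin.castSucc_lt_iff_succ_le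
      rcases lt_trichotomy k.succ l with h | h | h
      · rw [if_pos h, if_neg h.ne', if_pos (hl.2 h.le)]; simp
      · subst h; simp [hl]
      · rw [if_neg h.not_gt, if_neg h.ne, if_neg fun h' => h.not_ge (hl.1 h')]; simp
    have h3 : (e k.succ : ℤ) = charge e k.succ + e (k.succ + 1) := by simp [charge]
    have := le_abs_self (charge e k.succ)
    linarith

/-- A series in the gap variables with multiharmonic coefficients, of degrees bounded by
`gapWeight` up to a constant, belongs to the space of the thermal series. -/
lemma memPlus_toThermal {f : MvPowerSeries (Fin (m + 1)) (PointPoly D (m + 1))}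
    (hh : ∀ e, IsMultiHarmonic (coeff e f)) {w : ℕ}
    (hw : ∀ e, coeff e f ∈ degLE (gapWeight e + fun _ => w)) : MemPlus (toThermal f) := by
  refine ⟨fun κ j => ?_, fun j k κ₀ => ?_⟩
  · by_cases h : ∃ e, charge e = κ ∧ e 0 = j
    · obtain ⟨e, h1, h2⟩ := h
      rw [coeff_toThermal f h1 h2]; exact hh e
    · rw [coeff_toThermal_eq_zero f fun e h1 h2 => h ⟨e, h1, h2⟩]
      intro k; simp
  · refine ⟨2 * (j + ∑ l, if k < l then (κ₀ l).natAbs else 0) + w, fun κ hκ hne => ?_⟩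
    obtain ⟨e, rfl, rfl, h⟩ := coeff_toThermal_ne_zero hne
    rw [h]
    have h1 := degLE_iff_degIn.1 (hw e) k
    have h2 := gap_le_of_charge e k
    have h3 : (∑ l, if k < l then |charge e l| else 0) =
        ((∑ l, if k < l then (κ₀ l).natAbs else 0 : ℕ) : ℤ) := by
      push_cast
      refine sum_congr rfl fun l _ => ?_
      split_ifs with hl
      · rw [hκ l hl]
      · rfl
    rw [h3] at h2
    have h4 : charge e k = (e k : ℤ) - e (k + 1) := rfl
    simp only [gapWeight, Pi.add_apply] at h1
    push_cast at h1 h2 ⊢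
    zify at h1
    rw [h4]
    linarith

end DegreesGaps

/-! ### Lattice theta series -/

section Theta

variable {m : ℕ}

/-- The lattice vectors `4N (n a - (∑ a) 1)`, by which the charges are shifted under translations
of the `ζ_k` by `a_k τ`. -/
def shift (N : ℕ) (a : Charges m) : Charges m := fun k =>
  4 * N * ((m + 1) * a k - ∑ l, a l)

lemma shift_add (N : ℕ) (a b : Charges m) : shift N (a + b) = shift N a + shift N b := by
  ext k; simp [shift, sum_add_distrib]; ring

lemma shift_zero (N : ℕ) : shift N (0 : Charges m) = 0 := by ext k; simp [shift]

lemma shift_neg (N : ℕ) (a : Charges m) : shift N (-a) = -shift N a := by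
  ext k; simp [shift]; ring

lemma sum_shift (N : ℕ) (a : Charges m) : ∑ k, shift N a k = 0 := by
  simp only [shift, ← mul_sum, sum_sub_distrib, sum_const, Finset.card_univ,
    Fintype.card_fin, nsmul_eq_mul]
  push_cast; ring

lemma shift_comp (N : ℕ) (a : Charges m) (s : Perm (Fin (m + 1))) :
    shift N (a ∘ s) = shift N a ∘ s := by
  ext k
  simp only [shift, comp_apply, Equiv.sum_comp s a]

/-- The square of the Euclidean length. -/
def normSq (κ : Charges m) : ℤ := ∑ k, κ k ^ 2

lemma normSq_nonneg (κ : Charges m) : 0 ≤ normSq κ :=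
  sum_nonneg fun _ _ => sq_nonneg _

lemma normSq_comp (κ : Charges m) (s : Perm (Fin (m + 1))) :
    normSq (κ ∘ s) = normSq κ := Equiv.sum_comp s fun k => κ k ^ 2

lemma normSq_add_shift (N : ℕ) (κ a : Charges m) (h : ∑ k, κ k = 0) :
    normSq (κ + shift N a) = normSq κ + 8 * N * (m + 1) *
      (∑ k, a k * κ k + 2 * N * ((m + 1) * normSq a - (∑ k, a k) ^ 2)) := by
  have h1 : ∀ k, (κ + shift N a) k ^ 2 = κ k ^ 2 + 8 * N * (m + 1) * (a k * κ k) -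
      8 * N * (∑ l, a l) * κ k + 16 * N ^ 2 * ((m + 1) ^ 2 * a k ^ 2 -
        2 * (m + 1) * (∑ l, a l) * a k + (∑ l, a l) ^ 2) := fun k => by
    simp only [Pi.add_apply, shift]; ring
  simp only [normSq, h1, sum_add_distrib, sum_sub_distrib, ← mul_sum, h,
    sum_const, Finset.card_univ, Fintype.card_fin, nsmul_eq_mul]
  push_cast
  ring

/-- The parities `q` and the charges `κ₀` are admissible if they add up to zero, if they agree
mod 2, and if `κ₀` is of minimal length in its class modulo the lattice of the shifts. -/
structure Admissible (N : ℕ) (q : Fin (m + 1) → ZMod 2) (κ₀ : Charges m) : Prop where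
  pos : 0 < N
  sum_parity : ∑ k, q k = 0
  sum_charge : ∑ k, κ₀ k = 0
  parity : ∀ k, (κ₀ k : ZMod 2) = q k
  minimal : ∀ a, normSq κ₀ ≤ normSq (κ₀ + shift N a)

lemma Admissible.comp {N : ℕ} {q : Fin (m + 1) → ZMod 2} {κ₀ : Charges m}
    (h : Admissible N q κ₀) (s : Perm (Fin (m + 1))) :
    Admissible N (q ∘ s) (κ₀ ∘ s) where
  pos := h.pos
  sum_parity := by rw [← h.sum_parity]; exact Equiv.sum_comp s q
  sum_charge := by rw [← h.sum_charge]; exact Equiv.sum_comp s κ₀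
  parity := fun k => h.parity (s k)
  minimal := fun a => by
    have e : κ₀ ∘ s + shift N a = (κ₀ + shift N (a ∘ s.symm)) ∘ s := by
      have : a = (a ∘ s.symm) ∘ s := by ext k; simp
      conv_lhs => rw [this, shift_comp]
      rfl
    rw [e, normSq_comp, normSq_comp]
    exact h.minimal _

/-- The sign picked up under the translations by `a_k τ` by fields of parities `q k`. -/
def shiftSign (q : Fin (m + 1) → ZMod 2) (a : Charges m) : ℂ :=
  ∏ k, ((-1 : ℂ) ^ (q k).val) ^ a k

lemma shiftSign_add (q : Fin (m + 1) → ZMod 2) (a b : Charges m) :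
    shiftSign q (a + b) = shiftSign q a * shiftSign q b := by
  rw [shiftSign, shiftSign, shiftSign, ← prod_mul_distrib]
  exact prod_congr rfl fun k _ => zpow_add₀ (pow_ne_zero _ (by norm_num)) _ _

lemma shiftSign_single (q : Fin (m + 1) → ZMod 2) (k : Fin (m + 1)) :
    shiftSign q (Pi.single k 1) = (-1) ^ (q k).val := by
  rw [shiftSign, Finset.prod_eq_single k]
  · simp
  · intro l _ hl; simp [hl]
  · simp

lemma shiftSign_const {q : Fin (m + 1) → ZMod 2} (hq : ∑ k, q k = 0) (d : ℤ) :
    shiftSign q (fun _ => d) = 1 := by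
  rw [shiftSign, Finset.prod_zpow, Finset.prod_pow_eq_pow_sum, Even.neg_one_pow, one_zpow]
  rw [even_iff_two_dvd, ← ZMod.natCast_eq_zero_iff]
  push_cast
  simpa using hq

lemma norm_shiftSign (q : Fin (m + 1) → ZMod 2) (a : Charges m) :
    ‖shiftSign q a‖ = 1 := by simp [shiftSign]

lemma shiftSign_comp (q : Fin (m + 1) → ZMod 2) (a : Charges m)
    (s : Perm (Fin (m + 1))) : shiftSign (q ∘ s) (a ∘ s) = shiftSign q a :=
  Equiv.prod_comp s fun k => ((-1 : ℂ) ^ (q k).val) ^ a k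

lemma shiftSign_eq_of_shift_eq {N : ℕ} (hN : 0 < N) {q : Fin (m + 1) → ZMod 2}
    (hq : ∑ k, q k = 0) {a b : Charges m} (h : shift N a = shift N b) :
    shiftSign q a = shiftSign q b := by
  have h1 : ∀ k, (m + 1 : ℤ) * (a k - b k) = ∑ l, a l - ∑ l, b l := fun k => by
    have h2 := congrFun h k
    simp only [shift] at h2
    have hN' : (4 * N : ℤ) ≠ 0 := by positivity
    have h3 := mul_left_cancel₀ hN' h2
    linarith
  have h2 : a = b + fun _ => a 0 - b 0 := by
    ext k
    have h3 : (m + 1 : ℤ) * (a k - b k) = (m + 1) * (a 0 - b 0) := by rw [h1, h1]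
    have h4 := mul_left_cancel₀ (by positivity) h3
    simp only [Pi.add_apply]; linarith
  rw [h2, shiftSign_add, shiftSign_const hq, mul_one]

open Classical in
/-- The coefficient of the theta series at the charges `κ`. -/
def thetaCoef (N : ℕ) (q : Fin (m + 1) → ZMod 2) (κ₀ κ : Charges m) : ℂ :=
  if h : ∃ a, κ = κ₀ + shift N a then shiftSign q h.choose else 0

section

variable {N : ℕ} {q : Fin (m + 1) → ZMod 2} {κ₀ κ : Charges m}

lemma exists_of_thetaCoef_ne_zero (h : thetaCoef N q κ₀ κ ≠ 0) : ∃ a, κ = κ₀ + shift N a := by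
  by_contra h'
  exact h (dif_neg h')

lemma norm_thetaCoef_le (N : ℕ) (q : Fin (m + 1) → ZMod 2) (κ₀ κ : Charges m) :
    ‖thetaCoef N q κ₀ κ‖ ≤ 1 := by
  rw [thetaCoef]
  split_ifs
  · rw [norm_shiftSign]
  · simp

lemma thetaCoef_shift (hN : 0 < N) (hq : ∑ k, q k = 0) (a : Charges m) :
    thetaCoef N q κ₀ (κ₀ + shift N a) = shiftSign q a := by
  have h : ∃ b, κ₀ + shift N a = κ₀ + shift N b := ⟨a, rfl⟩
  rw [thetaCoef, dif_pos h]
  exact shiftSign_eq_of_shift_eq hN hq (add_left_cancel h.choose_spec).symm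

lemma thetaCoef_add_shift (hN : 0 < N) (hq : ∑ k, q k = 0) (κ a : Charges m) :
    thetaCoef N q κ₀ (κ + shift N a) = shiftSign q a * thetaCoef N q κ₀ κ := by
  by_cases h : ∃ b, κ = κ₀ + shift N b
  · obtain ⟨b, rfl⟩ := h
    rw [add_assoc, ← shift_add, thetaCoef_shift hN hq, thetaCoef_shift hN hq, shiftSign_add,
      mul_comm]
  · rw [thetaCoef, dif_neg, thetaCoef, dif_neg h, mul_zero]
    rintro ⟨b, hb⟩
    refine h ⟨b - a, ?_⟩
    rw [sub_eq_add_neg, shift_add, shift_neg, ← add_assoc, ← hb]; abel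

lemma thetaCoef_comp (hN : 0 < N) (hq : ∑ k, q k = 0) (s : Perm (Fin (m + 1)))
    (κ : Charges m) :
    thetaCoef N (q ∘ s) (κ₀ ∘ s) (κ ∘ s) = thetaCoef N q κ₀ κ := by
  have hq' : ∑ k, (q ∘ s) k = 0 := by rw [← hq]; exact Equiv.sum_comp s q
  by_cases h : ∃ b, κ = κ₀ + shift N b
  · obtain ⟨b, rfl⟩ := h
    have : (κ₀ + shift N b) ∘ s = κ₀ ∘ s + shift N (b ∘ s) := by rw [shift_comp]; rfl
    rw [this, thetaCoef_shift hN hq', thetaCoef_shift hN hq, shiftSign_comp]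
  · rw [thetaCoef, dif_neg, thetaCoef, dif_neg h]
    rintro ⟨b, hb⟩
    refine h ⟨b ∘ s.symm, ?_⟩
    ext k
    have := congrFun hb (s.symm k)
    have e : shift N b = shift N (b ∘ s.symm) ∘ s := by
      rw [← shift_comp]; congr 1; ext k; simp
    rw [e] at this
    simpa using this

/-- The power of `q^{1/2}` at the charges `κ`. -/
def thetaLevel (N : ℕ) (κ₀ κ : Charges m) : ℤ :=
  (normSq κ - normSq κ₀) / (8 * N * (m + 1))

lemma thetaLevel_comp (N : ℕ) (κ₀ κ : Charges m) (s : Perm (Fin (m + 1))) :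
    thetaLevel N (κ₀ ∘ s) (κ ∘ s) = thetaLevel N κ₀ κ := by
  rw [thetaLevel, normSq_comp, normSq_comp, thetaLevel]

lemma thetaLevel_shift (h : Admissible N q κ₀) (a : Charges m) :
    thetaLevel N κ₀ (κ₀ + shift N a) =
      ∑ k, a k * κ₀ k + 2 * N * ((m + 1) * normSq a - (∑ k, a k) ^ 2) := by
  rw [thetaLevel, normSq_add_shift N κ₀ a h.sum_charge, add_sub_cancel_left]
  have := h.pos
  exact Int.mul_ediv_cancel_left _ (by positivity)

lemma mul_thetaLevel (h : Admissible N q κ₀) (hκ : ∃ a, κ = κ₀ + shift N a) :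
    8 * N * (m + 1) * thetaLevel N κ₀ κ = normSq κ - normSq κ₀ := by
  obtain ⟨a, rfl⟩ := hκ
  rw [thetaLevel_shift h, normSq_add_shift N κ₀ a h.sum_charge]; ring

lemma thetaLevel_nonneg (h : Admissible N q κ₀) (hκ : ∃ a, κ = κ₀ + shift N a) :
    0 ≤ thetaLevel N κ₀ κ := by
  obtain ⟨a, rfl⟩ := hκ
  exact Int.ediv_nonneg (sub_nonneg.2 (h.minimal a)) (by positivity)

lemma sum_eq_zero_of_class (h : Admissible N q κ₀) (hκ : ∃ a, κ = κ₀ + shift N a) :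
    ∑ k, κ k = 0 := by
  obtain ⟨a, rfl⟩ := hκ
  simp only [Pi.add_apply, sum_add_distrib, sum_shift, h.sum_charge, add_zero]

/-- The levels obey the same recursion as the levels of the traces under cyclic rotations. -/
lemma thetaLevel_add_single (h : Admissible N q κ₀) (hκ : ∃ a, κ = κ₀ + shift N a)
    (k : Fin (m + 1)) :
    thetaLevel N κ₀ (κ + shift N (Pi.single k 1)) = thetaLevel N κ₀ κ + κ k + 2 * N * m := by
  have h1 := mul_thetaLevel h hκ
  have h2 := sum_eq_zero_of_class h hκ
  have hκ' : ∃ a, κ + shift N (Pi.single k 1) = κ₀ + shift N a := by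
    obtain ⟨a, rfl⟩ := hκ
    exact ⟨a + Pi.single k 1, by rw [shift_add, add_assoc]⟩
  have h3 := mul_thetaLevel h hκ'
  rw [normSq_add_shift N κ _ h2] at h3
  have hs1 : ∑ l, (Pi.single k 1 : Charges m) l * κ l = κ k := by
    simp [Pi.single_apply]
  have hs2 : normSq (Pi.single k 1 : Charges m) = 1 := by
    simp [normSq, Pi.single_apply]
  have hs3 : ∑ l, (Pi.single k 1 : Charges m) l = 1 := by simp
  rw [hs1, hs2, hs3] at h3
  have hN := h.pos
  have : (8 * N * (m + 1) : ℤ) ≠ 0 := by positivity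
  refine mul_left_cancel₀ this ?_
  linear_combination h3 - h1

/-- The sum of the charges of the points before the point `k`. -/
def chargeBefore (κ : Charges m) (k : Fin (m + 1)) : ℤ := ∑ l, if l < k then κ l else 0

lemma chargeBefore_succ (κ : Charges m) (hκ : ∑ k, κ k = 0) (k : Fin (m + 1)) :
    chargeBefore κ (k + 1) = chargeBefore κ k + κ k := by
  have h1 : κ k = ∑ l, if l = k then κ l else 0 := by simp
  induction k using Fin.lastCases with
  | last =>
    rw [Fin.last_add_one]
    have e1 : chargeBefore κ 0 = 0 := by simp [chargeBefore]
    rw [e1, ← hκ, h1, chargeBefore, ← sum_add_distrib]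
    refine sum_congr rfl fun l _ => ?_
    rcases eq_or_ne l (Fin.last m) with rfl | h
    · simp
    · simp [h, Fin.lt_last_iff_ne_last.2 h]
  | cast k =>
    rw [Fin.coeSucc_eq_succ, h1, chargeBefore, chargeBefore, ← sum_add_distrib]
    refine sum_congr rfl fun l _ => ?_
    simp only [Fin.lt_def, Fin.ext_iff, Fin.val_succ, Fin.val_castSucc]
    split_ifs <;> omega

lemma sum_ite_lt (k : Fin (m + 1)) : ∑ i : Fin (m + 1), (if i < k then 1 else 0 : ℤ) = k := by
  rw [Finset.sum_boole]
  have : (univ.filter fun i : Fin (m + 1) => i < k) = Finset.Iio k := by ext; simp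
  rw [this, Fin.card_Iio]

lemma arcsExp_apply (k : Fin (m + 1)) : (arcsExp m k : ℤ) = 2 * k * (m + 1 - k) := by
  have h1 : (arcsExp m k : ℤ) = ∑ i : Fin (m + 1), ∑ j : Fin (m + 1),
      (if i < k then 1 else 0) * (if k ≤ j then 2 else 0) := by
    rw [arcsExp]
    push_cast [Finsupp.finsetSum_apply]
    refine sum_congr rfl fun i _ => sum_congr rfl fun j _ => ?_
    by_cases hij : i < j
    · rw [if_pos hij, arcExp_apply]
      by_cases h1 : i < k <;> by_cases h2 : k ≤ j <;> simp [h1, h2]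
    · rw [if_neg hij]
      by_cases h1 : i < k <;> by_cases h2 : k ≤ j <;> simp [h1, h2]
      exact hij (h1.trans_le h2)
  have h2 := sum_ite_lt k
  have h3 : ∑ j : Fin (m + 1), (if k ≤ j then 2 else 0 : ℤ) = 2 * (m + 1 - k) := by
    have : ∀ j : Fin (m + 1), (if k ≤ j then 2 else 0 : ℤ) = 2 * (1 - if j < k then 1 else 0) :=
      fun j => by
        rcases lt_or_ge j k with h | h
        · simp [h, h.not_ge]
        · simp [h, h.not_gt]
    simp_rw [this]
    rw [← mul_sum, sum_sub_distrib, h2]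
    simp
  rw [h1, ← Finset.sum_mul_sum, h2, h3]; ring

lemma even_charge_nsmul (N : ℕ) {e : Fin (m + 1) →₀ ℕ} (he : ∀ k, Even (e k))
    (k : Fin (m + 1)) : ((charge (N • e) k : ℤ) : ZMod 2) = 0 := by
  refine (ZMod.intCast_zmod_eq_zero_iff_dvd _ 2).2 (even_iff_two_dvd.1 ?_)
  rw [charge_nsmul, Pi.smul_apply, charge]
  exact (((Int.even_coe_nat _).2 (he _)).sub ((Int.even_coe_nat _).2 (he _))).nsmul_right N

lemma even_arcsExp (k : Fin (m + 1)) : Even (arcsExp m k) := by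
  have h1 : Even (arcsExp m k : ℤ) := ⟨k * (m + 1 - k), by rw [arcsExp_apply]; ring⟩
  exact (Int.even_coe_nat _).1 h1

/-- The exponent of the gap variables at the charges `κ`. -/
def thetaExp (N : ℕ) (κ₀ κ : Charges m) : Fin (m + 1) →₀ ℕ :=
  Finsupp.equivFunOnFinite.symm fun k =>
    (thetaLevel N κ₀ κ - chargeBefore κ k + N * arcsExp m k).toNat

/-- The exponents of the gap variables are levels of shifted charges, hence non-negative. -/
lemma thetaExp_apply (h : Admissible N q κ₀) (hκ : ∃ a, κ = κ₀ + shift N a) (k : Fin (m + 1)) :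
    (thetaExp N κ₀ κ k : ℤ) = thetaLevel N κ₀ κ - chargeBefore κ k + N * arcsExp m k := by
  change ((thetaLevel N κ₀ κ - chargeBefore κ k + N * arcsExp m k).toNat : ℤ) = _
  rw [Int.toNat_of_nonneg]
  obtain ⟨a, rfl⟩ := hκ
  set b : Charges m := fun l => if l < k then 1 else 0 with hb
  have h0 := thetaLevel_nonneg h (κ := κ₀ + shift N (a + -b)) ⟨_, rfl⟩
  rw [thetaLevel_shift h] at h0
  rw [thetaLevel_shift h, arcsExp_apply]
  have s0 : ∑ l, b l = k := sum_ite_lt k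
  have s1 : ∑ l, (a + -b) l * κ₀ l = ∑ l, a l * κ₀ l - ∑ l, b l * κ₀ l := by
    rw [← sum_sub_distrib]; exact sum_congr rfl fun l _ => by simp; ring
  have s2 : normSq (a + -b) = normSq a - 2 * ∑ l, b l * a l + k := by
    rw [← s0, normSq, normSq, mul_sum, ← sum_sub_distrib, ← sum_add_distrib]
    refine sum_congr rfl fun l _ => ?_
    have : b l ^ 2 = b l := by simp only [hb]; split_ifs <;> norm_num
    simp only [Pi.add_apply, Pi.neg_apply]
    linear_combination this
  have s3 : ∑ l, (a + -b) l = ∑ l, a l - k := by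
    rw [← s0, ← sum_sub_distrib]; exact sum_congr rfl fun l _ => by simp; ring
  have s4 : chargeBefore (κ₀ + shift N a) k =
      ∑ l, b l * κ₀ l + 4 * N * ((m + 1) * ∑ l, b l * a l - k * ∑ l, a l) := by
    have : ∀ l, (if l < k then (κ₀ + shift N a) l else 0) =
        b l * κ₀ l + 4 * N * ((m + 1) * (b l * a l) - b l * ∑ l, a l) := fun l => by
      simp only [hb, Pi.add_apply, shift]; split_ifs <;> ring
    simp_rw [chargeBefore, this]
    rw [sum_add_distrib, ← mul_sum, sum_sub_distrib, ← mul_sum,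
      ← sum_mul, s0]
  rw [s1, s2, s3] at h0
  rw [s4]
  linarith

lemma thetaExp_zero (h : Admissible N q κ₀) (hκ : ∃ a, κ = κ₀ + shift N a) :
    (thetaExp N κ₀ κ 0 : ℤ) = thetaLevel N κ₀ κ := by
  rw [thetaExp_apply h hκ, arcsExp_apply]
  simp [chargeBefore]

/-- The exponents include those of the monomial by which the elliptic intervals are divided. -/
lemma charge_thetaExp (h : Admissible N q κ₀) (hκ : ∃ a, κ = κ₀ + shift N a) :
    charge (thetaExp N κ₀ κ) = κ + charge (N • arcsExp m) := by
  ext k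
  rw [charge, thetaExp_apply h hκ, thetaExp_apply h hκ,
    chargeBefore_succ κ (sum_eq_zero_of_class h hκ)]
  simp only [Pi.add_apply, charge, Finsupp.smul_apply, smul_eq_mul]
  push_cast; ring

/-- The theta series of the class of `κ₀`, as a power series in the gap variables. -/
def thetaSeries (N : ℕ) (q : Fin (m + 1) → ZMod 2) (κ₀ : Charges m) :
    MvPowerSeries (Fin (m + 1)) ℂ := famSum (thetaCoef N q κ₀) (thetaExp N κ₀)

lemma locFin_theta (h : Admissible N q κ₀) :
    LocFin (thetaCoef N q κ₀) (thetaExp N κ₀) := fun n => by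
  set B : ℤ := normSq κ₀ + 8 * N * (m + 1) * n
  refine (Set.finite_Icc (fun _ => -B : Charges m) fun _ => B).subset fun κ hκ => ?_
  have hc := exists_of_thetaCoef_ne_zero hκ.1
  have h1 := mul_thetaLevel h hc
  have h2 := thetaExp_zero h hc
  have h3 : thetaExp N κ₀ κ 0 ≤ (thetaExp N κ₀ κ).degree := Finsupp.le_degree 0 _
  have h4 : thetaLevel N κ₀ κ ≤ n := by have := hκ.2; omega
  have hB : normSq κ ≤ B := by
    have : (8 * N * (m + 1) : ℤ) * thetaLevel N κ₀ κ ≤ 8 * N * (m + 1) * n :=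
      mul_le_mul_of_nonneg_left h4 (by positivity)
    simp only [B]; linarith
  have hk : ∀ k, κ k ^ 2 ≤ B := fun k =>
    (single_le_sum (f := fun k => κ k ^ 2) (fun _ _ => sq_nonneg _)
      (mem_univ k)).trans hB
  have hI : ∀ x : ℤ, x ≤ x ^ 2 ∧ -x ≤ x ^ 2 := fun x => by
    rcases lt_trichotomy x 0 with h | h | h
    · constructor <;> nlinarith
    · subst h; simp
    · constructor <;> nlinarith
  exact ⟨fun k => by have := hI (κ k); have := hk k; simp only; linarith,
    fun k => by have := hI (κ k); have := hk k; simp only; linarith⟩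

/-- The charges of the terms of the theta series have the prescribed parities. -/
lemma parity_of_coeff_thetaSeries (h : Admissible N q κ₀) {e : Fin (m + 1) →₀ ℕ}
    (he : coeff e (thetaSeries N q κ₀) ≠ 0) (k : Fin (m + 1)) : (charge e k : ZMod 2) = q k := by
  by_cases hne : ∃ κ, thetaExp N κ₀ κ = e ∧ thetaCoef N q κ₀ κ ≠ 0
  · obtain ⟨κ, rfl, hκ⟩ := hne
    have hc := exists_of_thetaCoef_ne_zero hκ
    rw [charge_thetaExp h hc]
    obtain ⟨a, rfl⟩ := hc
    have h1 : Even (shift N a k) := ⟨2 * N * ((m + 1) * a k - ∑ l, a l), by rw [shift]; ring⟩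
    have h2 := (ZMod.intCast_zmod_eq_zero_iff_dvd _ 2).2 (even_iff_two_dvd.1 h1)
    simp only [Pi.add_apply, Int.cast_add, h.parity k, h2, even_charge_nsmul N even_arcsExp k,
      add_zero]
  · refine absurd ((AddSubgroup.mem_bot (G := ℂ)).1 (coeff_famSum_mem (⊥ : AddSubgroup ℂ)
      fun κ hκ => ?_)) he
    by_contra h'
    exact hne ⟨κ, hκ, h'⟩

/-! ### The theta functions -/

/-- The exponent of the term `κ` of the theta function, a linear form in `(ζ, τ)`. -/
def thetaForm (N : ℕ) (κ₀ κ : Charges m) : (Fin (m + 1) → ℂ) × ℂ →L[ℂ] ℂ :=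
  (pi * I * (thetaLevel N κ₀ κ : ℂ)) • ContinuousLinearMap.snd ℂ (Fin (m + 1) → ℂ) ℂ +
    ∑ k, (pi * I * (κ k : ℂ)) •
      (ContinuousLinearMap.proj k).comp (ContinuousLinearMap.fst ℂ (Fin (m + 1) → ℂ) ℂ)

lemma thetaForm_apply (N : ℕ) (κ₀ κ : Charges m) (x : (Fin (m + 1) → ℂ) × ℂ) :
    thetaForm N κ₀ κ x =
      pi * I * (thetaLevel N κ₀ κ * x.2 + ∑ k, (κ k : ℂ) * x.1 k) := by
  simp only [thetaForm, add_apply, smul_apply, sum_apply, ContinuousLinearMap.comp_apply,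
    ContinuousLinearMap.proj_apply, ContinuousLinearMap.coe_fst', ContinuousLinearMap.coe_snd',
    smul_eq_mul]
  rw [mul_add, mul_sum]
  congr 1
  · ring
  · exact sum_congr rfl fun k _ => by ring

/-- The theta function of the class of `κ₀`. -/
def thetaFun (N : ℕ) (q : Fin (m + 1) → ZMod 2) (κ₀ : Charges m)
    (ζ : Fin (m + 1) → ℂ) (τ : ℂ) : ℂ :=
  ∑' κ, thetaCoef N q κ₀ κ * exp (thetaForm N κ₀ κ (ζ, τ))

lemma norm_thetaForm_le (N : ℕ) (κ₀ κ : Charges m) : ‖thetaForm N κ₀ κ‖ ≤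
    pi * (|(thetaLevel N κ₀ κ : ℝ)| + ∑ k, |(κ k : ℝ)|) := by
  have hp := Real.pi_pos
  have hn : ‖(pi * I : ℂ)‖ = pi := by simp [abs_of_pos hp]
  refine (norm_add_le _ _).trans ?_
  rw [mul_add, mul_sum]
  refine add_le_add ?_ ((norm_sum_le _ _).trans (sum_le_sum fun k _ => ?_))
  · rw [norm_smul, norm_mul, hn, Complex.norm_intCast]
    exact mul_le_of_le_one_right (by positivity) (ContinuousLinearMap.norm_snd_le _ _ _)
  · rw [norm_smul, norm_mul, hn, Complex.norm_intCast]
    refine mul_le_of_le_one_right (by positivity) ?_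
    refine (ContinuousLinearMap.opNorm_comp_le _ _).trans ?_
    refine mul_le_one₀ ?_ (norm_nonneg _) (ContinuousLinearMap.norm_fst_le _ _ _)
    exact ContinuousLinearMap.opNorm_le_bound _ zero_le_one fun x => by
      rw [one_mul]; exact norm_le_pi_norm x k

lemma norm_exp_thetaForm (N : ℕ) (κ₀ κ : Charges m) (x : (Fin (m + 1) → ℂ) × ℂ) :
    ‖exp (thetaForm N κ₀ κ x)‖ ≤ Real.exp (pi * (-(thetaLevel N κ₀ κ) * x.2.im +
      (∑ k, |(x.1 k).im|) * ∑ k, |(κ k : ℝ)|)) := by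
  have hp := Real.pi_pos
  rw [Complex.norm_exp, Real.exp_le_exp, thetaForm_apply]
  have e : (pi * I * (thetaLevel N κ₀ κ * x.2 + ∑ k, (κ k : ℂ) * x.1 k)).re =
      pi * (-(thetaLevel N κ₀ κ) * x.2.im + ∑ k, -(κ k * (x.1 k).im)) := by
    have h1 : pi * I * (thetaLevel N κ₀ κ * x.2 + ∑ k, (κ k : ℂ) * x.1 k) =
      (pi : ℂ) * ((((thetaLevel N κ₀ κ : ℝ) : ℂ) * x.2 + ∑ k, ((κ k : ℝ) : ℂ) * x.1 k) *
        I) := by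
      push_cast; ring
    rw [h1, Complex.re_ofReal_mul, Complex.mul_I_re, Complex.add_im, Complex.im_sum,
      Complex.im_ofReal_mul]
    simp only [Complex.im_ofReal_mul, Finset.sum_neg_distrib]
    ring
  rw [e]
  refine mul_le_mul_of_nonneg_left (add_le_add le_rfl ?_) hp.le
  rw [mul_sum]
  refine sum_le_sum fun k _ => ?_
  calc -(κ k * (x.1 k).im) ≤ |κ k * (x.1 k).im| := neg_le_abs _
    _ = |(x.1 k).im| * |(κ k : ℝ)| := by rw [abs_mul, mul_comm]
    _ ≤ _ := mul_le_mul_of_nonneg_right (single_le_sum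
        (f := fun k => |(x.1 k).im|) (fun _ _ => abs_nonneg _) (mem_univ k)) (abs_nonneg _)

lemma summable_theta (h : Admissible N q κ₀) (x : (Fin (m + 1) → ℂ) × ℂ) {r : ℝ} (hr0 : 0 ≤ r)
    (hr : r < x.2.im) : Summable fun κ => ‖exp (thetaForm N κ₀ κ x)‖ *
      (‖thetaCoef N q κ₀ κ‖ * Real.exp (‖thetaForm N κ₀ κ‖ * r)) := by
  have hp := Real.pi_pos
  have hN := h.pos
  set K : ℝ := 8 * N * (m + 1) with hK
  have hK0 : 0 < K := by positivity
  set Y := ∑ k, |(x.1 k).im|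
  set δ := pi * (x.2.im - r) / K with hδ
  have hδ0 : 0 < δ := div_pos (mul_pos hp (by linarith)) hK0
  have hs := (summable_gauss_fin (m + 1) hδ0 (pi * (Y + r))).mul_left
    (Real.exp (δ * normSq κ₀))
  refine Summable.of_nonneg_of_le (fun _ => by positivity) (fun κ => ?_) hs
  by_cases hc : thetaCoef N q κ₀ κ = 0
  · rw [hc]; simp only [norm_zero, zero_mul, mul_zero]; positivity
  replace hc := exists_of_thetaCoef_ne_zero hc
  have h1 := norm_exp_thetaForm N κ₀ κ x
  have h2 := mul_le_mul_of_nonneg_right (norm_thetaForm_le N κ₀ κ) hr0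
  have h3 : (0 : ℝ) ≤ thetaLevel N κ₀ κ := by exact_mod_cast thetaLevel_nonneg h hc
  rw [abs_of_nonneg h3] at h2
  have h4 : K * thetaLevel N κ₀ κ = normSq κ - normSq κ₀ := by
    rw [hK]; exact_mod_cast mul_thetaLevel h hc
  refine (mul_le_mul h1 (mul_le_mul (norm_thetaCoef_le N q κ₀ κ) (Real.exp_le_exp.2 h2)
    (Real.exp_pos _).le zero_le_one) (by positivity) (Real.exp_pos _).le).trans ?_
  rw [one_mul, ← Real.exp_add, ← Real.exp_add, Real.exp_le_exp]
  have h5 : (∑ k, (κ k : ℝ) ^ 2) = (normSq κ : ℝ) := by rw [normSq]; push_cast; rfl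
  have h6 : δ * (normSq κ - normSq κ₀ : ℝ) = pi * (x.2.im - r) * thetaLevel N κ₀ κ := by
    rw [← h4, hδ]; field_simp
  rw [h5]
  linarith

lemma summable_norm_theta (h : Admissible N q κ₀) (ζ : Fin (m + 1) → ℂ) {τ : ℂ}
    (hτ : 0 < τ.im) :
    Summable fun κ => ‖thetaCoef N q κ₀ κ * exp (thetaForm N κ₀ κ (ζ, τ))‖ := by
  refine (summable_theta h (ζ, τ) le_rfl hτ).congr fun κ => ?_
  rw [norm_mul, mul_zero, Real.exp_zero, mul_one, mul_comm]

lemma hasSum_thetaFun (h : Admissible N q κ₀) (ζ : Fin (m + 1) → ℂ) {τ : ℂ} (hτ : 0 < τ.im) :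
    HasSum (fun κ => thetaCoef N q κ₀ κ * exp (thetaForm N κ₀ κ (ζ, τ)))
      (thetaFun N q κ₀ ζ τ) := (summable_norm_theta h ζ hτ).of_norm.hasSum

lemma polyMaj_C (r : ℝ) (a : ℂ) : polyMaj r (Polynomial.C a) = ‖a‖ := by
  rw [polyMaj_eq (N := 1) (by simp)]; simp

lemma analyticAt_thetaFun (h : Admissible N q κ₀) {x : (Fin (m + 1) → ℂ) × ℂ}
    (hx : 0 < x.2.im) :
    AnalyticAt ℂ (fun y : (Fin (m + 1) → ℂ) × ℂ => thetaFun N q κ₀ y.1 y.2) x := by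
  have hr : (0 : ℝ) < x.2.im / 2 := by linarith
  have := analyticAt_tsum_exp_poly (J := Charges m)
    (fun κ => Polynomial.C (thetaCoef N q κ₀ κ)) (thetaForm N κ₀) 0 x (r := ⟨x.2.im / 2, hr.le⟩) hr
    (by
      refine (summable_theta h x hr.le (by linarith)).congr fun κ => ?_
      rw [polyMaj_C]; rfl)
  refine this.congr (Filter.Eventually.of_forall fun y => tsum_congr fun κ => ?_)
  rw [Polynomial.eval_C]

lemma thetaFun_add_one (h : Admissible N q κ₀) (ζ : Fin (m + 1) → ℂ) (τ : ℂ)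
    (k : Fin (m + 1)) :
    thetaFun N q κ₀ (ζ + Pi.single k 1) τ = (-1) ^ (q k).val * thetaFun N q κ₀ ζ τ := by
  rw [thetaFun, thetaFun, ← tsum_mul_left]
  refine tsum_congr fun κ => ?_
  by_cases hc : thetaCoef N q κ₀ κ = 0
  · rw [hc]; ring
  have hc' := exists_of_thetaCoef_ne_zero hc
  have hpar : exp (pi * I * κ k) = (-1) ^ (q k).val := by
    rw [mul_comm, Complex.exp_int_mul, Complex.exp_pi_mul_I]
    obtain ⟨a, rfl⟩ := hc'
    have h1 : Even (shift N a k) := ⟨2 * N * ((m + 1) * a k - ∑ l, a l), by rw [shift]; ring⟩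
    rw [Pi.add_apply, zpow_add₀ (by norm_num), h1.neg_one_zpow, mul_one, ← h.parity k]
    rcases Int.even_or_odd (κ₀ k) with h2 | h2
    · have : ((κ₀ k : ℤ) : ZMod 2) = 0 :=
        (ZMod.intCast_zmod_eq_zero_iff_dvd _ 2).2 (even_iff_two_dvd.1 h2)
      rw [this, h2.neg_one_zpow]; simp
    · have : ((κ₀ k : ℤ) : ZMod 2) = 1 := by
        obtain ⟨c, hc⟩ := h2
        rw [hc]; push_cast
        rw [show (2 : ZMod 2) = 0 from rfl]; simp
      rw [this, h2.neg_one_zpow]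
      rw [show (1 : ZMod 2).val = 1 from rfl, pow_one]
  have e : thetaForm N κ₀ κ (ζ + Pi.single k 1, τ) =
      thetaForm N κ₀ κ (ζ, τ) + pi * I * κ k := by
    rw [thetaForm_apply, thetaForm_apply]
    simp only [Pi.add_apply, mul_add, sum_add_distrib, Pi.single_apply, mul_ite, mul_one,
      mul_zero, Finset.sum_ite_eq', mem_univ, if_true]
    ring
  rw [e, Complex.exp_add, hpar]; ring

lemma thetaFun_add_tau (h : Admissible N q κ₀) (ζ : Fin (m + 1) → ℂ) (τ : ℂ)
    (k : Fin (m + 1)) :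
    thetaFun N q κ₀ (ζ + Pi.single k τ) τ = (-1) ^ (q k).val *
      (exp (-(2 * pi * I * N * m * τ) -
        4 * pi * I * N * ((m + 1) * ζ k - ∑ l, ζ l)) * thetaFun N q κ₀ ζ τ) := by
  have hs := (Equiv.addRight (shift N (Pi.single k 1))).tsum_eq
    fun κ => thetaCoef N q κ₀ κ * exp (thetaForm N κ₀ κ (ζ, τ))
  rw [thetaFun, thetaFun, ← hs, ← tsum_mul_left, ← tsum_mul_left]
  refine tsum_congr fun κ => ?_
  rw [Equiv.coe_addRight, thetaCoef_add_shift h.pos h.sum_parity, shiftSign_single]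
  have hsq : ((-1 : ℂ) ^ (q k).val) * (-1) ^ (q k).val = 1 := by
    rw [← mul_pow]; simp
  by_cases hc : thetaCoef N q κ₀ κ = 0
  · rw [hc]; ring
  have hc' := exists_of_thetaCoef_ne_zero hc
  have e : thetaForm N κ₀ κ (ζ + Pi.single k τ, τ) =
      -(2 * pi * I * N * m * τ) -
        4 * pi * I * N * ((m + 1) * ζ k - ∑ l, ζ l) +
        thetaForm N κ₀ (κ + shift N (Pi.single k 1)) (ζ, τ) := by
    rw [thetaForm_apply, thetaForm_apply, thetaLevel_add_single h hc' k]
    have e1 : ∑ l, (shift N (Pi.single k 1) l : ℂ) * ζ l =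
        4 * N * ((m + 1) * ζ k - ∑ l, ζ l) := by
      have : ∀ l, (shift N (Pi.single k 1) l : ℂ) * ζ l =
          4 * N * ((m + 1) * (if l = k then ζ l else 0) - ζ l) := fun l => by
        simp only [shift, Pi.single_apply]
        split_ifs
        · simp; ring
        · simp
      simp_rw [this]
      rw [← mul_sum, sum_sub_distrib, ← mul_sum]
      simp
    simp only [Pi.add_apply, mul_add, sum_add_distrib, Pi.single_apply, mul_ite,
      mul_zero, Finset.sum_ite_eq', mem_univ, if_true, Int.cast_add, add_mul, e1]
    push_cast
    ring
  rw [e, Complex.exp_add]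
  linear_combination (-(thetaCoef N q κ₀ κ *
    (exp (-(2 * pi * I * N * m * τ) -
        4 * pi * I * N * ((m + 1) * ζ k - ∑ l, ζ l)) *
      exp (thetaForm N κ₀ (κ + shift N (Pi.single k 1)) (ζ, τ))))) * hsq

lemma thetaFun_comp (hN : 0 < N) (hq : ∑ k, q k = 0) (s : Perm (Fin (m + 1)))
    (ζ : Fin (m + 1) → ℂ) (τ : ℂ) :
    thetaFun N (q ∘ s) (κ₀ ∘ s) (ζ ∘ s) τ = thetaFun N q κ₀ ζ τ := by
  rw [thetaFun, thetaFun, ← (Equiv.arrowCongr s.symm (Equiv.refl ℤ)).tsum_eq]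
  refine tsum_congr fun κ => ?_
  have e : (Equiv.arrowCongr s.symm (Equiv.refl ℤ)) κ = κ ∘ s := by ext k; simp
  rw [e, thetaCoef_comp hN hq]
  congr 2
  rw [thetaForm_apply, thetaForm_apply, thetaLevel_comp]
  congr 2
  exact Equiv.sum_comp s fun k => (κ k : ℂ) * ζ k

lemma mpow_thetaExp (h : Admissible N q κ₀) (hκ : ∃ a, κ = κ₀ + shift N a)
    (ζ : Fin (m + 1) → ℂ) (τ : ℂ) : mpow (gapPoint ζ τ) (thetaExp N κ₀ κ) =
      mpow (gapPoint ζ τ) (arcsExp m) ^ N * exp (thetaForm N κ₀ κ (ζ, τ)) := by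
  rw [← mpow_nsmul, mpow_gapPoint, mpow_gapPoint, ← Complex.exp_add, thetaForm_apply,
    charge_thetaExp h hκ]
  congr 1
  have e1 : ((thetaExp N κ₀ κ 0 : ℕ) : ℂ) = ((thetaLevel N κ₀ κ : ℤ) : ℂ) := by
    exact_mod_cast congrArg (Int.cast (R := ℂ)) (thetaExp_zero h hκ)
  have e2 : (N • arcsExp m) 0 = 0 := by
    have : (arcsExp m 0 : ℤ) = 0 := by rw [arcsExp_apply]; simp
    simp only [Finsupp.smul_apply, smul_eq_mul]
    have : arcsExp m 0 = 0 := by exact_mod_cast this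
    rw [this, mul_zero]
  rw [e1, e2]
  simp only [Pi.add_apply, Int.cast_add, add_mul, sum_add_distrib, Nat.cast_zero]
  ring

lemma pval_thetaSeries (h : Admissible N q κ₀) (ζ : Fin (m + 1) → ℂ) {τ : ℂ} (hτ : 0 < τ.im) :
    wnorm (fun i => ‖gapPoint ζ τ i‖₊) (thetaSeries N q κ₀) ≠ ∞ ∧
    pval (gapPoint ζ τ) (thetaSeries N q κ₀) =
      mpow (gapPoint ζ τ) (arcsExp m) ^ N * thetaFun N q κ₀ ζ τ := by
  have key : ∀ κ, thetaCoef N q κ₀ κ * mpow (gapPoint ζ τ) (thetaExp N κ₀ κ) =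
      mpow (gapPoint ζ τ) (arcsExp m) ^ N *
        (thetaCoef N q κ₀ κ * exp (thetaForm N κ₀ κ (ζ, τ))) := fun κ => by
    by_cases hc : thetaCoef N q κ₀ κ = 0
    · rw [hc]; ring
    · rw [mpow_thetaExp h (exists_of_thetaCoef_ne_zero hc)]; ring
  constructor
  · refine ne_top_of_le_ne_top ?_ (wnorm_famSum_le (locFin_theta h) _)
    refine ENNReal.tsum_coe_ne_top_iff_summable.2 (NNReal.summable_coe.1 ?_)
    refine ((summable_norm_theta h ζ hτ).mul_left
      ‖mpow (gapPoint ζ τ) (arcsExp m) ^ N‖).congr fun κ => ?_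
    rw [← norm_mul, ← key, ← nnnorm_mpow, ← nnnorm_mul, coe_nnnorm]
  · exact pval_famSum (locFin_theta h) (((hasSum_thetaFun h ζ hτ).mul_left _).congr_fun key)

end

end Theta

/-! ### Harmonic projection -/

section Fischer

variable {σ : Type*} {D : ℕ}

/-- The Laplace operator in the variables `v α`. -/
def lap (v : Fin D → σ) : MvPolynomial σ ℂ →ₗ[ℂ] MvPolynomial σ ℂ :=
  ∑ α, (pderiv (v α)).toLinearMap ∘ₗ (pderiv (v α)).toLinearMap

lemma lap_apply (v : Fin D → σ) (P : MvPolynomial σ ℂ) :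
    lap v P = ∑ α, pderiv (v α) (pderiv (v α) P) := by
  simp [lap, LinearMap.sum_apply]

/-- The sum of the squares of the variables `v α`. -/
def radSq (v : Fin D → σ) : MvPolynomial σ ℂ := ∑ α, MvPolynomial.X (v α) ^ 2

lemma radSq_ne_zero [NeZero D] (v : Fin D → σ) : radSq v ≠ 0 := fun h => by
  have h1 := congrArg (eval fun _ => (1 : ℂ)) h
  simp [radSq, NeZero.ne D] at h1

variable [Fintype σ]

/-- The multi-factorial `∏ (s i)!`. -/
def multiFactorial (s : σ →₀ ℕ) : ℂ := ∏ i, ((s i).factorial : ℂ)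

/-- Fischer's bilinear form `∑_s s! P_s Q_s`, for which multiplication by a variable and the
corresponding partial derivative are adjoint to each other. -/
def fischer : MvPolynomial σ ℂ →ₗ[ℂ] MvPolynomial σ ℂ →ₗ[ℂ] ℂ :=
  (MvPolynomial.basisMonomials σ ℂ).constr ℂ fun s => multiFactorial s • MvPolynomial.lcoeff ℂ s

lemma fischer_monomial (s : σ →₀ ℕ) (a : ℂ) (Q : MvPolynomial σ ℂ) :
    fischer (MvPolynomial.monomial s a) Q = a * (multiFactorial s * MvPolynomial.coeff s Q) := by
  have h1 : MvPolynomial.monomial s a = a • MvPolynomial.basisMonomials σ ℂ s := by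
    rw [MvPolynomial.coe_basisMonomials, MvPolynomial.smul_monomial, smul_eq_mul, mul_one]
  rw [h1, map_smul, fischer, Module.Basis.constr_basis]
  rfl

lemma fischer_X_mul (i : σ) (P Q : MvPolynomial σ ℂ) :
    fischer (MvPolynomial.X i * P) Q = fischer P (pderiv i Q) := by
  classical
  induction P using MvPolynomial.induction_on' with
  | add P P' h h' => rw [mul_add, map_add, map_add, LinearMap.add_apply, LinearMap.add_apply, h, h']
  | monomial s a =>
    rw [MvPolynomial.X, MvPolynomial.monomial_mul, one_mul, fischer_monomial, fischer_monomial]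
    congr 1
    induction Q using MvPolynomial.induction_on' with
    | add Q Q' h h' => simp only [map_add, MvPolynomial.coeff_add, mul_add, h, h']
    | monomial t b =>
      rw [MvPolynomial.pderiv_monomial, MvPolynomial.coeff_monomial, MvPolynomial.coeff_monomial]
      have hf : multiFactorial (Finsupp.single i 1 + s) = multiFactorial s * (s i + 1) := by
        have : ∀ j, (((Finsupp.single i 1 + s : σ →₀ ℕ) j).factorial : ℂ) =
            (s j).factorial * if j = i then (s i + 1 : ℂ) else 1 := fun j => by
          rcases eq_or_ne j i with rfl | h
          · simp [add_comm 1, Nat.factorial_succ]; ring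
          · simp [h]
        rw [multiFactorial, multiFactorial, prod_congr rfl fun j _ => this j,
          prod_mul_distrib, Finset.prod_ite_eq' univ i, if_pos (mem_univ i)]
      by_cases h : t = Finsupp.single i 1 + s
      · rw [if_pos h, if_pos (by rw [h, add_tsub_cancel_left]), hf, h]
        simp only [Finsupp.add_apply, Finsupp.single_eq_same]
        push_cast; ring
      · rw [if_neg h]
        by_cases h2 : t - Finsupp.single i 1 = s
        · rw [if_pos h2]
          have : t i = 0 := by
            by_contra h3
            refine h ?_
            rw [← h2, add_tsub_cancel_of_le]
            rw [Finsupp.single_le_iff]; omega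
          rw [this]; simp
        · rw [if_neg h2, mul_zero, mul_zero]

lemma eq_zero_of_fischer_conj {P : MvPolynomial σ ℂ}
    (h : fischer P (MvPolynomial.map (starRingEnd ℂ) P) = 0) : P = 0 := by
  have h1 : fischer P (MvPolynomial.map (starRingEnd ℂ) P) =
      ((∑ s ∈ P.support, (∏ i, ((s i).factorial : ℝ)) * ‖MvPolynomial.coeff s P‖ ^ 2 : ℝ) : ℂ) := by
    conv_lhs => rw [P.as_sum, map_sum, LinearMap.sum_apply]
    push_cast
    refine sum_congr rfl fun s _ => ?_
    rw [← P.as_sum, fischer_monomial, MvPolynomial.coeff_map, ← Complex.conj_mul', multiFactorial]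
    ring
  rw [h1, Complex.ofReal_eq_zero, Finset.sum_eq_zero_iff_of_nonneg fun s _ => by positivity] at h
  refine MvPolynomial.ext _ _ fun s => ?_
  rw [MvPolynomial.coeff_zero]
  by_contra hs
  have h2 := h s (MvPolynomial.mem_support_iff.2 hs)
  have h3 : (∏ i, ((s i).factorial : ℝ)) ≠ 0 :=
    Finset.prod_ne_zero_iff.2 fun i _ => by exact_mod_cast (Nat.factorial_ne_zero _)
  exact hs (by simpa [h3] using h2)

lemma fischer_radSq_mul (v : Fin D → σ) (P Q : MvPolynomial σ ℂ) :
    fischer (radSq v * P) Q = fischer P (lap v Q) := by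
  rw [radSq, sum_mul, map_sum, LinearMap.sum_apply, lap_apply, map_sum]
  refine sum_congr rfl fun α _ => ?_
  rw [sq, mul_assoc, fischer_X_mul, fischer_X_mul]

/-- A multiple of `r²` is not harmonic, unless it vanishes. -/
lemma eq_zero_of_lap_radSq_mul [NeZero D] (v : Fin D → σ) {Q : MvPolynomial σ ℂ}
    (h : lap v (radSq v * Q) = 0) : Q = 0 := by
  have h1 : radSq v * Q = 0 := by
    refine eq_zero_of_fischer_conj ?_
    rw [fischer_radSq_mul]
    have : lap v (MvPolynomial.map (starRingEnd ℂ) (radSq v * Q)) =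
        MvPolynomial.map (starRingEnd ℂ) (lap v (radSq v * Q)) := by
      rw [lap_apply, lap_apply, map_sum]
      exact sum_congr rfl fun α _ => by rw [MvPolynomial.pderiv_map, MvPolynomial.pderiv_map]
    rw [this, h, map_zero, map_zero]
  exact (mul_eq_zero.1 h1).resolve_left (radSq_ne_zero v)

/-- Uniqueness of the expansion in powers of `r²` with harmonic coefficients. -/
lemma eq_zero_of_sum_radSq_pow [NeZero D] (v : Fin D → σ) (n : ℕ) (F : ℕ → MvPolynomial σ ℂ)
    (hF : ∀ i, lap v (F i) = 0) (h : ∑ i ∈ range n, radSq v ^ i * F i = 0) :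
    ∀ i < n, F i = 0 := by
  induction n generalizing F with
  | zero => simp
  | succ n ih =>
    rw [Finset.sum_range_succ', pow_zero, one_mul] at h
    have h1 : ∑ i ∈ range n, radSq v ^ (i + 1) * F (i + 1) =
        radSq v * ∑ i ∈ range n, radSq v ^ i * F (i + 1) := by
      rw [mul_sum]; exact sum_congr rfl fun i _ => by ring
    rw [h1] at h
    have h2 : ∑ i ∈ range n, radSq v ^ i * F (i + 1) = 0 := by
      refine eq_zero_of_lap_radSq_mul v ?_
      have := congrArg (lap v) h
      rwa [map_add, hF 0, add_zero, map_zero] at this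
    rw [h2, mul_zero, zero_add] at h
    intro i hi
    rcases i with _ | i
    · exact h
    · exact ih (fun i => F (i + 1)) (fun i => hF _) h2 i (by omega)

end Fischer

section Projection

variable {D n : ℕ}

/-- The Laplace operator of the point number `k`. -/
def lapAt (k : Fin n) : PointPoly D n →ₗ[ℂ] PointPoly D n := lap fun α => (k, α)

lemma isMultiHarmonic_iff {P : PointPoly D n} : IsMultiHarmonic P ↔ ∀ k, lapAt k P = 0 := by
  simp only [IsMultiHarmonic, lapAt, lap_apply]

lemma pderiv_mem_degLE {w : Fin n → ℕ} {P : PointPoly D n} (hP : P ∈ degLE w) (k : Fin n)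
    (α : Fin D) : pderiv (k, α) P ∈ degLE (fun l => if l = k then w l - 2 else w l) := by
  classical
  rw [P.as_sum, map_sum]
  refine sum_mem fun s hs t ht l => ?_
  rw [MvPolynomial.pderiv_monomial] at ht
  have h1 := MvPolynomial.support_monomial_subset ht
  rw [Finset.mem_singleton] at h1
  have hsk : s (k, α) ≠ 0 := fun h0 => by
    rw [h0, Nat.cast_zero, mul_zero, map_zero] at ht
    simp at ht
  have h2 := hP s hs l
  have h3 : t + Finsupp.single (k, α) 1 = s := by
    rw [h1, tsub_add_cancel_of_le]; rw [Finsupp.single_le_iff]; omega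
  have h4 : ∑ β, t (l, β) + (if l = k then 1 else 0) = ∑ β, s (l, β) := by
    rw [← h3]
    simp only [Finsupp.add_apply, sum_add_distrib]
    congr 1
    split_ifs with h
    · subst h
      rw [Finset.sum_eq_single α]
      · simp
      · intro β _ hβ; simp [hβ.symm]
      · simp
    · rw [sum_eq_zero]
      intro β _
      simp [Ne.symm h]
  change 2 * ∑ β, t (l, β) ≤ if l = k then w l - 2 else w l
  split_ifs at h4 ⊢ <;> omega

lemma pderiv_eq_zero_of_degLE {w : Fin n → ℕ} {P : PointPoly D n} (hP : P ∈ degLE w) {k : Fin n}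
    (hk : w k < 2) (α : Fin D) : pderiv (k, α) P = 0 := by
  classical
  rw [P.as_sum, map_sum]
  refine sum_eq_zero fun s hs => ?_
  have h1 := hP s hs k
  have h2 : s (k, α) ≤ ∑ β, s (k, β) :=
    single_le_sum (f := fun β => s (k, β)) (fun _ _ => Nat.zero_le _) (mem_univ α)
  have h3 : s (k, α) = 0 := by omega
  rw [MvPolynomial.pderiv_monomial, h3, Nat.cast_zero, mul_zero, map_zero]

lemma radSq_mul_mem_degLE {w : Fin n → ℕ} {P : PointPoly D n} (hP : P ∈ degLE w) (k : Fin n) :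
    radSq (fun α => (k, α)) * P ∈ degLE (Pi.single k 4 + w) := by
  refine mul_mem_degLE (sum_mem fun α _ => ?_) hP
  have h := mul_mem_degLE (X_mem_degLE (D := D) k α) (X_mem_degLE k α)
  rw [← Pi.single_add] at h
  rw [sq]; exact h

lemma lapAt_mem_degLE {w : Fin n → ℕ} {P : PointPoly D n} (hP : P ∈ degLE w) (k : Fin n) :
    lapAt k P ∈ degLE (fun l => if l = k then w l - 4 else w l) := by
  rw [lapAt, lap_apply]
  refine sum_mem fun α _ => degLE_mono (fun l => ?_)
    (pderiv_mem_degLE (pderiv_mem_degLE hP k α) k α)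
  simp only
  split_ifs <;> omega

lemma pderiv_comm (i j : Fin n × Fin D) (P : PointPoly D n) :
    pderiv i (pderiv j P) =
      pderiv j (pderiv i P) := by
  classical
  induction P using MvPolynomial.induction_on' with
  | add P Q h h' => simp only [map_add, h, h']
  | monomial s a =>
    simp only [MvPolynomial.pderiv_monomial]
    rcases eq_or_ne i j with rfl | h
    · rfl
    · rw [tsub_right_comm]
      congr 1
      simp [h, h.symm]; ring

lemma lapAt_comm (j k : Fin n) (P : PointPoly D n) :
    lapAt j (lapAt k P) = lapAt k (lapAt j P) := by
  simp only [lapAt, lap_apply, map_sum]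
  rw [sum_comm]
  refine sum_congr rfl fun α _ => sum_congr rfl fun β _ => ?_
  rw [pderiv_comm (j, α) (k, β), pderiv_comm (j, α) (k, β), pderiv_comm (j, α) (k, β),
    pderiv_comm (j, α) (k, β)]

lemma lapAt_radSq_mul {j k : Fin n} (h : j ≠ k) (P : PointPoly D n) :
    lapAt j (radSq (fun α => (k, α)) * P) = radSq (fun α => (k, α)) * lapAt j P := by
  have h0 : ∀ β, pderiv (j, β) (radSq fun α => (k, α) : PointPoly D n) = 0 :=
    fun β => by
    rw [radSq, map_sum]
    refine sum_eq_zero fun α _ => ?_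
    rw [sq, MvPolynomial.pderiv_mul, MvPolynomial.pderiv_X_of_ne]
    · simp
    · intro h'; exact h (Prod.mk.inj h').1.symm
  simp only [lapAt, lap_apply, mul_sum]
  refine sum_congr rfl fun β _ => ?_
  rw [MvPolynomial.pderiv_mul, h0, zero_mul, zero_add, MvPolynomial.pderiv_mul, h0, zero_mul,
    zero_add]

/-- Polynomials of bounded degrees that are harmonic in the points of `J`. -/
def partHarmonic (w : Fin n → ℕ) (J : Finset (Fin n)) : Submodule ℂ (PointPoly D n) where
  carrier := {P | P ∈ degLE w ∧ ∀ j ∈ J, lapAt j P = 0}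
  zero_mem' := ⟨zero_mem _, fun j _ => map_zero _⟩
  add_mem' := fun hP hQ => ⟨add_mem hP.1 hQ.1, fun j hj => by
    rw [map_add, hP.2 j hj, hQ.2 j hj, add_zero]⟩
  smul_mem' := fun c P hP => ⟨fun s hs => hP.1 s (MvPolynomial.support_smul hs), fun j hj => by
    rw [map_smul, hP.2 j hj, smul_zero]⟩

instance (w : Fin n → ℕ) (J : Finset (Fin n)) :
    FiniteDimensional ℂ (partHarmonic (D := D) w J) := by
  classical
  set S : Set (Fin n × Fin D →₀ ℕ) := {s | ∀ x, s x ≤ w x.1}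
  have hS : S.Finite := by
    have : S ⊆ Finsupp.equivFunOnFinite.symm '' Set.Iic (fun x : Fin n × Fin D => w x.1) :=
      fun s hs => ⟨Finsupp.equivFunOnFinite s, fun x => hs x, by simp⟩
    exact ((Set.finite_Iic _).image _).subset this
  have := hS.to_subtype
  have : FiniteDimensional ℂ (MvPolynomial.restrictSupport ℂ S) :=
    Module.Finite.of_basis (MvPolynomial.basisRestrictSupport ℂ S)
  refine Submodule.finiteDimensional_of_le (S₂ := MvPolynomial.restrictSupport ℂ S) fun P hP => ?_
  rw [MvPolynomial.mem_restrictSupport_iff]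
  intro s hs x
  have h1 := hP.1 s hs x.1
  have h2 : s x ≤ ∑ β, s (x.1, β) :=
    single_le_sum (f := fun β => s (x.1, β)) (fun _ _ => Nat.zero_le _)
      (mem_univ x.2)
  omega

/-- Restricted to the product of the spheres, a polynomial that is harmonic in the points of `J`
agrees with one that is harmonic in one more point: the operator `Q ↦ Δ (r² Q)` is injective, hence
surjective on polynomials of bounded degree, so a multiple of `r²` can be subtracted to make the
polynomial harmonic. -/
lemma exists_harmonic_insert [NeZero D] (J : Finset (Fin n)) {k : Fin n} (hk : k ∉ J) (d : ℕ) :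
    ∀ (w : Fin n → ℕ), w k ≤ d → ∀ P ∈ partHarmonic (D := D) w J,
      ∃ Q ∈ partHarmonic (D := D) w (insert k J), ∀ u : Fin n → Fin D → ℂ,
        (∀ k, dot (u k) (u k) = 1) → evalAt u Q = evalAt u P := by
  induction d using Nat.strong_induction_on with
  | _ d ih =>
    intro w hw P hP
    rcases lt_or_ge (w k) 4 with h4 | h4
    · refine ⟨P, ⟨hP.1, fun j hj => ?_⟩, fun _ _ => rfl⟩
      rcases Finset.mem_insert.1 hj with rfl | hj
      · rw [lapAt, lap_apply]
        refine sum_eq_zero fun α _ => ?_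
        rcases lt_or_ge (w j) 2 with h2 | h2
        · rw [pderiv_eq_zero_of_degLE hP.1 h2, map_zero]
        · exact pderiv_eq_zero_of_degLE (pderiv_mem_degLE hP.1 j α) (k := j) (by simp; omega) α
      · exact hP.2 j hj
    · set w' : Fin n → ℕ := fun l => if l = k then w l - 4 else w l with hw'
      have hsum : Pi.single k 4 + w' = w := by
        ext l
        simp only [hw', Pi.add_apply, Pi.single_apply]
        split_ifs with h
        · subst h; omega
        · omega
      let f : partHarmonic (D := D) w' J →ₗ[ℂ] partHarmonic (D := D) w' J :=
        LinearMap.restrict ((lapAt k) ∘ₗ LinearMap.mulLeft ℂ (radSq fun α => (k, α))) (by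
          intro Q hQ
          refine ⟨?_, fun j hj => ?_⟩
          · have := lapAt_mem_degLE (radSq_mul_mem_degLE hQ.1 k) k
            rw [hsum] at this; exact this
          · change lapAt j (lapAt k (radSq (fun α => (k, α)) * Q)) = 0
            have hjk : j ≠ k := fun h => hk (h ▸ hj)
            rw [lapAt_comm, lapAt_radSq_mul hjk, hQ.2 j hj, mul_zero, map_zero])
      have hf : Function.Injective f := by
        rw [injective_iff_map_eq_zero]
        intro Q hQ
        have : lapAt k (radSq (fun α => (k, α)) * (Q : PointPoly D n)) = 0 :=
          congrArg Subtype.val hQ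
        exact Subtype.ext (eq_zero_of_lap_radSq_mul _ this)
      obtain ⟨Q, hQ⟩ := (LinearMap.injective_iff_surjective.1 hf) ⟨lapAt k P,
        lapAt_mem_degLE hP.1 k, fun j hj => by rw [lapAt_comm, hP.2 j hj, map_zero]⟩
      have hQ' : lapAt k (radSq (fun α => (k, α)) * (Q : PointPoly D n)) = lapAt k P :=
        congrArg Subtype.val hQ
      obtain ⟨R, hR, hR'⟩ := ih (d - 4) (by omega) w' (by simp [hw']; omega) Q Q.2
      have hle : w' ≤ w := fun l => by simp only [hw']; split_ifs <;> omega
      refine ⟨P - radSq (fun α => (k, α)) * (Q : PointPoly D n) + R, ⟨?_, fun j hj => ?_⟩, ?_⟩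
      · refine add_mem (sub_mem hP.1 ?_) (degLE_mono hle hR.1)
        have := radSq_mul_mem_degLE Q.2.1 k
        rwa [hsum] at this
      · rw [map_add, hR.2 j hj, add_zero, map_sub]
        rcases Finset.mem_insert.1 hj with rfl | hj
        · rw [hQ', sub_self]
        · have hjk : j ≠ k := fun h => hk (h ▸ hj)
          rw [lapAt_radSq_mul hjk, hP.2 j hj, Q.2.2 j hj, mul_zero, sub_zero]
      · intro u hu
        have hr : evalAt u (radSq fun α => (k, α)) = 1 := by
          rw [← hu k]; simp [evalAt, radSq, dot, sq]
        rw [map_add, map_sub, map_mul, hr, one_mul, hR' u hu, sub_add_cancel]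

/-- On the products of spheres every polynomial agrees with one that is harmonic in each point and
not of higher degree. -/
lemma exists_multiHarmonic [NeZero D] (P : PointPoly D n) :
    ∃ Q : PointPoly D n, IsMultiHarmonic Q ∧ (∀ w, P ∈ degLE w → Q ∈ degLE w) ∧
      ∀ u : Fin n → Fin D → ℂ, (∀ k, dot (u k) (u k) = 1) → evalAt u Q = evalAt u P := by
  classical
  set w : Fin n → ℕ := fun k => 2 * degIn k P
  have hP : P ∈ degLE w := degLE_iff_degIn.2 fun k => le_rfl
  have key : ∀ J : Finset (Fin n), ∃ Q ∈ partHarmonic (D := D) w J, ∀ u : Fin n → Fin D → ℂ,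
      (∀ k, dot (u k) (u k) = 1) → evalAt u Q = evalAt u P := by
    intro J
    induction J using Finset.induction_on with
    | empty => exact ⟨P, ⟨hP, by simp⟩, fun _ _ => rfl⟩
    | insert k J hk ih =>
      obtain ⟨Q, hQ, hQ'⟩ := ih
      obtain ⟨R, hR, hR'⟩ := exists_harmonic_insert J hk (w k) w le_rfl Q hQ
      exact ⟨R, hR, fun u hu => (hR' u hu).trans (hQ' u hu)⟩
  obtain ⟨Q, hQ, hQ'⟩ := key univ
  refine ⟨Q, isMultiHarmonic_iff.2 fun k => hQ.2 k (mem_univ k), fun w' hw' => ?_, hQ'⟩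
  exact degLE_mono (fun k => degLE_iff_degIn.1 hw' k) hQ.1

open Classical in
/-- The multiharmonic polynomial with the same restriction to the product of the spheres. -/
def harmonicProj [NeZero D] (P : PointPoly D n) : PointPoly D n :=
  if P = 0 then 0 else (exists_multiHarmonic P).choose

lemma harmonicProj_zero [NeZero D] : harmonicProj (0 : PointPoly D n) = 0 := by
  rw [harmonicProj, if_pos rfl]

lemma isMultiHarmonic_harmonicProj [NeZero D] (P : PointPoly D n) :
    IsMultiHarmonic (harmonicProj P) := by
  rw [harmonicProj]
  split_ifs
  · intro k; simp
  · exact (exists_multiHarmonic P).choose_spec.1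

lemma harmonicProj_mem_degLE [NeZero D] {w : Fin n → ℕ} {P : PointPoly D n}
    (h : P ∈ degLE w) : harmonicProj P ∈ degLE w := by
  rw [harmonicProj]
  split_ifs
  · exact zero_mem _
  · exact (exists_multiHarmonic P).choose_spec.2.1 w h

lemma dot_coord_self (u : UnitSphere D) : dot (coord u) (coord u) = 1 := by
  rw [dot_coord, real_inner_self_eq_norm_sq, norm_eq_of_mem_sphere]; norm_num

lemma evalAt_harmonicProj [NeZero D] (P : PointPoly D n) (u : Fin n → UnitSphere D) :
    evalAt (fun k => coord (u k)) (harmonicProj P) = evalAt (fun k => coord (u k)) P := by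
  rw [harmonicProj]
  split_ifs with h
  · rw [h]
  · exact (exists_multiHarmonic P).choose_spec.2.2 _ fun k => dot_coord_self (u k)

/-! ### Polynomials as a finite module over the symmetric polynomials -/

/-- The permutation of the points. -/
def permPoly (s : Perm (Fin n)) : PointPoly D n →ₐ[ℂ] PointPoly D n :=
  MvPolynomial.rename fun x => (s x.1, x.2)

lemma isSymm_iff {P : PointPoly D n} : IsSymm P ↔ ∀ s, permPoly s P = P := Iff.rfl

lemma permPoly_mul (s t : Perm (Fin n)) (P : PointPoly D n) :
    permPoly (s * t) P = permPoly s (permPoly t P) := by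
  rw [permPoly, permPoly, permPoly, MvPolynomial.rename_rename]; rfl

lemma permPoly_one (P : PointPoly D n) : permPoly 1 P = P := MvPolynomial.rename_id_apply P

lemma evalAt_permPoly (s : Perm (Fin n)) (u : Fin n → Fin D → ℂ) (P : PointPoly D n) :
    evalAt u (permPoly s P) = evalAt (u ∘ s) P := by
  rw [evalAt, evalAt, permPoly, MvPolynomial.eval_rename]; rfl

lemma isMultiHarmonic_permPoly {P : PointPoly D n} (h : IsMultiHarmonic P)
    (s : Perm (Fin n)) : IsMultiHarmonic (permPoly s P) := by
  intro k
  have hi : Function.Injective fun x : Fin n × Fin D => (s x.1, x.2) := fun x y hxy =>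
    Prod.ext (s.injective (Prod.mk.inj hxy).1) (Prod.mk.inj hxy).2
  have h1 := congrArg (permPoly s) (h (s.symm k))
  rw [map_sum, map_zero] at h1
  rw [← h1]
  refine sum_congr rfl fun α _ => ?_
  have h2 : ∀ Q : PointPoly D n, pderiv (k, α) (permPoly s Q) =
      permPoly s (pderiv (s.symm k, α) Q) := fun Q => by
    have := MvPolynomial.pderiv_rename (R := ℂ) hi (s.symm k, α) Q
    simp only [Equiv.apply_symm_apply] at this
    exact this
  rw [h2, h2]

/-- A symmetric polynomial agrees on the product of the spheres with a symmetric multiharmonic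
polynomial. -/
lemma exists_symm_multiHarmonic [NeZero D] {P : PointPoly D n} (hP : IsSymm P) :
    ∃ Q : PointPoly D n, IsSymm Q ∧ IsMultiHarmonic Q ∧ ∀ u : Fin n → UnitSphere D,
      evalAt (fun k => coord (u k)) Q = evalAt (fun k => coord (u k)) P := by
  set c : ℂ := (Fintype.card (Perm (Fin n)) : ℂ)
  have hc : c ≠ 0 := by simp [c, Fintype.card_ne_zero]
  refine ⟨c⁻¹ • ∑ s, permPoly s (harmonicProj P), fun t => ?_, fun k => ?_, fun u => ?_⟩
  · change permPoly t _ = _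
    rw [map_smul, map_sum]
    congr 1
    simp_rw [← permPoly_mul]
    exact Equiv.sum_comp (Equiv.mulLeft t) fun s => permPoly s (harmonicProj P)
  · have : lapAt k (c⁻¹ • ∑ s, permPoly s (harmonicProj P)) = 0 := by
      rw [map_smul, map_sum, sum_eq_zero, smul_zero]
      intro s _
      exact isMultiHarmonic_iff.1 (isMultiHarmonic_permPoly (isMultiHarmonic_harmonicProj P) s) k
    rwa [lapAt, lap_apply] at this
  · have h1 : ∀ s, evalAt (fun k => coord (u k)) (permPoly s (harmonicProj P)) =
        evalAt (fun k => coord (u k)) P := fun s => by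
      rw [evalAt_permPoly]
      have := evalAt_harmonicProj P (u ∘ s)
      refine this.trans ?_
      rw [show (fun k => coord ((u ∘ s) k)) = (fun k => coord (u k)) ∘ s from rfl,
        ← evalAt_permPoly, isSymm_iff.1 hP]
    have h2 : ∀ (a : ℂ) (Q : PointPoly D n),
        evalAt (fun k => coord (u k)) (a • Q) = a * evalAt (fun k => coord (u k)) Q :=
      fun a Q => by simp [evalAt]
    rw [h2, map_sum, sum_congr rfl fun s _ => h1 s, sum_const, nsmul_eq_mul,
      ← mul_assoc]
    change c⁻¹ * c * _ = _
    rw [inv_mul_cancel₀ hc, one_mul]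

/-- The subalgebra of the symmetric polynomials. -/
def symmSubalgebra (D n : ℕ) : Subalgebra ℂ (PointPoly D n) where
  carrier := {P | IsSymm P}
  mul_mem' := fun {P Q} hP hQ s => by rw [map_mul, hP s, hQ s]
  add_mem' := fun {P Q} hP hQ s => by rw [map_add, hP s, hQ s]
  algebraMap_mem' := fun r s => by simp [MvPolynomial.algebraMap_eq]

/-- The polynomials in several points are a finite module over the symmetric ones, since the
variables are integral over these. -/
lemma exists_generators (D n : ℕ) : ∃ (B : ℕ) (e : Fin B → PointPoly D n),
    ∀ P : PointPoly D n, ∃ g : Fin B → PointPoly D n, (∀ b, IsSymm (g b)) ∧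
      P = ∑ b, g b * e b := by
  classical
  set A := symmSubalgebra D n
  -- Each variable is a root of the product of `T - X` over its orbit under the permutations.
  have hint : ∀ x ∈ Set.range (MvPolynomial.X : Fin n × Fin D → PointPoly D n), IsIntegral A x := by
    rintro _ ⟨x, rfl⟩
    set p : Polynomial (PointPoly D n) := ∏ s : Perm (Fin n),
      (Polynomial.X - Polynomial.C (permPoly s (MvPolynomial.X x))) with hp
    have hmonic : p.Monic := Polynomial.monic_prod_of_monic _ _ fun _ _ =>
      Polynomial.monic_X_sub_C _
    have hcoef : (p.coeffs : Set (PointPoly D n)) ⊆ A.toSubring := by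
      intro a ha
      obtain ⟨i, _, rfl⟩ := Polynomial.mem_coeffs_iff.1 (Finset.mem_coe.1 ha)
      intro t
      change (permPoly t).toRingHom (p.coeff i) = p.coeff i
      rw [← Polynomial.coeff_map, hp, Polynomial.map_prod]
      congr 1
      simp only [Polynomial.map_sub, Polynomial.map_X, Polynomial.map_C]
      refine (prod_congr rfl fun s _ => ?_).trans
        (Equiv.prod_comp (Equiv.mulLeft t) fun s =>
          (Polynomial.X - Polynomial.C (permPoly s (MvPolynomial.X x : PointPoly D n))))
      rw [Equiv.coe_mulLeft, permPoly_mul]; rfl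
    refine ⟨p.toSubring A.toSubring hcoef, (Polynomial.monic_toSubring _ _ _).2 hmonic, ?_⟩
    have h1 : Polynomial.eval₂ (algebraMap A (PointPoly D n)) (MvPolynomial.X x)
        (p.toSubring A.toSubring hcoef) = Polynomial.eval (MvPolynomial.X x) p := by
      conv_rhs => rw [← Polynomial.map_toSubring p A.toSubring hcoef, Polynomial.eval_map]
      rfl
    rw [h1, hp, Polynomial.eval_prod]
    refine Finset.prod_eq_zero (mem_univ 1) ?_
    rw [permPoly_one]; simp
  have hfg := fg_adjoin_of_finite (Set.finite_range _) hint
  have htop : Algebra.adjoin A (Set.range (MvPolynomial.X : Fin n × Fin D → PointPoly D n)) =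
      ⊤ := by
    rw [eq_top_iff]
    intro P _
    induction P using MvPolynomial.induction_on with
    | C a =>
      have : (MvPolynomial.C a : PointPoly D n) = algebraMap A _ (algebraMap ℂ A a) := rfl
      rw [this]; exact Subalgebra.algebraMap_mem _ _
    | add P Q hP hQ => exact add_mem (hP trivial) (hQ trivial)
    | mul_X P x hP => exact mul_mem (hP trivial) (Algebra.subset_adjoin ⟨x, rfl⟩)
  rw [htop, Algebra.top_toSubmodule] at hfg
  obtain ⟨B, e, he⟩ := Submodule.fg_iff_exists_fin_generating_family.1 hfg
  refine ⟨B, e, fun P => ?_⟩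
  have hP : P ∈ Submodule.span A (Set.range e) := he ▸ Submodule.mem_top
  obtain ⟨c, hc⟩ := (Submodule.mem_span_range_iff_exists_fun A).1 hP
  exact ⟨fun b => c b, fun b => (c b).2, by rw [← hc]; rfl⟩

/-- Series with polynomial coefficients are combinations of the generators whose coefficients are
symmetric and harmonic in every point. -/
lemma exists_symm_decomposition {B : ℕ} [NeZero D] {e : Fin B → PointPoly D n}
    (he : ∀ P : PointPoly D n, ∃ g : Fin B → PointPoly D n, (∀ b, IsSymm (g b)) ∧
      P = ∑ b, g b * e b) (F : PowerSeries (PointPoly D n)) :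
    ∃ G : Fin B → PowerSeries (PointPoly D n),
      (∀ b j, IsSymm (PowerSeries.coeff j (G b)) ∧ IsMultiHarmonic (PowerSeries.coeff j (G b))) ∧
      ∀ (u : Fin n → UnitSphere D) (s : Perm (Fin n)),
        PowerSeries.map (evalAt fun k => coord ((u ∘ s) k)) F =
          ∑ b, PowerSeries.map (evalAt fun k => coord (u k)) (G b) *
            PowerSeries.C (evalAt ((fun k => coord (u k)) ∘ s) (e b)) := by
  choose g hg hF using fun j => he (PowerSeries.coeff j F)
  choose Q hQ1 hQ2 hQ3 using fun j b => exists_symm_multiHarmonic (hg j b)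
  refine ⟨fun b => PowerSeries.mk fun j => Q j b, fun b j => ?_, fun u s => ?_⟩
  · rw [coeff_mk]
    exact ⟨hQ1 j b, hQ2 j b⟩
  · ext j
    rw [PowerSeries.coeff_map, hF, map_sum, map_sum]
    refine sum_congr rfl fun b _ => ?_
    rw [mul_comm, mul_comm (PowerSeries.map _ _), PowerSeries.coeff_C_mul, PowerSeries.coeff_map,
      coeff_mk, map_mul, ← hQ3 j b (u ∘ s)]
    congr 1
    conv_rhs => rw [← isSymm_iff.1 (hQ1 j b) s, evalAt_permPoly]
    rfl

end Projection

/-! ### Products over pairs of points and statistical signs -/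

section Pairs

variable {n : ℕ}

lemma prod_pairs_eq {M : Type*} [CommMonoid M] (F : Fin n → Fin n → M) :
    (∏ j, ∏ k, if j < k then F j k else 1) =
      ∏ x ∈ univ.filter (fun x : Fin n × Fin n => x.1 < x.2), F x.1 x.2 := by
  rw [Finset.prod_filter, ← Finset.univ_product_univ, Finset.prod_product]

/-- The product of a symmetric function over the unordered pairs is invariant under permutations. -/
lemma prod_pairs_comp {M : Type*} [CommMonoid M] (F : Fin n → Fin n → M)
    (hF : ∀ j k, F j k = F k j) (s : Perm (Fin n)) :
    (∏ j, ∏ k, if j < k then F (s j) (s k) else 1) = ∏ j, ∏ k, if j < k then F j k else 1 := by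
  rw [prod_pairs_eq fun j k => F (s j) (s k), prod_pairs_eq]
  let g : Perm (Fin n) → Fin n × Fin n → Fin n × Fin n := fun s x =>
    if s x.1 < s x.2 then (s x.1, s x.2) else (s x.2, s x.1)
  have hg : ∀ s : Perm (Fin n), ∀ x : Fin n × Fin n, x.1 < x.2 → (g s x).1 < (g s x).2 ∧
      g s⁻¹ (g s x) = x := fun s x hx => by
    have hne : s x.1 ≠ s x.2 := fun h => hx.ne (s.injective h)
    simp only [g]
    rcases lt_or_gt_of_ne hne with h | h
    · simp [h, hx]
    · simp [h, h.not_gt, hx.not_gt]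
  refine Finset.prod_nbij' (g s) (g s⁻¹) ?_ ?_ ?_ ?_ ?_
  · intro x hx
    exact mem_filter.2 ⟨mem_univ _, (hg s x (mem_filter.1 hx).2).1⟩
  · intro x hx
    exact mem_filter.2 ⟨mem_univ _, (hg s⁻¹ x (mem_filter.1 hx).2).1⟩
  · intro x hx
    exact (hg s x (mem_filter.1 hx).2).2
  · intro x hx
    have := (hg s⁻¹ x (mem_filter.1 hx).2).2
    rwa [inv_inv] at this
  · intro x _
    simp only [g]
    split_ifs
    · rfl
    · exact hF _ _

lemma paritySign_comm (a b : ZMod 2) : paritySign a b = paritySign b a := by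
  rw [paritySign, paritySign, mul_comm]

lemma paritySign_mul_self (a b : ZMod 2) : paritySign a b * paritySign a b = 1 := by
  rw [paritySign, ← mul_pow]; simp

variable {I : Type*} (p : I → ZMod 2)

lemma statSign_mul_self (A : Fin n → I) (s : Perm (Fin n)) :
    statSign p A s * statSign p A s = 1 := by
  rw [statSign, ← prod_mul_distrib]
  refine prod_eq_one fun i _ => ?_
  rw [← prod_mul_distrib]
  refine prod_eq_one fun j _ => ?_
  split_ifs
  · exact paritySign_mul_self _ _
  · exact one_mul _

lemma statSign_one (A : Fin n → I) : statSign p A 1 = 1 :=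
  prod_eq_one fun _ _ => prod_eq_one fun _ _ =>
    if_neg fun h => lt_asymm h.1 h.2

/-- The statistical signs form a cocycle. -/
lemma statSign_mul (A : Fin n → I) (s t : Perm (Fin n)) :
    statSign p A (s * t) = statSign p A s * statSign p (A ∘ s) t := by
  set F : Fin n → Fin n → ℂ := fun i j => if (i < j ∧ s j < s i) ∨ (j < i ∧ s i < s j) then
    paritySign (p (A (s i))) (p (A (s j))) else 1
  have hF : ∀ i j, F i j = F j i := fun i j => by
    simp only [F, paritySign_comm (p (A (s j)))]
    exact if_congr or_comm rfl rfl
  have h1 : statSign p A s = ∏ i, ∏ j, if i < j then F i j else 1 := by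
    refine prod_congr rfl fun i _ => prod_congr rfl fun j _ => ?_
    by_cases h : i < j
    · simp [F, h, h.not_gt]
    · simp [h]
  rw [h1, ← prod_pairs_comp F hF t, statSign, statSign, ← prod_mul_distrib]
  refine prod_congr rfl fun i _ => ?_
  rw [← prod_mul_distrib]
  refine prod_congr rfl fun j _ => ?_
  by_cases h : i < j
  · have hne : t i ≠ t j := fun h' => h.ne (t.injective h')
    have hne' : s (t i) ≠ s (t j) := fun h' => hne (s.injective h')
    simp only [F, h, true_and, if_true, Equiv.Perm.mul_apply, comp_apply]
    rcases lt_or_gt_of_ne hne with h2 | h2 <;> rcases lt_or_gt_of_ne hne' with h3 | h3 <;>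
      simp [h2, h3, h2.not_gt, h3.not_gt, paritySign_mul_self]
  · simp [h]

lemma prod_pairs_single (μ : Fin n) (a : Fin n → ℂ) :
    (∏ j, ∏ k, if j < k then (if j = μ then a k else if k = μ then a j else 1) else 1) =
      ∏ l, if l = μ then 1 else a l := by
  have h1 : ∀ j k, (if j < k then (if j = μ then a k else if k = μ then a j else 1) else 1) =
      (if j = μ then (if μ < k then a k else 1) else 1) *
        (if k = μ then (if j < μ then a j else 1) else 1) := fun j k => by
    rcases eq_or_ne j μ with rfl | hj
    · rcases eq_or_ne k j with rfl | hk
      · simp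
      · simp [hk]
    · rcases eq_or_ne k μ with rfl | hk
      · simp [hj]
      · simp [hj, hk]
  simp_rw [h1, prod_mul_distrib]
  rw [Finset.prod_comm]
  simp only [Finset.prod_ite_eq', mem_univ, if_true]
  rw [← prod_mul_distrib]
  refine prod_congr rfl fun l _ => ?_
  rcases lt_trichotomy l μ with h | rfl | h
  · simp [h, h.ne, h.not_gt]
  · simp
  · simp [h, h.ne', h.not_gt]

end Pairs

/-! ### The elliptic functions -/

section Elliptic

variable {D n : ℕ}

lemma ellInterval_add_one (ζ : ℂ) (u v : UnitSphere D) (τ : ℂ) :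
    ellInterval (ζ + 1) u v τ = ellInterval ζ u v τ := by
  simp only [ellInterval]
  rw [add_right_comm, theta11_add_one, add_sub_right_comm, theta11_add_one]
  ring

lemma ellInterval_add_tau (ζ : ℂ) (u v : UnitSphere D) (τ : ℂ) :
    ellInterval (ζ + τ) u v τ =
      exp (-(2 * pi * I * τ) - 4 * pi * I * ζ) *
        ellInterval ζ u v τ := by
  simp only [ellInterval]
  set α : ℝ := Real.arccos ⟪(u : EuclideanSpace ℝ (Fin D)), (v : EuclideanSpace ℝ (Fin D))⟫_ℝ /
    (2 * pi)
  rw [add_right_comm, theta11_add_tau, show ζ + τ - α = (ζ - α) + τ from by ring, theta11_add_tau,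
    show -(2 * pi * I * τ) - 4 * pi * I * ζ =
      (-(pi * I * τ) - 2 * pi * I * (ζ + α)) +
      (-(pi * I * τ) - 2 * pi * I * (ζ - α)) from by ring, Complex.exp_add]
  ring

lemma ellInterval_neg (ζ : ℂ) (u v : UnitSphere D) (τ : ℂ) :
    ellInterval (-ζ) u v τ = ellInterval ζ u v τ := by
  simp only [ellInterval]
  set α : ℝ := Real.arccos ⟪(u : EuclideanSpace ℝ (Fin D)), (v : EuclideanSpace ℝ (Fin D))⟫_ℝ /
    (2 * pi)
  rw [show -ζ + α = -(ζ - α) from by ring, show -ζ - α = -(ζ + α) from by ring, theta11_neg,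
    theta11_neg]
  ring

lemma ellInterval_symm (ζ : ℂ) (u v : UnitSphere D) (τ : ℂ) :
    ellInterval ζ u v τ = ellInterval ζ v u τ := by
  simp only [ellInterval]
  rw [real_inner_comm]

lemma ellInterval_sub_one (ζ : ℂ) (u v : UnitSphere D) (τ : ℂ) :
    ellInterval (ζ - 1) u v τ = ellInterval ζ u v τ := by
  rw [← ellInterval_add_one, sub_add_cancel]

lemma ellInterval_sub_tau (ζ : ℂ) (u v : UnitSphere D) (τ : ℂ) :
    ellInterval (ζ - τ) u v τ =
      exp (-(2 * pi * I * τ) + 4 * pi * I * ζ) *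
        ellInterval ζ u v τ := by
  rw [← ellInterval_neg, neg_sub, sub_eq_neg_add, ellInterval_add_tau, ellInterval_neg]
  congr 2; ring

/-- The product of the negatives of the elliptic intervals; it differs from `ellProduct` by a
sign. -/
def negProduct (ζ : Fin n → ℂ) (u : Fin n → UnitSphere D) (τ : ℂ) : ℂ :=
  ∏ j, ∏ k, if j < k then -ellInterval (ζ j - ζ k) (u j) (u k) τ else 1

/-- The sign `(-1)^{n(n-1)/2}`. -/
def pairSign (n : ℕ) : ℂ := ∏ j : Fin n, ∏ k, if j < k then -1 else 1

lemma pairSign_mul_self (n : ℕ) : pairSign n * pairSign n = 1 := by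
  rw [pairSign, ← prod_mul_distrib]
  refine prod_eq_one fun i _ => ?_
  rw [← prod_mul_distrib]
  exact prod_eq_one fun j _ => by split_ifs <;> norm_num

lemma negProduct_eq (ζ : Fin n → ℂ) (u : Fin n → UnitSphere D) (τ : ℂ) :
    negProduct ζ u τ = pairSign n * ellProduct ζ u τ := by
  rw [negProduct, pairSign, ellProduct, ← prod_mul_distrib]
  refine prod_congr rfl fun i _ => ?_
  rw [← prod_mul_distrib]
  exact prod_congr rfl fun j _ => by split_ifs <;> simp

lemma negProduct_comp (ζ : Fin n → ℂ) (u : Fin n → UnitSphere D) (τ : ℂ)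
    (s : Perm (Fin n)) : negProduct (ζ ∘ s) (u ∘ s) τ = negProduct ζ u τ :=
  prod_pairs_comp (fun j k => -ellInterval (ζ j - ζ k) (u j) (u k) τ)
    (fun j k => by rw [← neg_sub, ellInterval_neg, ellInterval_symm]) s

lemma negProduct_add_one (ζ : Fin n → ℂ) (u : Fin n → UnitSphere D) (τ : ℂ) (μ : Fin n) :
    negProduct (ζ + Pi.single μ 1) u τ = negProduct ζ u τ := by
  refine prod_congr rfl fun j _ => prod_congr rfl fun k _ => ?_
  by_cases h : j < k
  · rw [if_pos h, if_pos h]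
    congr 1
    simp only [Pi.add_apply, Pi.single_apply]
    rcases eq_or_ne j μ with rfl | hj
    · rw [if_pos rfl, if_neg h.ne', add_zero, add_sub_right_comm, ellInterval_add_one]
    · rcases eq_or_ne k μ with rfl | hk
      · rw [if_pos rfl, if_neg h.ne, add_zero, ← sub_sub, ellInterval_sub_one]
      · rw [if_neg hj, if_neg hk, add_zero, add_zero]
  · rw [if_neg h, if_neg h]

lemma negProduct_add_tau (ζ : Fin n → ℂ) (u : Fin n → UnitSphere D) (τ : ℂ) (μ : Fin n) :
    negProduct (ζ + Pi.single μ τ) u τ = (∏ l, if l = μ then 1 else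
      exp (-(2 * pi * I * τ) - 4 * pi * I * (ζ μ - ζ l))) *
        negProduct ζ u τ := by
  rw [← prod_pairs_single, negProduct, negProduct, ← prod_mul_distrib]
  refine prod_congr rfl fun j _ => ?_
  rw [← prod_mul_distrib]
  refine prod_congr rfl fun k _ => ?_
  by_cases h : j < k
  · rw [if_pos h, if_pos h, if_pos h]
    simp only [Pi.add_apply, Pi.single_apply]
    rcases eq_or_ne j μ with rfl | hj
    · rw [if_pos rfl, if_pos rfl, if_neg h.ne', add_zero, add_sub_right_comm, ellInterval_add_tau]
      ring
    · rcases eq_or_ne k μ with rfl | hk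
      · rw [if_neg hj, if_neg hj, if_pos rfl, if_pos rfl, add_zero, ← sub_sub, ellInterval_sub_tau,
          ← neg_sub (ζ k) (ζ j)]
        rw [mul_neg, mul_neg, ← sub_eq_add_neg]
      · rw [if_neg hj, if_neg hj, if_neg hk, if_neg hk, add_zero, add_zero, one_mul]
  · rw [if_neg h, if_neg h, if_neg h, one_mul]

/-- The extension of `negProduct` to complex values of the coordinates. -/
def negProductC (x : (Fin n → ℂ) × (Fin n → Fin D → ℂ) × ℂ) : ℂ :=
  ∏ j, ∏ k, if j < k then -ellFun (x.1 j - x.1 k) (dot (x.2.1 j) (x.2.1 k)) x.2.2 else 1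

lemma negProduct_eq_negProductC (ζ : Fin n → ℂ) (u : Fin n → UnitSphere D) {τ : ℂ}
    (hτ : 0 < τ.im) : negProduct ζ u τ = negProductC (ζ, fun k => coord (u k), τ) := by
  refine prod_congr rfl fun j _ => prod_congr rfl fun k _ => ?_
  simp only [ellInterval_eq_ellFun _ _ _ hτ]

lemma analyticAt_fst_apply (x : (Fin n → ℂ) × (Fin n → Fin D → ℂ) × ℂ) (j : Fin n) :
    AnalyticAt ℂ (fun y : (Fin n → ℂ) × (Fin n → Fin D → ℂ) × ℂ => y.1 j) x :=
  ((ContinuousLinearMap.proj (R := ℂ) (φ := fun _ : Fin n => ℂ) j).comp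
    (ContinuousLinearMap.fst ℂ (Fin n → ℂ) ((Fin n → Fin D → ℂ) × ℂ))).analyticAt x

lemma analyticAt_snd_fst_apply (x : (Fin n → ℂ) × (Fin n → Fin D → ℂ) × ℂ) (j : Fin n)
    (α : Fin D) :
    AnalyticAt ℂ (fun y : (Fin n → ℂ) × (Fin n → Fin D → ℂ) × ℂ => y.2.1 j α) x :=
  ((ContinuousLinearMap.proj (R := ℂ) (φ := fun _ : Fin D => ℂ) α).comp
    ((ContinuousLinearMap.proj (R := ℂ) (φ := fun _ : Fin n => Fin D → ℂ) j).comp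
    ((ContinuousLinearMap.fst ℂ (Fin n → Fin D → ℂ) ℂ).comp
    (ContinuousLinearMap.snd ℂ (Fin n → ℂ) ((Fin n → Fin D → ℂ) × ℂ))))).analyticAt x

lemma analyticAt_snd_snd (x : (Fin n → ℂ) × (Fin n → Fin D → ℂ) × ℂ) :
    AnalyticAt ℂ (fun y : (Fin n → ℂ) × (Fin n → Fin D → ℂ) × ℂ => y.2.2) x :=
  ((ContinuousLinearMap.snd ℂ (Fin n → Fin D → ℂ) ℂ).comp
    (ContinuousLinearMap.snd ℂ (Fin n → ℂ) ((Fin n → Fin D → ℂ) × ℂ))).analyticAt x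

lemma analyticAt_ellFun_comp {E : Type*} [NormedAddCommGroup E] [NormedSpace ℂ E] {f g h : E → ℂ}
    {x : E} (hf : AnalyticAt ℂ f x) (hg : AnalyticAt ℂ g x) (hh : AnalyticAt ℂ h x)
    (hx : 0 < (h x).im) : AnalyticAt ℂ (fun y => ellFun (f y) (g y) (h y)) x :=
  AnalyticAt.fun_comp (g := fun y : ℂ × ℂ × ℂ => GCI.ellFun y.1 y.2.1 y.2.2)
    (f := fun y => (f y, g y, h y)) (analyticAt_ellFun hx) (hf.prod (hg.prod hh))

lemma analyticAt_negProductC {x : (Fin n → ℂ) × (Fin n → Fin D → ℂ) × ℂ} (hx : 0 < x.2.2.im) :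
    AnalyticAt ℂ negProductC x := by
  refine Finset.analyticAt_fun_prod _ fun j _ => Finset.analyticAt_fun_prod _ fun k _ => ?_
  split_ifs with h
  · refine (analyticAt_ellFun_comp ((analyticAt_fst_apply x j).sub (analyticAt_fst_apply x k)) ?_
      (analyticAt_snd_snd x) hx).neg
    exact Finset.analyticAt_fun_sum _ fun α _ =>
      (analyticAt_snd_fst_apply x j α).mul (analyticAt_snd_fst_apply x k α)
  · exact analyticAt_const

/-- For given `u` and `τ`, the product of the elliptic intervals does not vanish identically near
any configuration `ζ`. -/
lemma frequently_negProductC_ne_zero (ζ₀ : Fin n → ℂ) (u : Fin n → UnitSphere D) {τ : ℂ}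
    (hτ : 0 < τ.im) :
    ∃ᶠ x in nhds (ζ₀, τ), negProductC (x.1, fun k => coord (u k), x.2) ≠ 0 := by
  -- Each factor is a non-zero entire function of the parameter of a line through `ζ₀`.
  set L : ℂ → (Fin n → ℂ) × ℂ := fun w => (fun k => ζ₀ k + w * (k : ℂ), τ)
  have hL : Filter.Tendsto L (nhdsWithin 0 {0}ᶜ) (nhds (ζ₀, τ)) := by
    have h0 : L 0 = (ζ₀, τ) := by simp [L]
    rw [← h0]
    have : Continuous L := by fun_prop
    exact this.continuousAt.tendsto.mono_left nhdsWithin_le_nhds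
  refine hL.frequently (Filter.Eventually.frequently ?_)
  have h1 : ∀ j k : Fin n, ∀ᶠ w in nhdsWithin (0 : ℂ) {0}ᶜ, j < k →
      ellFun ((L w).1 j - (L w).1 k) (dot (coord (u j)) (coord (u k))) τ ≠ 0 := fun j k => by
    by_cases h : j < k
    · have han : AnalyticOnNhd ℂ (fun w => ellFun ((L w).1 j - (L w).1 k)
          (dot (coord (u j)) (coord (u k))) τ) Set.univ := fun w _ => by
        refine analyticAt_ellFun_comp (AnalyticAt.sub ?_ ?_) analyticAt_const analyticAt_const hτ
        · exact analyticAt_const.add (analyticAt_id.mul analyticAt_const)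
        · exact analyticAt_const.add (analyticAt_id.mul analyticAt_const)
      rcases (han 0 trivial).eventually_eq_zero_or_eventually_ne_zero with h2 | h2
      · exfalso
        have h3 := han.eqOn_zero_of_preconnected_of_eventuallyEq_zero isPreconnected_univ
          (Set.mem_univ 0) h2
        have hd : (0 : ℝ) < (k : ℝ) - j := sub_pos.2 (by exact_mod_cast h)
        set t : ℝ := (τ.im / 2 + (ζ₀ j - ζ₀ k).im) / ((k : ℝ) - j)
        have h4 := h3 (Set.mem_univ (t * I))
        have him : ((L (t * I)).1 j - (L (t * I)).1 k).im = -(τ.im / 2) := by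
          have : ((L (t * I)).1 j - (L (t * I)).1 k).im =
              (ζ₀ j - ζ₀ k).im - t * ((k : ℝ) - j) := by
            simp [L]; ring
          rw [this, div_mul_cancel₀ _ hd.ne']; ring
        simp only [Pi.zero_apply] at h4
        rw [dot_coord_eq_cos] at h4
        exact ellFun_ne_zero _ (by rw [him]; linarith) (by rw [him]; linarith) h4
      · exact h2.mono fun w hw _ => hw
    · exact Filter.Eventually.of_forall fun w h' => absurd h' h
  have h2 := Filter.eventually_all.2 fun j => Filter.eventually_all.2 fun k => h1 j k
  filter_upwards [h2] with w hw
  refine Finset.prod_ne_zero_iff.2 fun j _ => Finset.prod_ne_zero_iff.2 fun k _ => ?_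
  by_cases h : j < k
  · rw [if_pos h]; exact neg_ne_zero.2 (hw j k h)
  · rw [if_neg h]; exact one_ne_zero

end Elliptic

/-! ### The elliptic basis functions -/

/-- The properties required of a family of universal series `E` with sums `f`. -/
structure IsEllipticFamily {D n : ℕ} {I : Type*} (p : I → ZMod 2) (N : ℕ)
    (E : (Fin n → I) → ThermalSeries D n)
    (f : (Fin n → I) → (Fin n → ℂ) → (Fin n → UnitSphere D) → ℂ → ℂ) : Prop where
  memPlus : ∀ A, MemPlus (E A)
  differences : ∀ A, DependsOnDifferences (E A)
  parity : ∀ A κ, E A κ ≠ 0 → ∀ k, (κ k : ZMod 2) = p (A k)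
  convergesTo : ∀ A, ConvergesTo (E A) (f A)
  meromorphic : ∀ A, IsMeromorphicOver (f A)
  denominator : ∀ A, HasEllipticDenominator N (f A)
  periodic : ∀ A (k : Fin n) ζ u τ, 0 < τ.im →
    f A (ζ + Pi.single k 1) u τ = (-1) ^ (p (A k)).val * f A ζ u τ ∧
    f A (ζ + Pi.single k τ) u τ = (-1) ^ (p (A k)).val * f A ζ u τ
  symmetric : ∀ A (s : Perm (Fin n)) ζ u τ, 0 < τ.im →
    f (A ∘ s) (ζ ∘ s) (u ∘ s) τ = statSign p A s * f A ζ u τ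

lemma isEllipticFamily_zero {D n : ℕ} {I : Type*} (p : I → ZMod 2) (N : ℕ) :
    IsEllipticFamily (D := D) (n := n) p N 0 0 where
  memPlus A := ⟨fun κ j k => by simp, fun j k κ₀ => ⟨0, fun κ _ h => absurd (by simp) h⟩⟩
  differences A κ h := absurd rfl h
  parity A κ h := absurd rfl h
  convergesTo A ζ τ _ u := by simp
  meromorphic A ζ₀ u₀ τ₀ _ := ⟨fun _ => 0, fun _ => 1, analyticAt_const, analyticAt_const,
    Filter.Eventually.frequently (by simp), by simp⟩
  denominator A := ⟨fun _ => 0, analyticOnNhd_const, by simp⟩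
  periodic A k ζ u τ _ := by simp
  symmetric A s ζ u τ _ := by simp

/-- For `n = 0` the only function needed is the constant `1`. -/
lemma isEllipticFamily_one {D : ℕ} {I : Type*} (p : I → ZMod 2) (N : ℕ) :
    IsEllipticFamily (D := D) (n := 0) p N 1 1 where
  memPlus A := ⟨fun κ j k => k.elim0, fun j k => k.elim0⟩
  differences A κ h := by simp
  parity A κ h k := k.elim0
  convergesTo A ζ τ _ u := by
    have h1 := hasSum_ite_eq ((0, default) : ℕ × (Fin 0 → ℤ)) (1 : ℂ)
    refine h1.congr_fun fun x => ?_
    obtain ⟨j, κ⟩ := x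
    obtain rfl := Subsingleton.elim κ default
    rcases eq_or_ne j 0 with rfl | hj
    · simp
    · simp [hj, PowerSeries.coeff_one]
  meromorphic A ζ₀ u₀ τ₀ _ := ⟨fun _ => 1, fun _ => 1, analyticAt_const, analyticAt_const,
    Filter.Eventually.frequently (by simp), by simp⟩
  denominator A := ⟨fun _ => 1, analyticOnNhd_const, by simp [ellProduct]⟩
  periodic A k := k.elim0
  symmetric A s ζ u τ _ := by simp [statSign]

section Family

variable {m D : ℕ} {I : Type*} (p : I → ZMod 2) (N : ℕ)
  (A₀ : Fin (m + 1) → I) (κ₀ : Charges m) (P : PointPoly D (m + 1))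

lemma admissible_comp_inv {p : I → ZMod 2} {N : ℕ} {A₀ : Fin (m + 1) → I}
    {κ₀ : Charges m} (h : Admissible N (p ∘ A₀) κ₀) {A : Fin (m + 1) → I}
    {s : Perm (Fin (m + 1))} (hA : A ∘ s = A₀) : Admissible N (p ∘ A) (κ₀ ∘ ⇑s⁻¹) := by
  have h1 := h.comp s⁻¹
  have h2 : (p ∘ A₀) ∘ ⇑s⁻¹ = p ∘ A := by
    ext k; simp [← hA]
  rwa [h2] at h1

variable [DecidableEq I]

/-- The numerator of a basis function, a signed sum over the orderings of the fields of products of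
a theta function and a polynomial, as a function of complex coordinates. -/
def numerator (A : Fin (m + 1) → I)
    (x : (Fin (m + 1) → ℂ) × (Fin (m + 1) → Fin D → ℂ) × ℂ) : ℂ :=
  ∑ s : Perm (Fin (m + 1)), if A ∘ s = A₀ then
    statSign p A s * thetaFun N (p ∘ A) (κ₀ ∘ ⇑s⁻¹) x.1 x.2.2 * evalAt (x.2.1 ∘ s) P else 0

/-- The power series in the gap variables for the numerator. -/
def numeratorSeries (A : Fin (m + 1) → I) :
    MvPowerSeries (Fin (m + 1)) (PointPoly D (m + 1)) :=
  ∑ s : Perm (Fin (m + 1)), if A ∘ s = A₀ then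
    MvPowerSeries.C (MvPolynomial.C (statSign p A s) * permPoly s P) *
      MvPowerSeries.map MvPolynomial.C (thetaSeries N (p ∘ A) (κ₀ ∘ ⇑s⁻¹)) else 0

/-- Coefficientwise harmonic projection. -/
def harmonicSeries [NeZero D] {σ : Type*} {n : ℕ} (F : MvPowerSeries σ (PointPoly D n)) :
    MvPowerSeries σ (PointPoly D n) := fun e => harmonicProj (coeff e F)

/-- The basis function. -/
def basisFun (A : Fin (m + 1) → I) (ζ : Fin (m + 1) → ℂ) (u : Fin (m + 1) → UnitSphere D)
    (τ : ℂ) : ℂ :=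
  numerator p N A₀ κ₀ P A (ζ, fun k => coord (u k), τ) / negProduct ζ u τ ^ N

/-- The expansion of the basis function. -/
def basisSeries [NeZero D] (A : Fin (m + 1) → I) : ThermalSeries D (m + 1) :=
  toThermal (harmonicSeries
    (numeratorSeries p N A₀ κ₀ P A * ellInv (fun j k => dotPoly j k) ^ N))

variable {p N A₀ κ₀ P}

lemma coeff_harmonicSeries [NeZero D] {σ : Type*} {n : ℕ} (F : MvPowerSeries σ (PointPoly D n))
    (e : σ →₀ ℕ) : coeff e (harmonicSeries F) = harmonicProj (coeff e F) := rfl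

lemma map_harmonicSeries [NeZero D] {σ : Type*} {n : ℕ} (F : MvPowerSeries σ (PointPoly D n))
    (u : Fin n → UnitSphere D) :
    MvPowerSeries.map (evalAt fun k => coord (u k)) (harmonicSeries F) =
      MvPowerSeries.map (evalAt fun k => coord (u k)) F := by
  ext e
  rw [MvPowerSeries.coeff_map, MvPowerSeries.coeff_map, coeff_harmonicSeries, evalAt_harmonicProj]

lemma map_numeratorSeries (A : Fin (m + 1) → I) (u : Fin (m + 1) → UnitSphere D) :
    MvPowerSeries.map (evalAt fun k => coord (u k)) (numeratorSeries p N A₀ κ₀ P A) =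
      ∑ s : Perm (Fin (m + 1)), if A ∘ s = A₀ then
        MvPowerSeries.C (statSign p A s * evalAt ((fun k => coord (u k)) ∘ s) P) *
          thetaSeries N (p ∘ A) (κ₀ ∘ ⇑s⁻¹) else 0 := by
  rw [numeratorSeries, map_sum]
  refine sum_congr rfl fun s _ => ?_
  split_ifs
  · rw [map_mul, MvPowerSeries.map_C, map_mul, evalAt_permPoly]
    have h1 : ∀ a, evalAt (fun k => coord (u k)) (MvPolynomial.C a) = a := fun a => by simp [evalAt]
    rw [h1]
    congr 1
    ext e
    rw [MvPowerSeries.coeff_map, MvPowerSeries.coeff_map, h1]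
  · rw [map_zero]

lemma map_ellInv_dotPoly (u : Fin (m + 1) → UnitSphere D) :
    MvPowerSeries.map (evalAt fun k => coord (u k)) (ellInv fun j k => dotPoly j k) =
      ellInv (cosines u) := by
  rw [map_ellInv]
  congr 1
  ext j k
  rw [evalAt_dotPoly, cosines]

/-- The basis series before expansion in the charges, at given points of the sphere. -/
lemma map_basisSeries [NeZero D] (A : Fin (m + 1) → I) (u : Fin (m + 1) → UnitSphere D)
    (κ : Charges m) :
    PowerSeries.map (evalAt fun k => coord (u k)) (basisSeries p N A₀ κ₀ P A κ) =
      toThermal ((∑ s : Perm (Fin (m + 1)), if A ∘ s = A₀ then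
        MvPowerSeries.C (statSign p A s * evalAt ((fun k => coord (u k)) ∘ s) P) *
          thetaSeries N (p ∘ A) (κ₀ ∘ ⇑s⁻¹) else 0) * ellInv (cosines u) ^ N) κ := by
  rw [basisSeries, map_toThermal, map_harmonicSeries, map_mul, map_numeratorSeries, map_pow,
    map_ellInv_dotPoly]

lemma coeff_mul_mem_degLE {w : ℕ} {f g : MvPowerSeries (Fin (m + 1)) (PointPoly D (m + 1))}
    (hf : ∀ e, coeff e f ∈ degLE (fun _ => w)) (hg : g ∈ degBounded m D) (e : Fin (m + 1) →₀ ℕ) :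
    coeff e (f * g) ∈ degLE (gapWeight e + fun _ => w) :=
  coeff_mul_mem (fun _ => degLE fun _ => w) (fun e => degLE (gapWeight e))
    (fun e => degLE (gapWeight e + fun _ => w)) (fun a b x y hx hy => by
      refine degLE_mono ?_ (mul_mem_degLE hx hy)
      rw [gapWeight_add]
      intro k
      simp only [Pi.add_apply]
      omega) hf hg e

lemma C_mem_degLE {n : ℕ} (w : Fin n → ℕ) (a : ℂ) :
    (MvPolynomial.C a : PointPoly D n) ∈ degLE w := fun s hs k => by
  have h1 := MvPolynomial.support_monomial_subset hs
  rw [Finset.mem_singleton] at h1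
  simp [h1]

lemma exists_coeff_numeratorSeries_mem (A : Fin (m + 1) → I) :
    ∃ w : ℕ, ∀ e, coeff e (numeratorSeries p N A₀ κ₀ P A) ∈ degLE (fun _ => w) := by
  refine ⟨∑ s : Perm (Fin (m + 1)), ∑ k, 2 * degIn k (permPoly s P), fun e => ?_⟩
  rw [numeratorSeries, map_sum]
  refine sum_mem fun s _ => ?_
  split_ifs
  · have h1 : permPoly s P ∈ degLE (D := D) (fun _ : Fin (m + 1) =>
        ∑ s : Perm (Fin (m + 1)), ∑ k, 2 * degIn k (permPoly s P)) := by
      refine degLE_iff_degIn.2 fun k => ?_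
      refine le_trans ?_ (single_le_sum (f := fun s : Perm (Fin (m + 1)) =>
        ∑ k, 2 * degIn k (permPoly s P)) (fun _ _ => Nat.zero_le _) (mem_univ s))
      exact single_le_sum (f := fun k => 2 * degIn k (permPoly s P))
        (fun _ _ => Nat.zero_le _) (mem_univ k)
    rw [MvPowerSeries.coeff_C_mul, MvPowerSeries.coeff_map]
    have h2 := mul_mem_degLE (mul_mem_degLE (C_mem_degLE (D := D) 0 (statSign p A s)) h1)
      (C_mem_degLE 0 (coeff e (thetaSeries N (p ∘ A) (κ₀ ∘ ⇑s⁻¹))))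
    rwa [zero_add, add_zero] at h2
  · rw [map_zero]; exact zero_mem _

lemma memPlus_basisSeries [NeZero D] (A : Fin (m + 1) → I) :
    MemPlus (basisSeries p N A₀ κ₀ P A) := by
  obtain ⟨w, hw⟩ := exists_coeff_numeratorSeries_mem (p := p) (N := N) (A₀ := A₀) (κ₀ := κ₀)
    (P := P) A
  refine memPlus_toThermal (w := w) (fun e => isMultiHarmonic_harmonicProj _) fun e => ?_
  exact harmonicProj_mem_degLE (coeff_mul_mem_degLE hw (pow_mem ellInv_mem_degBounded N) e)

lemma basisSeries_ne_zero [NeZero D] {A : Fin (m + 1) → I} {κ : Charges m}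
    (h : basisSeries p N A₀ κ₀ P A κ ≠ 0) : ∃ e, charge e = κ ∧
      coeff e (numeratorSeries p N A₀ κ₀ P A * ellInv (fun j k => dotPoly j k) ^ N) ≠ 0 := by
  obtain ⟨j, hj⟩ : ∃ j, PowerSeries.coeff j (basisSeries p N A₀ κ₀ P A κ) ≠ 0 := by
    by_contra! h'
    exact h (PowerSeries.ext h')
  obtain ⟨e, h1, _, h2⟩ := coeff_toThermal_ne_zero hj
  refine ⟨e, h1, fun h3 => hj ?_⟩
  refine h2.trans ?_
  rw [coeff_harmonicSeries, h3, harmonicProj_zero]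

lemma parity_basisSeries [NeZero D] (h : Admissible N (p ∘ A₀) κ₀) {A : Fin (m + 1) → I}
    {κ : Charges m} (hE : basisSeries p N A₀ κ₀ P A κ ≠ 0) (k : Fin (m + 1)) :
    (κ k : ZMod 2) = p (A k) := by
  classical
  obtain ⟨e, rfl, he⟩ := basisSeries_ne_zero hE
  rw [MvPowerSeries.coeff_mul] at he
  obtain ⟨x, hx, hne⟩ := Finset.exists_ne_zero_of_sum_ne_zero he
  rw [mem_antidiagonal] at hx
  have h1 := left_ne_zero_of_mul hne
  have h2 := right_ne_zero_of_mul hne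
  rw [← hx, charge_add, Pi.add_apply, Int.cast_add]
  have h3 : (charge x.2 k : ZMod 2) = 0 := by
    have ha := even_of_mem_evenSeries (pow_mem (ellInv_mem_evenSeries _) N) h2
    rw [charge, Int.cast_sub, Int.cast_natCast, Int.cast_natCast,
      (ZMod.natCast_eq_zero_iff_even).2 (ha k), (ZMod.natCast_eq_zero_iff_even).2 (ha (k + 1)),
      sub_zero]
  rw [h3, add_zero]
  rw [numeratorSeries, map_sum] at h1
  obtain ⟨s, _, hs⟩ := Finset.exists_ne_zero_of_sum_ne_zero h1
  split_ifs at hs with hA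
  · rw [MvPowerSeries.coeff_C_mul, MvPowerSeries.coeff_map] at hs
    refine parity_of_coeff_thetaSeries (admissible_comp_inv h hA) (fun h0 => hs ?_) k
    rw [h0, map_zero, mul_zero]
  · exact absurd (map_zero _) hs

lemma pval_C_mul {σ : Type*} (x : σ → ℂ) (a : ℂ) (f : MvPowerSeries σ ℂ) :
    pval x (MvPowerSeries.C a * f) = a * pval x f := by
  simp only [pval, MvPowerSeries.coeff_C_mul, mul_assoc, tsum_mul_left]

lemma wnorm_C_ne_top {σ : Type*} (r : σ → ℝ≥0) (a : ℂ) :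
    wnorm r (MvPowerSeries.C a : MvPowerSeries σ ℂ) ≠ ∞ := by
  rw [← MvPowerSeries.monomial_zero_eq_C_apply, wnorm_monomial]
  exact ENNReal.coe_ne_top

lemma wnorm_sum_ne_top {σ α : Type*} {r : σ → ℝ≥0} {s : Finset α} {F : α → MvPowerSeries σ ℂ}
    (h : ∀ a ∈ s, wnorm r (F a) ≠ ∞) : wnorm r (∑ a ∈ s, F a) ≠ ∞ :=
  ((wnorm_sum_le r s F).trans_lt (ENNReal.sum_lt_top.2 fun a ha => (h a ha).lt_top)).ne

lemma pval_sum {σ α : Type*} {x : σ → ℂ} {s : Finset α} {F : α → MvPowerSeries σ ℂ}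
    (h : ∀ a ∈ s, wnorm (fun i => ‖x i‖₊) (F a) ≠ ∞) :
    pval x (∑ a ∈ s, F a) = ∑ a ∈ s, pval x (F a) := by
  refine HasSum.unique ((hasSum_pval (wnorm_sum_ne_top h))) ?_
  refine (hasSum_sum fun a ha => hasSum_pval (h a ha)).congr_fun fun e => ?_
  rw [map_sum, sum_mul]

lemma convergesTo_basisSeries [NeZero D] (h : Admissible N (p ∘ A₀) κ₀) (A : Fin (m + 1) → I) :
    ConvergesTo (basisSeries p N A₀ κ₀ P A) (basisFun p N A₀ κ₀ P A) := by
  intro ζ τ hx u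
  have hτ := hx.1
  set x := gapPoint ζ τ
  set r : Fin (m + 1) → ℝ≥0 := fun i => ‖x i‖₊
  have hr : ∀ i, r i < 1 := fun i => norm_gapPoint_lt_one hx i
  set F : Perm (Fin (m + 1)) → MvPowerSeries (Fin (m + 1)) ℂ := fun s => if A ∘ s = A₀ then
        MvPowerSeries.C (statSign p A s * evalAt ((fun k => coord (u k)) ∘ s) P) *
          thetaSeries N (p ∘ A) (κ₀ ∘ ⇑s⁻¹) else 0 with hF
  have hF1 : ∀ s ∈ univ, wnorm r (F s) ≠ ∞ := fun s _ => by
    simp only [hF]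
    split_ifs with hA
    · exact wnorm_mul_ne_top (wnorm_C_ne_top _ _)
        (pval_thetaSeries (admissible_comp_inv h hA) ζ hτ).1
    · simp [wnorm]
  have hF2 : ∀ s, pval x (F s) = mpow x (arcsExp m) ^ N * (if A ∘ s = A₀ then
      statSign p A s * thetaFun N (p ∘ A) (κ₀ ∘ ⇑s⁻¹) ζ τ *
        evalAt ((fun k => coord (u k)) ∘ s) P else 0) := fun s => by
    simp only [hF]
    split_ifs with hA
    · rw [pval_C_mul, (pval_thetaSeries (admissible_comp_inv h hA) ζ hτ).2]; ring
    · simp [pval]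
  have hE := wnorm_pow_ne_top (wnorm_ellInv_ne_top u hr) N
  have hs := wnorm_sum_ne_top hF1
  have h1 := hasSum_toThermal (wnorm_mul_ne_top hs hE)
  have h2 : pval x ((∑ s, F s) * ellInv (cosines u) ^ N) = basisFun p N A₀ κ₀ P A ζ u τ := by
    have h3 := pval_ellInv u hx
    rw [pval_mul hs hE, pval_pow (wnorm_ellInv_ne_top u hr), pval_sum hF1,
      sum_congr rfl fun s _ => hF2 s, ← mul_sum]
    change _ = (∑ s : Perm (Fin (m + 1)), _) / _
    have h4 : negProduct ζ u τ ≠ 0 := fun h0 => by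
      change _ * negProduct ζ u τ * _ = 1 at h3
      rw [h0, mul_zero, zero_mul] at h3
      exact zero_ne_one h3
    rw [eq_div_iff (pow_ne_zero N h4)]
    have h5 : mpow x (arcsExp m) ^ N * negProduct ζ u τ ^ N * pval x (ellInv (cosines u)) ^ N = 1 :=
      by
      rw [← mul_pow, ← mul_pow]
      exact (congrArg (· ^ N) h3).trans (one_pow N)
    linear_combination (∑ s : Perm (Fin (m + 1)), (if A ∘ s = A₀ then
      statSign p A s * thetaFun N (p ∘ A) (κ₀ ∘ ⇑s⁻¹) ζ τ *
        evalAt ((fun k => coord (u k)) ∘ s) P else 0)) * h5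
  rw [h2] at h1
  refine h1.congr_fun fun y => ?_
  rw [← map_basisSeries, PowerSeries.coeff_map]

lemma analyticAt_numerator (h : Admissible N (p ∘ A₀) κ₀) (A : Fin (m + 1) → I)
    {x : (Fin (m + 1) → ℂ) × (Fin (m + 1) → Fin D → ℂ) × ℂ} (hx : 0 < x.2.2.im) :
    AnalyticAt ℂ (numerator p N A₀ κ₀ P A) x := by
  refine Finset.analyticAt_fun_sum _ fun s _ => ?_
  split_ifs with hA
  · refine (analyticAt_const.mul ?_).mul ?_
    · exact AnalyticAt.fun_comp (g := fun y : (Fin (m + 1) → ℂ) × ℂ =>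
        thetaFun N (p ∘ A) (κ₀ ∘ ⇑s⁻¹) y.1 y.2)
        (f := fun y : (Fin (m + 1) → ℂ) × (Fin (m + 1) → Fin D → ℂ) × ℂ => (y.1, y.2.2))
        (analyticAt_thetaFun (admissible_comp_inv h hA) hx)
        (analyticAt_fst.prod (analyticAt_snd_snd x))
    · have h1 := AnalyticAt.aeval_mvPolynomial (𝕜 := ℂ) (A := ℂ) (z := x)
        (f := fun (y : (Fin (m + 1) → ℂ) × (Fin (m + 1) → Fin D → ℂ) × ℂ)
          (i : Fin (m + 1) × Fin D) => y.2.1 (s i.1) i.2)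
        (fun i => analyticAt_snd_fst_apply x (s i.1) i.2) P
      exact h1
  · exact analyticAt_const

/-- The sum over permutations makes the numerator symmetric. -/
lemma numerator_comp (h : Admissible N (p ∘ A₀) κ₀) (A : Fin (m + 1) → I)
    (t : Perm (Fin (m + 1))) (ζ : Fin (m + 1) → ℂ) (z : Fin (m + 1) → Fin D → ℂ) (τ : ℂ) :
    numerator p N A₀ κ₀ P (A ∘ t) (ζ ∘ t, z ∘ t, τ) =
      statSign p A t * numerator p N A₀ κ₀ P A (ζ, z, τ) := by
  rw [numerator, numerator, mul_sum]
  refine (sum_congr rfl fun s _ => ?_).trans (Equiv.sum_comp (Equiv.mulLeft t) _)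
  by_cases hA : (A ∘ t) ∘ s = A₀
  · have h0 : A ∘ ⇑(Equiv.mulLeft t s) = A₀ := hA
    rw [if_pos hA, if_pos h0, Equiv.coe_mulLeft, statSign_mul]
    have hq := (admissible_comp_inv h (s := t * s) hA)
    have h1 := thetaFun_comp (κ₀ := κ₀ ∘ ⇑(t * s)⁻¹) hq.pos hq.sum_parity t ζ τ
    have h2 : (κ₀ ∘ ⇑(t * s)⁻¹) ∘ t = κ₀ ∘ ⇑s⁻¹ := by
      ext k; simp
    rw [h2] at h1
    rw [← h1]
    have h3 := statSign_mul_self p A t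
    have h4 : (z ∘ t) ∘ s = z ∘ ⇑(t * s) := rfl
    rw [h4]
    change statSign p (A ∘ t) s * thetaFun N (p ∘ A ∘ t) _ _ τ * evalAt _ P = statSign p A t *
      (statSign p A t * statSign p (A ∘ t) s * thetaFun N (p ∘ A ∘ t) _ _ τ * evalAt _ P)
    linear_combination -(statSign p (A ∘ t) s * thetaFun N (p ∘ A ∘ t) (κ₀ ∘ ⇑s⁻¹) (ζ ∘ t) τ *
      evalAt (z ∘ ⇑(t * s)) P) * h3
  · have h0 : ¬A ∘ ⇑(Equiv.mulLeft t s) = A₀ := hA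
    rw [if_neg hA, if_neg h0, mul_zero]

lemma numerator_add_one (h : Admissible N (p ∘ A₀) κ₀) (A : Fin (m + 1) → I)
    (k : Fin (m + 1)) (ζ : Fin (m + 1) → ℂ) (z : Fin (m + 1) → Fin D → ℂ) (τ : ℂ) :
    numerator p N A₀ κ₀ P A (ζ + Pi.single k 1, z, τ) =
      (-1) ^ (p (A k)).val * numerator p N A₀ κ₀ P A (ζ, z, τ) := by
  rw [numerator, numerator, mul_sum]
  refine sum_congr rfl fun s _ => ?_
  split_ifs with hA
  · simp only [thetaFun_add_one (admissible_comp_inv h hA), comp_apply]; ring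
  · rw [mul_zero]

lemma numerator_add_tau (h : Admissible N (p ∘ A₀) κ₀) (A : Fin (m + 1) → I)
    (k : Fin (m + 1)) (ζ : Fin (m + 1) → ℂ) (z : Fin (m + 1) → Fin D → ℂ) (τ : ℂ) :
    numerator p N A₀ κ₀ P A (ζ + Pi.single k τ, z, τ) =
      (-1) ^ (p (A k)).val * (exp (-(2 * pi * Complex.I * N * m * τ) -
        4 * pi * Complex.I * N * ((m + 1) * ζ k - ∑ l, ζ l)) *
        numerator p N A₀ κ₀ P A (ζ, z, τ)) := by
  rw [numerator, numerator, mul_sum, mul_sum]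
  refine sum_congr rfl fun s _ => ?_
  split_ifs with hA
  · simp only [thetaFun_add_tau (admissible_comp_inv h hA), comp_apply]; ring
  · rw [mul_zero, mul_zero]

/-- The factor of automorphy of the product of the elliptic intervals agrees with the one of the
theta functions. -/
lemma prod_exp_pow (ζ : Fin (m + 1) → ℂ) (τ : ℂ) (k : Fin (m + 1)) :
    (∏ l, if l = k then 1 else
      exp (-(2 * pi * Complex.I * τ) - 4 * pi * Complex.I * (ζ k - ζ l))) ^ N =
    exp (-(2 * pi * Complex.I * N * m * τ) -
        4 * pi * Complex.I * N * ((m + 1) * ζ k - ∑ l, ζ l)) := by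
  have h1 : ∀ l, (if l = k then 1 else
      exp (-(2 * pi * Complex.I * τ) - 4 * pi * Complex.I * (ζ k - ζ l))) =
      exp (-(2 * pi * Complex.I * τ) - 4 * pi * Complex.I * (ζ k - ζ l) +
        if l = k then 2 * pi * Complex.I * τ else 0) := fun l => by
    split_ifs with h
    · rw [h, ← Complex.exp_zero]; congr 1; ring
    · rw [add_zero]
  rw [prod_congr rfl fun l _ => h1 l, ← Complex.exp_sum, ← Complex.exp_nat_mul]
  congr 1
  rw [sum_add_distrib, sum_sub_distrib, ← mul_sum, sum_sub_distrib]
  simp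
  ring

lemma isEllipticFamily_basis [NeZero D] (h : Admissible N (p ∘ A₀) κ₀) :
    IsEllipticFamily p N (basisSeries p N A₀ κ₀ P) (basisFun p N A₀ κ₀ P) where
  memPlus := memPlus_basisSeries
  differences A κ hκ := by
    obtain ⟨e, rfl, _⟩ := basisSeries_ne_zero hκ
    exact sum_charge e
  parity A κ hκ := parity_basisSeries h hκ
  convergesTo := convergesTo_basisSeries h
  meromorphic A ζ₀ u₀ τ₀ hτ := by
    refine ⟨numerator p N A₀ κ₀ P A, fun x => negProductC x ^ N, analyticAt_numerator h A hτ,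
      (analyticAt_negProductC hτ).pow N,
      (frequently_negProductC_ne_zero ζ₀ u₀ hτ).mono fun x hx => pow_ne_zero N hx, ?_⟩
    have h1 : ∀ᶠ x in nhds (ζ₀, u₀, τ₀), 0 < x.2.2.im := by
      refine (isOpen_lt continuous_const ?_).mem_nhds hτ
      exact Complex.continuous_im.comp (continuous_snd.comp continuous_snd)
    filter_upwards [h1] with x hx _
    rw [basisFun, negProduct_eq_negProductC _ _ hx]
  denominator A := by
    refine ⟨fun x => pairSign (m + 1) ^ N * numerator p N A₀ κ₀ P A x,
      fun x hx => analyticAt_const.mul (analyticAt_numerator h A hx), fun ζ u τ _ h0 => ?_⟩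
    have h2 := pairSign_mul_self (m + 1)
    have h3 : pairSign (m + 1) ≠ 0 := fun h' => by simp [h'] at h2
    rw [basisFun, negProduct_eq, mul_pow, div_eq_div_iff
      (mul_ne_zero (pow_ne_zero _ h3) (pow_ne_zero _ h0)) (pow_ne_zero _ h0)]
    have h4 : pairSign (m + 1) ^ N * pairSign (m + 1) ^ N = 1 := by rw [← mul_pow, h2, one_pow]
    linear_combination -(numerator p N A₀ κ₀ P A (ζ, fun k => coord (u k), τ) *
      ellProduct ζ u τ ^ N) * h4
  periodic A k ζ u τ _ := by
    constructor
    · rw [basisFun, basisFun, negProduct_add_one, numerator_add_one h, mul_div_assoc]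
    · rw [basisFun, basisFun, negProduct_add_tau, numerator_add_tau h, mul_pow, prod_exp_pow,
        mul_div_assoc, mul_div_mul_left _ _ (Complex.exp_ne_zero _)]
  symmetric A s ζ u τ _ := by
    rw [basisFun, basisFun, negProduct_comp, ← mul_div_assoc, ← numerator_comp h]
    rfl

end Family

/-! ### Derivatives of homogeneous harmonic polynomials -/

/-- A sum over the terms `(z²)^n h_{m,σ}(z)` of degree `k` with `n > -N`. -/
lemma finsum_level {V : Type*} [AddCommGroup V] (g : ℤ × ℕ → V) (k N : ℤ)
    (hg : ∀ x, x.1 ≤ -N → g x = 0) :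
    (∑ᶠ x : ℤ × ℕ, if 2 * x.1 + (x.2 : ℤ) = k then g x else 0) =
      ∑ i ∈ range (k / 2 + N).toNat, g (i + 1 - N, (k - 2 * (i + 1 - N)).toNat) := by
  classical
  set e : ℕ → ℤ × ℕ := fun i => (i + 1 - N, (k - 2 * (i + 1 - N)).toNat)
  have he : Function.Injective e := fun i j hij => by
    have := (Prod.mk.inj hij).1
    omega
  rw [finsum_eq_sum_of_support_subset (s := (range (k / 2 + N).toNat).image e),
    Finset.sum_image he.injOn]
  · refine sum_congr rfl fun i hi => if_pos ?_
    rw [mem_range] at hi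
    change 2 * ((i : ℤ) + 1 - N) + ((k - 2 * ((i : ℤ) + 1 - N)).toNat : ℤ) = k
    omega
  · intro x hx
    rw [Function.mem_support] at hx
    split_ifs at hx with h
    · have h1 : ¬x.1 ≤ -N := fun h' => hx (hg x h')
      rw [Finset.coe_image]
      refine ⟨(x.1 + N - 1).toNat, ?_, Prod.ext ?_ ?_⟩
      · rw [Finset.coe_range, Set.mem_Iio]; omega
      · change (((x.1 + N - 1).toNat : ℤ) + 1 - N) = x.1; omega
      · change (k - 2 * (((x.1 + N - 1).toNat : ℤ) + 1 - N)).toNat = x.2; omega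
    · exact absurd rfl hx

lemma dot_add_smul {D : ℕ} (z w : Fin D → ℂ) (t : ℂ) : dot (z + t • w) (z + t • w) =
    dot z z + 2 * dot z w * t + dot w w * t ^ 2 := by
  simp only [dot, Pi.add_apply, Pi.smul_apply, smul_eq_mul, mul_sum, sum_mul,
    ← sum_add_distrib]
  exact sum_congr rfl fun α _ => by ring

lemma hasDerivAt_eval_line {D : ℕ} (P : MvPolynomial (Fin D) ℂ) (z w : Fin D → ℂ) (t : ℂ) :
    HasDerivAt (fun t => eval (z + t • w) P)
      (∑ α, w α * eval (z + t • w) (pderiv α P)) t := by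
  classical
  induction P using MvPolynomial.induction_on with
  | C a => simpa using hasDerivAt_const t a
  | add P Q hP hQ =>
    refine ((hP.add hQ).congr_deriv ?_).congr_of_eventuallyEq (.of_forall fun t => by simp)
    rw [← sum_add_distrib]
    exact sum_congr rfl fun α _ => by rw [map_add, map_add, mul_add]
  | mul_X P i hP =>
    have h1 : HasDerivAt (fun t : ℂ => z i + t * w i) (1 * w i) t :=
      ((hasDerivAt_id t).mul_const (w i)).const_add (z i)
    refine ((hP.mul h1).congr_deriv ?_).congr_of_eventuallyEq (.of_forall fun t => by simp)
    have h2 : ∀ α, w α * eval (z + t • w) (pderiv α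
        (P * MvPolynomial.X i)) = w α * eval (z + t • w) (pderiv α P) *
          (z i + t * w i) + if α = i then w i * eval (z + t • w) P else 0 :=
      fun α => by
      rw [MvPolynomial.pderiv_mul, map_add, map_mul, map_mul, MvPolynomial.eval_X]
      rcases eq_or_ne α i with rfl | h
      · simp; ring
      · rw [MvPolynomial.pderiv_X_of_ne h.symm]; simp [h]; ring
    rw [sum_congr rfl fun α _ => h2 α, sum_add_distrib, sum_mul]
    simp; ring

lemma sum_mul_gradient {D : ℕ} {P : MvPolynomial (Fin D) ℂ} {m : ℕ} (hP : P.IsHomogeneous m)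
    {z : Fin D → ℂ} (hz : dot z z ≠ 0) (n : ℤ) :
    ∑ α, z α * ((n : ℂ) * dot z z ^ (n - 1) * (2 * z α) * eval z P +
      dot z z ^ n * eval z (pderiv α P)) =
    (2 * n + m) * (dot z z ^ n * eval z P) := by
  have h1 := congrArg (eval z) hP.sum_X_mul_pderiv
  rw [map_sum, map_nsmul, nsmul_eq_mul] at h1
  simp only [map_mul, MvPolynomial.eval_X] at h1
  have h2 : dot z z ^ n = dot z z ^ (n - 1) * ∑ α, z α * z α := by
    rw [← dot, ← zpow_add_one₀ hz, sub_add_cancel]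
  have h3 : ∀ α, z α * ((n : ℂ) * dot z z ^ (n - 1) * (2 * z α) * eval z P +
      dot z z ^ n * eval z (pderiv α P)) =
      2 * n * eval z P * dot z z ^ (n - 1) * (z α * z α) +
      dot z z ^ n * (z α * eval z (pderiv α P)) := fun α => by ring
  rw [sum_congr rfl fun α _ => h3 α, sum_add_distrib, ← mul_sum,
    ← mul_sum, h1]
  linear_combination (-(2 * n * eval z P)) * h2

lemma hasDerivAt_dot_zpow_mul_eval {D : ℕ} (P : MvPolynomial (Fin D) ℂ) (e w : Fin D → ℂ) {t : ℂ}
    (ht : dot (e + t • w) (e + t • w) ≠ 0) (n : ℤ) :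
    HasDerivAt (fun t => dot (e + t • w) (e + t • w) ^ n * eval (e + t • w) P)
      (∑ α, w α * ((n : ℂ) * dot (e + t • w) (e + t • w) ^ (n - 1) * (2 * (e + t • w) α) *
        eval (e + t • w) P + dot (e + t • w) (e + t • w) ^ n *
          eval (e + t • w) (pderiv α P))) t := by
  have h2 : HasDerivAt (fun t : ℂ => dot (e + t • w) (e + t • w))
      (∑ α, w α * (2 * (e + t • w) α)) t := by
    have h3 : HasDerivAt (fun t : ℂ => dot e e + 2 * dot e w * t + dot w w * t ^ 2)
        (2 * dot e w * 1 + dot w w * ((2 : ℕ) * t ^ (2 - 1) * 1)) t :=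
      (((hasDerivAt_id t).const_mul _).const_add _).add (((hasDerivAt_id t).pow 2).const_mul _)
    refine (h3.congr_deriv ?_).congr_of_eventuallyEq (.of_forall fun t => dot_add_smul _ _ _)
    simp only [dot, mul_sum, sum_mul, ← sum_add_distrib]
    exact sum_congr rfl fun α _ => by simp; ring
  have h3 : HasDerivAt (fun t : ℂ => dot (e + t • w) (e + t • w) ^ n)
      ((n : ℂ) * dot (e + t • w) (e + t • w) ^ (n - 1) * ∑ α, w α * (2 * (e + t • w) α)) t :=
    HasDerivAt.comp (h₂ := fun x => x ^ n) t
      (hasDerivAt_zpow n (dot (e + t • w) (e + t • w)) (Or.inl ht)) h2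
  refine (h3.mul (hasDerivAt_eval_line P e w t)).congr_deriv ?_
  rw [mul_sum, mul_sum, sum_mul, ← sum_add_distrib]
  exact sum_congr rfl fun α _ => by ring

lemma isHomogeneous_basis {D : ℕ} {ι : ℕ → Type*} {h : ∀ m, Module.Basis (ι m) ℂ (harmonic D m)}
    (m : ℕ) (σ : ι m) : (h m σ : MvPolynomial (Fin D) ℂ).IsHomogeneous m :=
  (MvPolynomial.mem_homogeneousSubmodule _ _).1 (h m σ).2.1

lemma lap_basis {D : ℕ} {ι : ℕ → Type*} {h : ∀ m, Module.Basis (ι m) ℂ (harmonic D m)}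
    (m : ℕ) (σ : ι m) : lap id (h m σ : MvPolynomial (Fin D) ℂ) = 0 :=
  LinearMap.mem_ker.1 (h m σ).2.2

/-! ### Backward differences -/

/-- The backward difference operator. -/
def nabla : End ℂ (ℤ → ℂ) where
  toFun f k := f k - f (k - 1)
  map_add' f g := by ext k; simp; ring
  map_smul' c f := by ext k; simp; ring

lemma nabla_apply (f : ℤ → ℂ) (k : ℤ) : nabla f k = f k - f (k - 1) := rfl

/-- A sequence on `ℤ` that is annihilated by a power of the difference operator (a polynomial) and
vanishes for large `k` is zero. -/
lemma eq_zero_of_nabla_pow {M : ℕ} {f : ℤ → ℂ} {K : ℤ} (hM : (nabla ^ M) f = 0)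
    (hK : ∀ k ≥ K, f k = 0) : f = 0 := by
  induction M generalizing f K with
  | zero => simpa using hM
  | succ M ih =>
    rw [pow_succ, Module.End.mul_apply] at hM
    have h1 : nabla f = 0 := ih hM (K := K + 1) fun k hk => by
      rw [nabla_apply, hK k (by omega), hK (k - 1) (by omega), sub_zero]
    have h2 : ∀ i : ℕ, f (K - i) = 0 := fun i => by
      induction i with
      | zero => simpa using hK K le_rfl
      | succ i ih =>
        have h3 := congrFun h1 (K - i)
        rw [nabla_apply, ih, zero_sub, Pi.zero_apply, neg_eq_zero] at h3
        rw [← h3]; congr 1; push_cast; ring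
    ext k
    rcases le_or_gt K k with h3 | h3
    · exact hK k h3
    · have := h2 (K - k).toNat
      rwa [show K - ((K - k).toNat : ℤ) = k by omega] at this

/-- The polynomial `(k + 1) ⋯ (k + n)`. -/
def rising (n : ℕ) (k : ℤ) : ℂ := ∏ i ∈ range n, ((k : ℂ) + 1 + i)

lemma rising_succ (n : ℕ) (k : ℤ) : rising (n + 1) k = rising n k * (k + 1 + n) :=
  Finset.prod_range_succ _ _

lemma rising_succ' (n : ℕ) (k : ℤ) : rising (n + 1) k = rising n (k + 1) * (k + 1) := by
  rw [rising, Finset.prod_range_succ', rising]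
  push_cast
  congr 1
  · exact prod_congr rfl fun i _ => by ring
  · ring

lemma nabla_pow_rising (n : ℕ) : (nabla ^ (n + 1)) (rising n) = 0 := by
  induction n with
  | zero => ext k; simp [nabla_apply, rising]
  | succ n ih =>
    have h1 : nabla (rising (n + 1)) = ((n : ℂ) + 1) • rising n := by
      ext k
      have h2 := rising_succ' n (k - 1)
      rw [sub_add_cancel] at h2
      rw [nabla_apply, h2, rising_succ, Pi.smul_apply, smul_eq_mul]
      push_cast; ring
    rw [pow_succ, Module.End.mul_apply, h1, map_smul, ih, smul_zero]

lemma rising_zero_right (n : ℕ) : rising n 0 = n.factorial := by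
  induction n with
  | zero => simp [rising]
  | succ n ih => rw [rising_succ, ih, Nat.factorial_succ]; push_cast; ring

lemma rising_neg (n : ℕ) : rising n (-n - 1) = (-1) ^ n * n.factorial := by
  induction n with
  | zero => simp [rising]
  | succ n ih =>
    rw [rising_succ', show (-((n + 1 : ℕ) : ℤ) - 1 + 1) = -n - 1 by push_cast; ring, ih,
      Nat.factorial_succ]
    push_cast; ring

/-! ### Products with elliptic intervals at the origin of the nome -/

section MulInterval

variable {D : ℕ} {V V' : Type*} [AddCommGroup V] [Module ℂ V] [AddCommGroup V'] [Module ℂ V']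
  (z w : Fin D → ℂ)

lemma mulInterval_zero : mulInterval z w (0 : ℤ → ℤ → V) = 0 := by
  ext; simp [mulInterval]

lemma iterate_mulInterval_zero (M : ℕ) : (mulInterval z w)^[M] (0 : ℤ → ℤ → V) = 0 :=
  Function.iterate_fixed (mulInterval_zero z w) M

lemma iterate_mulInterval_eq_zero_of_le {M M' : ℕ} (hM : M ≤ M') {f : ℤ → ℤ → V}
    (h : (mulInterval z w)^[M] f = 0) : (mulInterval z w)^[M'] f = 0 := by
  obtain ⟨i, rfl⟩ := Nat.exists_eq_add_of_le' hM
  rw [Function.iterate_add_apply, h, iterate_mulInterval_zero]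

lemma iterate_mulInterval_map (φ : V →ₗ[ℂ] V') (M : ℕ) (f : ℤ → ℤ → V) :
    (mulInterval z w)^[M] (fun a b => φ (f a b)) =
      fun a b => φ ((mulInterval z w)^[M] f a b) := by
  induction M generalizing f with
  | zero => rfl
  | succ M ih =>
    rw [Function.iterate_succ_apply, Function.iterate_succ_apply, ← ih]
    congr 1
    ext a b
    simp only [mulInterval, map_add, map_sub, map_smul]

lemma iterate_mulInterval_add (M : ℕ) (f g : ℤ → ℤ → V) :
    (mulInterval z w)^[M] (f + g) = (mulInterval z w)^[M] f + (mulInterval z w)^[M] g := by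
  induction M generalizing f g with
  | zero => rfl
  | succ M ih =>
    rw [Function.iterate_succ_apply, Function.iterate_succ_apply, Function.iterate_succ_apply,
      ← ih]
    congr 1
    ext a b
    simp only [mulInterval, Pi.add_apply, smul_add]
    abel

lemma iterate_mulInterval_sum {K : Type*} (s : Finset K) (M : ℕ) (f : K → ℤ → ℤ → V) :
    (mulInterval z w)^[M] (∑ x ∈ s, f x) = ∑ x ∈ s, (mulInterval z w)^[M] (f x) := by
  classical
  induction s using Finset.induction_on with
  | empty => rw [Finset.sum_empty, Finset.sum_empty, iterate_mulInterval_zero]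
  | insert x s hx ih => rw [sum_insert hx, sum_insert hx, iterate_mulInterval_add, ih]

variable {z w}

/-- Multiplication by `(z - w)²` has no kernel on series whose powers of `w` are bounded below. -/
lemma eq_zero_of_mulInterval (hz : dot z z ≠ 0) {f : ℤ → ℤ → V} {K : ℤ}
    (hK : ∀ a, ∀ b < K, f a b = 0) (h : mulInterval z w f = 0) : f = 0 := by
  have h1 : ∀ i : ℕ, ∀ b < K + i, ∀ a, f a b = 0 := fun i => by
    induction i with
    | zero => exact fun b hb a => hK a b (by simpa using hb)
    | succ i ih =>
      intro b hb a
      have h2 := congrFun (congrFun h (a + 2)) b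
      simp only [mulInterval, Pi.zero_apply] at h2
      rw [ih (b - 1) (by push_cast at hb; omega), ih (b - 2) (by push_cast at hb; omega), smul_zero,
        smul_zero, sub_zero, add_zero, smul_eq_zero, add_sub_cancel_right] at h2
      exact h2.resolve_left hz
  ext a b
  exact h1 (b - K + 1).toNat b (by omega) a

lemma eq_zero_of_iterate_mulInterval (hz : dot z z ≠ 0) {M : ℕ} {f : ℤ → ℤ → V} {K : ℤ}
    (hK : ∀ a, ∀ b < K, f a b = 0) (h : (mulInterval z w)^[M] f = 0) : f = 0 := by
  induction M generalizing f with
  | zero => exact h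
  | succ M ih =>
    rw [Function.iterate_succ_apply] at h
    refine eq_zero_of_mulInterval hz hK (ih (fun a b hb => ?_) h)
    simp only [mulInterval]
    rw [hK _ b hb, hK _ (b - 1) (by omega), hK _ (b - 2) (by omega)]
    simp

/-- At coinciding points, multiplication by the interval acts by differences on a series
concentrated in one total degree. -/
lemma iterate_mulInterval_self (hz : dot z z = 1) (M : ℕ) (c : ℤ) (f : ℤ → ℂ) :
    (mulInterval z z)^[M] (fun a b => if a + b = c then f b else 0) =
      fun a b => if a + b = c + 2 * M then (nabla ^ (2 * M)) f b else 0 := by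
  induction M generalizing c f with
  | zero => simp
  | succ M ih =>
    have h1 : mulInterval z z (fun a b => if a + b = c then f b else 0) =
        fun a b => if a + b = c + 2 then (nabla ^ 2) f b else 0 := by
      ext a b
      simp only [mulInterval, hz, smul_eq_mul, mul_one, sq, Module.End.mul_apply,
        nabla_apply, sub_sub, one_add_one_eq_two]
      by_cases h : a + b = c + 2
      · rw [if_pos h, if_pos (by omega), if_pos (by omega), if_pos (by omega)]; ring
      · rw [if_neg h, if_neg (by omega), if_neg (by omega), if_neg (by omega)]; ring
    rw [Function.iterate_succ_apply, h1, ih]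
    ext a b
    rw [← Module.End.mul_apply, ← pow_add, show c + 2 + 2 * (M : ℤ) = c + 2 * ((M + 1 : ℕ) : ℤ) by
      push_cast; ring]
    rfl

end MulInterval

/-! ### Interval operators on sequences -/

/-- The operator by which the Laurent polynomial `X^μ + X^{-μ} - 2c` acts on functions. -/
def ellOp {G W : Type*} [AddGroup G] [AddCommGroup W] [Module ℂ W] (μ : G) (c : ℂ) (F : G → W) :
    G → W := fun κ => F (κ + μ) + F (κ - μ) - (2 * c) • F κ

section EllOp

variable {G W W' : Type*} [AddCommGroup G] [AddCommGroup W] [Module ℂ W] [AddCommGroup W']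
  [Module ℂ W']

lemma ellOp_zero (μ : G) (c : ℂ) : ellOp μ c (0 : G → W) = 0 := by
  funext κ; simp [ellOp]

lemma ellOp_neg (μ : G) (c : ℂ) :
    ellOp (W := W) (-μ) c = ellOp μ c := by
  funext F κ
  rw [ellOp, ellOp, sub_neg_eq_add, ← sub_eq_add_neg, add_comm (F (κ - μ))]

lemma iterate_ellOp_eq_zero_of_le {μ : G} {c : ℂ} {M N : ℕ} (h : M ≤ N) {F : G → W}
    (hF : (ellOp μ c)^[M] F = 0) : (ellOp μ c)^[N] F = 0 := by
  obtain ⟨i, rfl⟩ := Nat.exists_eq_add_of_le' h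
  rw [Function.iterate_add_apply, hF, Function.iterate_fixed (ellOp_zero μ c)]

lemma iterate_ellOp_map (φ : W →ₗ[ℂ] W') (μ : G) (c : ℂ) (M : ℕ) (F : G → W) :
    (ellOp μ c)^[M] (fun κ => φ (F κ)) = fun κ => φ ((ellOp μ c)^[M] F κ) := by
  induction M generalizing F with
  | zero => rfl
  | succ M ih =>
    rw [Function.iterate_succ_apply, Function.iterate_succ_apply, ← ih]
    congr 1
    funext κ
    simp only [ellOp, map_add, map_sub, map_smul]

/-- The operator acts along each coset of the multiples of `μ`. -/
lemma iterate_ellOp_line (μ : G) (c : ℂ) (M : ℕ) (F : G → W) (κ : G) (i : ℤ) :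
    (ellOp (1 : ℤ) c)^[M] (fun i : ℤ => F (κ + i • μ)) i = (ellOp μ c)^[M] F (κ + i • μ) := by
  induction M generalizing F with
  | zero => rfl
  | succ M ih =>
    rw [Function.iterate_succ_apply, Function.iterate_succ_apply, ← ih]
    refine congrFun (congrArg _ (funext fun i => ?_)) i
    simp only [ellOp, add_smul, sub_smul, one_smul, add_assoc, add_sub_assoc]

lemma iterate_ellOp_eq_zero {μ : G} {c : ℂ} {M : ℕ} {F : G → W}
    (h : ∀ κ, (ellOp (1 : ℤ) c)^[M] (fun i : ℤ => F (κ + i • μ)) = 0) :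
    (ellOp μ c)^[M] F = 0 := funext fun κ => by
  have := iterate_ellOp_line μ c M F κ 0
  rw [zero_smul, add_zero, h] at this
  exact this.symm

lemma iterate_ellOp_mulInterval {D : ℕ} {z w : Fin D → ℂ} (hz : dot z z = 1) (hw : dot w w = 1)
    (M : ℕ) (g : ℤ → ℤ → W) (k₁ k₂ i : ℤ) :
    (ellOp (1 : ℤ) (dot z w))^[M] (fun i => g (k₁ + i) (k₂ - i)) i =
      (mulInterval z w)^[M] g (k₁ + i + M) (k₂ - i + M) := by
  induction M generalizing g k₁ k₂ with
  | zero => simp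
  | succ M ih =>
    rw [Function.iterate_succ_apply, Function.iterate_succ_apply]
    have h1 : ellOp (1 : ℤ) (dot z w) (fun i => g (k₁ + i) (k₂ - i)) =
        fun i => mulInterval z w g (k₁ + 1 + i) (k₂ + 1 - i) := by
      funext i
      simp only [ellOp, mulInterval, hz, hw, one_smul]
      rw [show k₁ + 1 + i - 2 = k₁ + (i - 1) by ring, show k₂ + 1 - i = k₂ - (i - 1) by ring,
        show k₁ + 1 + i - 1 = k₁ + i by ring, show k₂ - (i - 1) - 1 = k₂ - i by ring,
        show k₁ + 1 + i = k₁ + (i + 1) by ring, show k₂ - (i - 1) - 2 = k₂ - (i + 1) by ring]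
      abel
    rw [h1, ih, Nat.cast_add, Nat.cast_one, show k₁ + 1 + i + (M : ℤ) = k₁ + i + (M + 1) by ring,
      show k₂ + 1 - i + (M : ℤ) = k₂ - i + (M + 1) by ring]

end EllOp

/-! ### Polynomial functions of the points -/

/-- Functions of the points on the sphere that are polynomial, with values in a vector space. -/
def polyFun (D n : ℕ) (W : Type*) [AddCommGroup W] [Module ℂ W] :
    Submodule ℂ ((Fin n → UnitSphere D) → W) :=
  Submodule.span ℂ {f | ∃ (P : PointPoly D n) (v : W),
    f = fun u => evalAt (fun k => coord (u k)) P • v}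

section PolyFun

variable {D n : ℕ} {W W' : Type*} [AddCommGroup W] [Module ℂ W] [AddCommGroup W'] [Module ℂ W']

lemma smul_mem_polyFun (P : PointPoly D n) (v : W) :
    (fun u => evalAt (fun k => coord (u k)) P • v) ∈ polyFun D n W :=
  Submodule.subset_span ⟨P, v, rfl⟩

lemma evalAt_smul_mem_polyFun (P : PointPoly D n) {f : (Fin n → UnitSphere D) → W}
    (hf : f ∈ polyFun D n W) :
    (fun u => evalAt (fun k => coord (u k)) P • f u) ∈ polyFun D n W := by
  induction hf using Submodule.span_induction with
  | mem f hf =>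
    obtain ⟨Q, v, rfl⟩ := hf
    simp only [smul_smul, ← map_mul]
    exact smul_mem_polyFun _ _
  | zero => simp only [Pi.zero_apply, smul_zero]; exact zero_mem _
  | add f g _ _ hf hg => simp only [Pi.add_apply, smul_add]; exact add_mem hf hg
  | smul c f _ hf =>
    simp only [Pi.smul_apply, smul_comm _ c]
    exact Submodule.smul_mem _ c hf

/-- A family of linear maps that is polynomial at each vector preserves polynomial functions. -/
lemma apply_mem_polyFun {φ : (Fin n → UnitSphere D) → W →ₗ[ℂ] W'}
    (hφ : ∀ v, (fun u => φ u v) ∈ polyFun D n W') {f : (Fin n → UnitSphere D) → W}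
    (hf : f ∈ polyFun D n W) : (fun u => φ u (f u)) ∈ polyFun D n W' := by
  induction hf using Submodule.span_induction with
  | mem f hf =>
    obtain ⟨Q, v, rfl⟩ := hf
    simpa only [map_smul] using evalAt_smul_mem_polyFun Q (hφ v)
  | zero => simp only [Pi.zero_apply, map_zero]; exact zero_mem _
  | add f g _ _ hf hg => simp only [Pi.add_apply, map_add]; exact add_mem hf hg
  | smul c f _ hf => simp only [Pi.smul_apply, map_smul]; exact Submodule.smul_mem _ c hf

lemma exists_of_mem_polyFun {f : (Fin n → UnitSphere D) → ℂ} (hf : f ∈ polyFun D n ℂ) :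
    ∃ P : PointPoly D n, ∀ u, f u = evalAt (fun k => coord (u k)) P := by
  induction hf using Submodule.span_induction with
  | mem f hf =>
    obtain ⟨Q, v, rfl⟩ := hf
    exact ⟨Q * MvPolynomial.C v, fun u => by simp [evalAt]⟩
  | zero => exact ⟨0, fun u => by simp⟩
  | add f g _ _ hf hg =>
    obtain ⟨P, hP⟩ := hf
    obtain ⟨Q, hQ⟩ := hg
    exact ⟨P + Q, fun u => by rw [map_add, ← hP, ← hQ]; rfl⟩
  | smul c f _ hf =>
    obtain ⟨P, hP⟩ := hf
    exact ⟨MvPolynomial.C c * P, fun u => by rw [map_mul, ← hP]; simp [evalAt]⟩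

end PolyFun

/-! ### The symmetric form of the pair series -/

section PairLaurent

variable {R : Type*} [CommRing R]

/-- Divisibility by `Y + Y⁻¹ - 2c`, by the recursion of the Chebyshev polynomials. -/
lemma dvd_zpow_add_zpow_sub (Y : Rˣ) (c : R) (n : ℤ) :
    ((Y : R) + ((Y⁻¹ : Rˣ) : R) - 2 * c) ∣
      ((Y ^ n : Rˣ) : R) + ((Y ^ (-n) : Rˣ) : R) - 2 * (Polynomial.Chebyshev.T R n).eval c := by
  induction n using Polynomial.Chebyshev.induct' with
  | zero => simp [one_add_one_eq_two]
  | one => simp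
  | add_two n ih1 ih2 =>
    have hY : (Y : R) * ((Y⁻¹ : Rˣ) : R) = 1 := Y.mul_inv
    have e1 : ((Y ^ ((n : ℤ) + 2) : Rˣ) : R) = Y * ((Y ^ ((n : ℤ) + 1) : Rˣ) : R) := by
      rw [← Units.val_mul, ← zpow_one_add]; congr 2; ring
    have e2 : ((Y ^ (n : ℤ) : Rˣ) : R) = ((Y⁻¹ : Rˣ) : R) * ((Y ^ ((n : ℤ) + 1) : Rˣ) : R) := by
      rw [← Units.val_mul, ← zpow_neg_one, ← zpow_add]; congr 2; ring
    have e3 : ((Y ^ (-((n : ℤ) + 2)) : Rˣ) : R) =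
        ((Y⁻¹ : Rˣ) : R) * ((Y ^ (-((n : ℤ) + 1)) : Rˣ) : R) := by
      rw [← Units.val_mul, ← zpow_neg_one, ← zpow_add]; congr 2; ring
    have e4 : ((Y ^ (-(n : ℤ)) : Rˣ) : R) = Y * ((Y ^ (-((n : ℤ) + 1)) : Rˣ) : R) := by
      rw [← Units.val_mul, ← zpow_one_add]; congr 2; ring
    have e5 : (Polynomial.Chebyshev.T R ((n : ℤ) + 2)).eval c =
        2 * c * (Polynomial.Chebyshev.T R ((n : ℤ) + 1)).eval c -
          (Polynomial.Chebyshev.T R (n : ℤ)).eval c := by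
      rw [Polynomial.Chebyshev.T_add_two]; simp
    have := ((ih1.mul_left ((Y : R) + ((Y⁻¹ : Rˣ) : R))).sub ih2).add
      (dvd_mul_left ((Y : R) + ((Y⁻¹ : Rˣ) : R) - 2 * c)
        (2 * (Polynomial.Chebyshev.T R ((n : ℤ) + 1)).eval c))
    convert this using 1
    rw [e1, e3, e2, e4, e5]
    ring
  | neg n ih =>
    rw [neg_neg, Polynomial.Chebyshev.T_neg, add_comm ((Y ^ (-n) : Rˣ) : R)]
    exact ih

/-- The power of `q^{1/2}` in the term `(a, b)` of the pair series. -/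
def pairLevel (ab : ℤ × ℤ) : ℕ := 2 * (tri (-ab.1) + tri (-ab.2))

lemma tri_neg_one_sub (a : ℤ) : tri (-(1 - a)) = tri (-a) := by
  have h1 := two_mul_tri (-(1 - a))
  have h2 := two_mul_tri (-a)
  have : (2 : ℤ) * tri (-(1 - a)) = 2 * tri (-a) := by rw [h1, h2]; ring
  omega

lemma mem_box_of_pairLevel_le {ab : ℤ × ℤ} {i : ℕ} (h : pairLevel ab ≤ i) :
    ab ∈ Icc (-i : ℤ) (i + 1) ×ˢ Icc (-i : ℤ) (i + 1) := by
  have h1 := two_mul_tri (-ab.1)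
  have h2 := two_mul_tri (-ab.2)
  have h3 : (2 : ℤ) * tri (-ab.1) + 2 * tri (-ab.2) ≤ i := by
    have : ((2 * (tri (-ab.1) + tri (-ab.2)) : ℕ) : ℤ) ≤ i := by exact_mod_cast h
    push_cast at this; linarith
  have h4 : ∀ x : ℤ, (-x) * (-x + 1) ≤ i → -(i : ℤ) ≤ x ∧ x ≤ i + 1 := fun x hx => by
    constructor
    · by_contra! h; nlinarith
    · by_contra! h; nlinarith
  have h5 := h4 ab.1 (by rw [← h1]; omega)
  have h6 := h4 ab.2 (by rw [← h2]; omega)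
  simp only [Finset.mem_product, Finset.mem_Icc]
  exact ⟨h5, h6⟩

/-- The terms of the pair series with the power `i` of `q^{1/2}`. -/
def pairTerms (i : ℕ) : Finset (ℤ × ℤ) :=
  (Icc (-i : ℤ) (i + 1) ×ˢ Icc (-i : ℤ) (i + 1)).filter fun ab => pairLevel ab = i

lemma mem_pairTerms {i : ℕ} {ab : ℤ × ℤ} : ab ∈ pairTerms i ↔ pairLevel ab = i := by
  rw [pairTerms, mem_filter]
  exact ⟨fun h => h.2, fun h => ⟨mem_box_of_pairLevel_le h.le, h⟩⟩

/-- The pair series as a power series in `q^{1/2}` with coefficients Laurent polynomials in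
`Y = e^{2πi(ζ_k - ζ_j)}`, divided by `Y`. -/
def pairLaurent (Y : Rˣ) (c : R) : PowerSeries R := PowerSeries.mk fun i =>
  ∑ ab ∈ pairTerms i, pairCoef c ab * ((Y ^ (ab.1 + ab.2 - 1) : Rˣ) : R)

lemma map_pairCoef {S : Type*} [CommRing S] (φ : R →+* S) (c : R) (ab : ℤ × ℤ) :
    φ (pairCoef c ab) = pairCoef (φ c) ab := by
  rw [pairCoef, pairCoef, map_mul, map_pow, map_neg, map_one, ← Polynomial.eval_map_apply,
    Polynomial.Chebyshev.map_T]

lemma pairCoef_refl_both (c : R) (a b : ℤ) : pairCoef c (1 - a, 1 - b) = pairCoef c (a, b) := by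
  simp only [pairCoef]
  congr 1
  · refine neg_one_pow_congr ?_
    rw [Int.natAbs_even, Int.natAbs_even, show 1 - a + (1 - b) = 2 - (a + b) by ring, Int.even_sub]
    simp
  · rw [show 1 - a - (1 - b) = -(a - b) by ring, Polynomial.Chebyshev.T_neg]

lemma sum_pairTerms_refl_left (i : ℕ) (f : ℤ × ℤ → R) :
    ∑ ab ∈ pairTerms i, f (1 - ab.1, ab.2) = ∑ ab ∈ pairTerms i, f ab :=
  Finset.sum_nbij' (fun ab => (1 - ab.1, ab.2)) (fun ab => (1 - ab.1, ab.2))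
    (fun ab h => by rw [mem_pairTerms, pairLevel] at h ⊢; rw [tri_neg_one_sub, h])
    (fun ab h => by rw [mem_pairTerms, pairLevel] at h ⊢; rw [tri_neg_one_sub, h])
    (fun ab _ => by simp) (fun ab _ => by simp) fun ab _ => rfl

lemma sum_pairTerms_refl_right (i : ℕ) (f : ℤ × ℤ → R) :
    ∑ ab ∈ pairTerms i, f (ab.1, 1 - ab.2) = ∑ ab ∈ pairTerms i, f ab :=
  Finset.sum_nbij' (fun ab => (ab.1, 1 - ab.2)) (fun ab => (ab.1, 1 - ab.2))
    (fun ab h => by rw [mem_pairTerms, pairLevel] at h ⊢; rw [tri_neg_one_sub, h])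
    (fun ab h => by rw [mem_pairTerms, pairLevel] at h ⊢; rw [tri_neg_one_sub, h])
    (fun ab _ => by simp) (fun ab _ => by simp) fun ab _ => rfl

lemma pairLaurent_inv (Y : Rˣ) (c : R) : pairLaurent Y⁻¹ c = pairLaurent Y c := by
  ext i
  rw [pairLaurent, pairLaurent, coeff_mk, coeff_mk,
    ← sum_pairTerms_refl_left, ← sum_pairTerms_refl_right i]
  refine sum_congr rfl fun ab _ => ?_
  rw [pairCoef_refl_both, inv_zpow', show -(1 - ab.1 + (1 - ab.2) - 1) = ab.1 + ab.2 - 1 by ring]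

lemma map_pairLaurent {S : Type*} [CommRing S] (φ : R →+* S) (Y : Rˣ) (c : R) :
    PowerSeries.map φ (pairLaurent Y c) = pairLaurent (Units.map (φ : R →* S) Y) (φ c) := by
  ext i
  rw [PowerSeries.coeff_map, pairLaurent, pairLaurent, coeff_mk, coeff_mk,
    map_sum]
  refine sum_congr rfl fun ab _ => ?_
  rw [map_mul, ← map_zpow]
  rw [map_pairCoef]
  rfl

/-- The pair series vanishes where the interval does. -/
lemma dvd_pairLaurent (h4 : IsUnit (4 : R)) (Y : Rˣ) (c : R) :
    PowerSeries.C ((Y : R) + ((Y⁻¹ : Rˣ) : R) - 2 * c) ∣ pairLaurent Y c := by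
  have h1 : ∀ i, ((Y : R) + ((Y⁻¹ : Rˣ) : R) - 2 * c) ∣ PowerSeries.coeff i (pairLaurent Y c) :=
    fun i => by
    refine (h4.dvd_mul_left).1 ?_
    rw [pairLaurent, coeff_mk]
    set f : ℤ × ℤ → R := fun ab => pairCoef c ab * ((Y ^ (ab.1 + ab.2 - 1) : Rˣ) : R)
    have h2 : 4 * ∑ ab ∈ pairTerms i, f ab = ∑ ab ∈ pairTerms i,
        (f ab + f (ab.1, 1 - ab.2) + f (1 - ab.1, ab.2) + f (1 - ab.1, 1 - ab.2)) := by
      rw [sum_add_distrib, sum_add_distrib, sum_add_distrib,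
        sum_pairTerms_refl_right, sum_pairTerms_refl_left,
        sum_pairTerms_refl_left i (fun ab => f (ab.1, 1 - ab.2)), sum_pairTerms_refl_right]
      ring
    rw [h2]
    refine Finset.dvd_sum fun ab _ => ?_
    obtain ⟨a, b⟩ := ab
    have e1 : (-1 : R) ^ (a + (1 - b)).natAbs = -(-1) ^ (a + b).natAbs := by
      rw [← neg_one_mul ((-1 : R) ^ _), ← pow_succ']
      refine neg_one_pow_congr ?_
      rw [Int.natAbs_even, Nat.even_add_one, Int.natAbs_even,
        show a + (1 - b) = (a + b) + (1 - 2 * b) by ring, Int.even_add]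
      simp [Int.even_sub]
    have e2 : (-1 : R) ^ (1 - a + b).natAbs = -(-1) ^ (a + b).natAbs := by
      rw [← neg_one_mul ((-1 : R) ^ _), ← pow_succ']
      refine neg_one_pow_congr ?_
      rw [Int.natAbs_even, Nat.even_add_one, Int.natAbs_even,
        show 1 - a + b = (a + b) + (1 - 2 * a) by ring, Int.even_add]
      simp [Int.even_sub]
    have hs := dvd_zpow_add_zpow_sub Y c (a + b - 1)
    have hd := dvd_zpow_add_zpow_sub Y c (a - b)
    have := ((hs.mul_left ((Polynomial.Chebyshev.T R (a - b)).eval c)).sub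
      (hd.mul_left ((Polynomial.Chebyshev.T R (a + b - 1)).eval c))).mul_left
        ((-1) ^ (a + b).natAbs)
    convert this using 1
    simp only [f, pairCoef_refl_both]
    simp only [pairCoef]
    rw [e1, e2, show a - (1 - b) = a + b - 1 by ring, show a + (1 - b) - 1 = a - b by ring,
      show 1 - a - b = -(a + b - 1) by ring, Polynomial.Chebyshev.T_neg,
      show 1 - a + b - 1 = -(a - b) by ring, show 1 - a + (1 - b) - 1 = -(a + b - 1) by ring]
    ring
  choose g hg using h1
  exact ⟨PowerSeries.mk g, by ext i; rw [hg, PowerSeries.coeff_C_mul, coeff_mk]⟩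

end PairLaurent

/-! ### Laurent polynomials acting on functions of the charges -/

section Action

variable {G : Type*} [AddCommGroup G]

/-- Translations of functions. -/
def translation (G : Type*) [AddCommGroup G] : Multiplicative G →* End ℂ (G → ℂ) where
  toFun g := LinearMap.funLeft ℂ ℂ fun κ => κ - g.toAdd
  map_one' := by ext; simp [LinearMap.funLeft_apply]
  map_mul' g g' := by
    ext F κ
    simp only [Module.End.mul_apply, LinearMap.funLeft_apply, toAdd_mul, sub_sub]

/-- The action of Laurent polynomials on functions of the charges, by translations. -/
def act (G : Type*) [AddCommGroup G] : AddMonoidAlgebra ℂ G →ₐ[ℂ] End ℂ (G → ℂ) :=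
  AddMonoidAlgebra.lift ℂ _ G (translation G)

/-- The monomials, as units of the algebra of Laurent polynomials. -/
def monoUnit (G : Type*) [AddCommGroup G] : Multiplicative G →* (AddMonoidAlgebra ℂ G)ˣ :=
  (AddMonoidAlgebra.of ℂ G).toHomUnits

lemma monoUnit_val (g : Multiplicative G) :
    (monoUnit G g : AddMonoidAlgebra ℂ G) = AddMonoidAlgebra.single g.toAdd 1 := rfl

lemma act_monoUnit (g : G) (F : G → ℂ) (κ : G) :
    act G (monoUnit G (Multiplicative.ofAdd g)) F κ = F (κ - g) := by
  rw [monoUnit_val, act, AddMonoidAlgebra.lift_single, one_smul]; rfl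

lemma act_algebraMap (c : ℂ) (F : G → ℂ) : act G (algebraMap ℂ _ c) F = c • F := by
  rw [AlgHom.commutes]; rfl

/-- The action of power series with coefficients Laurent polynomials on power series with
coefficients functions of the charges. -/
def pact (f : PowerSeries (AddMonoidAlgebra ℂ G)) (F : ℕ → G → ℂ) : ℕ → G → ℂ := fun j =>
  ∑ x ∈ antidiagonal j, act G (PowerSeries.coeff x.1 f) (F x.2)

lemma pact_mul (f g : PowerSeries (AddMonoidAlgebra ℂ G)) (F : ℕ → G → ℂ) :
    pact (f * g) F = pact f (pact g F) := by
  funext j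
  simp only [pact, PowerSeries.coeff_mul, map_sum, LinearMap.sum_apply, map_mul,
    Module.End.mul_apply]
  simp only [Finset.sum_sigma']
  refine Finset.sum_nbij' (fun x => ⟨(x.2.1, x.2.2 + x.1.2), (x.2.2, x.1.2)⟩)
    (fun x => ⟨(x.1.1 + x.2.1, x.2.2), (x.1.1, x.2.1)⟩) ?_ ?_ ?_ ?_ ?_ <;>
  simp +contextual [mem_antidiagonal, Finset.mem_sigma] <;> omega

lemma pact_C (r : AddMonoidAlgebra ℂ G) (F : ℕ → G → ℂ) (j : ℕ) :
    pact (PowerSeries.C r) F j = act G r (F j) := by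
  rw [pact, Finset.sum_eq_single (0, j)]
  · simp
  · intro x hx hne
    have h1 : x.1 ≠ 0 := fun h0 => hne (by
      rw [mem_antidiagonal, h0, zero_add] at hx
      exact Prod.ext h0 hx)
    rw [PowerSeries.coeff_C, if_neg h1, map_zero, LinearMap.zero_apply]
  · simp [mem_antidiagonal]

lemma pact_one (F : ℕ → G → ℂ) : pact 1 F = F := by
  funext j
  rw [← map_one (PowerSeries.C (R := AddMonoidAlgebra ℂ G)), pact_C, map_one, Module.End.one_apply]

lemma pact_zero_right (f : PowerSeries (AddMonoidAlgebra ℂ G)) : pact f 0 = 0 := by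
  funext j
  simp [pact]

lemma pact_sub (f : PowerSeries (AddMonoidAlgebra ℂ G)) (F F' : ℕ → G → ℂ) :
    pact f (F - F') = pact f F - pact f F' := by
  funext j
  simp [pact]

lemma pact_smul (f : PowerSeries (AddMonoidAlgebra ℂ G)) (c : ℂ) (F : ℕ → G → ℂ) :
    pact f (c • F) = c • pact f F := by
  funext j
  simp [pact, Finset.smul_sum]

/-- The Laurent polynomial of an interval acts by the interval operator. -/
lemma act_interval_pow (μ : G) (c : ℂ) (N : ℕ) (F : G → ℂ) :
    act G (((monoUnit G (Multiplicative.ofAdd μ) : AddMonoidAlgebra ℂ G) +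
      (((monoUnit G (Multiplicative.ofAdd μ))⁻¹ : (AddMonoidAlgebra ℂ G)ˣ) : AddMonoidAlgebra ℂ G) -
        2 * algebraMap ℂ _ c) ^ N) F = (ellOp μ c)^[N] F := by
  induction N generalizing F with
  | zero => simp
  | succ N ih =>
    rw [pow_succ, map_mul, Module.End.mul_apply, ih, Function.iterate_succ_apply]
    congr 1
    rw [← map_inv, ← ofAdd_neg, ← map_ofNat (algebraMap ℂ (AddMonoidAlgebra ℂ G)) 2, ← map_mul,
      map_sub, map_add]
    funext κ
    rw [LinearMap.sub_apply, LinearMap.add_apply, Pi.sub_apply, Pi.add_apply, act_monoUnit,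
      act_monoUnit, act_algebraMap, sub_neg_eq_add, ellOp, Pi.smul_apply, add_comm (F (κ - μ))]

/-- Automorphisms of the group of charges. -/
lemma pact_comp {σ : G ≃+ G} (f : PowerSeries (AddMonoidAlgebra ℂ G)) (F : ℕ → G → ℂ) (j : ℕ)
    (κ : G) : pact f (fun j => F j ∘ σ) j κ =
      pact (PowerSeries.map (AddMonoidAlgebra.mapDomainRingHom ℂ (σ : G →+ G)) f) F j (σ κ) := by
  have h1 : ∀ (r : AddMonoidAlgebra ℂ G) (F : G → ℂ) (κ : G), act G r (F ∘ σ) κ =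
      act G (AddMonoidAlgebra.mapDomainRingHom ℂ (σ : G →+ G) r) F (σ κ) := fun r F κ => by
    induction r using AddMonoidAlgebra.induction_on with
    | of m =>
      have h2 := act_monoUnit m (F ∘ σ) κ
      have h3 := act_monoUnit (σ m) F (σ κ)
      rw [← map_sub] at h3
      refine h2.trans (h3.symm.trans ?_)
      rw [monoUnit_val, AddMonoidAlgebra.of_apply, AddMonoidAlgebra.mapDomainRingHom_apply,
        AddMonoidAlgebra.mapDomain_single]
      rfl
    | add x y hx hy =>
      rw [map_add, map_add, map_add, LinearMap.add_apply, LinearMap.add_apply, Pi.add_apply,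
        Pi.add_apply, hx, hy]
    | smul c x hx =>
      have h4 : AddMonoidAlgebra.mapDomainRingHom ℂ (σ : G →+ G) (c • x) =
          c • AddMonoidAlgebra.mapDomainRingHom ℂ (σ : G →+ G) x :=
        map_smul (AddMonoidAlgebra.mapDomainAlgHom ℂ ℂ (σ : G →+ G)) c x
      rw [h4, map_smul, map_smul]
      exact congrArg (c • ·) hx
  simp only [pact, Finset.sum_apply, PowerSeries.coeff_map, h1]

lemma map_monoUnit {σ : G ≃+ G} (g : G) :
    Units.map ((AddMonoidAlgebra.mapDomainRingHom ℂ (σ : G →+ G) : AddMonoidAlgebra ℂ G →+* _) :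
      AddMonoidAlgebra ℂ G →* AddMonoidAlgebra ℂ G) (monoUnit G (Multiplicative.ofAdd g)) =
      monoUnit G (Multiplicative.ofAdd (σ g)) := by
  ext1
  simp [monoUnit_val]

/-- The action of the pair series, term by term. -/
lemma pact_pairLaurent (μ : G) (c : ℂ) (F : ℕ → G → ℂ) (j : ℕ) (κ : G) :
    pact (PowerSeries.C (monoUnit G (Multiplicative.ofAdd μ) : AddMonoidAlgebra ℂ G) *
      pairLaurent (monoUnit G (Multiplicative.ofAdd μ)) (algebraMap ℂ _ c)) F j κ =
      ∑ ab ∈ (Icc (-j : ℤ) (j + 1) ×ˢ Icc (-j : ℤ) (j + 1)).filter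
        fun ab => pairLevel ab ≤ j,
        pairCoef c ab * F (j - pairLevel ab) (κ - (ab.1 + ab.2) • μ) := by
  have h1 : ∀ x ∈ antidiagonal j, act G (PowerSeries.coeff x.1
      (PowerSeries.C (monoUnit G (Multiplicative.ofAdd μ) : AddMonoidAlgebra ℂ G) *
      pairLaurent (monoUnit G (Multiplicative.ofAdd μ)) (algebraMap ℂ _ c))) (F x.2) κ =
      ∑ ab ∈ pairTerms x.1, pairCoef c ab * F (j - pairLevel ab) (κ - (ab.1 + ab.2) • μ) :=
    fun x hx => by
    rw [PowerSeries.coeff_C_mul, pairLaurent, coeff_mk, mul_sum, map_sum,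
      LinearMap.sum_apply, Finset.sum_apply]
    refine sum_congr rfl fun ab hab => ?_
    rw [mem_pairTerms] at hab
    rw [mem_antidiagonal] at hx
    have h2 : pairCoef (algebraMap ℂ (AddMonoidAlgebra ℂ G) c) ab =
        algebraMap ℂ (AddMonoidAlgebra ℂ G) (pairCoef c ab) := (map_pairCoef _ _ _).symm
    rw [mul_left_comm, ← Units.val_mul, ← zpow_one_add, ← map_zpow, ← ofAdd_zsmul, h2, map_mul,
      Module.End.mul_apply, act_algebraMap, Pi.smul_apply, act_monoUnit, smul_eq_mul,
      show 1 + (ab.1 + ab.2 - 1) = ab.1 + ab.2 by ring, hab, show x.2 = j - x.1 by omega]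
  rw [pact, Finset.sum_apply, sum_congr rfl h1,
    Finset.Nat.sum_antidiagonal_eq_sum_range_succ_mk]
  rw [← Finset.sum_fiberwise_of_maps_to (g := pairLevel) (t := range (j + 1)) fun ab hab =>
    mem_range.2 (Nat.lt_succ_of_le (mem_filter.1 hab).2)]
  refine sum_congr rfl fun i hi => sum_congr ?_ fun _ _ => rfl
  ext ab
  rw [mem_pairTerms, mem_filter, mem_filter]
  rw [mem_range] at hi
  exact ⟨fun h => ⟨⟨mem_box_of_pairLevel_le (by omega), by omega⟩, h⟩, fun h => h.2⟩

end Action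

/-! ### Series in the gap variables as functions of the charges -/

section Charges

variable {m : ℕ}

/-- The coefficients of a series in the gap variables as functions of the power of `q^{1/2}` and of
the charges. -/
def charges (f : MvPowerSeries (Fin (m + 1)) ℂ) : ℕ → Charges m → ℂ := fun j κ =>
  PowerSeries.coeff j (toThermal f κ)

lemma charges_eq (f : MvPowerSeries (Fin (m + 1)) ℂ) (e : Fin (m + 1) →₀ ℕ) :
    charges f (e 0) (charge e) = coeff e f := coeff_toThermal f rfl rfl

lemma exists_charge_eq {κ : Charges m} (hκ : ∑ k, κ k = 0) {j : ℕ}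
    (hj : ∀ k, chargeBefore κ k ≤ j) : ∃ e : Fin (m + 1) →₀ ℕ, charge e = κ ∧ e 0 = j := by
  refine ⟨Finsupp.equivFunOnFinite.symm fun k => (j - chargeBefore κ k).toNat, ?_, ?_⟩
  · ext k
    have h1 := hj k
    have h2 := hj (k + 1)
    have h3 := chargeBefore_succ κ hκ k
    simp only [charge, Finsupp.coe_equivFunOnFinite_symm]
    omega
  · simp [chargeBefore]

lemma eq_zero_of_charges_ne_zero {f : MvPowerSeries (Fin (m + 1)) ℂ} {j : ℕ}
    {κ : Charges m} (h : charges f j κ ≠ 0) : ∃ e, charge e = κ ∧ e 0 = j ∧ coeff e f ≠ 0 := by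
  obtain ⟨e, h1, h2, h3⟩ := coeff_toThermal_ne_zero h
  exact ⟨e, h1, h2, fun h0 => h (h3.trans h0)⟩

lemma coeff_famSum_mul {J : Type*} {t : J → ℂ} {ex : J → Fin (m + 1) →₀ ℕ} (hl : LocFin t ex)
    (f : MvPowerSeries (Fin (m + 1)) ℂ) {e : Fin (m + 1) →₀ ℕ} {B : Finset J}
    (hB : ∀ x, t x ≠ 0 → ex x ≤ e → x ∈ B) [DecidablePred fun x => ex x ≤ e] :
    coeff e (famSum t ex * f) = ∑ x ∈ B, if ex x ≤ e then t x * coeff (e - ex x) f else 0 := by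
  classical
  have h1 := famSum_congr (t := t) (ex := ex) ((hl (e.degree + 1)).toFinset ∪ B) fun x hx hd =>
    Finset.mem_union_left _ ((hl (e.degree + 1)).mem_toFinset.2 ⟨hx, hd⟩)
  rw [(h1.mul (.refl _ f)) e (by omega), sum_mul, map_sum]
  simp_rw [MvPowerSeries.coeff_monomial_mul]
  refine (sum_congr rfl fun _ _ => by congr).trans
    (Finset.sum_subset Finset.subset_union_right fun x _ hx => ?_).symm
  by_cases h2 : ex x ≤ e
  · have : t x = 0 := by_contra fun h3 => hx (hB x h3 h2)
    rw [if_pos h2, this, zero_mul]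
  · rw [if_neg h2]

/-- Multiplication by the series `s` acts on the functions of the charges by `S`. -/
def ActsBy (s : MvPowerSeries (Fin (m + 1)) ℂ)
    (S : PowerSeries (AddMonoidAlgebra ℂ (Charges m))) : Prop :=
  ∀ f, charges (s * f) = pact S (charges f)

lemma actsBy_one : ActsBy (1 : MvPowerSeries (Fin (m + 1)) ℂ) 1 := fun f => by
  rw [one_mul, pact_one]

lemma ActsBy.mul {s s' : MvPowerSeries (Fin (m + 1)) ℂ}
    {S S' : PowerSeries (AddMonoidAlgebra ℂ (Charges m))} (h : ActsBy s S)
    (h' : ActsBy s' S') : ActsBy (s * s') (S * S') := fun f => by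
  rw [mul_assoc, h, h', pact_mul]

lemma ActsBy.prod {J : Type*} {F : Finset J} {s : J → MvPowerSeries (Fin (m + 1)) ℂ}
    {S : J → PowerSeries (AddMonoidAlgebra ℂ (Charges m))}
    (h : ∀ x ∈ F, ActsBy (s x) (S x)) : ActsBy (∏ x ∈ F, s x) (∏ x ∈ F, S x) := by
  classical
  induction F using Finset.induction_on with
  | empty => exact actsBy_one
  | insert x F hx ih =>
    rw [prod_insert hx, prod_insert hx]
    exact (h x (Finset.mem_insert_self _ _)).mul
      (ih fun y hy => h y (Finset.mem_insert_of_mem hy))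

lemma ActsBy.pow {s : MvPowerSeries (Fin (m + 1)) ℂ}
    {S : PowerSeries (AddMonoidAlgebra ℂ (Charges m))} (h : ActsBy s S) (N : ℕ) :
    ActsBy (s ^ N) (S ^ N) := by
  induction N with
  | zero => simpa using actsBy_one
  | succ N ih => rw [pow_succ, pow_succ]; exact ih.mul h

/-- The monomial `e^{2πi(ζ_k - ζ_j)}`. -/
def pairUnit (j k : Fin (m + 1)) : (AddMonoidAlgebra ℂ (Charges m))ˣ :=
  monoUnit _ (Multiplicative.ofAdd (Pi.single k 2 - Pi.single j 2))

lemma pairUnit_comm (j k : Fin (m + 1)) : pairUnit k j = (pairUnit j k)⁻¹ := by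
  rw [pairUnit, pairUnit, ← map_inv, ← ofAdd_neg, neg_sub]

lemma charge_pairExp {j k : Fin (m + 1)} (h : j < k) (ab : ℤ × ℤ) :
    charge (pairExp (arcExp j k) (coarcExp j k) ab) =
      (ab.1 + ab.2) • (Pi.single k 2 - Pi.single j 2) := by
  have h1 : ∀ r : ℤ, (tri r : ℤ) - tri (-r) = r := fun r => by
    have := two_mul_tri r; have := two_mul_tri (-r); nlinarith
  rw [pairExp, charge_add, charge_nsmul, charge_nsmul, charge_arcExp h, charge_coarcExp h]
  ext l
  have e1 := h1 ab.1
  have e2 := h1 ab.2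
  simp only [Pi.add_apply, Pi.smul_apply, Pi.sub_apply, smul_eq_mul]
  linear_combination ((Pi.single k 2 : Charges m) l - (Pi.single j 2 : Charges m) l) *
    (e1 + e2)

lemma pairExp_zero (j k : Fin (m + 1)) (ab : ℤ × ℤ) :
    pairExp (arcExp j k) (coarcExp j k) ab 0 = pairLevel ab := by
  simp [pairExp, arcExp_zero, coarcExp_zero, pairLevel, mul_comm]

/-- In terms of the charges, multiplication by the pair series is, up to a shift, the action of a
Laurent polynomial at every level. -/
lemma actsBy_pairSeries {j k : Fin (m + 1)} (h : j < k) (c : ℂ) :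
    ActsBy (pairSeries (arcExp j k) (coarcExp j k) c)
      (PowerSeries.C (pairUnit j k : AddMonoidAlgebra ℂ (Charges m)) *
        pairLaurent (pairUnit j k) (algebraMap ℂ _ c)) := fun f => by
  classical
  funext i κ
  rw [pairUnit, pact_pairLaurent]
  have hzero : ∀ ab : ℤ × ℤ, pairLevel ab ≤ i → (∀ e, charge e = κ → e 0 = i →
      ¬ pairExp (arcExp j k) (coarcExp j k) ab ≤ e) → charges f (i - pairLevel ab)
        (κ - (ab.1 + ab.2) • (Pi.single k 2 - Pi.single j 2)) = 0 := fun ab hab hne => by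
    by_contra h0
    obtain ⟨e, h1, h2, -⟩ := eq_zero_of_charges_ne_zero h0
    refine hne (e + pairExp (arcExp j k) (coarcExp j k) ab) ?_ ?_ (le_add_of_nonneg_left zero_le)
    · rw [charge_add, charge_pairExp h, h1, sub_add_cancel]
    · rw [Finsupp.add_apply, pairExp_zero, h2]; omega
  by_cases he : ∃ e, charge e = κ ∧ e 0 = i
  · obtain ⟨e, rfl, rfl⟩ := he
    rw [charges_eq, pairSeries, coeff_famSum_mul (locFin_pair (arcExp_ne_zero h)
      (coarcExp_ne_zero j k) c) (B := (Icc (-(e 0 : ℤ)) (e 0 + 1) ×ˢ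
        Icc (-(e 0 : ℤ)) (e 0 + 1)).filter fun ab => pairLevel ab ≤ e 0)]
    · refine sum_congr rfl fun ab hab => ?_
      have hab' := (mem_filter.1 hab).2
      by_cases hle : pairExp (arcExp j k) (coarcExp j k) ab ≤ e
      · rw [if_pos hle, ← charges_eq]
        congr 2
        · rw [Finsupp.tsub_apply, pairExp_zero]
        · rw [eq_sub_iff_add_eq, ← charge_pairExp h, ← charge_add, tsub_add_cancel_of_le hle]
      · rw [if_neg hle, hzero ab hab' fun e' h1 h2 => by rwa [eq_of_charge h1 h2], mul_zero]
    · intro ab _ hab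
      have := hab 0
      rw [pairExp_zero] at this
      exact mem_filter.2 ⟨mem_box_of_pairLevel_le this, this⟩
  · rw [charges, coeff_toThermal_eq_zero _ fun e h1 h2 => he ⟨e, h1, h2⟩]
    refine (sum_eq_zero fun ab hab => ?_).symm
    rw [hzero ab (mem_filter.1 hab).2 fun e h1 h2 => absurd ⟨e, h1, h2⟩ he, mul_zero]

/-- The product of the symmetric forms of the pair series. -/
def laurentProduct (c : Fin (m + 1) → Fin (m + 1) → ℂ) :
    PowerSeries (AddMonoidAlgebra ℂ (Charges m)) :=
  ∏ j, ∏ k, if j < k then pairLaurent (pairUnit j k) (algebraMap ℂ _ (c j k)) else 1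

lemma charge_sum {J : Type*} (F : Finset J) (e : J → Fin (m + 1) →₀ ℕ) :
    charge (∑ x ∈ F, e x) = ∑ x ∈ F, charge (e x) :=
  map_sum (⟨⟨charge, charge_zero⟩, charge_add⟩ : (Fin (m + 1) →₀ ℕ) →+ (Charges m)) e F

lemma prod_pairUnit : (∏ j, ∏ k, if j < k then pairUnit j k else 1) =
    monoUnit _ (Multiplicative.ofAdd (charge (arcsExp m))) := by
  rw [arcsExp, charge_sum, ofAdd_sum, map_prod]
  refine prod_congr rfl fun j _ => ?_
  rw [charge_sum, ofAdd_sum, map_prod]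
  refine prod_congr rfl fun k _ => ?_
  split_ifs with h
  · rw [charge_arcExp h, pairUnit]
  · rw [charge_zero, ofAdd_zero, map_one]

lemma actsBy_ellSeries (c : Fin (m + 1) → Fin (m + 1) → ℂ) : ActsBy (ellSeries c)
    (PowerSeries.C (monoUnit _ (Multiplicative.ofAdd (charge (arcsExp m))) :
      AddMonoidAlgebra ℂ (Charges m)) * laurentProduct c) := by
  rw [← prod_pairUnit, laurentProduct, Units.coe_prod, map_prod, ← prod_mul_distrib]
  refine ActsBy.prod fun j _ => ?_
  rw [Units.coe_prod, map_prod, ← prod_mul_distrib]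
  refine ActsBy.prod fun k _ => ?_
  split_ifs with h
  · exact actsBy_pairSeries h _
  · rw [Units.val_one, map_one, one_mul]; exact actsBy_one

lemma charges_ellSeries_pow_mul (c : Fin (m + 1) → Fin (m + 1) → ℂ) (N : ℕ)
    (f : MvPowerSeries (Fin (m + 1)) ℂ) (j : ℕ) (κ : Charges m) :
    charges (ellSeries c ^ N * f) j κ =
      pact (laurentProduct c ^ N) (charges f) j (κ - charge (N • arcsExp m)) := by
  rw [(actsBy_ellSeries c).pow N, mul_pow, ← map_pow, pact_mul, pact_C, ← Units.val_pow_eq_pow_val,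
    ← map_pow, ← ofAdd_nsmul, act_monoUnit, charge_nsmul]

lemma dvd_laurentProduct (c : Fin (m + 1) → Fin (m + 1) → ℂ) {j k : Fin (m + 1)} (h : j < k) :
    PowerSeries.C ((pairUnit j k : AddMonoidAlgebra ℂ (Charges m)) +
      (((pairUnit j k)⁻¹ : (AddMonoidAlgebra ℂ (Charges m))ˣ) :
        AddMonoidAlgebra ℂ (Charges m)) - 2 * algebraMap ℂ _ (c j k)) ∣ laurentProduct c := by
  have h4 : IsUnit (4 : AddMonoidAlgebra ℂ (Charges m)) := by
    have := (isUnit_iff_ne_zero.2 (by norm_num : (4 : ℂ) ≠ 0)).map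
      (algebraMap ℂ (AddMonoidAlgebra ℂ (Charges m)))
    rwa [map_ofNat] at this
  refine (dvd_pairLaurent h4 _ _).trans (dvd_trans ?_
    (Finset.dvd_prod_of_mem _ (mem_univ j)))
  have := Finset.dvd_prod_of_mem (fun k => if j < k then
    pairLaurent (pairUnit j k) (algebraMap ℂ _ (c j k)) else 1) (mem_univ k)
  rwa [if_pos h] at this

/-- Permutations of the charges. -/
def permCharges (s : Perm (Fin (m + 1))) : Charges m ≃+ (Charges m) where
  toFun κ := κ ∘ s
  invFun κ := κ ∘ s.symm
  left_inv κ := by ext; simp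
  right_inv κ := by ext; simp
  map_add' _ _ := rfl

lemma map_laurentProduct (c : Fin (m + 1) → Fin (m + 1) → ℂ) (hc : ∀ j k, c j k = c k j)
    (s : Perm (Fin (m + 1))) : PowerSeries.map (AddMonoidAlgebra.mapDomainRingHom ℂ
      (permCharges s : Charges m →+ (Charges m))) (laurentProduct c) =
      laurentProduct fun j k => c (s j) (s k) := by
  have h1 : ∀ k : Fin (m + 1), (Pi.single k 2 : Charges m) ∘ s = Pi.single (s.symm k) 2 :=
    fun k => by
    ext l
    simp only [comp_apply, Pi.single_apply, Equiv.eq_symm_apply]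
  have h2 : ∀ j k, Units.map ((AddMonoidAlgebra.mapDomainRingHom ℂ
      (permCharges s : Charges m →+ (Charges m)) : AddMonoidAlgebra ℂ _ →+* _) :
      AddMonoidAlgebra ℂ (Charges m) →* AddMonoidAlgebra ℂ (Charges m)) (pairUnit j k) =
      pairUnit (s.symm j) (s.symm k) := fun j k => by
    rw [pairUnit, map_monoUnit, pairUnit, ← h1, ← h1, map_sub]
    rfl
  have h3 : ∀ a : ℂ, AddMonoidAlgebra.mapDomainRingHom ℂ
      (permCharges s : Charges m →+ (Charges m)) (algebraMap ℂ _ a) =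
      algebraMap ℂ _ a :=
    (AddMonoidAlgebra.mapDomainAlgHom ℂ ℂ
      (permCharges s : Charges m →+ (Charges m))).commutes
  rw [laurentProduct, laurentProduct, map_prod, ← prod_pairs_comp (fun j k =>
    pairLaurent (pairUnit j k) (algebraMap ℂ _ (c (s j) (s k)))) (fun j k => by
      rw [pairUnit_comm, pairLaurent_inv, hc]) s.symm]
  refine prod_congr rfl fun j _ => ?_
  rw [map_prod]
  refine prod_congr rfl fun k _ => ?_
  split_ifs with h
  · rw [map_pairLaurent, h2, h3, Equiv.apply_symm_apply, Equiv.apply_symm_apply]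
  · exact map_one _

/-- Iterated multiplication by intervals is compensated by the product of the pair series. -/
lemma pact_laurentProduct_eq_zero (c : Fin (m + 1) → Fin (m + 1) → ℂ) {j k : Fin (m + 1)}
    (h : j < k) (N : ℕ) {F : ℕ → Charges m → ℂ}
    (hF : ∀ i, (ellOp (Pi.single k 2 - Pi.single j 2) (c j k))^[N] (F i) = 0) :
    pact (laurentProduct c ^ N) F = 0 := by
  obtain ⟨g, hg⟩ := dvd_laurentProduct c h
  rw [hg, mul_comm, mul_pow, pact_mul, ← map_pow]
  refine (congrArg _ (funext fun i => ?_)).trans (pact_zero_right _)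
  rw [pact_C, pairUnit, act_interval_pow, hF]
  rfl

end Charges

/-! ### Cyclic rotations of the gap variables -/

section Rotation

variable {m : ℕ}

/-- The cyclic successor of the index of a gap. -/
def nextGap (m : ℕ) : Fin (m + 1) ↪ Fin (m + 1) := (Equiv.addRight (1 : Fin (m + 1))).toEmbedding

/-- The cyclic rotation of the points, `k ↦ k - 1`. -/
def rotation (m : ℕ) : Perm (Fin (m + 1)) := Equiv.subRight 1

/-- The cyclic rotation of exponents. -/
def rotExp (e : Fin (m + 1) →₀ ℕ) : Fin (m + 1) →₀ ℕ := Finsupp.embDomain (nextGap m) e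

lemma rotExp_add_one (e : Fin (m + 1) →₀ ℕ) (k : Fin (m + 1)) : rotExp e (k + 1) = e k :=
  Finsupp.embDomain_apply_self (nextGap m) e k

lemma rotExp_apply (e : Fin (m + 1) →₀ ℕ) (k : Fin (m + 1)) : rotExp e k = e (k - 1) := by
  rw [← rotExp_add_one e (k - 1), sub_add_cancel]

lemma rotExp_injective : Function.Injective (rotExp (m := m)) := Finsupp.embDomain_injective _

lemma exists_rotExp_eq (y : Fin (m + 1) →₀ ℕ) : ∃ e, rotExp e = y :=
  ⟨Finsupp.equivFunOnFinite.symm fun k => y (k + 1), by ext k; simp [rotExp_apply]⟩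

lemma charge_rotExp (e : Fin (m + 1) →₀ ℕ) : charge (rotExp e) = charge e ∘ rotation m := by
  ext k
  simp [charge, rotExp_apply, rotation]

lemma zero_sub_one_eq_last : (0 : Fin (m + 1)) - 1 = Fin.last m := by
  rw [sub_eq_iff_eq_add, Fin.last_add_one]

lemma rotation_zero : rotation m 0 = Fin.last m := zero_sub_one_eq_last

lemma rotation_succ (k : Fin m) : rotation m k.succ = k.castSucc := by
  rw [rotation, Equiv.subRight_apply, sub_eq_iff_eq_add, Fin.coeSucc_eq_succ]

lemma rotExp_pairExp (α β : Fin (m + 1) →₀ ℕ) (ab : ℤ × ℤ) :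
    rotExp (pairExp α β ab) = pairExp (rotExp α) (rotExp β) ab := by
  ext k
  simp [pairExp, rotExp_apply]

lemma rename_pairSeries (α β : Fin (m + 1) →₀ ℕ) (c : ℂ) :
    MvPowerSeries.rename (nextGap m) (pairSeries α β c) = pairSeries (rotExp α) (rotExp β) c := by
  classical
  ext y
  obtain ⟨e, rfl⟩ := exists_rotExp_eq y
  refine (MvPowerSeries.coeff_embDomain_rename (nextGap m) _ e).trans ?_
  rw [pairSeries, pairSeries, coeff_famSum, coeff_famSum]
  refine finsum_congr fun ab => ?_
  rw [← rotExp_pairExp]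
  by_cases h : pairExp α β ab = e
  · rw [if_pos h, if_pos (congrArg _ h)]
  · rw [if_neg h, if_neg fun h' => h (rotExp_injective h')]

lemma rotExp_arcExp {j k : Fin (m + 1)} (h : j < k) : rotExp (arcExp j k) =
    if k = Fin.last m then coarcExp 0 (j + 1) else arcExp (j + 1) (k + 1) := by
  ext l
  obtain ⟨l, rfl⟩ : ∃ i, l = i + 1 := ⟨l - 1, (sub_add_cancel _ _).symm⟩
  have hj : j ≠ Fin.last m := (h.trans_le (Fin.le_last k)).ne
  rw [rotExp_add_one]
  split_ifs with hk <;>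
  simp only [arcExp_apply, coarcExp_apply, Fin.lt_def, Fin.le_def, Fin.val_add_one,
    Fin.ext_iff, Fin.val_last, Fin.val_zero] at * <;>
  have := l.isLt <;> have := k.isLt <;> split_ifs <;> omega

lemma rotExp_coarcExp {j k : Fin (m + 1)} (h : j < k) : rotExp (coarcExp j k) =
    if k = Fin.last m then arcExp 0 (j + 1) else coarcExp (j + 1) (k + 1) := by
  have h1 : rotExp (arcExp j k) + rotExp (coarcExp j k) = 2 • allOne := by
    ext l
    have := DFunLike.congr_fun (arc_add_coarc j k) (l - 1)
    simpa [rotExp_apply] using this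
  rw [rotExp_arcExp h] at h1
  refine add_left_cancel (h1.trans ?_)
  split_ifs
  · exact (arc_add_coarc 0 (j + 1)).symm.trans (add_comm _ _)
  · rw [← arc_add_coarc (j + 1) (k + 1)]

/-- The product of the elliptic intervals is invariant under the rotation of the points, which
exchanges arcs and coarcs of the pairs with the last point. -/
lemma rename_ellSeries (c : Fin (m + 1) → Fin (m + 1) → ℂ) (hc : ∀ j k, c j k = c k j) :
    MvPowerSeries.rename (nextGap m) (ellSeries c) =
      ellSeries fun j k => c (rotation m j) (rotation m k) := by
  have hF : ∀ j k : Fin (m + 1), pairSeries (arcExp (min j k) (max j k))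
      (coarcExp (min j k) (max j k)) (c (rotation m j) (rotation m k)) =
      pairSeries (arcExp (min k j) (max k j)) (coarcExp (min k j) (max k j))
        (c (rotation m k) (rotation m j)) := fun j k => by rw [min_comm, max_comm, hc]
  have h1 : ellSeries (fun j k => c (rotation m j) (rotation m k)) = ∏ j, ∏ k, if j < k then
      pairSeries (arcExp (min j k) (max j k)) (coarcExp (min j k) (max j k))
        (c (rotation m j) (rotation m k)) else 1 :=
    prod_congr rfl fun j _ => prod_congr rfl fun k _ => by
      split_ifs with h
      · rw [min_eq_left h.le, max_eq_right h.le]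
      · rfl
  rw [h1, ← prod_pairs_comp _ hF (rotation m).symm, ellSeries, map_prod]
  refine prod_congr rfl fun j _ => ?_
  rw [map_prod]
  refine prod_congr rfl fun k _ => ?_
  split_ifs with h
  · have e1 : ∀ k, (rotation m).symm k = k + 1 := fun k => rfl
    rw [rename_pairSeries, Equiv.apply_symm_apply, Equiv.apply_symm_apply, e1, e1]
    have hj : j ≠ Fin.last m := (h.trans_le (Fin.le_last k)).ne
    rw [rotExp_arcExp h, rotExp_coarcExp h]
    split_ifs with hk
    -- The arc between the points passes through the end, and becomes the complementary arc.
    · rw [hk, Fin.last_add_one, min_eq_right (Fin.zero_le _), max_eq_left (Fin.zero_le _),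
        pairSeries_symm]
    · have hle : j + 1 ≤ k + 1 := by
        simp only [Fin.le_def, Fin.val_add_one, if_neg hj, if_neg hk]
        have := Fin.lt_def.1 h; omega
      rw [min_eq_left hle, max_eq_right hle]
  · exact map_one _

end Rotation

/-! ### The signs of rotations and of transpositions -/

lemma paritySign_add (a b c : ZMod 2) :
    paritySign a (b + c) = paritySign a b * paritySign a c := by
  have h2 : ∀ x : ZMod 2, x = 0 ∨ x = 1 := by decide
  have h3 : (1 : ZMod 2) + 1 = 0 := rfl
  rcases h2 a with rfl | rfl <;> rcases h2 b with rfl | rfl <;> rcases h2 c with rfl | rfl <;>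
    simp [paritySign, ZMod.val_one, h3]

lemma paritySign_sum {J : Type*} (F : Finset J) (a : ZMod 2) (b : J → ZMod 2) :
    ∏ x ∈ F, paritySign a (b x) = paritySign a (∑ x ∈ F, b x) := by
  classical
  induction F using Finset.induction_on with
  | empty => simp [paritySign]
  | insert x F hx ih => rw [prod_insert hx, sum_insert hx, paritySign_add, ih]

/-- A field has to be moved past all others, whose total parity is its own. -/
lemma statSign_rotation {m : ℕ} {I : Type*} (p : I → ZMod 2) (A : Fin (m + 1) → I)
    (hA : ∑ k, p (A k) = 0) :
    statSign p A (rotation m) = (-1) ^ (p (A (Fin.last m))).val := by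
  rw [statSign, Fin.prod_univ_succ, prod_eq_one (s := univ) (f := fun i : Fin m => _),
    mul_one, Fin.prod_univ_succ, if_neg (by simp), one_mul]
  · have h1 : ∀ k : Fin m, (if (0 : Fin (m + 1)) < k.succ ∧ rotation m k.succ < rotation m 0 then
        paritySign (p (A (rotation m 0))) (p (A (rotation m k.succ))) else 1) =
        paritySign (p (A (Fin.last m))) (p (A k.castSucc)) := fun k => by
      rw [rotation_zero, rotation_succ, if_pos ⟨Fin.succ_pos k, Fin.castSucc_lt_last k⟩]
    rw [prod_congr rfl fun k _ => h1 k, paritySign_sum]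
    rw [Fin.sum_univ_castSucc, add_eq_zero_iff_eq_neg, ZMod.neg_eq_self_mod_two] at hA
    rw [hA]
    have h2 : ∀ x : ZMod 2, x.val * x.val = x.val := by decide
    rw [paritySign, h2]
  · intro k _
    refine prod_eq_one fun l _ => if_neg fun h => ?_
    cases l using Fin.cases with
    | zero => exact absurd h.1 (by simp)
    | succ l =>
      rw [rotation_succ, rotation_succ, Fin.castSucc_lt_castSucc_iff] at h
      exact absurd (Fin.succ_lt_succ_iff.1 h.1) h.2.not_gt

lemma statSign_swap {m : ℕ} {I : Type*} (p : I → ZMod 2) (A : Fin (m + 1) → I) (k : Fin m) :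
    statSign p A (Equiv.swap k.castSucc k.succ) =
      paritySign (p (A k.castSucc)) (p (A k.succ)) := by
  have h1 : ∀ i j : Fin (m + 1), i < j ∧ Equiv.swap k.castSucc k.succ j <
      Equiv.swap k.castSucc k.succ i → i = k.castSucc ∧ j = k.succ := fun i j h => by
    obtain ⟨h2, h3⟩ := h
    simp only [Equiv.swap_apply_def, Fin.ext_iff] at h3 ⊢
    split_ifs at h3 <;>
      simp only [Fin.lt_def, Fin.val_castSucc, Fin.val_succ] at * <;> omega
  rw [statSign, Finset.prod_eq_single k.castSucc, Finset.prod_eq_single k.succ]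
  · rw [if_pos, Equiv.swap_apply_left, Equiv.swap_apply_right, paritySign_comm]
    rw [Equiv.swap_apply_left, Equiv.swap_apply_right]
    exact ⟨Fin.castSucc_lt_succ, Fin.castSucc_lt_succ⟩
  · exact fun j _ hj => if_neg fun h => hj (h1 _ _ h).2
  · simp
  · exact fun i _ hi => prod_eq_one fun j _ => if_neg fun h => hi (h1 _ _ h).1
  · simp

/-! ### Theta series at fixed charges and vectors of minimal length -/

lemma charge_arcsExp {m : ℕ} (N : ℕ) (k : Fin (m + 1)) :
    charge (N • arcsExp m) k = N * (4 * k - 2 * m) := by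
  rw [charge_nsmul, Pi.smul_apply, charge, nsmul_eq_mul, arcsExp_apply, arcsExp_apply]
  induction k using Fin.lastCases with
  | last => rw [Fin.last_add_one, Fin.val_last, Fin.val_zero]; push_cast; ring
  | cast k => rw [Fin.coeSucc_eq_succ, Fin.val_succ, Fin.val_castSucc]; push_cast; ring

/-- The monomial by which the elliptic intervals are divided is not invariant under rotations: its
charges change by a shift. -/
lemma charge_arcsExp_rotation (N m : ℕ) : charge (N • arcsExp m) ∘ rotation m =
    charge (N • arcsExp m) + shift N (Pi.single (Fin.last m) 1) ∘ rotation m := by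
  funext k
  have hs : ∑ l, (Pi.single (Fin.last m) 1 : Charges m) l = 1 := by simp
  simp only [comp_apply, Pi.add_apply, charge_arcsExp, shift, hs]
  induction k using Fin.cases with
  | zero => rw [rotation_zero]; simp; ring
  | succ k =>
    rw [rotation_succ, Pi.single_eq_of_ne (Fin.castSucc_lt_last k).ne, Fin.val_castSucc,
      Fin.val_succ]
    push_cast; ring

/-- In the gap variables a theta series is, for fixed charges, a monomial in `q^{1/2}`. -/
lemma toThermal_thetaSeries {N m : ℕ} {q : Fin (m + 1) → ZMod 2} {κ₀ : Charges m}
    (h : Admissible N q κ₀) (κ : Charges m) :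
    toThermal (thetaSeries N q κ₀) (κ + charge (N • arcsExp m)) =
      PowerSeries.C (thetaCoef N q κ₀ κ) * PowerSeries.X ^ (thetaLevel N κ₀ κ).toNat := by
  classical
  have hinj : ∀ x y, thetaCoef N q κ₀ x ≠ 0 → thetaCoef N q κ₀ y ≠ 0 →
      charge (thetaExp N κ₀ x) = charge (thetaExp N κ₀ y) → x = y := fun x y hx hy hxy => by
    rw [charge_thetaExp h (exists_of_thetaCoef_ne_zero hx),
      charge_thetaExp h (exists_of_thetaCoef_ne_zero hy)] at hxy
    exact add_right_cancel hxy
  ext i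
  rw [PowerSeries.coeff_C_mul_X_pow]
  by_cases h0 : thetaCoef N q κ₀ κ = 0
  · rw [h0, ite_self]
    by_contra hne
    obtain ⟨e, he, -, h1⟩ := coeff_toThermal_ne_zero hne
    refine hne (h1.trans ((AddSubgroup.mem_bot (G := ℂ)).1 (coeff_famSum_mem ⊥ fun x hx => ?_)))
    by_contra hx0
    have hxc := charge_thetaExp h (exists_of_thetaCoef_ne_zero hx0)
    rw [hx, he] at hxc
    exact hx0 (add_right_cancel hxc ▸ h0)
  · have hκ := exists_of_thetaCoef_ne_zero h0
    have hz : thetaExp N κ₀ κ 0 = (thetaLevel N κ₀ κ).toNat := by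
      rw [← thetaExp_zero h hκ, Int.toNat_natCast]
    split_ifs with hi
    · rw [coeff_toThermal _ (charge_thetaExp h hκ) (hz.trans hi.symm)]
      exact coeff_famSum_of_injOn (fun x y hx hy hxy => hinj x y hx hy (by rw [hxy])) κ h0
    · by_contra hne
      obtain ⟨e, he, rfl, h1⟩ := coeff_toThermal_ne_zero hne
      refine hne (h1.trans ((AddSubgroup.mem_bot (G := ℂ)).1 (coeff_famSum_mem ⊥ fun x hx => ?_)))
      by_contra hx0
      obtain rfl := hinj x κ hx0 h0 (by rw [hx, he, charge_thetaExp h hκ])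
      exact hi (by rw [← hz, hx])

open Classical in
/-- The charges of minimal length, which number the theta series. -/
def minimalCharges (N : ℕ) {m : ℕ} (q : Fin (m + 1) → ZMod 2) : Finset (Charges m) :=
  (Icc (fun _ => -(2 * N * m : ℤ)) fun _ => 2 * N * m).filter (Admissible N q)

lemma Admissible.mem_Icc {N m : ℕ} {q : Fin (m + 1) → ZMod 2} {κ₀ : Charges m}
    (h : Admissible N q κ₀) :
    κ₀ ∈ Icc (fun _ => -(2 * N * m : ℤ)) fun _ : Fin (m + 1) => (2 * N * m : ℤ) := by
  have hN := h.pos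
  have key : ∀ k (x : ℤ), x ^ 2 = 1 → 0 ≤ x * κ₀ k + 2 * N * m := fun k x hx => by
    have h1 := h.minimal (Pi.single k x)
    have hs1 : ∑ l, (Pi.single k x : Charges m) l * κ₀ l = x * κ₀ k := by
      simp [Pi.single_apply]
    have hs2 : normSq (Pi.single k x : Charges m) = x ^ 2 := by
      simp [normSq, Pi.single_apply]
    have hs3 : ∑ l, (Pi.single k x : Charges m) l = x := by simp
    rw [normSq_add_shift N κ₀ _ h.sum_charge, hs1, hs2, hs3, hx] at h1
    have h2 := nonneg_of_mul_nonneg_right (le_add_iff_nonneg_right _ |>.1 h1) (by positivity)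
    linarith
  refine Finset.mem_Icc.2 ⟨fun k => ?_, fun k => ?_⟩
  · have := key k 1 (by norm_num); dsimp only; linarith
  · have := key k (-1) (by norm_num); dsimp only; linarith

lemma mem_minimalCharges {N m : ℕ} {q : Fin (m + 1) → ZMod 2} {κ₀ : Charges m} :
    κ₀ ∈ minimalCharges N q ↔ Admissible N q κ₀ := by
  classical
  exact mem_filter.trans ⟨And.right, fun h => ⟨h.mem_Icc, h⟩⟩

open Classical in
/-- The number of the vectors of minimal length in the class of `κ`. -/
def multiplicity (N : ℕ) {m : ℕ} (q : Fin (m + 1) → ZMod 2) (κ : Charges m) : ℕ :=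
  ((minimalCharges N q).filter fun κ₀ => ∃ a, κ = κ₀ + shift N a).card

lemma multiplicity_add_shift (N : ℕ) {m : ℕ} (q : Fin (m + 1) → ZMod 2)
    (κ a : Charges m) : multiplicity N q (κ + shift N a) = multiplicity N q κ := by
  classical
  refine congrArg Finset.card (Finset.filter_congr fun κ₀ _ => ⟨?_, ?_⟩)
  · rintro ⟨b, hb⟩
    exact ⟨b + -a, by rw [shift_add, shift_neg, ← add_assoc, ← hb, add_neg_cancel_right]⟩
  · rintro ⟨b, rfl⟩
    exact ⟨b + a, by rw [shift_add, add_assoc]⟩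

lemma multiplicity_comp (N : ℕ) {m : ℕ} (q : Fin (m + 1) → ZMod 2) (κ : Charges m)
    (s : Perm (Fin (m + 1))) (hq : q ∘ s = q) :
    multiplicity N q (κ ∘ s) = multiplicity N q κ := by
  classical
  refine (Finset.card_equiv (s.arrowCongr (Equiv.refl ℤ)).symm fun κ₀ => ?_).symm
  change _ ↔ κ₀ ∘ s ∈ _
  rw [mem_filter, mem_filter, mem_minimalCharges, mem_minimalCharges]
  have hA : Admissible N q κ₀ ↔ Admissible N q (κ₀ ∘ s) := by
    refine ⟨fun h => hq ▸ h.comp s, fun h => ?_⟩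
    have h1 := h.comp s⁻¹
    have h2 : (q ∘ ⇑s⁻¹) = q := by
      conv_lhs => rw [← hq]
      funext k; simp
    have h3 : (κ₀ ∘ s) ∘ ⇑s⁻¹ = κ₀ := by funext k; simp
    rwa [h2, h3] at h1
  refine and_congr hA ⟨?_, ?_⟩
  · rintro ⟨a, rfl⟩
    exact ⟨a ∘ s, by rw [shift_comp]; rfl⟩
  · rintro ⟨a, ha⟩
    refine ⟨a ∘ ⇑s⁻¹, ?_⟩
    rw [shift_comp]
    funext k
    have := congrFun ha (s⁻¹ k)
    simpa using this

/-- Every class contains a vector of minimal length. -/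
lemma multiplicity_ne_zero {N m : ℕ} (hN : 0 < N) {q : Fin (m + 1) → ZMod 2}
    (hq : ∑ k, q k = 0) {κ : Charges m} (hκ : ∑ k, κ k = 0)
    (hp : ∀ k, (κ k : ZMod 2) = q k) : multiplicity N q κ ≠ 0 := by
  classical
  set f : Charges m → ℕ := fun a => (normSq (κ + shift N a)).toNat
  obtain ⟨a, ha⟩ : ∃ a, ∀ b, f a ≤ f b := ⟨Function.argmin f, fun b => Function.argmin_le f b⟩
  refine Finset.card_ne_zero_of_mem (a := κ + shift N a) (mem_filter.2
    ⟨mem_minimalCharges.2 ⟨hN, hq, ?_, fun k => ?_, fun b => ?_⟩, -a, ?_⟩)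
  · simp only [Pi.add_apply, sum_add_distrib, hκ, sum_shift, add_zero]
  · rw [Pi.add_apply, Int.cast_add, hp, shift]
    have : ((4 * N * ((m + 1) * a k - ∑ l, a l) : ℤ) : ZMod 2) = 0 :=
      (ZMod.intCast_zmod_eq_zero_iff_dvd _ 2).2 ⟨2 * N * ((m + 1) * a k - ∑ l, a l), by
        push_cast; ring⟩
    rw [this, add_zero]
  · rw [add_assoc, ← shift_add]
    have h1 := ha (a + b)
    have h2 := normSq_nonneg (κ + shift N (a + b))
    have h3 := normSq_nonneg (κ + shift N a)
    simp only [f] at h1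
    omega
  · rw [shift_neg, add_neg_cancel_right]

namespace GCITheory

variable {D : ℕ} [NeZero D] {I : Type*} [Fintype I] [DecidableEq I] {p : I → ZMod 2}
  {ι : ℕ → Type*} [∀ m, Fintype (ι m)] {h : ∀ m, Module.Basis (ι m) ℂ (harmonic D m)}
  {ℋ : Type*} [NormedAddCommGroup ℋ] [InnerProductSpace ℂ ℋ] [CompleteSpace ℋ]
  (𝒯 : GCITheory D I p h ℋ)

/-! ### The homogeneous parts of the fields as finite sums -/

/-- The field component `A` has no modes with `n ≤ -N` on `Ψ`. -/
def TruncatedAt (A : I) (Ψ : 𝒯.dom) (N : ℤ) : Prop := ∀ n ≤ -N, ∀ m σ, 𝒯.mode A n m σ Ψ = 0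

variable {𝒯}

lemma part_eq_sum {A : I} {Ψ : 𝒯.dom} {N : ℤ} (hN : 𝒯.TruncatedAt A Ψ N) (k : ℤ)
    (z : Fin D → ℂ) : part h 𝒯.mode A k z Ψ = ∑ i ∈ range (k / 2 + N).toNat,
      ∑ σ, (dot z z ^ ((i : ℤ) + 1 - N) * eval z
        (h (k - 2 * (i + 1 - N)).toNat σ : MvPolynomial (Fin D) ℂ)) •
        𝒯.mode A (i + 1 - N) (k - 2 * (i + 1 - N)).toNat σ Ψ :=
  finsum_level (fun x => ∑ σ : ι x.2,
      (dot z z ^ x.1 * eval z (h x.2 σ : MvPolynomial (Fin D) ℂ)) •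
        𝒯.mode A x.1 x.2 σ Ψ) k N fun x hx =>
    sum_eq_zero fun σ _ => by rw [hN x.1 hx, smul_zero]

lemma dpart_eq_sum {A : I} {Ψ : 𝒯.dom} {N : ℤ} (hN : 𝒯.TruncatedAt A Ψ N) (α : Fin D) (k : ℤ)
    (z : Fin D → ℂ) : dpart h 𝒯.mode A α k z Ψ = ∑ i ∈ range (k / 2 + N).toNat,
      ∑ σ, ((((i : ℤ) + 1 - N : ℤ) : ℂ) * dot z z ^ ((i : ℤ) + 1 - N - 1) * (2 * z α) *
        eval z (h (k - 2 * (i + 1 - N)).toNat σ : MvPolynomial (Fin D) ℂ) +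
        dot z z ^ ((i : ℤ) + 1 - N) * eval z (pderiv α
          (h (k - 2 * (i + 1 - N)).toNat σ : MvPolynomial (Fin D) ℂ))) •
        𝒯.mode A (i + 1 - N) (k - 2 * (i + 1 - N)).toNat σ Ψ :=
  finsum_level (fun x => ∑ σ : ι x.2,
      ((x.1 : ℂ) * dot z z ^ (x.1 - 1) * (2 * z α) *
          eval z (h x.2 σ : MvPolynomial (Fin D) ℂ) +
        dot z z ^ x.1 *
          eval z (pderiv α (h x.2 σ : MvPolynomial (Fin D) ℂ))) •
        𝒯.mode A x.1 x.2 σ Ψ) k N fun x hx =>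
    sum_eq_zero fun σ _ => by rw [hN x.1 hx, smul_zero]

lemma TruncatedAt.mono {A : I} {Ψ : 𝒯.dom} {N N' : ℤ} (hN : 𝒯.TruncatedAt A Ψ N)
    (hle : N ≤ N') : 𝒯.TruncatedAt A Ψ N' := fun n hn => hN n (by omega)

variable (𝒯) in
lemma exists_truncatedAt (A : I) (Ψ : 𝒯.dom) : ∃ N, 𝒯.TruncatedAt A Ψ N := 𝒯.truncation A Ψ

variable (𝒯) in
/-- The homogeneous part of degree `k` of `φ_A(z)`, as a linear operator. -/
def partL (A : I) (k : ℤ) (z : Fin D → ℂ) : 𝒯.dom →ₗ[ℂ] 𝒯.dom where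
  toFun := part h 𝒯.mode A k z
  map_add' := fun Ψ Φ => by
    obtain ⟨N, hN⟩ := 𝒯.exists_truncatedAt A Ψ
    obtain ⟨N', hN'⟩ := 𝒯.exists_truncatedAt A Φ
    have h1 := hN.mono (le_max_left N N')
    have h2 := hN'.mono (le_max_right N N')
    have h3 : 𝒯.TruncatedAt A (Ψ + Φ) (max N N') := fun n hn m σ => by
      rw [map_add, h1 n hn, h2 n hn, add_zero]
    simp only [part_eq_sum h1, part_eq_sum h2, part_eq_sum h3, map_add, smul_add,
      sum_add_distrib]
  map_smul' := fun c Ψ => by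
    obtain ⟨N, hN⟩ := 𝒯.exists_truncatedAt A Ψ
    have h3 : 𝒯.TruncatedAt A (c • Ψ) N := fun n hn m σ => by
      rw [map_smul, hN n hn, smul_zero]
    simp only [part_eq_sum hN, part_eq_sum h3, map_smul, Finset.smul_sum, RingHom.id_apply]
    refine sum_congr rfl fun i _ => sum_congr rfl fun σ _ => smul_comm _ _ _

lemma partL_apply (A : I) (k : ℤ) (z : Fin D → ℂ) (Ψ : 𝒯.dom) :
    𝒯.partL A k z Ψ = part h 𝒯.mode A k z Ψ := rfl

variable (𝒯) in
lemma exists_part_eq_zero (A : I) (Ψ : 𝒯.dom) :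
    ∃ K : ℤ, ∀ k < K, ∀ z, part h 𝒯.mode A k z Ψ = 0 := by
  obtain ⟨N, hN⟩ := 𝒯.exists_truncatedAt A Ψ
  refine ⟨-2 * N, fun k hk z => ?_⟩
  rw [part_eq_sum hN, show (k / 2 + N).toNat = 0 by omega, Finset.sum_range_zero]

/-- Euler's identity for the homogeneous parts. -/
lemma sum_smul_dpart (A : I) (k : ℤ) {z : Fin D → ℂ} (hz : dot z z ≠ 0) (Ψ : 𝒯.dom) :
    ∑ α, z α • dpart h 𝒯.mode A α k z Ψ = (k : ℂ) • part h 𝒯.mode A k z Ψ := by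
  obtain ⟨N, hN⟩ := 𝒯.exists_truncatedAt A Ψ
  simp only [dpart_eq_sum hN, part_eq_sum hN, Finset.smul_sum]
  rw [sum_comm]
  refine sum_congr rfl fun i hi => ?_
  rw [sum_comm]
  refine sum_congr rfl fun σ _ => ?_
  simp only [smul_smul]
  rw [← Finset.sum_smul]
  congr 1
  rw [sum_mul_gradient (isHomogeneous_basis _ σ) hz]
  congr 1
  rw [mem_range] at hi
  have : k = 2 * ((i : ℤ) + 1 - N) + (k - 2 * ((i : ℤ) + 1 - N)).toNat := by omega
  conv_rhs => rw [this]
  push_cast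
  ring

/-- A linear functional that annihilates the values of the homogeneous part of degree `k` of
`φ_A(z) Ψ` annihilates the modes. -/
lemma apply_mode_eq_zero (L : 𝒯.dom →ₗ[ℂ] ℂ) (A : I) (k : ℤ) (Ψ : 𝒯.dom)
    (hL : ∀ z, dot z z ≠ 0 → L (part h 𝒯.mode A k z Ψ) = 0) (n : ℤ) (m : ℕ) (σ : ι m)
    (hk : 2 * n + m = k) : L (𝒯.mode A n m σ Ψ) = 0 := by
  obtain ⟨N, hN⟩ := 𝒯.exists_truncatedAt A Ψ
  rcases le_or_gt n (-N) with hn | hn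
  · rw [hN n hn, map_zero]
  set F : ℕ → MvPolynomial (Fin D) ℂ := fun i => ∑ σ : ι (k - 2 * (i + 1 - N)).toNat,
    L (𝒯.mode A (i + 1 - N) (k - 2 * (i + 1 - N)).toNat σ Ψ) •
      (h (k - 2 * (i + 1 - N)).toNat σ : MvPolynomial (Fin D) ℂ)
  have hsum : ∀ z, dot z z ≠ 0 → L (part h 𝒯.mode A k z Ψ) =
      ∑ i ∈ range (k / 2 + N).toNat, dot z z ^ ((i : ℤ) + 1 - N) *
        eval z (F i) := fun z _ => by
    rw [part_eq_sum hN, map_sum]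
    refine sum_congr rfl fun i _ => ?_
    rw [map_sum, map_sum, mul_sum]
    refine sum_congr rfl fun σ _ => ?_
    rw [map_smul, MvPolynomial.smul_eval, smul_eq_mul]; ring
  have hrad : ∀ z : Fin D → ℂ, eval z (radSq id) = dot z z := fun z => by
    simp [radSq, dot, sq]
  have hQ : radSq id * ∑ i ∈ range (k / 2 + N).toNat, radSq id ^ i * F i = 0 := by
    refine MvPolynomial.funext fun z => ?_
    rw [map_mul, hrad, map_zero]
    rcases eq_or_ne (dot z z) 0 with hz | hz
    · rw [hz, zero_mul]
    · have h1 := hsum z hz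
      rw [hL z hz] at h1
      have h2 : eval z (∑ i ∈ range (k / 2 + N).toNat, radSq id ^ i * F i) =
          dot z z ^ (N - 1) * ∑ i ∈ range (k / 2 + N).toNat, dot z z ^ ((i : ℤ) + 1 - N) *
            eval z (F i) := by
        rw [map_sum, mul_sum]
        refine sum_congr rfl fun i _ => ?_
        rw [map_mul, map_pow, hrad, ← mul_assoc, ← zpow_add₀ hz, ← zpow_natCast]
        congr 2; ring
      rw [h2, ← h1, mul_zero, mul_zero]
  have hF : ∀ i, lap id (F i) = 0 := fun i => by
    rw [map_sum]
    exact sum_eq_zero fun σ _ => by rw [map_smul, lap_basis, smul_zero]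
  have h0 := eq_zero_of_sum_radSq_pow id _ F hF
    ((mul_eq_zero.1 hQ).resolve_left (radSq_ne_zero id)) (n + N - 1).toNat (by omega)
  have hn' : (((n + N - 1).toNat : ℤ) + 1 - N) = n := by omega
  have hm' : (k - 2 * (((n + N - 1).toNat : ℤ) + 1 - N)).toNat = m := by omega
  have h1 : ∀ (n' : ℤ) (m' : ℕ), n' = n → m' = m → (∑ σ : ι m', L (𝒯.mode A n' m' σ Ψ) •
      (h m' σ : MvPolynomial (Fin D) ℂ)) = 0 → L (𝒯.mode A n m σ Ψ) = 0 := by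
    rintro n' m' rfl rfl h2
    have h3 : ∑ σ, L (𝒯.mode A n' m' σ Ψ) • h m' σ = 0 := by
      refine Subtype.ext ?_
      rw [Submodule.coe_sum, Submodule.coe_zero, ← h2]; rfl
    exact (Fintype.linearIndependent_iff.1 (h m').linearIndependent) _ h3 σ
  exact h1 _ _ hn' hm' h0

lemma mode_mem_of_part_mem (W : Submodule ℂ 𝒯.dom) (A : I) (Ψ : 𝒯.dom)
    (hW : ∀ k z, dot z z ≠ 0 → part h 𝒯.mode A k z Ψ ∈ W) (n : ℤ) (m : ℕ) (σ : ι m) :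
    𝒯.mode A n m σ Ψ ∈ W := by
  rw [← Submodule.Quotient.mk_eq_zero, ← Module.forall_dual_apply_eq_zero_iff ℂ]
  intro φ
  refine apply_mode_eq_zero (φ ∘ₗ W.mkQ) A (2 * n + m) Ψ (fun z hz => ?_) n m σ rfl
  rw [LinearMap.comp_apply, Submodule.mkQ_apply, (Submodule.Quotient.mk_eq_zero W).2 (hW _ z hz),
    map_zero]

/-- If a homogeneous part has zero gradient and vanishes at one point, then it vanishes: it is
constant on complex lines. -/
lemma part_eq_zero_of_dpart (A : I) (k : ℤ) (Ψ : 𝒯.dom)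
    (hd : ∀ α z, dot z z ≠ 0 → dpart h 𝒯.mode A α k z Ψ = 0) {e z : Fin D → ℂ}
    (he : dot e e ≠ 0) (hz : dot z z ≠ 0) (h0 : part h 𝒯.mode A k e Ψ = 0) :
    part h 𝒯.mode A k z Ψ = 0 := by
  rw [← Module.forall_dual_apply_eq_zero_iff ℂ]
  intro L
  obtain ⟨N, hN⟩ := 𝒯.exists_truncatedAt A Ψ
  set w := z - e
  set S : Set ℂ := {t | dot (e + t • w) (e + t • w) ≠ 0}
  set q : Polynomial ℂ := Polynomial.C (dot e e) + Polynomial.C (2 * dot e w) * Polynomial.X +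
    Polynomial.C (dot w w) * Polynomial.X ^ 2
  have hq : ∀ t, q.eval t = dot (e + t • w) (e + t • w) := fun t => by
    rw [dot_add_smul]; simp [q]
  have hq0 : q ≠ 0 := fun h0 => he (by
    have := hq 0
    rw [h0, zero_smul, add_zero] at this
    simpa using this.symm)
  have hS : S = (↑q.roots.toFinset : Set ℂ)ᶜ := by
    ext t
    simp [S, hq0, hq, Polynomial.IsRoot]
  have hopen : IsOpen S := by rw [hS]; exact q.roots.toFinset.finite_toSet.isClosed.isOpen_compl
  have hconn : IsPreconnected S := by
    rw [hS]
    exact (q.roots.toFinset.finite_toSet.countable.isConnected_compl_of_one_lt_rank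
      (by rw [Complex.rank_real_complex]; norm_num)).isPreconnected
  have hder : ∀ t ∈ S, HasDerivAt (fun t => L (part h 𝒯.mode A k (e + t • w) Ψ)) 0 t :=
    fun t ht => by
    have h1 : (∑ α, w α * L (dpart h 𝒯.mode A α k (e + t • w) Ψ)) = 0 :=
      sum_eq_zero fun α _ => by rw [hd α _ ht, map_zero, mul_zero]
    rw [← h1]
    simp only [part_eq_sum hN, dpart_eq_sum hN, map_sum, map_smul, smul_eq_mul, mul_sum]
    rw [sum_comm]
    refine HasDerivAt.fun_sum fun i _ => ?_
    rw [sum_comm]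
    refine HasDerivAt.fun_sum fun σ _ => ?_
    refine ((hasDerivAt_dot_zpow_mul_eval _ e w ht _).mul_const _).congr_deriv ?_
    rw [sum_mul]
    exact sum_congr rfl fun α _ => mul_assoc _ _ _
  have h0S : (0 : ℂ) ∈ S := by simpa [S] using he
  have h1S : (1 : ℂ) ∈ S := by simpa [S, w] using hz
  have h2 := hopen.is_const_of_deriv_eq_zero hconn
    (fun t ht => (hder t ht).differentiableAt.differentiableWithinAt)
    (fun t ht => (hder t ht).deriv) h1S h0S
  simp only [one_smul, zero_smul, add_zero] at h2
  rw [h0, map_zero] at h2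
  rwa [show e + w = z by simp [w]] at h2

variable (𝒯)

/-! ### Spin and statistics -/

lemma H_part {A : I} {k : ℤ} {z : Fin D → ℂ} (hz : dot z z ≠ 0) {E : ℂ} {Ψ : 𝒯.dom}
    (hΨ : 𝒯.H Ψ = E • Ψ) : 𝒯.H (𝒯.partL A k z Ψ) = (E + k + 𝒯.d A) • 𝒯.partL A k z Ψ := by
  have h1 := 𝒯.cov_H A k z hz Ψ
  rw [hΨ] at h1
  simp only [← partL_apply, map_smul] at h1
  rw [sub_eq_iff_eq_add] at h1
  rw [h1, ← add_smul]
  congr 1; ring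

lemma eigenvalue_eq_conj {Ψ : 𝒯.dom} {E : ℂ} (hΨ : 𝒯.H Ψ = E • Ψ) {Φ : 𝒯.dom} {E' : ℂ}
    (hΦ : 𝒯.H Φ = E' • Φ) (hE : (starRingEnd ℂ) E ≠ E') : ⟪Ψ, Φ⟫_ℂ = 0 := by
  have h1 := 𝒯.adj_H Ψ Φ
  rw [hΨ, hΦ, inner_smul_left, inner_smul_right] at h1
  have h2 : ((starRingEnd ℂ) E - E') * ⟪Ψ, Φ⟫_ℂ = 0 := by rw [sub_mul, h1, sub_self]
  exact (mul_eq_zero.1 h2).resolve_left (sub_ne_zero.2 hE)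

lemma eq_zero_of_energy_neg {Ψ : 𝒯.dom} {E : ℝ} (hE : E < 0) (hΨ : 𝒯.H Ψ = (E : ℂ) • Ψ) :
    Ψ = 0 := by
  have h1 := 𝒯.H_nonneg Ψ
  rw [hΨ, inner_smul_right, inner_self_eq_norm_sq_to_K] at h1
  have h2 : ((E : ℂ) * ((‖Ψ‖ : ℝ) : ℂ) ^ 2).re = E * ‖Ψ‖ ^ 2 := by
    rw [← Complex.ofReal_pow, ← Complex.ofReal_mul, Complex.ofReal_re]
  have h3 : 0 ≤ E * ‖Ψ‖ ^ 2 := h2 ▸ h1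
  by_contra h4
  have : 0 < ‖Ψ‖ ^ 2 := by positivity
  nlinarith

lemma inner_vac_eq_zero {Ψ : 𝒯.dom} {E : ℂ} (hΨ : 𝒯.H Ψ = E • Ψ) (hE : E ≠ 0) :
    ⟪𝒯.vac, Ψ⟫_ℂ = 0 :=
  𝒯.eigenvalue_eq_conj (E := 0) (by rw [𝒯.vac_inv.1, zero_smul]) hΨ (by simpa using hE.symm)

/-- The generator of translations in the direction `z`. -/
def translate (z : Fin D → ℂ) : End ℂ 𝒯.dom := ∑ α, z α • 𝒯.T α

lemma translate_vac (z : Fin D → ℂ) : 𝒯.translate z 𝒯.vac = 0 := by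
  rw [translate, LinearMap.sum_apply]
  exact sum_eq_zero fun α _ => by rw [LinearMap.smul_apply, 𝒯.vac_inv.2.1, smul_zero]

lemma inner_vac_translate (z : Fin D → ℂ) (Ψ : 𝒯.dom) : ⟪𝒯.vac, 𝒯.translate z Ψ⟫_ℂ = 0 := by
  have h1 : ∀ α, ⟪𝒯.vac, 𝒯.T α Ψ⟫_ℂ = 0 := fun α => by
    rw [← inner_conj_symm, 𝒯.adj_T, 𝒯.vac_inv.2.2.1, inner_zero_right, neg_zero, map_zero]
  rw [translate, LinearMap.sum_apply]
  simp only [LinearMap.smul_apply]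
  rw [inner_sum]
  exact sum_eq_zero fun α _ => by rw [inner_smul_right, h1, mul_zero]

lemma translate_part (A : I) (k : ℤ) {z : Fin D → ℂ} (hz : dot z z ≠ 0) (Ψ : 𝒯.dom) :
    𝒯.translate z (𝒯.partL A k z Ψ) - 𝒯.partL A k z (𝒯.translate z Ψ) =
      ((k : ℂ) + 1) • 𝒯.partL A (k + 1) z Ψ := by
  have h1 := sum_smul_dpart A (k + 1) hz Ψ
  rw [Int.cast_add, Int.cast_one] at h1
  rw [partL_apply (k := k + 1), ← h1, translate, LinearMap.sum_apply, LinearMap.sum_apply, map_sum,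
    ← sum_sub_distrib]
  refine sum_congr rfl fun α _ => ?_
  rw [← 𝒯.cov_T A α k z hz Ψ, LinearMap.smul_apply, LinearMap.smul_apply, map_smul, smul_sub]
  rfl

lemma translate_part_vac (A : I) (k : ℤ) {z : Fin D → ℂ} (hz : dot z z ≠ 0) :
    𝒯.translate z (𝒯.partL A k z 𝒯.vac) = ((k : ℂ) + 1) • 𝒯.partL A (k + 1) z 𝒯.vac := by
  rw [← translate_part _ _ _ hz, translate_vac, map_zero, sub_zero]

/-- The field applied to the vacuum is regular at the origin. -/
lemma part_vac_eq_zero (A : I) {k : ℤ} (hk : k < 0) {z : Fin D → ℂ} (hz : dot z z ≠ 0) :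
    𝒯.partL A k z 𝒯.vac = 0 := by
  obtain ⟨K, hK⟩ := 𝒯.exists_part_eq_zero A 𝒯.vac
  have h1 : ∀ i : ℕ, K - 1 + i < 0 → 𝒯.partL A (K - 1 + i) z 𝒯.vac = 0 := fun i => by
    induction i with
    | zero => exact fun _ => hK _ (by simp) z
    | succ i ih =>
      intro hi
      have h2 := 𝒯.translate_part_vac A (K - 1 + i) hz
      rw [ih (by push_cast at hi; omega), map_zero, eq_comm, smul_eq_zero] at h2
      have h3 : ((K - 1 + i : ℤ) : ℂ) + 1 ≠ 0 := by
        have : (K - 1 + i : ℤ) + 1 ≠ 0 := by push_cast at hi; omega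
        exact_mod_cast this
      rw [Nat.cast_add, Nat.cast_one, ← add_assoc]
      exact h2.resolve_left h3
  rcases lt_or_ge k K with h2 | h2
  · exact hK k h2 z
  · have := h1 (k - (K - 1)).toNat (by omega)
    rwa [show K - 1 + ((k - (K - 1)).toNat : ℤ) = k by omega] at this

/-- Separating property of the vacuum: no field annihilates it. -/
lemma exists_part_vac_ne_zero (A : I) :
    ∃ k z, dot z z ≠ 0 ∧ 𝒯.partL A k z 𝒯.vac ≠ 0 := by
  by_contra! hA
  set W : Submodule ℂ 𝒯.dom :=
    ⨅ x : {x : ℤ × (Fin D → ℂ) // dot x.2 x.2 ≠ 0}, LinearMap.ker (𝒯.partL A x.1.1 x.1.2)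
  have hW : ∀ Ψ, Ψ ∈ W ↔ ∀ k z, dot z z ≠ 0 → 𝒯.partL A k z Ψ = 0 := fun Ψ => by
    simp only [W, Submodule.mem_iInf, LinearMap.mem_ker, Subtype.forall, Prod.forall]
  have htop : W = ⊤ := by
    refine 𝒯.complete W ((hW _).2 hA) fun B n m σ Ψ hΨ => ?_
    refine mode_mem_of_part_mem W B Ψ (fun k₂ w hw => (hW _).2 fun k z hz => ?_) n m σ
    obtain ⟨M, hM⟩ := 𝒯.locality A B
    obtain ⟨K, hK⟩ := 𝒯.exists_part_eq_zero B Ψ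
    have h0 := eq_zero_of_iterate_mulInterval (V := 𝒯.dom) (z := z) (w := w) (M := M) (K := K)
      (f := fun k₁ k₂ => 𝒯.partL A k₁ z (part h 𝒯.mode B k₂ w Ψ)) hz (fun a b hb => by
        rw [hK b hb, map_zero]) (by
        ext1 a; ext1 b
        have h1 := hM Ψ z w hz hw a b
        have h2 : ∀ k₁, part h 𝒯.mode A k₁ z Ψ = 0 := fun k₁ => (hW Ψ).1 hΨ k₁ z hz
        have h3 : ∀ k₁ k₂, part h 𝒯.mode B k₂ w (part h 𝒯.mode A k₁ z Ψ) = 0 := fun k₁ k₂ => by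
          rw [h2]; exact map_zero (𝒯.partL B k₂ w)
        simp only [h3, smul_zero, sub_zero] at h1
        exact h1)
    exact congrFun (congrFun h0 k) k₂
  obtain ⟨n, m, σ, hne⟩ := 𝒯.field_ne_zero A
  refine hne (LinearMap.ext fun Ψ => ?_)
  have hΨ : Ψ ∈ W := htop ▸ Submodule.mem_top
  have := mode_mem_of_part_mem ⊥ A Ψ (fun k z hz => by
    rw [Submodule.mem_bot]; exact (hW Ψ).1 hΨ k z hz) n m σ
  simpa using this

/-- The leading term of the field on the vacuum, at one point, does not vanish. -/
lemma part_zero_vac_ne_zero (A : I) {e : Fin D → ℂ} (he : dot e e ≠ 0) :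
    𝒯.partL A 0 e 𝒯.vac ≠ 0 := fun h0 => by
  have h1 : ∀ z, dot z z ≠ 0 → 𝒯.partL A 0 z 𝒯.vac = 0 := fun z hz => by
    refine part_eq_zero_of_dpart A 0 𝒯.vac (fun α z hz => ?_) he hz h0
    have h2 := 𝒯.cov_T A α (-1) z hz 𝒯.vac
    rw [𝒯.vac_inv.2.1] at h2
    simp only [← partL_apply, map_zero] at h2
    rw [𝒯.part_vac_eq_zero A (by norm_num) hz, map_zero, sub_zero] at h2
    exact h2.symm
  have h2 : ∀ i : ℕ, ∀ z, dot z z ≠ 0 → 𝒯.partL A i z 𝒯.vac = 0 := fun i => by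
    induction i with
    | zero => exact h1
    | succ i ih =>
      intro z hz
      have h3 := 𝒯.translate_part_vac A i hz
      rw [ih z hz, map_zero, eq_comm, smul_eq_zero] at h3
      refine h3.resolve_left ?_
      exact_mod_cast (Nat.succ_ne_zero i)
  obtain ⟨k, z, hz, hne⟩ := 𝒯.exists_part_vac_ne_zero A
  rcases lt_or_ge k 0 with hk | hk
  · exact hne (𝒯.part_vac_eq_zero A hk hz)
  · have := h2 k.toNat z hz
    rw [Int.toNat_of_nonneg hk] at this
    exact hne this

/-- The last basis vector, as a point of `ℂ^D`. -/
def eLast (D : ℕ) [NeZero D] : Fin D → ℂ := coord (unitVec (lastIdx D))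

lemma dot_eLast : dot (eLast D) (eLast D) = 1 := dot_coord_self _

/-- The conjugate field at the point `e_D`. -/
def conjPart (A : I) (k : ℤ) : End ℂ 𝒯.dom := ∑ B, 𝒯.J A B • 𝒯.partL B k (eLast D)

lemma inner_part_eq (A : I) {k k' : ℤ} (hk : (k : ℝ) + k' + 2 * 𝒯.d A = 0) (Ψ₁ Ψ₂ : 𝒯.dom) :
    ⟪Ψ₁, 𝒯.partL A k (eLast D) Ψ₂⟫_ℂ = ⟪𝒯.conjPart A k' Ψ₁, Ψ₂⟫_ℂ := by
  have h1 : spinPair (unitVec (lastIdx D)) (unitVec (lastIdx D)) = 1 :=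
    Subtype.ext (ι_mul_self _)
  have h2 := 𝒯.conj_law A (unitVec (lastIdx D)) k k' hk Ψ₁ Ψ₂
  rw [h1, map_one] at h2
  simp only [Matrix.one_apply, ite_mul, one_mul, zero_mul, Finset.sum_ite_eq, mem_univ,
    if_true] at h2
  rw [conjPart, LinearMap.sum_apply]
  exact h2

lemma H_conjPart (A : I) (k : ℤ) {E : ℂ} {Ψ : 𝒯.dom} (hΨ : 𝒯.H Ψ = E • Ψ) :
    𝒯.H (𝒯.conjPart A k Ψ) = (E + k + 𝒯.d A) • 𝒯.conjPart A k Ψ := by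
  have hz : dot (eLast D) (eLast D) ≠ 0 := by rw [dot_eLast]; exact one_ne_zero
  rw [conjPart, LinearMap.sum_apply, map_sum, Finset.smul_sum]
  refine sum_congr rfl fun B _ => ?_
  rw [LinearMap.smul_apply, map_smul, 𝒯.H_part hz hΨ, smul_comm]
  by_cases hJ : 𝒯.J A B = 0
  · rw [hJ, zero_smul, smul_zero, smul_zero]
  · rw [(𝒯.J_grading A B hJ).1]

lemma H_vac : 𝒯.H 𝒯.vac = (0 : ℂ) • 𝒯.vac := by rw [𝒯.vac_inv.1, zero_smul]

lemma conjPart_vac_eq_zero (A : I) {k : ℤ} (hk : k < 0) : 𝒯.conjPart A k 𝒯.vac = 0 := by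
  rw [conjPart, LinearMap.sum_apply]
  refine sum_eq_zero fun B _ => ?_
  rw [LinearMap.smul_apply, 𝒯.part_vac_eq_zero B hk (by rw [dot_eLast]; exact one_ne_zero),
    smul_zero]

lemma translate_conjPart_vac (A : I) (k : ℤ) :
    𝒯.translate (eLast D) (𝒯.conjPart A k 𝒯.vac) =
      ((k : ℂ) + 1) • 𝒯.conjPart A (k + 1) 𝒯.vac := by
  have hz : dot (eLast D) (eLast D) ≠ 0 := by rw [dot_eLast]; exact one_ne_zero
  rw [conjPart, conjPart, LinearMap.sum_apply, LinearMap.sum_apply, map_sum, Finset.smul_sum]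
  refine sum_congr rfl fun B _ => ?_
  rw [LinearMap.smul_apply, LinearMap.smul_apply, map_smul, 𝒯.translate_part_vac B k hz, smul_comm]

/-- Locality of a field and its conjugate, applied to the vacuum. -/
lemma conj_locality (A : I) : ∃ M : ℕ, ∀ Ψ : 𝒯.dom,
    (mulInterval (eLast D) (eLast D))^[M] (fun k₁ k₂ =>
      𝒯.partL A k₁ (eLast D) (𝒯.conjPart A k₂ Ψ) - paritySign (p A) (p A) •
        𝒯.conjPart A k₂ (𝒯.partL A k₁ (eLast D) Ψ)) = 0 := by
  have hz : dot (eLast D) (eLast D) ≠ 0 := by rw [dot_eLast]; exact one_ne_zero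
  choose M hM using fun B => 𝒯.locality A B
  refine ⟨∑ B, M B, fun Ψ => ?_⟩
  have h1 : (fun k₁ k₂ => 𝒯.partL A k₁ (eLast D) (𝒯.conjPart A k₂ Ψ) - paritySign (p A) (p A) •
      𝒯.conjPart A k₂ (𝒯.partL A k₁ (eLast D) Ψ)) =
      ∑ B, fun k₁ k₂ => (LinearMap.lsmul ℂ 𝒯.dom (𝒯.J A B)) (𝒯.partL A k₁ (eLast D)
        (𝒯.partL B k₂ (eLast D) Ψ) - paritySign (p A) (p B) •
        𝒯.partL B k₂ (eLast D) (𝒯.partL A k₁ (eLast D) Ψ)) := by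
    ext1 k₁; ext1 k₂
    simp only [conjPart, LinearMap.sum_apply, map_sum, Finset.smul_sum, ← sum_sub_distrib,
      Finset.sum_apply]
    refine sum_congr rfl fun B _ => ?_
    simp only [LinearMap.smul_apply, map_smul, LinearMap.lsmul_apply, smul_sub]
    by_cases hJ : 𝒯.J A B = 0
    · simp [hJ]
    · rw [(𝒯.J_grading A B hJ).2, smul_comm]
  rw [h1, iterate_mulInterval_sum]
  refine sum_eq_zero fun B _ => ?_
  rw [iterate_mulInterval_map]
  have h2 := iterate_mulInterval_eq_zero_of_le (eLast D) (eLast D)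
    (single_le_sum (f := M) (fun _ _ => Nat.zero_le _) (mem_univ B))
    (funext fun a => funext fun b => hM B Ψ (eLast D) (eLast D) hz hz a b)
  ext1 a; ext1 b
  have h3 := congrFun (congrFun h2 a) b
  simp only [Pi.zero_apply] at h3 ⊢
  refine (congrArg _ h3).trans (map_zero _)

lemma inner_vac_conjPart (A : I) {k k' : ℤ} (hk : (k : ℝ) + k' + 2 * 𝒯.d A = 0) (Ψ : 𝒯.dom) :
    ⟪𝒯.vac, 𝒯.conjPart A k' Ψ⟫_ℂ = ⟪𝒯.partL A k (eLast D) 𝒯.vac, Ψ⟫_ℂ := by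
  rw [Submodule.coe_inner, ← inner_conj_symm, ← Submodule.coe_inner, ← 𝒯.inner_part_eq A hk,
    Submodule.coe_inner, inner_conj_symm, Submodule.coe_inner]

/-- The differences of the norms of the vectors created by a field and by its conjugate are
annihilated by a difference operator. -/
lemma exists_nabla_pow_norms (A : I) {m : ℤ} (hm : 2 * 𝒯.d A = m) : ∃ M : ℕ, (nabla ^ M)
    (fun k => ⟪𝒯.conjPart A k 𝒯.vac, 𝒯.conjPart A k 𝒯.vac⟫_ℂ - paritySign (p A) (p A) *
      ⟪𝒯.partL A (-m - k) (eLast D) 𝒯.vac, 𝒯.partL A (-m - k) (eLast D) 𝒯.vac⟫_ℂ) = 0 := by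
  have hz : dot (eLast D) (eLast D) ≠ 0 := by rw [dot_eLast]; exact one_ne_zero
  obtain ⟨M, hM⟩ := 𝒯.conj_locality A
  refine ⟨2 * M, funext fun b => ?_⟩
  have h1 := iterate_mulInterval_map (eLast D) (eLast D)
    ((innerSL ℂ (𝒯.vac : ℋ)).toLinearMap ∘ₗ 𝒯.dom.subtype) M (fun k₁ k₂ =>
      𝒯.partL A k₁ (eLast D) (𝒯.conjPart A k₂ 𝒯.vac) - paritySign (p A) (p A) •
        𝒯.conjPart A k₂ (𝒯.partL A k₁ (eLast D) 𝒯.vac))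
  rw [hM] at h1
  have hm' : (𝒯.d A : ℂ) + 𝒯.d A = m := by
    rw [← two_mul]; exact_mod_cast congrArg (Complex.ofReal) hm
  have h2 : (fun k₁ k₂ => ((innerSL ℂ (𝒯.vac : ℋ)).toLinearMap ∘ₗ 𝒯.dom.subtype)
      (𝒯.partL A k₁ (eLast D) (𝒯.conjPart A k₂ 𝒯.vac) - paritySign (p A) (p A) •
        𝒯.conjPart A k₂ (𝒯.partL A k₁ (eLast D) 𝒯.vac))) = fun k₁ k₂ => if k₁ + k₂ = -m then
      ⟪𝒯.conjPart A k₂ 𝒯.vac, 𝒯.conjPart A k₂ 𝒯.vac⟫_ℂ - paritySign (p A) (p A) *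
      ⟪𝒯.partL A (-m - k₂) (eLast D) 𝒯.vac, 𝒯.partL A (-m - k₂) (eLast D) 𝒯.vac⟫_ℂ else 0 := by
    ext k₁ k₂
    change ⟪𝒯.vac, 𝒯.partL A k₁ (eLast D) (𝒯.conjPart A k₂ 𝒯.vac) - paritySign (p A) (p A) •
        𝒯.conjPart A k₂ (𝒯.partL A k₁ (eLast D) 𝒯.vac)⟫_ℂ = _
    rw [inner_sub_right, inner_smul_right]
    split_ifs with hk
    · have hk' : (k₁ : ℝ) + k₂ + 2 * 𝒯.d A = 0 := by
        rw [hm, ← Int.cast_add, ← Int.cast_add, hk]; simp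
      rw [show -m - k₂ = k₁ by omega, 𝒯.inner_part_eq A hk', 𝒯.inner_vac_conjPart A hk']
    · have hne : ((k₁ + k₂ + m : ℤ) : ℂ) ≠ 0 := by
        have : k₁ + k₂ + m ≠ 0 := by omega
        exact_mod_cast this
      have h3 := 𝒯.H_part (A := A) (k := k₁) hz (𝒯.H_conjPart A k₂ 𝒯.H_vac)
      have h4 := 𝒯.H_conjPart A k₂ (𝒯.H_part (A := A) (k := k₁) hz 𝒯.H_vac)
      push_cast at hne
      rw [← hm'] at hne
      rw [𝒯.inner_vac_eq_zero h3 (by convert hne using 1; ring),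
        𝒯.inner_vac_eq_zero h4 (by convert hne using 1; ring), mul_zero, sub_zero]
  rw [h2, iterate_mulInterval_self dot_eLast] at h1
  have h3 := congrFun (congrFun h1 (-m + 2 * M - b)) b
  rw [if_pos (by ring)] at h3
  exact h3.trans (map_zero _)

lemma inner_conjPart_succ (A : I) {m : ℤ} (hm : 2 * 𝒯.d A = m) (k : ℤ) :
    ((k : ℂ) + 1) * ⟪𝒯.conjPart A (k + 1) 𝒯.vac, 𝒯.conjPart A (k + 1) 𝒯.vac⟫_ℂ =
      (k + m) * ⟪𝒯.conjPart A k 𝒯.vac, 𝒯.conjPart A k 𝒯.vac⟫_ℂ := by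
  have hz : dot (eLast D) (eLast D) ≠ 0 := by rw [dot_eLast]; exact one_ne_zero
  have h1 : ∀ k : ℤ, ⟪𝒯.conjPart A k 𝒯.vac, 𝒯.conjPart A k 𝒯.vac⟫_ℂ =
      ⟪𝒯.vac, 𝒯.partL A (-m - k) (eLast D) (𝒯.conjPart A k 𝒯.vac)⟫_ℂ := fun k =>
    (𝒯.inner_part_eq A (by rw [hm]; push_cast; ring) _ _).symm
  have h2 := 𝒯.translate_part A (-m - k - 1) hz (𝒯.conjPart A k 𝒯.vac)
  rw [translate_conjPart_vac, sub_eq_iff_eq_add] at h2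
  have h3 := 𝒯.inner_vac_translate (eLast D)
    (𝒯.partL A (-m - k - 1) (eLast D) (𝒯.conjPart A k 𝒯.vac))
  rw [h2, inner_add_right, map_smul, inner_smul_right, inner_smul_right, sub_add_cancel, ← h1,
    sub_sub, ← h1] at h3
  push_cast at h3
  linear_combination h3

lemma inner_self_eq_zero_of_neg {V : Type*} [NormedAddCommGroup V] [InnerProductSpace ℂ V]
    {x y : V} (hxy : ⟪x, x⟫_ℂ = -⟪y, y⟫_ℂ) : y = 0 := by
  rw [inner_self_eq_norm_sq_to_K, inner_self_eq_norm_sq_to_K] at hxy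
  have h1 : ‖x‖ ^ 2 = -‖y‖ ^ 2 := by exact_mod_cast hxy
  have h2 : ‖y‖ ^ 2 = 0 := le_antisymm (by linarith [sq_nonneg ‖x‖]) (sq_nonneg _)
  exact norm_eq_zero.1 (pow_eq_zero_iff two_ne_zero |>.1 h2)

/-- Spin and statistics: fields of integral dimension are bosonic, fields of half-integral
dimension are fermionic. With `m = 2 d_A`, translation covariance determines the norms of the
vectors `φ*_{k} |0⟩` from that of `φ*_{0} |0⟩`, as the values of a polynomial in `k` of degree
`m - 1`. By locality they differ from the norms of the vectors `φ_{-m-k} |0⟩`, up to the sign of the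
statistics, by a polynomial, which therefore is the same one, and at `k = -m` its sign is
`(-1)^{m-1}`. -/
lemma spin_statistics (A : I) {m : ℤ} (hm : 2 * 𝒯.d A = m) : (m : ZMod 2) = p A := by
  have hz : dot (eLast D) (eLast D) ≠ 0 := by rw [dot_eLast]; exact one_ne_zero
  by_contra hp
  refine 𝒯.part_zero_vac_ne_zero A hz ?_
  rcases lt_or_ge m 0 with hneg | hpos
  · have h1 := 𝒯.H_part (A := A) (k := 0) hz 𝒯.H_vac
    rw [zero_add, Int.cast_zero, zero_add] at h1
    refine 𝒯.eq_zero_of_energy_neg ?_ h1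
    have : (m : ℝ) < 0 := by exact_mod_cast hneg
    linarith
  obtain ⟨M, hM⟩ := 𝒯.exists_nabla_pow_norms A hm
  set N' : ℤ → ℂ := fun k => ⟪𝒯.conjPart A k 𝒯.vac, 𝒯.conjPart A k 𝒯.vac⟫_ℂ with hN'
  set N : ℤ → ℂ := fun k => ⟪𝒯.partL A k (eLast D) 𝒯.vac, 𝒯.partL A k (eLast D) 𝒯.vac⟫_ℂ with hN
  set σ := paritySign (p A) (p A)
  have hrec : ∀ k : ℤ, ((k : ℂ) + 1) * N' (k + 1) = (k + m) * N' k := 𝒯.inner_conjPart_succ A hm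
  have hN0 : ∀ k < 0, N k = 0 := fun k hk => by
    simp only [hN]; rw [𝒯.part_vac_eq_zero A hk hz, inner_zero_left]
  have hN'0 : ∀ k < 0, N' k = 0 := fun k hk => by
    simp only [hN']; rw [𝒯.conjPart_vac_eq_zero A hk, inner_zero_left]
  have hsq : σ * σ = 1 := paritySign_mul_self _ _
  suffices hkey : σ * N 0 = (-1) ^ m.toNat * N' 0 by
    have h2 : σ * (-1) ^ m.toNat = -1 := by
      obtain ⟨n, rfl⟩ := Int.eq_ofNat_of_zero_le hpos
      have h3 : ∀ a b : ZMod 2, a ≠ b → (a = 0 ∧ b = 1) ∨ (a = 1 ∧ b = 0) := by decide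
      simp only [σ, paritySign, Int.toNat_natCast]
      rw [Int.cast_natCast] at hp
      rcases h3 _ _ hp with ⟨ha, hb⟩ | ⟨ha, hb⟩
      · rw [hb, Even.neg_one_pow ((ZMod.natCast_eq_zero_iff_even).1 ha)]; norm_num [ZMod.val_one]
      · rw [hb, Odd.neg_one_pow ((ZMod.natCast_eq_one_iff_odd).1 ha)]; norm_num
    have h4 : N' 0 = -N 0 := by
      have h5 : ((-1 : ℂ) ^ m.toNat) * (-1) ^ m.toNat = 1 := by
        rw [← mul_pow]; norm_num
      have h6 : σ = -(-1) ^ m.toNat := by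
        linear_combination (-1 : ℂ) ^ m.toNat * h2 - σ * h5
      rw [h6] at hkey
      linear_combination (-(-1 : ℂ) ^ m.toNat) * hkey + (-(N' 0) - N 0) * h5
    exact inner_self_eq_zero_of_neg h4
  rcases hpos.eq_or_lt with h0 | h0
  · subst h0
    have h1 : ∀ i : ℕ, N' ((i : ℤ) + 1) = 0 := fun i => by
      have h2 := hrec i
      have h3 : ((i : ℤ) : ℂ) + 1 ≠ 0 := by exact_mod_cast Nat.succ_ne_zero i
      induction i with
      | zero =>
        refine (mul_eq_zero.1 (h2.trans ?_)).resolve_left h3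
        simp
      | succ i ih =>
        refine (mul_eq_zero.1 (h2.trans ?_)).resolve_left h3
        specialize ih (hrec i) (by exact_mod_cast Nat.succ_ne_zero i)
        rw [Nat.cast_add, Nat.cast_one]
        exact mul_eq_zero_of_right _ ih
    have h2 := eq_zero_of_nabla_pow (f := fun k => N' k - σ * N (-0 - k)) (K := 1) hM fun k hk => by
      obtain ⟨i, rfl⟩ : ∃ i : ℕ, k = i + 1 := ⟨(k - 1).toNat, by omega⟩
      rw [h1, hN0 _ (by omega), mul_zero, sub_zero]
    have h3 := congrFun h2 0
    simp only [Pi.zero_apply] at h3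
    rw [neg_zero, sub_zero, sub_eq_zero] at h3
    rw [← h3, Int.toNat_zero, pow_zero, one_mul]
  · obtain ⟨n, rfl⟩ : ∃ n : ℕ, m = n + 1 := ⟨(m - 1).toNat, by omega⟩
    have h1 : ∀ i : ℕ, n.factorial * N' i = N' 0 * rising n i := fun i => by
      induction i with
      | zero => rw [Nat.cast_zero, rising_zero_right, mul_comm]
      | succ i ih =>
        have h2 := hrec i
        have h3 : ((i : ℤ) : ℂ) + 1 ≠ 0 := by exact_mod_cast Nat.succ_ne_zero i
        have h4 := rising_succ n i
        rw [rising_succ'] at h4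
        rw [Nat.cast_add, Nat.cast_one]
        refine mul_left_cancel₀ h3 ?_
        push_cast at h2 h4 ih ⊢
        linear_combination (n.factorial : ℂ) * h2 + (i + (n + 1)) * ih - N' 0 * h4
    have h2 : (n.factorial : ℂ) • (fun k => N' k - σ * N (-((n : ℤ) + 1) - k)) -
        N' 0 • rising n = 0 := by
      refine eq_zero_of_nabla_pow (M := M + (n + 1)) (K := 0) ?_ fun k hk => ?_
      · rw [map_sub, map_smul, map_smul]
        rw [pow_add _ M, Module.End.mul_apply _ _ (rising n), nabla_pow_rising, map_zero, smul_zero,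
          sub_zero, ((Commute.refl nabla).pow_pow M (n + 1)).eq, Module.End.mul_apply]
        exact smul_eq_zero_of_right _ ((congrArg _ hM).trans (map_zero _))
      · obtain ⟨i, rfl⟩ := Int.eq_ofNat_of_zero_le hk
        simp only [Pi.sub_apply, Pi.smul_apply, smul_eq_mul]
        rw [hN0 (-((n : ℤ) + 1) - i) (by omega), mul_zero, sub_zero, h1, sub_self]
    have h3 := congrFun h2 (-n - 1)
    simp only [Pi.sub_apply, Pi.smul_apply, smul_eq_mul, Pi.zero_apply] at h3
    rw [rising_neg, hN'0 _ (by omega), show -((n : ℤ) + 1) - (-n - 1) = 0 by ring] at h3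
    have h5 : (n.factorial : ℂ) ≠ 0 := by exact_mod_cast n.factorial_ne_zero
    refine mul_left_cancel₀ h5 ?_
    rw [show ((n : ℤ) + 1).toNat = n + 1 by omega, pow_succ]
    linear_combination -h3

/-- The modes in the compact picture of a bosonic (fermionic) field have even (odd) index. -/
lemma compactMode_eq_zero (A : I) {κ : ℤ} (hκ : (κ : ZMod 2) ≠ p A) (u : UnitSphere D)
    (Ψ : 𝒯.dom) : 𝒯.compactMode A κ u Ψ = 0 := by
  rw [compactMode]
  refine finsum_eq_zero_of_forall_eq_zero fun k => if_neg fun hk => hκ ?_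
  have h1 := 𝒯.spin_statistics A (m := κ - 2 * k) (by push_cast; linarith)
  rw [← h1]
  push_cast
  rw [show (2 : ZMod 2) = 0 from rfl, zero_mul, sub_zero]

/-! ### Words in the modes of the fields and their traces -/

/-- A product of operators as a function of two neighbouring factors. -/
lemma exists_prod_ofFn_eq {M : Type*} [Monoid M] {m : ℕ} (f : Fin (m + 1) → M) (k : Fin m) :
    ∃ X Y : M, ∀ g : Fin (m + 1) → M, (∀ l, l ≠ k.castSucc → l ≠ k.succ → g l = f l) →
      (List.ofFn g).prod = X * (g k.castSucc * g k.succ) * Y := by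
  induction m with
  | zero => exact k.elim0
  | succ m ih =>
    cases k using Fin.cases with
    | zero =>
      refine ⟨1, (List.ofFn fun i : Fin m => f i.succ.succ).prod, fun g hg => ?_⟩
      rw [List.ofFn_succ, List.ofFn_succ, List.prod_cons, List.prod_cons, one_mul, mul_assoc]
      refine congrArg₂ _ rfl (congrArg₂ _ rfl (congrArg _ (congrArg _ (funext fun i => ?_))))
      refine hg _ (by simp) fun h => ?_
      simp [Fin.ext_iff] at h
    | succ k =>
      obtain ⟨X, Y, h⟩ := ih (fun i => f i.succ) k
      refine ⟨f 0 * X, Y, fun g hg => ?_⟩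
      rw [List.ofFn_succ, List.prod_cons, h (fun i => g i.succ) fun l h1 h2 => hg _ (fun h3 =>
        h1 (Fin.succ_injective _ h3)) (fun h3 => h2 (Fin.succ_injective _ h3)),
        hg 0 (by simp [Fin.ext_iff]) (Fin.succ_ne_zero _).symm]
      simp only [mul_assoc]
      rfl

open Classical in
/-- The operator coefficient of `e^{πiκζ}` in the compact picture field `φ_A(ζ, u)`,
`x = (A, u)`. -/
def op (x : I × UnitSphere D) (κ : ℤ) : End ℂ 𝒯.dom :=
  if hk : ∃ k : ℤ, 2 * (𝒯.d x.1 + k) = κ then 𝒯.partL x.1 hk.choose (coord x.2) else 0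

lemma op_eq {x : I × UnitSphere D} {κ k : ℤ} (hk : 2 * (𝒯.d x.1 + k) = κ) :
    𝒯.op x κ = 𝒯.partL x.1 k (coord x.2) := by
  have h1 : ∃ k : ℤ, 2 * (𝒯.d x.1 + k) = κ := ⟨k, hk⟩
  have h2 : h1.choose = k := by
    have := h1.choose_spec
    have h3 : ((h1.choose : ℤ) : ℝ) = k := by linarith
    exact_mod_cast h3
  rw [op, dif_pos h1, h2]

lemma op_eq_zero {x : I × UnitSphere D} {κ : ℤ} (hk : ∀ k : ℤ, 2 * (𝒯.d x.1 + k) ≠ κ) :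
    𝒯.op x κ = 0 := dif_neg fun ⟨k, h⟩ => hk k h

lemma compactMode_eq (A : I) (κ : ℤ) (u : UnitSphere D) (Ψ : 𝒯.dom) :
    𝒯.compactMode A κ u Ψ = 𝒯.op (A, u) κ Ψ := by
  rw [compactMode]
  by_cases hk : ∃ k : ℤ, 2 * (𝒯.d A + k) = κ
  · obtain ⟨k, hk⟩ := hk
    rw [finsum_eq_single _ k, if_pos hk, 𝒯.op_eq (x := (A, u)) hk, partL_apply]
    refine fun k' hne => if_neg fun h' => hne ?_
    have h3 : (k' : ℝ) = k := by linarith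
    exact_mod_cast h3
  · rw [𝒯.op_eq_zero (x := (A, u)) fun k h' => hk ⟨k, h'⟩,
      finsum_eq_zero_of_forall_eq_zero fun k => if_neg fun h' => hk ⟨k, h'⟩, LinearMap.zero_apply]

lemma op_eq_zero_of_parity {x : I × UnitSphere D} {κ : ℤ} (hκ : (κ : ZMod 2) ≠ p x.1) :
    𝒯.op x κ = 0 := LinearMap.ext fun Ψ => by
  rw [LinearMap.zero_apply, ← 𝒯.compactMode_eq_zero x.1 hκ x.2 Ψ, compactMode_eq]

lemma H_op (x : I × UnitSphere D) (κ : ℤ) {E : ℂ} {Ψ : 𝒯.dom} (hΨ : 𝒯.H Ψ = E • Ψ) :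
    𝒯.H (𝒯.op x κ Ψ) = (E + κ / 2) • 𝒯.op x κ Ψ := by
  by_cases hk : ∃ k : ℤ, 2 * (𝒯.d x.1 + k) = κ
  · obtain ⟨k, hk⟩ := hk
    have hk' : (κ : ℂ) = 2 * (𝒯.d x.1 + k) := by
      rw [← Complex.ofReal_intCast, ← hk]; push_cast; rfl
    rw [𝒯.op_eq hk, 𝒯.H_part (by rw [dot_coord_self]; exact one_ne_zero) hΨ, hk']
    congr 1; ring
  · rw [𝒯.op_eq_zero fun k h' => hk ⟨k, h'⟩, LinearMap.zero_apply, map_zero, smul_zero]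

/-- The coefficient of `e^{πi ∑ κ_k ζ_k}` in a product of compact picture fields. -/
def word {n : ℕ} (a : Fin n → I × UnitSphere D) (κ : Fin n → ℤ) : End ℂ 𝒯.dom :=
  (List.ofFn fun k => 𝒯.op (a k) (κ k)).prod

lemma foldr_compactMode {n : ℕ} (A : Fin n → I) (κ : Fin n → ℤ) (u : Fin n → UnitSphere D)
    (l : List (Fin n)) (Ψ : 𝒯.dom) :
    l.foldr (fun k Φ => 𝒯.compactMode (A k) (κ k) (u k) Φ) Ψ =
      (l.map fun k => 𝒯.op (A k, u k) (κ k)).prod Ψ := by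
  induction l with
  | nil => rfl
  | cons k l ih => rw [List.foldr_cons, ih, compactMode_eq, List.map_cons, List.prod_cons]; rfl

lemma product_eq {n : ℕ} (A : Fin n → I) (κ : Fin n → ℤ) (u : Fin n → UnitSphere D) :
    𝒯.product A κ u = 𝒯.word (fun k => (A k, u k)) κ := funext fun Ψ => by
  rw [product, foldr_compactMode, word, List.ofFn_eq_map]

lemma word_succ {n : ℕ} (a : Fin (n + 1) → I × UnitSphere D) (κ : Fin (n + 1) → ℤ) :
    𝒯.word a κ = 𝒯.op (a 0) (κ 0) * 𝒯.word (fun k => a k.succ) fun k => κ k.succ := by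
  rw [word, List.ofFn_succ, List.prod_cons]; rfl

lemma word_last {n : ℕ} (a : Fin (n + 1) → I × UnitSphere D) (κ : Fin (n + 1) → ℤ) :
    𝒯.word a κ = 𝒯.word (fun k => a k.castSucc) (fun k => κ k.castSucc) *
      𝒯.op (a (Fin.last n)) (κ (Fin.last n)) := by
  rw [word, List.ofFn_succ_last, List.prod_append, List.prod_singleton]; rfl

lemma H_word {n : ℕ} (a : Fin n → I × UnitSphere D) (κ : Fin n → ℤ) {E : ℂ} {Ψ : 𝒯.dom}
    (hΨ : 𝒯.H Ψ = E • Ψ) :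
    𝒯.H (𝒯.word a κ Ψ) = (E + ((∑ k, κ k : ℤ) : ℂ) / 2) • 𝒯.word a κ Ψ := by
  induction n with
  | zero => simpa [word] using hΨ
  | succ n ih =>
    rw [word_succ, Module.End.mul_apply, 𝒯.H_op _ _ (ih _ _), Fin.sum_univ_succ]
    congr 1; push_cast; ring

/-- A product of modes vanishes on a vector if it passes through negative energies. -/
lemma word_apply_eq_zero {n : ℕ} (a : Fin n → I × UnitSphere D) (κ : Fin n → ℤ) {E : ℝ}
    {Ψ : 𝒯.dom} (hΨ : 𝒯.H Ψ = (E : ℂ) • Ψ) (k : Fin n)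
    (hk : E + ((∑ l, if k ≤ l then κ l else 0 : ℤ) : ℝ) / 2 < 0) : 𝒯.word a κ Ψ = 0 := by
  induction n with
  | zero => exact k.elim0
  | succ n ih =>
    cases k using Fin.cases with
    | zero =>
      refine 𝒯.eq_zero_of_energy_neg hk ?_
      rw [𝒯.H_word a κ hΨ]
      simp
    | succ k =>
      rw [word_succ, Module.End.mul_apply, ih _ _ k, map_zero]
      simpa [Fin.sum_univ_succ] using hk

lemma word_eq_zero_of_parity {n : ℕ} {a : Fin n → I × UnitSphere D} {κ : Fin n → ℤ} (k : Fin n)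
    (hk : (κ k : ZMod 2) ≠ p (a k).1) : 𝒯.word a κ = 0 :=
  List.prod_eq_zero ((List.mem_ofFn' _ _).2 ⟨k, 𝒯.op_eq_zero_of_parity hk⟩)

/-- Locality of two fields in the compact picture. -/
lemma op_locality (A B : I) : ∃ M : ℕ, ∀ u v : UnitSphere D, ∀ κ₁ κ₂ : ℤ,
    (ellOp (1 : ℤ) (dot (coord u) (coord v)))^[M] (fun i : ℤ =>
      𝒯.op (A, u) (κ₁ + 2 * i) * 𝒯.op (B, v) (κ₂ - 2 * i) - paritySign (p A) (p B) •
        (𝒯.op (B, v) (κ₂ - 2 * i) * 𝒯.op (A, u) (κ₁ + 2 * i))) = 0 := by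
  obtain ⟨M, hM⟩ := 𝒯.locality A B
  refine ⟨M, fun u v κ₁ κ₂ => ?_⟩
  by_cases h1 : ∃ k : ℤ, 2 * (𝒯.d A + k) = κ₁
  · by_cases h2 : ∃ k : ℤ, 2 * (𝒯.d B + k) = κ₂
    · obtain ⟨k₁, h1⟩ := h1
      obtain ⟨k₂, h2⟩ := h2
      have h3 : ∀ i : ℤ, 𝒯.op (A, u) (κ₁ + 2 * i) = 𝒯.partL A (k₁ + i) (coord u) := fun i =>
        𝒯.op_eq (x := (A, u)) (by push_cast; rw [← h1]; ring)
      have h4 : ∀ i : ℤ, 𝒯.op (B, v) (κ₂ - 2 * i) = 𝒯.partL B (k₂ - i) (coord v) := fun i =>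
        𝒯.op_eq (x := (B, v)) (by push_cast; rw [← h2]; ring)
      simp only [h3, h4]
      ext1 i
      refine LinearMap.ext fun Ψ => ?_
      have h5 := congrFun (iterate_ellOp_map (LinearMap.applyₗ Ψ : End ℂ 𝒯.dom →ₗ[ℂ] 𝒯.dom)
        (1 : ℤ) (dot (coord u) (coord v)) M (fun i : ℤ => 𝒯.partL A (k₁ + i) (coord u) *
          𝒯.partL B (k₂ - i) (coord v) - paritySign (p A) (p B) •
        (𝒯.partL B (k₂ - i) (coord v) * 𝒯.partL A (k₁ + i) (coord u)))) i
      refine h5.symm.trans ?_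
      have h6 := iterate_ellOp_mulInterval (dot_coord_self u) (dot_coord_self v) M
        (fun k₁ k₂ => 𝒯.partL A k₁ (coord u) (𝒯.partL B k₂ (coord v) Ψ) -
          paritySign (p A) (p B) • 𝒯.partL B k₂ (coord v) (𝒯.partL A k₁ (coord u) Ψ)) k₁ k₂ i
      refine h6.trans (hM Ψ _ _ ?_ ?_ _ _) <;> rw [dot_coord_self] <;> exact one_ne_zero
    · have h3 : ∀ i : ℤ, 𝒯.op (B, v) (κ₂ - 2 * i) = 0 := fun i => 𝒯.op_eq_zero fun k hk =>
        h2 ⟨k + i, by push_cast at hk ⊢; linarith⟩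
      simp only [h3, mul_zero, zero_mul, smul_zero, sub_zero]
      exact Function.iterate_fixed (ellOp_zero _ _) M
  · have h3 : ∀ i : ℤ, 𝒯.op (A, u) (κ₁ + 2 * i) = 0 := fun i => 𝒯.op_eq_zero fun k hk =>
      h1 ⟨k - i, by push_cast at hk ⊢; linarith⟩
    simp only [h3, mul_zero, zero_mul, smul_zero, sub_zero]
    exact Function.iterate_fixed (ellOp_zero _ _) M

/-- Locality of two neighbouring fields in a product. -/
lemma word_locality : ∃ M : ℕ, ∀ {m : ℕ} (a : Fin (m + 1) → I × UnitSphere D) (k : Fin m),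
    (ellOp (Pi.single k.castSucc 2 - Pi.single k.succ 2 : Charges m)
      (dot (coord (a k.castSucc).2) (coord (a k.succ).2)))^[M] (fun κ => 𝒯.word a κ -
        paritySign (p (a k.castSucc).1) (p (a k.succ).1) •
          𝒯.word (a ∘ Equiv.swap k.castSucc k.succ) (κ ∘ Equiv.swap k.castSucc k.succ)) = 0 := by
  choose M hM using 𝒯.op_locality
  refine ⟨∑ A, ∑ B, M A B, fun {m} a k => ?_⟩
  have hle : M (a k.castSucc).1 (a k.succ).1 ≤ ∑ A, ∑ B, M A B :=
    (single_le_sum (f := fun B => M (a k.castSucc).1 B) (fun _ _ => Nat.zero_le _)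
      (mem_univ _)).trans (single_le_sum (f := fun A => ∑ B, M A B)
        (fun _ _ => Nat.zero_le _) (mem_univ _))
  refine iterate_ellOp_eq_zero_of_le hle (iterate_ellOp_eq_zero fun κ => ?_)
  have hne : k.castSucc ≠ k.succ := Fin.castSucc_lt_succ.ne
  obtain ⟨X, Y, hXY⟩ := exists_prod_ofFn_eq (fun l => 𝒯.op (a l) (κ l)) k
  set μ : Charges m := Pi.single k.castSucc 2 - Pi.single k.succ 2 with hμ
  have hμ1 : μ k.castSucc = 2 := by simp [hμ, hne]
  have hμ2 : μ k.succ = -2 := by simp [hμ, hne.symm]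
  have hμ3 : ∀ l, l ≠ k.castSucc → l ≠ k.succ → μ l = 0 := fun l h1 h2 => by simp [hμ, h1, h2]
  have h1 : (fun i : ℤ => 𝒯.word a (κ + i • μ) - paritySign (p (a k.castSucc).1) (p (a k.succ).1) •
      𝒯.word (a ∘ Equiv.swap k.castSucc k.succ) ((κ + i • μ) ∘ Equiv.swap k.castSucc k.succ)) =
      fun i => (LinearMap.mulRight ℂ Y ∘ₗ LinearMap.mulLeft ℂ X)
        (𝒯.op (a k.castSucc) (κ k.castSucc + 2 * i) * 𝒯.op (a k.succ) (κ k.succ - 2 * i) -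
          paritySign (p (a k.castSucc).1) (p (a k.succ).1) •
        (𝒯.op (a k.succ) (κ k.succ - 2 * i) * 𝒯.op (a k.castSucc) (κ k.castSucc + 2 * i))) := by
    ext1 i
    have e1 : (κ + i • μ) k.castSucc = κ k.castSucc + 2 * i := by
      rw [Pi.add_apply, Pi.smul_apply, hμ1, smul_eq_mul]; ring
    have e2 : (κ + i • μ) k.succ = κ k.succ - 2 * i := by
      rw [Pi.add_apply, Pi.smul_apply, hμ2, smul_eq_mul]; ring
    have e3 : ∀ l, l ≠ k.castSucc → l ≠ k.succ → (κ + i • μ) l = κ l := fun l h1 h2 => by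
      rw [Pi.add_apply, Pi.smul_apply, hμ3 l h1 h2, smul_zero, add_zero]
    rw [word, word, hXY _ fun l h1 h2 => by rw [e3 l h1 h2], hXY _ fun l h1 h2 => by
      rw [comp_apply, comp_apply, Equiv.swap_apply_of_ne_of_ne h1 h2, e3 l h1 h2]]
    simp only [comp_apply, Equiv.swap_apply_left, Equiv.swap_apply_right, e1, e2,
      LinearMap.comp_apply, LinearMap.mulLeft_apply, LinearMap.mulRight_apply, mul_sub, sub_mul,
      mul_smul_comm, smul_mul_assoc]
  rw [h1, iterate_ellOp_map]
  ext1 i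
  have h2 := congrFun (hM (a k.castSucc).1 (a k.succ).1 (a k.castSucc).2 (a k.succ).2
    (κ k.castSucc) (κ k.succ)) i
  exact (congrArg _ h2).trans (map_zero _)

/-- The trace over the eigenspace of `H` of eigenvalue `j/2`, as a linear form on operators. -/
def levelTr (fin : 𝒯.FiniteEigenspaces) (j : ℕ) : End ℂ 𝒯.dom →ₗ[ℂ] ℂ where
  toFun X := 𝒯.levelTrace fin X j
  map_add' X Y := by
    simp only [levelTrace, LinearMap.add_apply, inner_add_right, sum_add_distrib]
  map_smul' c X := by
    simp only [levelTrace, LinearMap.smul_apply, inner_smul_right, mul_sum, smul_eq_mul,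
      RingHom.id_apply]

variable {𝒯} in
lemma mem_level {j : ℕ} {Ψ : 𝒯.dom} :
    Ψ ∈ Module.End.eigenspace 𝒯.H ((j : ℂ) / 2) ↔ 𝒯.H Ψ = (((j : ℝ) / 2 : ℝ) : ℂ) • Ψ := by
  rw [Module.End.mem_eigenspace_iff]; push_cast; rfl

lemma levelTr_eq_zero (fin : 𝒯.FiniteEigenspaces) {j : ℕ} {X : End ℂ 𝒯.dom}
    (hX : ∀ Ψ Φ, 𝒯.H Ψ = (((j : ℝ) / 2 : ℝ) : ℂ) • Ψ → 𝒯.H Φ = (((j : ℝ) / 2 : ℝ) : ℂ) • Φ →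
      ⟪Ψ, X Φ⟫_ℂ = 0) : 𝒯.levelTr fin j X = 0 := by
  have := fin ((j : ℂ) / 2)
  change 𝒯.levelTrace fin X j = 0
  rw [levelTrace]
  exact sum_eq_zero fun i _ => hX _ _ (mem_level.1 (Subtype.coe_prop _))
    (mem_level.1 (Subtype.coe_prop _))

lemma levelTr_eq_trace (fin : 𝒯.FiniteEigenspaces) {j : ℕ} {X : End ℂ 𝒯.dom}
    (X' : End ℂ (Module.End.eigenspace 𝒯.H ((j : ℂ) / 2))) (hX : ∀ Ψ, (X' Ψ : 𝒯.dom) = X Ψ) :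
    𝒯.levelTr fin j X = LinearMap.trace ℂ _ X' := by
  have := fin ((j : ℂ) / 2)
  rw [LinearMap.trace_eq_sum_inner (E := Module.End.eigenspace 𝒯.H ((j : ℂ) / 2)) X'
    (stdOrthonormalBasis ℂ (Module.End.eigenspace 𝒯.H ((j : ℂ) / 2)))]
  change 𝒯.levelTrace fin X j = _
  rw [levelTrace]
  refine sum_congr rfl fun i _ => ?_
  rw [← hX]; rfl

/-- Cyclicity of the trace. -/
lemma levelTr_mul_comm (fin : 𝒯.FiniteEigenspaces) {i j : ℕ} {X Y : End ℂ 𝒯.dom}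
    (hY : ∀ Ψ ∈ Module.End.eigenspace 𝒯.H ((i : ℂ) / 2),
      Y Ψ ∈ Module.End.eigenspace 𝒯.H ((j : ℂ) / 2))
    (hX : ∀ Ψ ∈ Module.End.eigenspace 𝒯.H ((j : ℂ) / 2),
      X Ψ ∈ Module.End.eigenspace 𝒯.H ((i : ℂ) / 2)) :
    𝒯.levelTr fin i (X * Y) = 𝒯.levelTr fin j (Y * X) := by
  have := fin ((i : ℂ) / 2)
  have := fin ((j : ℂ) / 2)
  rw [𝒯.levelTr_eq_trace fin (X.restrict hX ∘ₗ Y.restrict hY) fun _ => rfl,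
    𝒯.levelTr_eq_trace fin (Y.restrict hY ∘ₗ X.restrict hX) fun _ => rfl,
    LinearMap.trace_comp_comm']

lemma op_mem_level (x : I × UnitSphere D) {κ : ℤ} {i j : ℕ} (hκ : (j : ℤ) = i + κ) {Ψ : 𝒯.dom}
    (hΨ : Ψ ∈ Module.End.eigenspace 𝒯.H ((i : ℂ) / 2)) :
    𝒯.op x κ Ψ ∈ Module.End.eigenspace 𝒯.H ((j : ℂ) / 2) := by
  rw [Module.End.mem_eigenspace_iff] at hΨ ⊢
  have : (j : ℂ) = i + κ := by exact_mod_cast hκ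
  rw [𝒯.H_op x κ hΨ, this]
  congr 1; ring

lemma word_mem_level {n : ℕ} (a : Fin n → I × UnitSphere D) {κ : Fin n → ℤ} {i j : ℕ}
    (hκ : (j : ℤ) = i + ∑ k, κ k) {Ψ : 𝒯.dom}
    (hΨ : Ψ ∈ Module.End.eigenspace 𝒯.H ((i : ℂ) / 2)) :
    𝒯.word a κ Ψ ∈ Module.End.eigenspace 𝒯.H ((j : ℂ) / 2) := by
  rw [Module.End.mem_eigenspace_iff] at hΨ ⊢
  have : (j : ℂ) = i + (∑ k, κ k : ℤ) := by exact_mod_cast hκ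
  rw [𝒯.H_word a κ hΨ, this]
  congr 1; ring

lemma levelTr_word_eq_zero_of_sum (fin : 𝒯.FiniteEigenspaces) {n : ℕ} (a : Fin n → I × UnitSphere D)
    {κ : Fin n → ℤ} (hκ : ∑ k, κ k ≠ 0) (j : ℕ) : 𝒯.levelTr fin j (𝒯.word a κ) = 0 := by
  refine 𝒯.levelTr_eq_zero fin fun Ψ Φ hΨ hΦ => 𝒯.eigenvalue_eq_conj hΨ (𝒯.H_word a κ hΦ) ?_
  rw [Complex.conj_ofReal]
  intro h0
  rw [eq_comm, add_eq_left, div_eq_zero_iff] at h0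
  exact hκ (by exact_mod_cast h0.resolve_right two_ne_zero)

lemma levelTr_word_eq_zero_of_neg (fin : 𝒯.FiniteEigenspaces) {n : ℕ} (a : Fin n → I × UnitSphere D)
    {κ : Fin n → ℤ} {j : ℕ} (k : Fin n) (hk : (j : ℤ) + (∑ l, if k ≤ l then κ l else 0) < 0) :
    𝒯.levelTr fin j (𝒯.word a κ) = 0 := by
  refine 𝒯.levelTr_eq_zero fin fun Ψ Φ hΨ hΦ => ?_
  have : ((j : ℤ) : ℝ) + ((∑ l, if k ≤ l then κ l else 0 : ℤ) : ℝ) < 0 := by exact_mod_cast hk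
  rw [𝒯.word_apply_eq_zero a κ hΦ k (by rw [Int.cast_natCast] at this; linarith), inner_zero_right]

/-- The levels are finite dimensional, so the traces are finite sums of products of polynomials. -/
lemma levelTr_word_mem_polyFun (fin : 𝒯.FiniteEigenspaces) {n : ℕ} (A : Fin n → I)
    (κ : Fin n → ℤ) (j : ℕ) :
    (fun u => 𝒯.levelTr fin j (𝒯.word (fun k => (A k, u k)) κ)) ∈ polyFun D n ℂ := by
  have hop : ∀ k (Ψ : 𝒯.dom), (fun u : Fin n → UnitSphere D => 𝒯.op (A k, u k) (κ k) Ψ) ∈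
      polyFun D n 𝒯.dom := fun k Ψ => by
    by_cases hk : ∃ i : ℤ, 2 * (𝒯.d (A k) + i) = κ k
    · obtain ⟨i, hi⟩ := hk
      obtain ⟨N, hN⟩ := 𝒯.exists_truncatedAt (A k) Ψ
      have h1 : (fun u : Fin n → UnitSphere D => 𝒯.op (A k, u k) (κ k) Ψ) = fun u =>
          part h 𝒯.mode (A k) i (coord (u k)) Ψ := funext fun u => by
        rw [𝒯.op_eq (x := (A k, u k)) hi, partL_apply]
      rw [h1]
      have h2 := fun u : Fin n → UnitSphere D => part_eq_sum hN i (coord (u k))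
      simp only [h2, dot_coord_self, one_zpow, one_mul]
      have h3 : ∀ (m : ℕ) (σ : ι m), (fun u : Fin n → UnitSphere D => eval (coord (u k))
          (h m σ : MvPolynomial (Fin D) ℂ)) = fun u => evalAt (fun k => coord (u k))
          (MvPolynomial.rename (fun α => (k, α)) (h m σ : MvPolynomial (Fin D) ℂ)) := fun m σ => by
        funext u
        rw [evalAt, MvPolynomial.eval_rename]; rfl
      have h4 := Submodule.sum_mem (polyFun D n 𝒯.dom) (t := range (i / 2 + N).toNat)
        (f := fun (i' : ℕ) u => ∑ σ, (eval (coord (u k))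
        (h (i - 2 * (i' + 1 - N)).toNat σ : MvPolynomial (Fin D) ℂ)) •
        𝒯.mode (A k) (i' + 1 - N) (i - 2 * (i' + 1 - N)).toNat σ Ψ) fun i' _ => by
          have h5 := Submodule.sum_mem (polyFun D n 𝒯.dom) (t := univ)
            (f := fun σ u => (eval (coord (u k))
              (h (i - 2 * (i' + 1 - N)).toNat σ : MvPolynomial (Fin D) ℂ)) •
              𝒯.mode (A k) (i' + 1 - N) (i - 2 * (i' + 1 - N)).toNat σ Ψ) fun σ _ => by
            have h6 := fun u => congrFun (h3 (i - 2 * (i' + 1 - N)).toNat σ) u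
            simp only [h6]
            exact smul_mem_polyFun _ _
          convert h5 using 1
          funext u
          rw [Finset.sum_apply]
      convert h4 using 1
      funext u
      rw [Finset.sum_apply]
    · simp only [𝒯.op_eq_zero (x := (A k, _)) fun i h' => hk ⟨i, h'⟩, LinearMap.zero_apply]
      exact zero_mem _
  have hprod : ∀ (l : List (Fin n)) (Ψ : 𝒯.dom), (fun u : Fin n → UnitSphere D =>
      (l.map fun k => 𝒯.op (A k, u k) (κ k)).prod Ψ) ∈ polyFun D n 𝒯.dom := fun l Ψ => by
    induction l with
    | nil => simpa [evalAt] using smul_mem_polyFun (1 : PointPoly D n) Ψ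
    | cons k l ih =>
      simp only [List.map_cons, List.prod_cons, Module.End.mul_apply]
      exact apply_mem_polyFun (φ := fun u => 𝒯.op (A k, u k) (κ k)) (hop k) ih
  have := fin ((j : ℂ) / 2)
  have h4 := Submodule.sum_mem (polyFun D n ℂ) (t := univ) fun i _ => apply_mem_polyFun
    (φ := fun _ => innerₛₗ ℂ
      (((stdOrthonormalBasis ℂ (Module.End.eigenspace 𝒯.H ((j : ℂ) / 2)) i : _) : 𝒯.dom)))
    (fun v => by
      simpa [evalAt] using smul_mem_polyFun (1 : PointPoly D n) (innerₛₗ ℂ (((stdOrthonormalBasis ℂ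
        (Module.End.eigenspace 𝒯.H ((j : ℂ) / 2)) i : _) : 𝒯.dom)) v))
    (hprod (List.finRange n)
      ((stdOrthonormalBasis ℂ (Module.End.eigenspace 𝒯.H ((j : ℂ) / 2)) i : _) : 𝒯.dom))
  convert h4 using 1
  funext u
  rw [Finset.sum_apply, word, List.ofFn_eq_map]
  rfl

variable (fin : 𝒯.FiniteEigenspaces) {m : ℕ} (N : ℕ)
  (a : Fin (m + 1) → I × UnitSphere D)

/-! ### The numerators of the thermal correlation functions -/

/-- The traces of the products of modes, as functions of the level and of the charges. -/
def traceFun : ℕ → Charges m → ℂ := fun j κ =>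
  𝒯.levelTr fin j (𝒯.word a κ)

/-- The traces of the products of modes, as a power series in the gap variables. -/
def traceSeries : MvPowerSeries (Fin (m + 1)) ℂ := fun e =>
  𝒯.traceFun fin a (e 0) (charge e)

lemma coeff_traceSeries (e : Fin (m + 1) →₀ ℕ) :
    coeff e (𝒯.traceSeries fin a) = 𝒯.traceFun fin a (e 0) (charge e) := rfl

/-- The energies of the intermediate states are non-negative. -/
lemma charges_traceSeries :
    charges (𝒯.traceSeries fin a) = 𝒯.traceFun fin a := by
  funext j κ
  by_cases he : ∃ e, charge e = κ ∧ e 0 = j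
  · obtain ⟨e, rfl, rfl⟩ := he
    rw [charges_eq, coeff_traceSeries]
  · rw [charges, coeff_toThermal_eq_zero _ fun e h1 h2 => he ⟨e, h1, h2⟩]
    by_cases hκ : ∑ k, κ k = 0
    · obtain ⟨k, hk⟩ : ∃ k, (j : ℤ) < chargeBefore κ k := by
        by_contra! hk
        exact he (exists_charge_eq hκ hk)
      refine (𝒯.levelTr_word_eq_zero_of_neg fin a k ?_).symm
      have h1 : chargeBefore κ k + (∑ l, if k ≤ l then κ l else 0) = 0 := by
        rw [chargeBefore, ← sum_add_distrib]
        refine (sum_congr rfl fun l _ => ?_).trans hκ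
        rcases lt_or_ge l k with h | h
        · rw [if_pos h, if_neg h.not_ge, add_zero]
        · rw [if_neg h.not_gt, if_pos h, zero_add]
      omega
    · exact (𝒯.levelTr_word_eq_zero_of_sum fin a hκ j).symm

lemma traceSeries_rotation :
    MvPowerSeries.rename (nextGap m) (𝒯.traceSeries fin a) =
      𝒯.traceSeries fin (a ∘ rotation m) := by
  ext y
  obtain ⟨e, rfl⟩ := exists_rotExp_eq y
  refine (MvPowerSeries.coeff_embDomain_rename (nextGap m) _ e).trans ?_
  have hc : (e (Fin.last m) : ℤ) = e 0 + charge e (Fin.last m) := by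
    rw [charge, Fin.last_add_one]; ring
  have hs := sum_charge e
  rw [Fin.sum_univ_castSucc] at hs
  rw [coeff_traceSeries, coeff_traceSeries, traceFun, traceFun, word_last, word_succ, charge_rotExp,
    rotExp_apply, zero_sub_one_eq_last,
    𝒯.levelTr_mul_comm fin (j := e (Fin.last m)) (fun Ψ => 𝒯.op_mem_level _ hc)
      fun Ψ => 𝒯.word_mem_level _ (by omega)]
  simp only [comp_apply, rotation_zero, rotation_succ]

/-- The product of the traces with the `N`-th power of the product of the pair series. -/
def numSeries : MvPowerSeries (Fin (m + 1)) ℂ :=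
  ellSeries (cosines fun k => (a k).2) ^ N * 𝒯.traceSeries fin a

/-- The same product in the symmetric form, which is compatible with permutations of the fields. -/
def symTrace : ℕ → Charges m → ℂ :=
  pact (laurentProduct (cosines fun k => (a k).2) ^ N) (𝒯.traceFun fin a)

lemma charges_numSeries (j : ℕ)
    (κ : Charges m) : charges (𝒯.numSeries fin N a) j κ =
      𝒯.symTrace fin N a j (κ - charge (N • arcsExp m)) := by
  rw [numSeries, charges_ellSeries_pow_mul, charges_traceSeries, symTrace]

lemma numSeries_rotation :
    MvPowerSeries.rename (nextGap m) (𝒯.numSeries fin N a) =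
      𝒯.numSeries fin N (a ∘ rotation m) := by
  rw [numSeries, map_mul, map_pow, rename_ellSeries _ (cosines_comm _), traceSeries_rotation]
  rfl

/-- The charges of the numerator add up to zero and have the parities of the fields. -/
lemma of_symTrace_ne_zero {N : ℕ} {a : Fin (m + 1) → I × UnitSphere D} {j : ℕ}
    {κ : Charges m} (h0 : 𝒯.symTrace fin N a j κ ≠ 0) :
    ∑ k, κ k = 0 ∧ ∀ k, (κ k : ZMod 2) = p (a k).1 := by
  rw [← add_sub_cancel_right κ (charge (N • arcsExp m)), ← charges_numSeries] at h0
  obtain ⟨e, he, -, hne⟩ := eq_zero_of_charges_ne_zero h0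
  obtain rfl : κ = charge e - charge (N • arcsExp m) := by rw [he, add_sub_cancel_right]
  refine ⟨by simp only [Pi.sub_apply, sum_sub_distrib, sum_charge, sub_zero], fun k => ?_⟩
  rw [numSeries, MvPowerSeries.coeff_mul] at hne
  obtain ⟨x, hx, hne⟩ := Finset.exists_ne_zero_of_sum_ne_zero hne
  have hx1 := even_of_mem_evenSeries (pow_mem (ellSeries_mem_evenSeries _) N)
    (left_ne_zero_of_mul hne)
  have hx2 := right_ne_zero_of_mul hne
  have h3 : (charge x.2 k : ZMod 2) = p (a k).1 := by
    by_contra hk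
    rw [coeff_traceSeries, traceFun, 𝒯.word_eq_zero_of_parity k hk, map_zero] at hx2
    exact hx2 rfl
  have h4 := even_charge_nsmul 1 hx1 k
  rw [one_smul] at h4
  rw [← mem_antidiagonal.1 hx, charge_add, Pi.sub_apply, Pi.add_apply,
    Int.cast_sub, Int.cast_add, even_charge_nsmul N even_arcsExp k, h4, h3, zero_add, sub_zero]

/-- The traces, multiplied with the `N`-th power of the pair series, are symmetric. -/
def SymmetricTraces (N m : ℕ) : Prop := ∀ (s : Perm (Fin (m + 1)))
  (a : Fin (m + 1) → I × UnitSphere D) (j : ℕ) (κ : Charges m), 𝒯.symTrace fin N a j κ =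
    statSign p (fun k => (a k).1) s * 𝒯.symTrace fin N (a ∘ s) j (κ ∘ s)

/-- After multiplication with the pair series the traces are symmetric: multiplied with a power of
the interval, neighbouring fields commute. -/
lemma exists_symmetricTraces : ∃ M : ℕ, ∀ N ≥ M, 𝒯.SymmetricTraces fin N m := by
  obtain ⟨M, hM⟩ := 𝒯.word_locality
  refine ⟨M, fun N hN s => ?_⟩
  have hs : s ∈ Submonoid.closure (Set.range fun i : Fin m => Equiv.swap i.castSucc i.succ) := by
    rw [Equiv.Perm.mclosure_swap_castSucc_succ]; exact Submonoid.mem_top s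
  induction hs using Submonoid.closure_induction with
  | one => intro a j κ; rw [statSign_one, one_mul]; rfl
  | mul s t _ _ ihs iht =>
    intro a j κ
    rw [ihs a j κ, iht (a ∘ s) j (κ ∘ s), ← mul_assoc]
    exact congrArg₂ _ (statSign_mul p (fun k => (a k).1) s t).symm rfl
  | mem s hs =>
    obtain ⟨k, rfl⟩ := hs
    intro a j κ
    dsimp only
    set s := Equiv.swap k.castSucc k.succ
    set σ := paritySign (p (a k.castSucc).1) (p (a k.succ).1) with hσ
    have h1 := pact_laurentProduct_eq_zero (cosines fun k => (a k).2)
      (Fin.castSucc_lt_succ (i := k)) N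
      (F := 𝒯.traceFun fin a - σ • fun j => 𝒯.traceFun fin (a ∘ s) j ∘ permCharges s)
      (fun i => by
        have h2 := iterate_ellOp_map (𝒯.levelTr fin i)
          (Pi.single k.castSucc 2 - Pi.single k.succ 2 : Charges m)
          (dot (coord (a k.castSucc).2) (coord (a k.succ).2)) N (fun κ => 𝒯.word a κ -
            σ • 𝒯.word (a ∘ s) (κ ∘ s))
        rw [iterate_ellOp_eq_zero_of_le hN (hM a k)] at h2
        rw [← neg_sub, ellOp_neg]
        refine (congrArg _ (funext fun κ => ?_)).trans (h2.trans (funext fun _ => map_zero _))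
        rw [map_sub, map_smul]
        rfl)
    rw [pact_sub, pact_smul, sub_eq_zero] at h1
    have h3 := congrFun (congrFun h1 j) κ
    rw [Pi.smul_apply, Pi.smul_apply, pact_comp, map_pow,
      map_laurentProduct _ (cosines_comm _)] at h3
    rw [statSign_swap]
    exact h3

/-! ### The expansion of the numerators in theta series -/

/-- The extension of `symTrace` by zero to negative levels. -/
def symTraceInt (j : ℤ) (κ : Charges m) : ℂ :=
  if 0 ≤ j then 𝒯.symTrace fin N a j.toNat κ else 0

lemma symTraceInt_natCast (j : ℕ)
    (κ : Charges m) : 𝒯.symTraceInt fin N a j κ = 𝒯.symTrace fin N a j κ := by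
  rw [symTraceInt, if_pos (Int.natCast_nonneg j), Int.toNat_natCast]

lemma symTraceInt_charge {j : ℤ}
    {κ : Charges m} {e : Fin (m + 1) →₀ ℕ} (he : charge e = κ + charge (N • arcsExp m))
    (hj : (e 0 : ℤ) = j) : 𝒯.symTraceInt fin N a j κ = coeff e (𝒯.numSeries fin N a) := by
  rw [← hj, symTraceInt_natCast, ← charges_eq, charges_numSeries, he, add_sub_cancel_right]

lemma exists_of_symTraceInt_ne_zero {N : ℕ} {a : Fin (m + 1) → I × UnitSphere D} {j : ℤ}
    {κ : Charges m} (h0 : 𝒯.symTraceInt fin N a j κ ≠ 0) :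
    ∃ e : Fin (m + 1) →₀ ℕ, charge e = κ + charge (N • arcsExp m) ∧ (e 0 : ℤ) = j := by
  rw [symTraceInt] at h0
  split_ifs at h0 with hj
  · rw [← add_sub_cancel_right κ (charge (N • arcsExp m)), ← charges_numSeries] at h0
    obtain ⟨e, he, hz, -⟩ := eq_zero_of_charges_ne_zero h0
    exact ⟨e, he, by omega⟩
  · exact absurd rfl h0

/-- By the cyclicity of the trace the last field may be moved to the first place. -/
lemma symTraceInt_rotation (j : ℤ)
    (κ : Charges m) : 𝒯.symTraceInt fin N a j κ =
      𝒯.symTraceInt fin N (a ∘ rotation m) (j + κ (Fin.last m) + 2 * N * m)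
        ((κ + shift N (Pi.single (Fin.last m) 1)) ∘ rotation m) := by
  have hc : ∀ e : Fin (m + 1) →₀ ℕ, (charge (rotExp e) =
      (κ + shift N (Pi.single (Fin.last m) 1)) ∘ rotation m + charge (N • arcsExp m) ↔
      charge e = κ + charge (N • arcsExp m)) := fun e => by
    have h1 : (κ + shift N (Pi.single (Fin.last m) 1)) ∘ rotation m + charge (N • arcsExp m) =
        (κ + charge (N • arcsExp m)) ∘ rotation m := by
      rw [Pi.add_comp κ (charge _), charge_arcsExp_rotation, Pi.add_comp, add_assoc,
        add_comm (shift N _ ∘ _)]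
    rw [h1, charge_rotExp]
    exact (rotation m).surjective.injective_comp_right.eq_iff
  have hj : ∀ e : Fin (m + 1) →₀ ℕ, charge e = κ + charge (N • arcsExp m) →
      ((rotExp e 0 : ℤ) = j + κ (Fin.last m) + 2 * N * m ↔ (e 0 : ℤ) = j) := fun e he => by
    have h1 := congrFun he (Fin.last m)
    rw [Pi.add_apply, charge_arcsExp, charge, Fin.last_add_one, Fin.val_last] at h1
    rw [rotExp_apply, zero_sub_one_eq_last]
    constructor <;> intro <;> linarith
  by_cases he : ∃ e : Fin (m + 1) →₀ ℕ, charge e = κ + charge (N • arcsExp m) ∧ (e 0 : ℤ) = j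
  · obtain ⟨e, he, he0⟩ := he
    rw [𝒯.symTraceInt_charge fin N a he he0,
      𝒯.symTraceInt_charge fin N _ ((hc e).2 he) ((hj e he).2 he0), ← numSeries_rotation]
    exact (MvPowerSeries.coeff_embDomain_rename (nextGap m) _ e).symm
  · have h1 : 𝒯.symTraceInt fin N a j κ = 0 := by
      by_contra h0
      exact he (𝒯.exists_of_symTraceInt_ne_zero fin h0)
    rw [h1]
    by_contra h0
    obtain ⟨y, hy, hy0⟩ := 𝒯.exists_of_symTraceInt_ne_zero fin (Ne.symm h0)
    obtain ⟨e, rfl⟩ := exists_rotExp_eq y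
    exact he ⟨e, (hc e).1 hy, (hj e ((hc e).1 hy)).1 hy0⟩

/-- The behaviour of the traces under the translations by `τ`. -/
lemma symTraceInt_add_single {N : ℕ} (hs : 𝒯.SymmetricTraces fin N m)
    {a : Fin (m + 1) → I × UnitSphere D} (ha : ∑ k, p (a k).1 = 0) (j : ℤ)
    (κ : Charges m) (k : Fin (m + 1)) : 𝒯.symTraceInt fin N a j κ =
      (-1) ^ (p (a k).1).val *
        𝒯.symTraceInt fin N a (j + κ k + 2 * N * m) (κ + shift N (Pi.single k 1)) := by
  have hs' : ∀ (s : Perm (Fin (m + 1))) (a : Fin (m + 1) → I × UnitSphere D) (j : ℤ)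
      (κ : Charges m), 𝒯.symTraceInt fin N a j κ =
        statSign p (fun k => (a k).1) s * 𝒯.symTraceInt fin N (a ∘ s) j (κ ∘ s) :=
    fun s a j κ => by
      rw [symTraceInt, symTraceInt]
      split_ifs
      · exact hs s a _ κ
      · rw [mul_zero]
  have hlast : ∀ (a : Fin (m + 1) → I × UnitSphere D) (_ : ∑ k, p (a k).1 = 0) (j : ℤ)
      (κ : Charges m), 𝒯.symTraceInt fin N a j κ = (-1) ^ (p (a (Fin.last m)).1).val *
        𝒯.symTraceInt fin N a (j + κ (Fin.last m) + 2 * N * m)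
          (κ + shift N (Pi.single (Fin.last m) 1)) := fun a ha j κ => by
    rw [symTraceInt_rotation, hs' (rotation m) a (_ + _),
      ← statSign_rotation p (fun k => (a k).1) ha, ← mul_assoc, statSign_mul_self, one_mul]
  set t := Equiv.swap k (Fin.last m)
  have ht : t (Fin.last m) = k := Equiv.swap_apply_right _ _
  have hk : (Pi.single k 1 : Charges m) ∘ t = Pi.single (Fin.last m) 1 := by
    funext l
    rw [comp_apply, Pi.single_apply, Pi.single_apply]
    exact if_congr (by rw [← ht, t.injective.eq_iff]) rfl rfl
  have ha' : ∑ l, p ((a ∘ t) l).1 = 0 := (Equiv.sum_comp t fun l => p (a l).1).trans ha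
  rw [hs' t a j κ, hs' t a (_ + _), hlast (a ∘ t) ha', Pi.add_comp, ← shift_comp, hk,
    comp_apply, comp_apply, ht]
  ring

/-- The traces in a class of charges are determined by the traces at a vector of minimal length. -/
lemma symTraceInt_add_shift {N : ℕ} (hs : 𝒯.SymmetricTraces fin N m)
    {a : Fin (m + 1) → I × UnitSphere D} {κ₀ : Charges m}
    (h₀ : Admissible N (fun k => p (a k).1) κ₀) (j : ℤ) (b : Charges m) :
    𝒯.symTraceInt fin N a j (κ₀ + shift N b) = shiftSign (fun k => p (a k).1) b *
      𝒯.symTraceInt fin N a (j - thetaLevel N κ₀ (κ₀ + shift N b)) κ₀ := by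
  set V : ℤ → Charges m → ℂ := fun i b => shiftSign (fun k => p (a k).1) b *
    𝒯.symTraceInt fin N a (i + thetaLevel N κ₀ (κ₀ + shift N b)) (κ₀ + shift N b) with hV
  have hp : ∀ i k, Function.Periodic (V i) (Pi.single k 1) := fun i k b => by
    simp only [hV]
    rw [𝒯.symTraceInt_add_single fin hs h₀.sum_parity _ (κ₀ + shift N b) k, shift_add, ← add_assoc,
      thetaLevel_add_single h₀ ⟨b, rfl⟩, shiftSign_add, shiftSign_single, add_assoc i, add_assoc i,
      mul_assoc]
  have hc : ∀ i, V i b = V i 0 := fun i => by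
    have h1 : Function.Periodic (V i) (∑ k, b k • Pi.single k (1 : ℤ)) :=
      Finset.sum_induction _ (Function.Periodic (V i)) (fun _ _ => Function.Periodic.add_period)
        (fun x => by rw [add_zero]) fun k _ => (hp i k).zsmul (b k)
    rw [← h1 0, zero_add]
    congr 1
    funext l
    simp [Finset.sum_apply, Pi.single_apply]
  have h1 := hc (j - thetaLevel N κ₀ (κ₀ + shift N b))
  have h2 : shiftSign (fun k => p (a k).1) b * shiftSign (fun k => p (a k).1) b = 1 := by
    rw [shiftSign, ← prod_mul_distrib]
    refine prod_eq_one fun k _ => ?_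
    rw [← mul_zpow, ← mul_pow, neg_mul_neg, one_mul, one_pow, one_zpow]
  have h3 : shiftSign (fun k => p (a k).1) 0 = 1 := by simp [shiftSign]
  have h4 : thetaLevel N κ₀ κ₀ = 0 := by rw [thetaLevel, sub_self, Int.zero_ediv]
  simp only [hV, sub_add_cancel, shift_zero, add_zero, h3, h4, one_mul] at h1
  rw [← h1, ← mul_assoc, h2, one_mul]

/-- The numerators are combinations of theta series whose coefficients are power series in
`q^{1/2}`. Every class of charges is counted with its vectors of minimal length. -/
lemma numSeries_eq_sum {N : ℕ} (hN : 0 < N) (hs : 𝒯.SymmetricTraces fin N m)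
    {a : Fin (m + 1) → I × UnitSphere D} {q : Fin (m + 1) → ZMod 2} (hq : ∀ k, p (a k).1 = q k) :
    𝒯.numSeries fin N a = ∑ κ₀ ∈ minimalCharges N q,
      ofNome (PowerSeries.C (multiplicity N q κ₀ : ℂ)⁻¹ * PowerSeries.mk fun j =>
        𝒯.symTrace fin N a j κ₀) * thetaSeries N q κ₀ := by
  classical
  obtain rfl : (fun k => p (a k).1) = q := funext hq
  set q := fun k => p (a k).1
  ext e
  obtain ⟨κ, hκ⟩ : ∃ κ, charge e = κ + charge (N • arcsExp m) :=
    ⟨_, (sub_add_cancel _ (charge (N • arcsExp m))).symm⟩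
  rw [← coeff_toThermal (∑ κ₀ ∈ _, _) hκ rfl, toThermal_sum, map_sum,
    ← 𝒯.symTraceInt_charge fin N a hκ rfl]
  have h1 : ∀ κ₀ ∈ minimalCharges N q, PowerSeries.coeff (e 0) (toThermal (ofNome (
      PowerSeries.C (multiplicity N q κ₀ : ℂ)⁻¹ * PowerSeries.mk fun j =>
        𝒯.symTrace fin N a j κ₀) * thetaSeries N q κ₀) (κ + charge (N • arcsExp m))) =
      if ∃ b, κ = κ₀ + shift N b then
        (multiplicity N q κ : ℂ)⁻¹ * 𝒯.symTraceInt fin N a (e 0) κ else 0 := fun κ₀ h₀ => by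
    have h₀ := mem_minimalCharges.1 h₀
    rw [toThermal_ofNome_mul, toThermal_thetaSeries h₀]
    split_ifs with hb
    · have hl := thetaLevel_nonneg h₀ hb
      obtain ⟨b, rfl⟩ := hb
      rw [𝒯.symTraceInt_add_shift fin hs h₀, thetaCoef_shift h₀.pos h₀.sum_parity,
        multiplicity_add_shift, mul_assoc, PowerSeries.coeff_C_mul, ← mul_assoc (PowerSeries.mk _),
        PowerSeries.coeff_mul_X_pow', mul_comm (PowerSeries.mk _), PowerSeries.coeff_C_mul,
        coeff_mk, symTraceInt]
      by_cases hle : (thetaLevel N κ₀ (κ₀ + shift N b)).toNat ≤ e 0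
      · rw [if_pos hle, if_pos (by omega)]
        congr 3
        omega
      · rw [if_neg hle, if_neg (by omega), mul_zero, mul_zero, mul_zero]
    · have h3 : thetaCoef N q κ₀ κ = 0 := dif_neg hb
      rw [h3, map_zero PowerSeries.C, zero_mul, mul_zero]
      rfl
  rw [sum_congr rfl h1, ← Finset.sum_filter, sum_const, nsmul_eq_mul, ← mul_assoc]
  by_cases h0 : 𝒯.symTraceInt fin N a (e 0) κ = 0
  · rw [h0, mul_zero]
  · rw [symTraceInt_natCast] at h0
    obtain ⟨hc, hp⟩ := 𝒯.of_symTrace_ne_zero fin h0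
    have hq0 : ∑ k, q k = 0 := by
      rw [← sum_congr rfl fun k _ => hp k, ← Int.cast_sum, hc, Int.cast_zero]
    change _ = (multiplicity N q κ : ℂ) * _ * _
    rw [mul_inv_cancel₀ (Nat.cast_ne_zero.2 (multiplicity_ne_zero hN hq0 hc hp)), one_mul]

/-! ### The expansion of the thermal correlation functions -/

lemma trace_product (A : Fin (m + 1) → I) (κ : Charges m)
    (u : Fin (m + 1) → UnitSphere D) : 𝒯.trace fin (𝒯.product A κ u) =
      toThermal (𝒯.traceSeries fin fun k => (A k, u k)) κ := by
  ext j
  refine Eq.trans ?_ (congrFun (congrFun (𝒯.charges_traceSeries fin fun k => (A k, u k)) j) κ).symm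
  rw [trace, coeff_mk, product_eq]
  rfl

/-- The coefficients of the numerators are polynomials in the points. -/
lemma exists_symTrace_eq_evalAt (N : ℕ) (A : Fin (m + 1) → I) (j : ℕ) (κ : Charges m) :
    ∃ P : PointPoly D (m + 1), ∀ u : Fin (m + 1) → UnitSphere D,
      𝒯.symTrace fin N (fun k => (A k, u k)) j κ = evalAt (fun k => coord (u k)) P := by
  by_cases he : ∃ e : Fin (m + 1) →₀ ℕ, charge e = κ + charge (N • arcsExp m) ∧ (e 0 : ℤ) = j
  · obtain ⟨e, he, hj⟩ := he
    choose T hT using fun (j : ℕ) (κ : Charges m) =>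
      exists_of_mem_polyFun (𝒯.levelTr_word_mem_polyFun fin A κ j)
    refine ⟨∑ x ∈ antidiagonal e, coeff x.1 (ellSeries (fun j k => dotPoly j k) ^ N) *
      T (x.2 0) (charge x.2), fun u => ?_⟩
    rw [← symTraceInt_natCast, 𝒯.symTraceInt_charge fin N _ he hj, numSeries,
      MvPowerSeries.coeff_mul, map_sum]
    refine sum_congr rfl fun x _ => ?_
    rw [map_mul, ← hT, ← MvPowerSeries.coeff_map, map_pow (MvPowerSeries.map _), map_ellSeries]
    simp only [evalAt_dotPoly]
    rfl
  · refine ⟨0, fun u => ?_⟩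
    rw [map_zero]
    by_contra h0
    rw [← symTraceInt_natCast] at h0
    exact he (𝒯.exists_of_symTraceInt_ne_zero fin h0)

/-- The thermal correlation functions in terms of the basis. The sum over the permutations that fix
the labels of the fields is compensated by the number of these permutations. -/
lemma exists_expansion {B N : ℕ} {e : Fin B → PointPoly D (m + 1)}
    (he : ∀ P : PointPoly D (m + 1), ∃ g : Fin B → PointPoly D (m + 1), (∀ b, IsSymm (g b)) ∧
      P = ∑ b, g b * e b) (hN : 0 < N) (hs : 𝒯.SymmetricTraces fin N m) :
    ∃ G : (Fin (m + 1) → I) → Charges m → Fin B → PowerSeries (PointPoly D (m + 1)),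
      (∀ A κ₀ b j, IsSymm (PowerSeries.coeff j (G A κ₀ b)) ∧
        IsMultiHarmonic (PowerSeries.coeff j (G A κ₀ b))) ∧
      ∀ A κ (u : Fin (m + 1) → UnitSphere D), 𝒯.thermal fin A κ u =
        ∑ κ₀ ∈ minimalCharges N (p ∘ A), ∑ b, PowerSeries.map (evalAt fun k => coord (u k))
          (G A κ₀ b * basisSeries p N A κ₀ (e b) A κ) := by
  classical
  set Z := 𝒯.trace fin id
  set S : (Fin (m + 1) → I) → Finset (Perm (Fin (m + 1))) := fun A =>
    univ.filter fun s => A ∘ s = A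
  -- Every permutation that fixes `A` contributes the same numerator.
  set x : (Fin (m + 1) → I) → Charges m → PowerSeries ℂ := fun A κ₀ =>
    Z⁻¹ * PowerSeries.C (((S A).card : ℂ)⁻¹ * (multiplicity N (p ∘ A) κ₀ : ℂ)⁻¹)
  choose P hP using fun A κ₀ j => 𝒯.exists_symTrace_eq_evalAt fin N A (m := m) j κ₀
  choose G hG1 hG2 using fun A κ₀ => exists_symm_decomposition he
    (PowerSeries.map MvPolynomial.C (x A κ₀) * PowerSeries.mk (P A κ₀))
  refine ⟨G, hG1, fun A κ u => ?_⟩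
  set a : Fin (m + 1) → I × UnitSphere D := fun k => (A k, u k)
  set T : Charges m → PowerSeries ℂ := fun κ₁ =>
    toThermal (thetaSeries N (p ∘ A) κ₁ * ellInv (cosines u) ^ N) κ
  have h1 : toThermal (𝒯.traceSeries fin a) κ = ∑ κ₁ ∈ minimalCharges N (p ∘ A),
      PowerSeries.C (multiplicity N (p ∘ A) κ₁ : ℂ)⁻¹ *
        PowerSeries.mk (fun j => 𝒯.symTrace fin N a j κ₁) * T κ₁ := by
    have h2 : 𝒯.traceSeries fin a = 𝒯.numSeries fin N a * ellInv (cosines u) ^ N := by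
      have h3 : ellSeries (cosines u) ^ N * ellInv (cosines u) ^ N = 1 := by
        rw [← mul_pow, ellSeries_mul_ellInv, one_pow]
      change _ = ellSeries (cosines u) ^ N * _ * _
      rw [mul_right_comm, h3, one_mul]
    rw [h2, 𝒯.numSeries_eq_sum fin hN hs (q := p ∘ A) fun _ => rfl, sum_mul, toThermal_sum]
    simp_rw [mul_assoc (ofNome _), toThermal_ofNome_mul]
    rfl
  have h2 : ∀ κ₀, ∑ b, PowerSeries.map (evalAt fun k => coord (u k))
      (G A κ₀ b * basisSeries p N A κ₀ (e b) A κ) = ∑ s ∈ S A, PowerSeries.C (statSign p A s) *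
        (x A κ₀ * PowerSeries.mk fun j => 𝒯.symTrace fin N (a ∘ s) j κ₀) * T (κ₀ ∘ ⇑s⁻¹) :=
    fun κ₀ => by
      have h3 : ∀ b, PowerSeries.map (evalAt fun k => coord (u k))
          (basisSeries p N A κ₀ (e b) A κ) = ∑ s ∈ S A, PowerSeries.C (statSign p A s *
            evalAt ((fun k => coord (u k)) ∘ s) (e b)) * T (κ₀ ∘ ⇑s⁻¹) := fun b => by
        rw [map_basisSeries, ← Finset.sum_filter, sum_mul, toThermal_sum]
        simp_rw [mul_assoc (MvPowerSeries.C _), toThermal_C_mul]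
        rfl
      simp_rw [map_mul (PowerSeries.map _), h3, mul_sum]
      rw [sum_comm]
      refine sum_congr rfl fun s hs => ?_
      have hA : A ∘ s = A := (mem_filter.1 hs).2
      have h4 : x A κ₀ * PowerSeries.mk (fun j => 𝒯.symTrace fin N (a ∘ s) j κ₀) =
          PowerSeries.map (evalAt fun k => coord ((u ∘ s) k))
            (PowerSeries.map MvPolynomial.C (x A κ₀) * PowerSeries.mk (P A κ₀)) := by
        rw [map_mul]
        congr 1
        · ext j
          rw [PowerSeries.coeff_map, PowerSeries.coeff_map, evalAt, MvPolynomial.eval_C]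
        · ext j
          rw [PowerSeries.coeff_map, coeff_mk, coeff_mk, ← hP]
          congr 1
          funext k
          exact Prod.ext (congrFun hA k) rfl
      rw [h4, hG2, mul_sum, sum_mul]
      refine sum_congr rfl fun b _ => ?_
      rw [map_mul PowerSeries.C]
      ring
  have h3 : ∀ s ∈ S A, ∑ κ₀ ∈ minimalCharges N (p ∘ A), PowerSeries.C (statSign p A s) *
      (x A κ₀ * PowerSeries.mk fun j => 𝒯.symTrace fin N (a ∘ s) j κ₀) * T (κ₀ ∘ ⇑s⁻¹) =
        Z⁻¹ * PowerSeries.C ((S A).card : ℂ)⁻¹ * toThermal (𝒯.traceSeries fin a) κ :=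
    fun s hsA => by
      have hA : A ∘ s = A := (mem_filter.1 hsA).2
      have hq : (p ∘ A) ∘ s = p ∘ A := congrArg (p ∘ ·) hA
      have hA' : A ∘ ⇑s⁻¹ = A := by
        conv_lhs => rw [← hA]
        funext k; simp
      have hq' : (p ∘ A) ∘ ⇑s⁻¹ = p ∘ A := congrArg (p ∘ ·) hA'
      rw [h1, mul_sum]
      refine Finset.sum_bij' (fun κ₀ _ => κ₀ ∘ ⇑s⁻¹) (fun κ₁ _ => κ₁ ∘ s) (fun κ₀ hκ => ?_)
        (fun κ₁ hκ => ?_) (fun κ₀ _ => by funext k; simp) (fun κ₁ _ => by funext k; simp)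
        fun κ₀ _ => ?_
      · exact mem_minimalCharges.2 (hq' ▸ (mem_minimalCharges.1 hκ).comp s⁻¹)
      · exact mem_minimalCharges.2 (hq ▸ (mem_minimalCharges.1 hκ).comp s)
      · have h5 : PowerSeries.mk (fun j => 𝒯.symTrace fin N a j (κ₀ ∘ ⇑s⁻¹)) =
            PowerSeries.C (statSign p A s) *
              PowerSeries.mk fun j => 𝒯.symTrace fin N (a ∘ s) j κ₀ := by
          ext j
          rw [PowerSeries.coeff_C_mul, coeff_mk, coeff_mk,
            hs s a j (κ₀ ∘ ⇑s⁻¹)]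
          congr 2
          funext k; simp
        rw [h5, multiplicity_comp N _ κ₀ s⁻¹ hq']
        simp only [x, map_mul]
        ring
  rw [sum_congr rfl fun κ₀ _ => h2 κ₀, sum_comm, sum_congr rfl h3,
    sum_const, nsmul_eq_mul, thermal, trace_product]
  have h4 : ((S A).card : ℂ) ≠ 0 := Nat.cast_ne_zero.2 (Finset.card_ne_zero_of_mem
    (mem_filter.2 ⟨mem_univ 1, rfl⟩))
  have h5 : ((S A).card : PowerSeries ℂ) * PowerSeries.C ((S A).card : ℂ)⁻¹ = 1 := by
    rw [← map_natCast (PowerSeries.C (R := ℂ)), ← map_mul, mul_inv_cancel₀ h4, map_one]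
  linear_combination -(Z⁻¹ * toThermal (𝒯.traceSeries fin a) κ) * h5

end GCITheory

end

end GCI

open GCI in
theorem theorem3p5 (D : ℕ) [NeZero D] (I : Type*) [Fintype I] [DecidableEq I] (p : I → ZMod 2)
    (n : ℕ) :
    ∃ (C : ℕ → ℕ) (E : (N : ℕ) → Fin (C N) → (Fin n → I) → ThermalSeries D n),
      (∀ N, ∃ f : Fin (C N) → (Fin n → I) →
            (Fin n → ℂ) → (Fin n → UnitSphere D) → ℂ → ℂ,
          (∀ c A,
            MemPlus (E N c A) ∧ DependsOnDifferences (E N c A) ∧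
            (∀ κ, E N c A κ ≠ 0 → ∀ m, (κ m : ZMod 2) = p (A m)) ∧
            ConvergesTo (E N c A) (f c A) ∧
            IsMeromorphicOver (f c A) ∧
            HasEllipticDenominator N (f c A) ∧
            (∀ (m : Fin n) ζ u τ, 0 < τ.im →
              f c A (ζ + Pi.single m 1) u τ = (-1) ^ (p (A m)).val * f c A ζ u τ ∧
              f c A (ζ + Pi.single m τ) u τ = (-1) ^ (p (A m)).val * f c A ζ u τ)) ∧
          (∀ c A (s : Equiv.Perm (Fin n)) ζ u τ, 0 < τ.im →
            f c (A ∘ s) (ζ ∘ s) (u ∘ s) τ = statSign p A s * f c A ζ u τ)) ∧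
      ∀ {ι : ℕ → Type*} [∀ m, Fintype (ι m)] (h : ∀ m, Module.Basis (ι m) ℂ (harmonic D m))
        (ℋ : Type*) [NormedAddCommGroup ℋ] [InnerProductSpace ℂ ℋ] [CompleteSpace ℋ]
        (𝒯 : GCITheory D I p h ℋ) (fin : 𝒯.FiniteEigenspaces),
        ∃ N₀ : ℕ, ∀ N ≥ N₀, ∃ G : Fin (C N) → (Fin n → I) → PowerSeries (PointPoly D n),
          (∀ c A j, IsSymm (PowerSeries.coeff j (G c A)) ∧
            IsMultiHarmonic (PowerSeries.coeff j (G c A))) ∧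
          ∀ (A : Fin n → I) (κ : Fin n → ℤ) (u : Fin n → UnitSphere D),
            𝒯.thermal fin A κ u =
              ∑ c, PowerSeries.map (evalAt fun k => coord (u k)) (G c A * E N c A κ) := by
  classical
  -- The basis may be numbered by any finite types.
  suffices hK : ∃ (K : ℕ → Type u_1) (_ : ∀ N, Fintype (K N))
      (E : (N : ℕ) → K N → (Fin n → I) → ThermalSeries D n),
      (∀ N x, ∃ f, IsEllipticFamily p N (E N x) f) ∧
      ∀ {ι : ℕ → Type u_2} [∀ m, Fintype (ι m)] (h : ∀ m, Module.Basis (ι m) ℂ (harmonic D m))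
        (ℋ : Type u_3) [NormedAddCommGroup ℋ] [InnerProductSpace ℂ ℋ] [CompleteSpace ℋ]
        (𝒯 : GCITheory D I p h ℋ) (fin : 𝒯.FiniteEigenspaces),
        ∃ N₀ : ℕ, ∀ N ≥ N₀, ∃ G : K N → (Fin n → I) → PowerSeries (PointPoly D n),
          (∀ x A j, IsSymm (PowerSeries.coeff j (G x A)) ∧
            IsMultiHarmonic (PowerSeries.coeff j (G x A))) ∧
          ∀ (A : Fin n → I) (κ : Fin n → ℤ) (u : Fin n → UnitSphere D),
            𝒯.thermal fin A κ u =
              ∑ x, PowerSeries.map (evalAt fun k => coord (u k)) (G x A * E N x A κ) by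
    obtain ⟨K, _, E, hE, hG⟩ := hK
    refine ⟨fun N => Fintype.card (K N), fun N c => E N ((Fintype.equivFin (K N)).symm c),
      fun N => ?_, fun h ℋ => ?_⟩
    · choose f hf using fun c => hE N ((Fintype.equivFin (K N)).symm c)
      exact ⟨f, fun c A => ⟨(hf c).memPlus A, (hf c).differences A, (hf c).parity A,
        (hf c).convergesTo A, (hf c).meromorphic A, (hf c).denominator A, (hf c).periodic A⟩,
        fun c A s => (hf c).symmetric A s⟩
    · intro _ _ _ 𝒯 fin
      obtain ⟨N₀, hN₀⟩ := hG h ℋ 𝒯 fin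
      refine ⟨N₀, fun N hN => ?_⟩
      obtain ⟨G, hG1, hG2⟩ := hN₀ N hN
      refine ⟨fun c => G ((Fintype.equivFin (K N)).symm c), fun c => hG1 _, fun A κ u => ?_⟩
      rw [hG2]
      exact (Equiv.sum_comp (Fintype.equivFin (K N)).symm fun x =>
        PowerSeries.map (evalAt fun k => coord (u k)) (G x A * E N x A κ)).symm
  cases n with
  | zero =>
    refine ⟨fun _ => PUnit, inferInstance, fun _ _ => 1, fun N _ => ⟨1, isEllipticFamily_one p N⟩,
      fun h ℋ => ?_⟩
    intro _ _ _ 𝒯 fin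
    refine ⟨0, fun N _ => ⟨fun _ A => PowerSeries.map MvPolynomial.C
      (𝒯.thermal fin A 0 Fin.elim0), fun _ A j => ⟨fun s => ?_, fun k => k.elim0⟩,
      fun A κ u => ?_⟩⟩
    · rw [PowerSeries.coeff_map, MvPolynomial.rename_C]
    · obtain rfl : κ = 0 := Subsingleton.elim _ _
      obtain rfl : u = Fin.elim0 := Subsingleton.elim _ _
      refine Eq.trans ?_ (Fintype.sum_unique _).symm
      change _ = PowerSeries.map _ (_ * 1)
      rw [mul_one]
      ext j
      rw [PowerSeries.coeff_map, PowerSeries.coeff_map, evalAt, MvPolynomial.eval_C]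
  | succ m =>
    obtain ⟨B, e, he⟩ := exists_generators D (m + 1)
    set box : ℕ → Finset (Fin (m + 1) → ℤ) := fun N =>
      Finset.Icc (fun _ => -(2 * N * m : ℤ)) fun _ => 2 * N * m
    refine ⟨fun N => (Fin (m + 1) → I) × box N × Fin B, inferInstance, fun N x =>
      if Admissible N (p ∘ x.1) x.2.1 then basisSeries p N x.1 x.2.1 (e x.2.2) else 0,
      fun N x => ?_, fun h ℋ => ?_⟩
    · dsimp only
      split_ifs with hx
      · exact ⟨_, isEllipticFamily_basis hx⟩
      · exact ⟨0, isEllipticFamily_zero p N⟩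
    · intro _ _ _ 𝒯 fin
      obtain ⟨M, hM⟩ := 𝒯.exists_symmetricTraces fin (m := m)
      refine ⟨M + 1, fun N hN => ?_⟩
      obtain ⟨G, hG1, hG2⟩ := 𝒯.exists_expansion fin he (by omega) (hM N (by omega))
      refine ⟨fun x A => if A = x.1 then G A x.2.1 x.2.2 else 0, fun x A j => ?_, fun A κ u => ?_⟩
      · dsimp only
        split_ifs
        · exact hG1 A _ _ j
        · exact ⟨fun s => by rw [map_zero, map_zero], fun k => by simp⟩
      · rw [hG2]
        dsimp only
        rw [Fintype.sum_prod_type, Finset.sum_eq_single_of_mem A (Finset.mem_univ _)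
          fun A' _ hA => Finset.sum_eq_zero fun y _ => by
            rw [if_neg (Ne.symm hA), zero_mul, map_zero], Fintype.sum_prod_type]
        simp_rw [if_true]
        rw [minimalCharges, Finset.sum_filter, ← Finset.sum_coe_sort (box N)]
        refine Finset.sum_congr rfl fun κ₀ _ => ?_
        split_ifs
        · rfl
        · simp
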